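/- **Proposition (Parity).** Let $(M,g)$ be a smooth Riemannian manifold of dimension $n$, $\mathcal E\to M$ a smooth complex vector bundle of rank $r$ with a hermitian metric $\gamma$ (conjugate linear in the first argument), and $H_\hbar=\hbar^2L+\hbar W+V$, where $L$ is a Laplace type operator on $\Gamma^\infty(M,\mathcal E)$ (locally $L=-\sum g^{ij}\partial_i\partial_j+\sum b_j\partial_j+c$ with endomorphism valued $b_j,c$) that is symmetric for $\int_M\gamma[\cdot,\cdot]$, $W$ is a symmetric endomorphism field, and $V\in C^\infty(M,\mathbb R)$ has a non-degenerate minimum at $p$ with $V(p)=0$. Let $\phi$ be a smooth real solution of $|\mathrm d\phi|^2=V$ on an open neighbourhood $U$ of $p$, with $\phi(p)=0$ and a non-degenerate minimum at $p$. Choose smooth coordinates $x$ on a neighbourhood of $p$ in $U$ with $x(p)=0$, $g_{ij}(p)=\delta_{ij}$ and $\phi=\frac12\sum_\nu\lambda_\nu x_\nu^2+O(|x|^3)$, and a smooth frame of $\mathcal E$ there which at $p$ is an orthonormal basis $e_1,\dots,e_r$ of $\mathcal E_p$ with $W(p)e_k=\mu_ke_k$ (for example geodesic normal coordinates, and a frame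 that is parallel along the geodesics from $p$). Let $\tau_p$ denote the Taylor expansion at $p$ in these coordinates and this frame, and identify $\mathcal E_p$ with $\mathbb C^r$. Let $\mathfrak S=\mathcal E_p[[x]](\!(\hbar^{1/2})\!)$ and let $\mathfrak S_0$ be the space of all $\hbar^{-K}\sum_{j\in\mathbb N_0/2}\hbar^jP_j(y)$ with $K\in\mathbb N_0/2$, $P_j\in\mathcal E_p[y]$, $\deg P_j\le 2j$. Let $R:\mathfrak S\to\mathfrak S_0$ be the isomorphism given by the substitution $x=\hbar^{1/2}y$, and $$Q=\hbar^{-1}\,R\circ\tau_p\bigl(e^{\phi/\hbar}H_\hbar e^{-\phi/\hbar}\bigr)\circ R^{-1}\quad\text{on }\mathfrak S_0 .$$ For $u,v\in\mathfrak S$ let $(u,v)_{\mathfrak S,\phi}\in\mathbb C(\!(\hbar^{1/2})\!)$ be the formal stationary phase expansion of $\hbar^{-n/2}\int\gamma[u,v]\,e^{-2\phi/\hbar}(\det g)^{1/2}dx$, i.e. the series obtained from the Taylor series of $\gamma$, $\phi$, $(\det g)^{1/2}$ by the substitution $x=\hbar^{1/2}y$, expansion in powers of $\hbar^{1/2}$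 against the weight $e^{-\sum_\nu\lambda_\nu y_\nu^2}$ on $\mathbb R^n$, and termwise integration; put $(u,v)_{\mathfrak S_0,\phi}=(R^{-1}u,R^{-1}v)_{\mathfrak S,\phi}$. For $\alpha\in\mathbb N_0^n$, $1\le k\le r$ put $E_{\alpha,k}=\sum_\nu(2\alpha_\nu+1)\lambda_\nu+\mu_k$ and $h_{\alpha,k}(y)=\prod_\nu\lambda_\nu^{1/4}h_{\alpha_\nu}(\lambda_\nu^{1/2}y_\nu)\,e_k$, with the normalized Hermite polynomials $h_j(z)=(-1)^j(2^jj!)^{-1/2}\pi^{-1/4}e^{z^2}\frac{d^j}{dz^j}e^{-z^2}$. Fix $E_0\in\mathbb R$ and let $(\alpha^j,k^j)$, $j=1,\dots,m_0$, enumerate $I_{E_0}=\{(\alpha,k):E_{\alpha,k}=E_0\}$. Let $$\Pi_{E_0}u=-\frac1{2\pi i}\oint_{|z-E_0|=\varepsilon}(Q-z)^{-1}u\,dz\qquad(u\in\mathfrak S_0),$$ the integral being taken coefficientwise, where $\varepsilon>0$ is such that $|E_{\alpha,k}-E_0|\le\varepsilon$ only if $E_{\alpha,k}=E_0$. Let $f^j=\Pi_{E_0}h_{\alpha^j,k^j}$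 and $A=\bigl((f^i,f^j)_{\mathfrak S_0,\phi}\bigr)_{i,j}$. Assume that $|\alpha|$ is even for all $(\alpha,k)\in I_{E_0}$, or odd for all $(\alpha,k)\in I_{E_0}$. Then $A$ has an inverse square root $B=A^{-1/2}=\mathbf 1+\sum_{j\in\mathbb N/2}\hbar^jB_j$, the vectors $b^j=\sum_iB_{ij}f^i$ form an orthonormal basis of $V=\Pi_{E_0}\mathfrak S_0$ over $\mathbb C(\!(\hbar^{1/2})\!)$, $Q$ maps $V$ to itself, and for the matrix $M$ of $Q|_V$ in this basis, defined by $Qb^j=\sum_iM_{ij}b^i$, one has: 1. all entries $M_{ij}$ lie in $\mathbb C(\!(\hbar)\!)$; 2. the characteristic polynomial of $M$ is $\prod_{j=1}^{m_0}(X-E_j)$ with $E_1,\dots,E_{m_0}\in\mathbb R(\!(\hbar)\!)$. In particular, no half-integer powers of $\hbar$ occur in the eigenvalues $E_j$ of $Q|_V$. -/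

import Mathlib

open scoped Manifold ContDiff
open Bundle

noncomputable section

namespace Parity

/-! ## Formal series

The formal variable of every Laurent series below is `t = ħ ^ (1/2)`, so that the coefficient of
index `m : ℤ` belongs to the power `ħ ^ (m / 2)`. -/

/-- `ℂ((ħ^{1/2}))`. -/
abbrev K : Type := LaurentSeries ℂ

/-- `ℂ[[x]]`, with `x = (x_1, …, x_n)`. -/
abbrev PS (n : ℕ) : Type := MvPowerSeries (Fin n) ℂ

/-- `ℂ[y]`, with `y = (y_1, …, y_n)`. -/
abbrev Pol (n : ℕ) : Type := MvPolynomial (Fin n) ℂ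

/-- The space `𝔖 = ℂ^r[[x]]((ħ^{1/2}))`, written componentwise. -/
abbrev S (n r : ℕ) : Type := Fin r → LaurentSeries (PS n)

/-- The subspace of all `ħ^{-N/2} ∑_j ħ^{j/2} P_j(y)` with `P_j ∈ ℂ^r[y]`, `deg P_j ≤ j`. -/
def S₀Sub (n r : ℕ) : Submodule ℂ (Fin r → LaurentSeries (Pol n)) where
  carrier := {w | ∃ N : ℕ, ∀ (k : Fin r) (m : ℤ) (α : Fin n →₀ ℕ),
    MvPolynomial.coeff α ((w k).coeff m) ≠ 0 → (α.degree : ℤ) ≤ m + N}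
  zero_mem' := ⟨0, fun k m α h => by simp at h⟩
  add_mem' := by
    rintro v w ⟨N, hN⟩ ⟨N', hN'⟩
    refine ⟨max N N', fun k m α h => ?_⟩
    by_cases h1 : MvPolynomial.coeff α ((v k).coeff m) = 0
    · have h2 : MvPolynomial.coeff α ((w k).coeff m) ≠ 0 := fun h2 => h (by simp [h1, h2])
      have := hN' k m α h2
      push_cast
      omega
    · have := hN k m α h1
      push_cast
      omega
  smul_mem' := by
    rintro c w ⟨N, hN⟩
    exact ⟨N, fun k m α h => hN k m α fun h0 => h (by simp [h0])⟩

/-- The space `𝔖₀` of all `ħ^{-N/2} ∑_j ħ^{j/2} P_j(y)` with `P_j ∈ ℂ^r[y]`, `deg P_j ≤ j`. -/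
def S₀ (n r : ℕ) : Type := ↥(S₀Sub n r)

instance (n r : ℕ) : AddCommGroup (S₀ n r) := inferInstanceAs (AddCommGroup ↥(S₀Sub n r))

instance (n r : ℕ) : Module ℂ (S₀ n r) := inferInstanceAs (Module ℂ ↥(S₀Sub n r))

/-- The inclusion of `𝔖₀` in `ℂ^r[y]((ħ^{1/2}))`. -/
def S₀.val {n r : ℕ} : S₀ n r →ₗ[ℂ] (Fin r → LaurentSeries (Pol n)) := (S₀Sub n r).subtype

/-- The element of `𝔖₀` given by a member of the subspace. -/
def S₀.mk {n r : ℕ} (w : Fin r → LaurentSeries (Pol n)) (hw : w ∈ S₀Sub n r) : S₀ n r := ⟨w, hw⟩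

theorem S₀.val_mk {n r : ℕ} (w : Fin r → LaurentSeries (Pol n)) (hw : w ∈ S₀Sub n r) :
    (S₀.mk w hw).val = w := rfl

theorem S₀.val_mem {n r : ℕ} (w : S₀ n r) : w.val ∈ S₀Sub n r := w.2

theorem S₀.val_injective {n r : ℕ} {v w : S₀ n r} (h : v.val = w.val) : v = w :=
  Subtype.ext h

/-- The coefficient of `t ^ m` of the rescaled series: substituting `x = t y` into
`F = ∑_k t^k F_k(x)`, one gets `∑_d (F_{m-d})_d (y)` where `(·)_d` is the homogeneous part of
degree `d`. -/
def rescaleCoeff {n : ℕ} (F : LaurentSeries (PS n)) (m : ℤ) : Pol n :=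
  ∑ d ∈ Finset.range ((m - F.order).toNat + 1),
    ∑ α ∈ Finset.finsuppAntidiag (Finset.univ : Finset (Fin n)) d,
      MvPolynomial.monomial α (MvPowerSeries.coeff α (F.coeff (m - d)))

theorem coeff_rescaleCoeff {n : ℕ} (F : LaurentSeries (PS n)) (m : ℤ) (α : Fin n →₀ ℕ) :
    MvPolynomial.coeff α (rescaleCoeff F m) =
      MvPowerSeries.coeff α (F.coeff (m - (α.degree : ℤ))) := by
  classical
  have key : ∀ d : ℕ, α ∈ Finset.finsuppAntidiag (Finset.univ : Finset (Fin n)) d ↔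
      α.degree = d := by
    intro d
    simp [Finset.mem_finsuppAntidiag, Finsupp.degree_eq_sum]
  unfold rescaleCoeff
  simp only [MvPolynomial.coeff_sum, MvPolynomial.coeff_monomial, Finset.sum_ite_eq', key]
  rw [Finset.sum_ite_eq]
  split_ifs with h
  · rfl
  · rw [HahnSeries.coeff_eq_zero_of_lt_order, map_zero]
    simp only [Finset.mem_range] at h
    omega

/-- The rescaling `x = ħ^{1/2} y` on scalar series. -/
def rescale (n : ℕ) : LaurentSeries (PS n) →ₗ[ℂ] LaurentSeries (Pol n) where
  toFun F := HahnSeries.ofSuppBddBelow (rescaleCoeff F) ⟨F.order, fun m hm => by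
    by_contra hlt
    refine hm (MvPolynomial.ext _ _ fun α => ?_)
    rw [coeff_rescaleCoeff, HahnSeries.coeff_eq_zero_of_lt_order (by omega)]
    simp⟩
  map_add' F G := by
    ext m α
    change MvPolynomial.coeff α (rescaleCoeff _ m) =
      MvPolynomial.coeff α (rescaleCoeff _ m + rescaleCoeff _ m)
    simp [coeff_rescaleCoeff]
  map_smul' c F := by
    ext m α
    change MvPolynomial.coeff α (rescaleCoeff _ m) =
      MvPolynomial.coeff α (c • rescaleCoeff _ m)
    simp [coeff_rescaleCoeff]

theorem coeff_rescale {n : ℕ} (F : LaurentSeries (PS n)) (m : ℤ) (α : Fin n →₀ ℕ) :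
    MvPolynomial.coeff α ((rescale n F).coeff m) =
      MvPowerSeries.coeff α (F.coeff (m - (α.degree : ℤ))) :=
  coeff_rescaleCoeff F m α

theorem rescale_mem {n r : ℕ} (u : S n r) : (fun k => rescale n (u k)) ∈ S₀Sub n r := by
  refine ⟨∑ k, (-(u k).order).toNat, fun k m α h => ?_⟩
  rw [coeff_rescale] at h
  have h1 : (u k).order ≤ m - (α.degree : ℤ) := by
    by_contra hlt
    exact h (by rw [HahnSeries.coeff_eq_zero_of_lt_order (by omega), map_zero])
  have h2 : (-(u k).order).toNat ≤ ∑ k, (-(u k).order).toNat :=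
    Finset.single_le_sum (f := fun k => (-(u k).order).toNat) (fun _ _ => Nat.zero_le _)
      (Finset.mem_univ k)
  omega

/-- The inverse substitution `y = ħ^{-1/2} x` on `𝔖₀`. -/
def unscale {n r : ℕ} (w : S₀ n r) : S n r := fun k =>
  HahnSeries.ofSuppBddBelow
    (fun m => (fun α => MvPolynomial.coeff α ((w.val k).coeff (m + (α.degree : ℤ))) : PS n)) (by
      obtain ⟨N, hN⟩ := w.val_mem
      refine ⟨-(N : ℤ), fun m hm => ?_⟩
      by_contra hlt
      refine hm (funext fun α => ?_)
      by_contra h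
      have := hN k _ α h
      omega)

theorem coeff_unscale {n r : ℕ} (w : S₀ n r) (k : Fin r) (m : ℤ) (α : Fin n →₀ ℕ) :
    MvPowerSeries.coeff α ((unscale w k).coeff m) =
      MvPolynomial.coeff α ((w.val k).coeff (m + (α.degree : ℤ))) :=
  rfl

/-- The rescaling operator `R : 𝔖 → 𝔖₀`, `x = ħ^{1/2} y`, a linear isomorphism. -/
def R (n r : ℕ) : S n r ≃ₗ[ℂ] S₀ n r where
  toFun u := S₀.mk (fun k => rescale n (u k)) (rescale_mem u)
  map_add' u v := by
    apply S₀.val_injective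
    rw [map_add]
    funext k
    exact map_add (rescale n) (u k) (v k)
  map_smul' c u := by
    apply S₀.val_injective
    rw [map_smul]
    funext k
    exact map_smul (rescale n) c (u k)
  invFun := unscale
  left_inv u := by
    ext k m α
    rw [coeff_unscale, S₀.val_mk, coeff_rescale]
    simp
  right_inv w := by
    apply S₀.val_injective
    rw [S₀.val_mk]
    ext k m α
    rw [coeff_rescale, coeff_unscale]
    simp

/-- Multiplication of an element of `𝔖₀` by a scalar from the field `ℂ((ħ^{1/2}))`. -/
def scale {n r : ℕ} (a : K) (w : S₀ n r) : S₀ n r :=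
  S₀.mk (fun k => a.map (algebraMap ℂ (Pol n)) * w.val k) (by
    obtain ⟨N, hN⟩ := w.val_mem
    refine ⟨N + (-a.order).toNat, fun k m α h => ?_⟩
    by_contra hlt
    refine h ?_
    rw [HahnSeries.coeff_mul, MvPolynomial.coeff_sum]
    refine Finset.sum_eq_zero fun ij hij => ?_
    rw [Finset.mem_antidiagonal] at hij
    obtain ⟨h1, -, h3⟩ := hij
    have h4 : a.order ≤ ij.1 := by
      refine HahnSeries.order_le_of_coeff_ne_zero fun h0 => h1 ?_
      simp [h0]
    change MvPolynomial.coeff α (MvPolynomial.C (a.coeff ij.1) * (w.val k).coeff ij.2) = 0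
    rw [MvPolynomial.coeff_C_mul]
    by_contra h5
    have h6 := hN k ij.2 α (right_ne_zero_of_mul h5)
    push_cast at hlt
    omega)

/-- A polynomial vector `P ∈ ℂ^r[y]`, regarded as an element of `𝔖₀` that is constant in `ħ`. -/
def ofPol {n r : ℕ} (P : Fin r → Pol n) : S₀ n r :=
  S₀.mk (fun k => HahnSeries.C (P k)) (by
    refine ⟨∑ k, (P k).totalDegree, fun k m α h => ?_⟩
    simp only [HahnSeries.C_apply, HahnSeries.coeff_single] at h
    split_ifs at h with hm
    · have h1 : α.degree ≤ (P k).totalDegree := by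
        have := MvPolynomial.le_totalDegree (MvPolynomial.mem_support_iff.mpr h)
        simpa [Finsupp.degree_apply, Finsupp.sum] using this
      have h2 : (P k).totalDegree ≤ ∑ k, (P k).totalDegree :=
        Finset.single_le_sum (f := fun k => (P k).totalDegree) (fun _ _ => Nat.zero_le _)
          (Finset.mem_univ k)
      subst hm
      omega
    · simp at h)

/-- `a ∈ ℂ((ħ))`: only integer powers of `ħ`, that is even powers of `ħ^{1/2}`, occur. -/
def IsIntegral (a : K) : Prop := ∀ m : ℤ, Odd m → a.coeff m = 0

/-- All coefficients of `a` are real. Together with `IsIntegral` this means `a ∈ ℝ((ħ))`. -/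
def IsRealSeries (a : K) : Prop := ∀ m : ℤ, (a.coeff m).im = 0

/-- `B = A^{-1/2}`, the inverse square root of `A = 1 + ∑_{j ≥ 1} ħ^{j/2} A_j` of the form
`B = 1 + ∑_{j ≥ 1} ħ^{j/2} B_j`. Such a `B` is unique. -/
def IsInvSqrt {m : ℕ} (A B : Matrix (Fin m) (Fin m) K) : Prop :=
  (∀ i j, (∀ l : ℤ, l < 0 → (B i j).coeff l = 0) ∧
    (B i j).coeff 0 = (1 : Matrix (Fin m) (Fin m) ℂ) i j) ∧
  B * B * A = 1

/-! ## The formal operator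

The next structure only collects the Taylor series (in `x`) of the geometric data; they are
computed from the geometry in `taylorData` below. -/

/-- Taylor series of the inverse metric `ginv`, of the coefficients `b`, `c` of
`L = -∑ g^{ij} ∂_i ∂_j + ∑ b_j ∂_j + c`, of the matrix `w` of `W`, of `V` and `φ`, of the Riemannian
density `vol = (det g)^{1/2}`, and of the matrix `γ` of the bundle metric; `lam` and `mu` are the
frequencies `λ_ν` and the eigenvalues `μ_k` of `W(p)`. -/
structure TaylorData (n r : ℕ) where
  ginv : Fin n → Fin n → PS n
  b : Fin n → Matrix (Fin r) (Fin r) (PS n)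
  c : Matrix (Fin r) (Fin r) (PS n)
  w : Matrix (Fin r) (Fin r) (PS n)
  V : PS n
  φ : PS n
  vol : PS n
  γ : Matrix (Fin r) (Fin r) (PS n)
  lam : Fin n → ℝ
  mu : Fin r → ℝ

/-- `∂/∂x_i` on Laurent series with coefficients in `ℂ[[x]]`. -/
def dx {n : ℕ} (i : Fin n) : LaurentSeries (PS n) →ₗ[ℂ] LaurentSeries (PS n) where
  toFun F := F.map (MvPowerSeries.pderiv ℂ i).toLinearMap
  map_add' F G := by
    ext1
    funext m
    simp
  map_smul' c F := by
    ext1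
    funext m
    simp

/-- Multiplication by `a`, as a linear map. -/
def mulL {n : ℕ} (a : LaurentSeries (PS n)) : LaurentSeries (PS n) →ₗ[ℂ] LaurentSeries (PS n) where
  toFun F := a * F
  map_add' F G := mul_add a F G
  map_smul' c F := by
    have h : ∀ G : LaurentSeries (PS n),
        c • G = HahnSeries.C (MvPowerSeries.C c : PS n) * G := by
      intro G
      ext m α
      simp [HahnSeries.C_apply]
    change a * (c • F) = c • (a * F)
    rw [h F, h (a * F), mul_left_comm]

/-- Componentwise multiplication by a scalar series. -/
def mulOp {n r : ℕ} (a : LaurentSeries (PS n)) : S n r →ₗ[ℂ] S n r :=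
  LinearMap.pi fun k => mulL a ∘ₗ LinearMap.proj k

/-- Multiplication by a matrix of power series. -/
def matOp {n r : ℕ} (A : Matrix (Fin r) (Fin r) (PS n)) : S n r →ₗ[ℂ] S n r :=
  LinearMap.pi fun k => ∑ l, mulL (HahnSeries.C (A k l)) ∘ₗ LinearMap.proj l

/-- Multiplication by `ħ ^ (m / 2)`. -/
def hPow {n r : ℕ} (m : ℤ) : S n r →ₗ[ℂ] S n r :=
  mulOp (HahnSeries.single m 1)

namespace TaylorData

variable {n r : ℕ} (D : TaylorData n r)

/-- The conjugated derivative `e^{φ/ħ} ∘ ∂_i ∘ e^{-φ/ħ} = ∂_i - ħ^{-1} (∂_i φ)` on `𝔖`. -/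
def conjDeriv (i : Fin n) : S n r →ₗ[ℂ] S n r :=
  (dx i).compLeft (Fin r) -
    mulOp (HahnSeries.single (-2) (MvPowerSeries.pderiv ℂ i D.φ))

/-- The formal operator `τ_p(H_{φ,ħ}) = τ_p(e^{φ/ħ} ∘ (ħ² L + ħ W + V) ∘ e^{-φ/ħ})` on `𝔖`. -/
def H : S n r →ₗ[ℂ] S n r :=
  hPow 4 ∘ₗ (-(∑ i, ∑ j, mulOp (HahnSeries.C (D.ginv i j)) ∘ₗ D.conjDeriv i ∘ₗ D.conjDeriv j)
      + ∑ j, matOp (D.b j) ∘ₗ D.conjDeriv j + matOp D.c)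
    + hPow 2 ∘ₗ matOp D.w + mulOp (HahnSeries.C D.V)

/-- The operator `Q = ħ^{-1} R ∘ τ_p(H_{φ,ħ}) ∘ R^{-1}` on `𝔖₀`. -/
def Q : Module.End ℂ (S₀ n r) :=
  (R n r).toLinearMap ∘ₗ (hPow (-2) ∘ₗ D.H) ∘ₗ (R n r).symm.toLinearMap

/-- The eigenvalues `E_{α,k} = ∑_ν (2 α_ν + 1) λ_ν + μ_k` of the local harmonic oscillator. -/
def energy (a : (Fin n → ℕ) × Fin r) : ℝ :=
  ∑ ν, (2 * (a.1 ν : ℝ) + 1) * D.lam ν + D.mu a.2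

end TaylorData

/-- The Hermite polynomials `H_j(z) = (-1)^j e^{z²} (d/dz)^j e^{-z²}`. -/
def hermiteH : ℕ → Polynomial ℝ
  | 0 => 1
  | j + 1 => 2 * Polynomial.X * hermiteH j - Polynomial.derivative (hermiteH j)

/-- The normalized Hermite polynomials `h_j = (2^j j!)^{-1/2} π^{-1/4} H_j`. -/
def hermiteNormalized (j : ℕ) : Polynomial ℝ :=
  Polynomial.C ((Real.sqrt (2 ^ j * (j.factorial : ℝ)) * Real.pi ^ (1 / 4 : ℝ))⁻¹) * hermiteH j

namespace TaylorData

variable {n r : ℕ} (D : TaylorData n r)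

/-- `h_{α,k}(y) = ∏_ν λ_ν^{1/4} h_{α_ν}(λ_ν^{1/2} y_ν) · e_k`, as an element of `𝔖₀`. -/
def h (a : (Fin n → ℕ) × Fin r) : S₀ n r :=
  ofPol (Pi.single a.2 (∏ ν, MvPolynomial.C ((D.lam ν ^ (1 / 4 : ℝ) : ℝ) : ℂ) *
    Polynomial.aeval (MvPolynomial.C ((Real.sqrt (D.lam ν) : ℝ) : ℂ) * MvPolynomial.X ν)
      (hermiteNormalized (a.1 ν))))

/-- The resolvent `(Q - z)^{-1}` on `𝔖₀`. -/
def resolvent (z : ℂ) : Module.End ℂ (S₀ n r) :=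
  Ring.inverse (D.Q - algebraMap ℂ (Module.End ℂ (S₀ n r)) z)

open Classical in
/-- The spectral projection `Π_{E₀} u = -(2πi)^{-1} ∮ (Q - z)^{-1} u dz`, the integral being taken
coefficientwise over the positively oriented circle of radius `ε` around `E₀`. -/
def proj (E₀ ε : ℝ) (u : S₀ n r) : S₀ n r :=
  if hv : ∃ v : S₀ n r, ∀ (k : Fin r) (m : ℤ) (α : Fin n →₀ ℕ),
      MvPolynomial.coeff α ((v.val k).coeff m) =
        -(2 * Real.pi * Complex.I)⁻¹ *
          ∮ z in C((E₀ : ℂ), ε), MvPolynomial.coeff α (((D.resolvent z u).val k).coeff m)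
  then hv.choose else 0

/-- `∫_{ℝ^n} P(y) e^{-⟨y, Λ y⟩} dy` with `Λ = diag(λ_1, …, λ_n)`. -/
def gaussIntegral : ZeroHom (Pol n) ℂ where
  toFun P := ∫ y : EuclideanSpace ℝ (Fin n),
    MvPolynomial.eval (fun i => (y i : ℂ)) P * (Real.exp (-∑ i, D.lam i * y i ^ 2) : ℂ)
  map_zero' := by simp

/-- The terms of order at least `3` of the Taylor series of `φ`, that is `φ - ⟨x, Λ x⟩ / 2`. -/
def phaseRest : PS n :=
  D.φ - ∑ i, MvPowerSeries.C ((D.lam i / 2 : ℝ) : ℂ) * MvPowerSeries.X i ^ 2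

/-- The formal stationary phase expansion `F ↦ 𝓘(F)` of `ħ^{-n/2} ∫ F e^{-2φ/ħ} (det g)^{1/2} dx`,
extended to Laurent series: one substitutes `x = ħ^{1/2} y`, writes
`e^{-2φ(ħ^{1/2}y)/ħ} = e^{-⟨y, Λ y⟩} exp(-2 (φ - φ_0)(ħ^{1/2} y)/ħ)` with `φ_0(x) = ⟨x, Λ x⟩ / 2`,
expands in powers of `ħ^{1/2}`, and integrates term by term. -/
def statPhase (F : LaurentSeries (PS n)) : K :=
  (rescale n (F * HahnSeries.C D.vol) *
    PowerSeries.heval (rescale n (HahnSeries.single (-2) (-2 * D.phaseRest)))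
      (PowerSeries.exp (Pol n))).map D.gaussIntegral

/-- The hermitian form `(u, v)_{𝔖,φ} = 𝓘(γ[u, v])`, conjugate linear in the first argument. -/
def formS (u v : S n r) : K :=
  D.statPhase (∑ k, ∑ l, HahnSeries.C (D.γ k l) *
    (u k).map (MvPowerSeries.map (starRingEnd ℂ)) * v l)

/-- The hermitian form `(u, v)_{𝔖₀,φ}`, the pull-back of `(·,·)_{𝔖,φ}` under `R^{-1}`. -/
def form (u v : S₀ n r) : K :=
  D.formS ((R n r).symm u) ((R n r).symm v)

end TaylorData

/-! ## The geometric setup -/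

/-- The `i`-th standard basis vector of `ℝ^n`. -/
abbrev stdVec {n : ℕ} (i : Fin n) : EuclideanSpace ℝ (Fin n) := EuclideanSpace.single i 1

/-- Partial derivative `∂_i f`. -/
def pd {n : ℕ} {X : Type*} [NormedAddCommGroup X] [NormedSpace ℝ X] (i : Fin n)
    (f : EuclideanSpace ℝ (Fin n) → X) : EuclideanSpace ℝ (Fin n) → X :=
  fun y => fderiv ℝ f y (stdVec i)

/-- Higher partial derivative `∂^α f`. -/
def mpd {n : ℕ} {X : Type*} [NormedAddCommGroup X] [NormedSpace ℝ X] (α : Fin n →₀ ℕ)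
    (f : EuclideanSpace ℝ (Fin n) → X) : EuclideanSpace ℝ (Fin n) → X :=
  (List.finRange n).foldr (fun i h => (pd i)^[α i] h) f

/-- The Taylor series at `0` of a function that is smooth near `0`. -/
def taylor {n : ℕ} (f : EuclideanSpace ℝ (Fin n) → ℂ) : PS n :=
  fun α => (∏ i, ((α i).factorial : ℂ))⁻¹ * mpd α f 0

section Geometry

variable {n : ℕ} {M : Type*} [TopologicalSpace M]
  [ChartedSpace (EuclideanSpace ℝ (Fin n)) M]

/-- Smooth Riemannian metrics on `M`. -/
abbrev RMetric (n : ℕ) (M : Type*) [TopologicalSpace M]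
    [ChartedSpace (EuclideanSpace ℝ (Fin n)) M] [IsManifold (𝓡 n) ∞ M] :=
  ContMDiffRiemannianMetric (𝓡 n) ∞ (EuclideanSpace ℝ (Fin n))
    (fun q : M => TangentSpace (𝓡 n) q)

/-- The matrix `(g_{ij}(y))` of the metric in the chart `x`, at the point with coordinates `y`. -/
def gram [IsManifold (𝓡 n) ∞ M] (g : RMetric n M)
    (x : OpenPartialHomeomorph M (EuclideanSpace ℝ (Fin n))) (y : EuclideanSpace ℝ (Fin n)) :
    Matrix (Fin n) (Fin n) ℝ :=
  Matrix.of fun i j => g.inner (x.symm y)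
    (mfderiv 𝓘(ℝ, EuclideanSpace ℝ (Fin n)) (𝓡 n) x.symm y (stdVec i))
    (mfderiv 𝓘(ℝ, EuclideanSpace ℝ (Fin n)) (𝓡 n) x.symm y (stdVec j))

/-- The squared norm of a covector `ξ ∈ T_q^*M` induced by `g_q` (the choice of a basis of `T_q M`
is irrelevant). -/
def conormSq [IsManifold (𝓡 n) ∞ M] (g : RMetric n M) (q : M)
    (ξ : TangentSpace (𝓡 n) q →L[ℝ] ℝ) : ℝ :=
  let e : Fin n → TangentSpace (𝓡 n) q := fun i => stdVec i
  ∑ i, ∑ j, (Matrix.of fun i j => g.inner q (e i) (e j))⁻¹ i j * ξ (e i) * ξ (e j)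

/-- `f` has a non-degenerate (local) minimum at `p`. -/
def IsNondegMin (n : ℕ) {M : Type*} [TopologicalSpace M]
    [ChartedSpace (EuclideanSpace ℝ (Fin n)) M] (f : M → ℝ) (p : M) : Prop :=
  IsLocalMin f p ∧ ∀ v : EuclideanSpace ℝ (Fin n), v ≠ 0 →
    0 < fderiv ℝ (fun y => fderiv ℝ
      (f ∘ (chartAt (EuclideanSpace ℝ (Fin n)) p).symm) y v)
      (chartAt (EuclideanSpace ℝ (Fin n)) p p) v

/-- Integral of a function with support in the domain of the chart `x` against the Riemannian
volume density. -/
def chartIntegral [IsManifold (𝓡 n) ∞ M] (g : RMetric n M)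
    (x : OpenPartialHomeomorph M (EuclideanSpace ℝ (Fin n))) (f : M → ℂ) : ℂ :=
  ∫ y in x.target, (Real.sqrt (gram g x y).det : ℂ) * f (x.symm y)

/-- The model fibre `ℂ^r`. -/
abbrev Fib (r : ℕ) : Type := EuclideanSpace ℂ (Fin r)

variable (n) (r : ℕ) (E : M → Type*) [TopologicalSpace (TotalSpace (Fib r) E)]
  [∀ q, TopologicalSpace (E q)] [∀ q, AddCommGroup (E q)] [∀ q, Module ℂ (E q)]
  [FiberBundle (Fib r) E]

/-- Smoothness of a section on a set. -/
def SmoothOn (u : ∀ q, E q) (O : Set M) : Prop :=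
  ContMDiffOn (𝓡 n) ((𝓡 n).prod 𝓘(ℝ, Fib r)) ∞ (fun q => TotalSpace.mk' (Fib r) q (u q)) O

/-- Smooth hermitian bundle metrics; conjugate linear in the first argument. -/
structure HMetric where
  form (q : M) : E q →ₗ⋆[ℂ] E q →ₗ[ℂ] ℂ
  symm (q : M) (u v : E q) : form q u v = starRingEnd ℂ (form q v u)
  pos (q : M) (u : E q) : u ≠ 0 → 0 < (form q u u).re
  smooth (O : Set M) (u v : ∀ q, E q) : IsOpen O → SmoothOn n r E u O → SmoothOn n r E v O →
    ContMDiffOn (𝓡 n) 𝓘(ℝ, ℂ) ∞ (fun q => form q (u q) (v q)) O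

/-- A smooth chart of `M` together with a smooth frame of the bundle over its domain. -/
structure FramedChart where
  x : OpenPartialHomeomorph M (EuclideanSpace ℝ (Fin n))
  x_mem : x ∈ IsManifold.maximalAtlas (𝓡 n) ∞ M
  frame : Fin r → ∀ q, E q
  smooth : ∀ k, SmoothOn n r E (frame k) x.source
  indep : ∀ q ∈ x.source, LinearIndependent ℂ (fun k => frame k q)
  span : ∀ q ∈ x.source, ⊤ ≤ Submodule.span ℂ (Set.range fun k => frame k q)

namespace FramedChart

variable {n r E} (κ : FramedChart n r E)

open Classical in
/-- Components of a vector of the fibre over a point of the chart domain in the given frame. -/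
def comp (q : M) (v : E q) : Fin r → ℂ :=
  if h : ∃ a : Fin r → ℂ, v = ∑ k, a k • κ.frame k q then h.choose else 0

/-- The local representation of a section, a `ℂ^r`-valued function of the coordinates. -/
def rep (u : ∀ q, E q) (y : EuclideanSpace ℝ (Fin n)) : Fin r → ℂ :=
  κ.comp (κ.x.symm y) (u (κ.x.symm y))

/-- The local matrix of an endomorphism field. -/
def repEnd (W : ∀ q, E q →ₗ[ℂ] E q) (y : EuclideanSpace ℝ (Fin n)) :
    Matrix (Fin r) (Fin r) ℂ :=
  Matrix.of fun k l =>
    κ.comp (κ.x.symm y) (W (κ.x.symm y) (κ.frame l (κ.x.symm y))) k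

end FramedChart

variable [IsManifold (𝓡 n) ∞ M] [VectorBundle ℂ (Fib r) E] [VectorBundle ℝ (Fib r) E]
  [ContMDiffVectorBundle ∞ (Fib r) E (𝓡 n)]

/-- The space `Γ^∞(M, E)` of smooth sections. -/
abbrev Sections : Type _ := ContMDiffSection (𝓡 n) (Fib r) ∞ E

variable {n r E}

/-- The expression of a Laplace type operator in a framed chart: smooth matrix functions `b_j`, `c`
such that `L = -∑ g^{ij} ∂_i ∂_j + ∑ b_j ∂_j + c`. -/
structure LaplaceForm (g : RMetric n M) (L : Sections n r E → Sections n r E)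
    (κ : FramedChart n r E) where
  b : Fin n → EuclideanSpace ℝ (Fin n) → Matrix (Fin r) (Fin r) ℂ
  c : EuclideanSpace ℝ (Fin n) → Matrix (Fin r) (Fin r) ℂ
  b_smooth : ∀ j k l, ContDiffOn ℝ ∞ (fun y => b j y k l) κ.x.target
  c_smooth : ∀ k l, ContDiffOn ℝ ∞ (fun y => c y k l) κ.x.target
  apply_eq : ∀ (u : Sections n r E), ∀ y ∈ κ.x.target, κ.rep (L u) y =
    -(∑ i, ∑ j, (gram g κ.x y)⁻¹ i j • pd i (pd j (κ.rep u)) y)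
      + ∑ j, (b j y).mulVec (pd j (κ.rep u) y) + (c y).mulVec (κ.rep u y)

variable (n r E)

/-- The data of a Schrödinger operator `H_ħ = ħ² L + ħ W + V` near a well `p`: a Riemannian metric
`g`, a bundle metric `γ`, a symmetric Laplace type operator `L`, a symmetric endomorphism field `W`
and a potential `V` with a non-degenerate minimum at `p` and `V(p) = 0`. -/
structure Setup (p : M) where
  g : RMetric n M
  γ : HMetric n r E
  L : Sections n r E → Sections n r E
  laplace : ∀ κ : FramedChart n r E, Nonempty (LaplaceForm g L κ)
  /-- `∫ γ[Lu, v] = ∫ γ[u, Lv]` for all `u, v` with compact support in the domain of a chart. (By a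
  partition of unity, the same holds then for all `u, v` with compact support.) -/
  L_symm : ∀ x ∈ IsManifold.maximalAtlas (𝓡 n) ∞ M, ∀ C : Set M, IsCompact C → C ⊆ x.source →
    ∀ u v : Sections n r E, (∀ q ∉ C, u q = 0) → (∀ q ∉ C, v q = 0) →
      chartIntegral g x (fun q => γ.form q (L u q) (v q)) =
        chartIntegral g x (fun q => γ.form q (u q) (L v q))
  W : ∀ q, E q →ₗ[ℂ] E q
  W_smooth : ∀ (O : Set M) (u : ∀ q, E q), IsOpen O → SmoothOn n r E u O →
    SmoothOn n r E (fun q => W q (u q)) O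
  W_symm : ∀ (q : M) (u v : E q), γ.form q (W q u) v = γ.form q u (W q v)
  V : M → ℝ
  V_smooth : ContMDiff (𝓡 n) 𝓘(ℝ, ℝ) ∞ V
  V_min : IsNondegMin n V p
  V_zero : V p = 0

namespace Setup

variable {n r E} {p : M} (𝒮 : Setup n r E p)

/-- `φ` is a smooth solution on the open neighbourhood `U` of `p` of the eikonal equation
`|dφ|² = V` with `φ(p) = 0` and a non-degenerate minimum at `p`. -/
structure IsEikonal (U : Set M) (φ : M → ℝ) : Prop where
  isOpen : IsOpen U
  mem : p ∈ U
  smooth : ContMDiffOn (𝓡 n) 𝓘(ℝ, ℝ) ∞ φ U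
  zero : φ p = 0
  min : IsNondegMin n φ p
  eikonal : ∀ q ∈ U, conormSq 𝒮.g q (mfderiv (𝓡 n) 𝓘(ℝ, ℝ) φ q) = 𝒮.V q

/-- The framed chart `κ` is centred at `p`, with `g_{ij}(p) = δ_{ij}` and
`φ = ∑_ν λ_ν x_ν² / 2 + O(|x|³)`, and its frame at `p` is an orthonormal basis of `E_p` consisting
of eigenvectors of `W(p)` with eigenvalues `μ_k`. (For instance `x` may be geodesic normal
coordinates, and the frame may be parallel along the geodesics issuing from `p`.) -/
structure IsAdapted (U : Set M) (φ : M → ℝ) (κ : FramedChart n r E) (lam : Fin n → ℝ)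
    (mu : Fin r → ℝ) : Prop where
  source_subset : κ.x.source ⊆ U
  mem : p ∈ κ.x.source
  centred : κ.x p = 0
  metric : gram 𝒮.g κ.x 0 = 1
  hessian : ∀ i j, pd i (pd j (φ ∘ κ.x.symm)) 0 = if i = j then lam i else 0
  orthonormal : ∀ k l, 𝒮.γ.form p (κ.frame k p) (κ.frame l p) = if k = l then 1 else 0
  eigen : ∀ k, 𝒮.W p (κ.frame k p) = (mu k : ℂ) • κ.frame k p

/-- The Taylor series `τ_p` of the geometric data in a framed chart. -/
def taylorData (φ : M → ℝ) (κ : FramedChart n r E) (ℓ : LaplaceForm 𝒮.g 𝒮.L κ) (lam : Fin n → ℝ)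
    (mu : Fin r → ℝ) : TaylorData n r where
  ginv i j := taylor fun y => (((gram 𝒮.g κ.x y)⁻¹ i j : ℝ) : ℂ)
  b j := Matrix.of fun k l => taylor fun y => ℓ.b j y k l
  c := Matrix.of fun k l => taylor fun y => ℓ.c y k l
  w := Matrix.of fun k l => taylor fun y => κ.repEnd 𝒮.W y k l
  V := taylor fun y => (𝒮.V (κ.x.symm y) : ℂ)
  φ := taylor fun y => (φ (κ.x.symm y) : ℂ)
  vol := taylor fun y => (Real.sqrt (gram 𝒮.g κ.x y).det : ℂ)
  γ := Matrix.of fun k l => taylor fun y =>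
    𝒮.γ.form (κ.x.symm y) (κ.frame k (κ.x.symm y)) (κ.frame l (κ.x.symm y))
  lam := lam
  mu := mu

end Setup

end Geometry

end Parity

end

noncomputable section

namespace Parity

/-! ## Taylor series of smooth germs -/

section TaylorCalculus

open Filter Topology

variable {n : ℕ}

/-! Write t = ħ^{1/2}. The parity statement comes from one symmetry, the substitution t ↦ -t with x
held fixed. In the variables y = x/t it reads t ↦ -t, y ↦ -y (`theta`). In the variable x, the
conjugated operator, the phase and the density involve only integral powers of ħ. Hence the
substitution commutes with `Q` (`Good.Q_theta`), and applying it to both arguments of the form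
amounts to t ↦ -t in the value (`Good.form_theta`). It multiplies h_{α,k} by (-1)^{|α|}. If all the
|α| have the same parity, every f^j, and then every b^j, is multiplied by the same sign, and this
sign cancels in (b^i, Q b^j). So these matrix entries are even in t. Four further ingredients are
needed.

Geometry. The formal theory uses the manifold only through the identities of Taylor series collected
in `TaylorData.Good`, which `Setup.good` derives. Taylor expansion at the centre is multiplicative
and commutes with derivatives. The eikonal equation transfers directly. The symmetry of L is tested
on frame sections times test functions, and integration by parts turns it into pointwise identities
for the coefficients.

Spectral theory. `Q` preserves the order in t of series in y and acts on the lowest coefficient as a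
harmonic oscillator, diagonal in Hermite polynomials (`Good.Q_leading`, `Q₀_hPol`). By the eikonal
equation it also preserves the order in t of series in x (`Good.Q_xVanish`), which bounds the degree
in y of every coefficient. Hence equations can be solved order by order without leaving 𝔖₀, and Q -
z is invertible for z off the oscillator spectrum (`Good.isUnit_Qsub`). Modulo any power of t a
vector is annihilated by a product of factors Q - E, so Bézout's identity splits it into a part
belonging to E₀ and a part belonging to the other energies. Coefficients of the resolvent are
rational in z, and the contour integral extracts the first part (`Good.proj_spec`).

The form. Integration by parts against the formal weight e^{-2φ/ħ}, together with the identities for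
L and W, shows that `Q` is symmetric (`Good.form_Q`). To lowest order the form is the Gaussian inner
product, in which the h_{α,k} are orthonormal. So A = 1 + O(t) has an inverse square root, and the
b^j are an orthonormal basis of the range of the projection (`Good.eq_zero_of_form`).

Real eigenvalues. The matrix C of `Q` is hermitian. Over ℂ((t)) a hermitian matrix is similar to a
real diagonal one (`realDiag_of_adj`): subtract a scalar, divide by a power of t so that the
constant term is not scalar, diagonalize the constant term, split by a Riccati equation and induct
on the size. Since C is even in t, this is applied to C as a matrix over ℂ((s)) with s = t²; thus
the eigenvalues are series in ħ (`charpoly_of_adj_of_isIntegral`). -/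

theorem pd_contDiffAt {f : EuclideanSpace ℝ (Fin n) → ℂ} {y : EuclideanSpace ℝ (Fin n)}
    (i : Fin n) (hf : ContDiffAt ℝ ∞ f y) : ContDiffAt ℝ ∞ (pd i f) y :=
  (hf.fderiv_right (m := ∞) (by simp)).clm_apply contDiffAt_const

theorem pd_congr {f g : EuclideanSpace ℝ (Fin n) → ℂ} {y : EuclideanSpace ℝ (Fin n)}
    (i : Fin n) (h : f =ᶠ[𝓝 y] g) : pd i f =ᶠ[𝓝 y] pd i g :=
  (h.fderiv (𝕜 := ℝ)).mono fun z hz => by simp only [pd, hz]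

theorem eventually_differentiableAt {f : EuclideanSpace ℝ (Fin n) → ℂ}
    {y : EuclideanSpace ℝ (Fin n)} (hf : ContDiffAt ℝ ∞ f y) :
    ∀ᶠ z in 𝓝 y, DifferentiableAt ℝ f z :=
  ((hf.of_le (m := 1) (by simp)).eventually (by simp)).mono fun _ hz =>
    hz.differentiableAt (by simp)

theorem pd_add {f g : EuclideanSpace ℝ (Fin n) → ℂ} {y : EuclideanSpace ℝ (Fin n)}
    (i : Fin n) (hf : ContDiffAt ℝ ∞ f y) (hg : ContDiffAt ℝ ∞ g y) :
    pd i (fun z => f z + g z) =ᶠ[𝓝 y] fun z => pd i f z + pd i g z := by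
  filter_upwards [eventually_differentiableAt hf, eventually_differentiableAt hg] with z h1 h2
  simp only [pd]
  rw [fderiv_fun_add h1 h2]
  rfl

theorem pd_mul {f g : EuclideanSpace ℝ (Fin n) → ℂ} {y : EuclideanSpace ℝ (Fin n)}
    (i : Fin n) (hf : ContDiffAt ℝ ∞ f y) (hg : ContDiffAt ℝ ∞ g y) :
    pd i (fun z => f z * g z) =ᶠ[𝓝 y] fun z => pd i f z * g z + f z * pd i g z := by
  filter_upwards [eventually_differentiableAt hf, eventually_differentiableAt hg] with z h1 h2
  simp only [pd]
  rw [fderiv_fun_mul h1 h2]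
  simp only [add_apply, smul_apply, smul_eq_mul]
  ring

theorem pd_const (i : Fin n) (c : ℂ) :
    pd i (fun _ : EuclideanSpace ℝ (Fin n) => c) = fun _ => 0 := by
  funext z
  simp [pd]

theorem pd_conj {f : EuclideanSpace ℝ (Fin n) → ℂ} {y : EuclideanSpace ℝ (Fin n)}
    (i : Fin n) (hf : ContDiffAt ℝ ∞ f y) :
    pd i (fun z => starRingEnd ℂ (f z)) =ᶠ[𝓝 y] fun z => starRingEnd ℂ (pd i f z) := by
  filter_upwards [eventually_differentiableAt hf] with z h1
  simp only [pd]
  have := (Complex.conjCLE.toContinuousLinearMap.hasFDerivAt.comp z h1.hasFDerivAt).fderiv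
  have h2 : (⇑Complex.conjCLE.toContinuousLinearMap ∘ f) = fun z => starRingEnd ℂ (f z) := rfl
  rw [h2] at this
  rw [this]
  rfl

/-- Both mixed derivatives are values of the second Fréchet derivative, which is symmetric. Only a
finite order of smoothness at a point persists at nearby points, hence the passage to order 2. -/
theorem pd_comm {f : EuclideanSpace ℝ (Fin n) → ℂ} {y : EuclideanSpace ℝ (Fin n)}
    (i j : Fin n) (hf : ContDiffAt ℝ ∞ f y) :
    pd i (pd j f) =ᶠ[𝓝 y] pd j (pd i f) := by
  have key : ∀ z, ContDiffAt ℝ 2 f z → ∀ i j : Fin n,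
      pd i (pd j f) z = fderiv ℝ (fderiv ℝ f) z (stdVec i) (stdVec j) := by
    intro z hz i j
    have hd : DifferentiableAt ℝ (fderiv ℝ f) z :=
      (hz.fderiv_right (m := 1) (by norm_num)).differentiableAt (by simp)
    change fderiv ℝ (fun y => fderiv ℝ f y (stdVec j)) z (stdVec i) = _
    rw [fderiv_clm_apply hd (differentiableAt_const _)]
    simp
  filter_upwards [(hf.of_le (m := 2) (by exact WithTop.coe_le_coe.mpr le_top)).eventually (by simp)] with z hz
  rw [key z hz, key z hz]
  exact (hz.isSymmSndFDerivAt (by simp)) _ _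

theorem iterate_pd_congr {f g : EuclideanSpace ℝ (Fin n) → ℂ} {y : EuclideanSpace ℝ (Fin n)}
    (i : Fin n) (k : ℕ) (h : f =ᶠ[𝓝 y] g) : (pd i)^[k] f =ᶠ[𝓝 y] (pd i)^[k] g := by
  induction k generalizing f g with
  | zero => exact h
  | succ k ih => exact ih (pd_congr i h)

theorem iterate_pd_contDiffAt {f : EuclideanSpace ℝ (Fin n) → ℂ} {y : EuclideanSpace ℝ (Fin n)}
    (i : Fin n) (k : ℕ) (hf : ContDiffAt ℝ ∞ f y) : ContDiffAt ℝ ∞ ((pd i)^[k] f) y := by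
  induction k generalizing f with
  | zero => exact hf
  | succ k ih => exact ih (pd_contDiffAt i hf)

theorem pd_iterate_comm {f : EuclideanSpace ℝ (Fin n) → ℂ} {y : EuclideanSpace ℝ (Fin n)}
    (i j : Fin n) (k : ℕ) (hf : ContDiffAt ℝ ∞ f y) :
    pd i ((pd j)^[k] f) =ᶠ[𝓝 y] (pd j)^[k] (pd i f) := by
  induction k generalizing f with
  | zero => rfl
  | succ k ih =>
    exact (ih (pd_contDiffAt j hf)).trans (iterate_pd_congr j k (pd_comm i j hf))

/-- The iterated derivative along a list of directions, of which `mpd` is a special case. -/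
def pdList (α : Fin n →₀ ℕ) (l : List (Fin n)) (f : EuclideanSpace ℝ (Fin n) → ℂ) :
    EuclideanSpace ℝ (Fin n) → ℂ :=
  l.foldr (fun i h => (pd i)^[α i] h) f

theorem pdList_congr {f g : EuclideanSpace ℝ (Fin n) → ℂ} {y : EuclideanSpace ℝ (Fin n)}
    (α : Fin n →₀ ℕ) (l : List (Fin n)) (h : f =ᶠ[𝓝 y] g) :
    pdList α l f =ᶠ[𝓝 y] pdList α l g := by
  induction l with
  | nil => exact h
  | cons j l ih => exact iterate_pd_congr j _ ih

theorem pdList_contDiffAt {f : EuclideanSpace ℝ (Fin n) → ℂ} {y : EuclideanSpace ℝ (Fin n)}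
    (α : Fin n →₀ ℕ) (l : List (Fin n)) (hf : ContDiffAt ℝ ∞ f y) :
    ContDiffAt ℝ ∞ (pdList α l f) y := by
  induction l with
  | nil => exact hf
  | cons j l ih => exact iterate_pd_contDiffAt j _ ih

theorem pd_pdList {f : EuclideanSpace ℝ (Fin n) → ℂ} {y : EuclideanSpace ℝ (Fin n)}
    (i : Fin n) (α : Fin n →₀ ℕ) (l : List (Fin n)) (hf : ContDiffAt ℝ ∞ f y) :
    pd i (pdList α l f) =ᶠ[𝓝 y] pdList α l (pd i f) := by
  induction l with
  | nil => rfl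
  | cons j l ih =>
    exact (pd_iterate_comm i j _ (pdList_contDiffAt α l hf)).trans (iterate_pd_congr j _ ih)

theorem pdList_add_single_of_notMem (i : Fin n) (α : Fin n →₀ ℕ) (l : List (Fin n)) (hi : i ∉ l)
    (f : EuclideanSpace ℝ (Fin n) → ℂ) :
    pdList (α + Finsupp.single i 1) l f = pdList α l f := by
  induction l with
  | nil => rfl
  | cons j l ih =>
    simp only [List.mem_cons, not_or] at hi
    change (pd j)^[(α + Finsupp.single i 1 : Fin n →₀ ℕ) j] (pdList (α + Finsupp.single i 1) l f) =
      (pd j)^[α j] (pdList α l f)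
    rw [ih hi.2, Finsupp.add_apply, Finsupp.single_eq_of_ne (Ne.symm hi.1), add_zero]

/-- The extra derivative appears where `i` occurs in the list and must be moved inwards past the
later directions. Without duplicates it appears exactly once. -/
theorem pdList_add_single {f : EuclideanSpace ℝ (Fin n) → ℂ} {y : EuclideanSpace ℝ (Fin n)}
    (i : Fin n) (α : Fin n →₀ ℕ) (l : List (Fin n)) (hl : l.Nodup) (hi : i ∈ l)
    (hf : ContDiffAt ℝ ∞ f y) :
    pdList (α + Finsupp.single i 1) l f =ᶠ[𝓝 y] pdList α l (pd i f) := by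
  induction l with
  | nil => simp at hi
  | cons j l ih =>
    rw [List.nodup_cons] at hl
    change (pd j)^[(α + Finsupp.single i 1 : Fin n →₀ ℕ) j] (pdList (α + Finsupp.single i 1) l f) =ᶠ[𝓝 y]
      (pd j)^[α j] (pdList α l (pd i f))
    by_cases hij : i = j
    · subst hij
      rw [pdList_add_single_of_notMem i α l hl.1, Finsupp.add_apply, Finsupp.single_eq_same,
        Function.iterate_succ]
      exact iterate_pd_congr i _ (pd_pdList i α l hf)
    · rw [Finsupp.add_apply, Finsupp.single_eq_of_ne (Ne.symm hij), add_zero]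
      exact iterate_pd_congr j _ (ih hl.2 ((List.mem_cons.mp hi).resolve_left hij))

theorem coeff_taylor (f : EuclideanSpace ℝ (Fin n) → ℂ) (α : Fin n →₀ ℕ) :
    MvPowerSeries.coeff α (taylor f) = (∏ i, ((α i).factorial : ℂ))⁻¹ * mpd α f 0 := rfl

theorem constantCoeff_taylor (f : EuclideanSpace ℝ (Fin n) → ℂ) :
    MvPowerSeries.constantCoeff (taylor f) = f 0 := by
  rw [← MvPowerSeries.coeff_zero_eq_constantCoeff_apply, coeff_taylor]
  have : ∀ l : List (Fin n), pdList 0 l f = f := by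
    intro l
    induction l with
    | nil => rfl
    | cons j l ih => exact ih
  change _ * pdList 0 _ f 0 = _
  rw [this]
  simp

theorem taylor_congr {f g : EuclideanSpace ℝ (Fin n) → ℂ} (h : f =ᶠ[𝓝 0] g) :
    taylor f = taylor g := by
  ext α
  rw [coeff_taylor, coeff_taylor]
  congr 1
  exact (pdList_congr α (List.finRange n) h).eq_of_nhds

/-- The factor α_i + 1 from differentiating a power series turns 1/(α + e_i)! into 1/α!. Through
this lemma identities of Taylor series can be proved by differentiating them, without unfolding
`mpd`. -/
theorem pderiv_taylor {f : EuclideanSpace ℝ (Fin n) → ℂ} (i : Fin n) (hf : ContDiffAt ℝ ∞ f 0) :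
    MvPowerSeries.pderiv ℂ i (taylor f) = taylor (pd i f) := by
  ext α
  rw [MvPowerSeries.coeff_pderiv, coeff_taylor, coeff_taylor]
  have h1 : mpd (α + Finsupp.single i 1) f 0 = mpd α (pd i f) 0 :=
    (pdList_add_single i α (List.finRange n) (List.nodup_finRange n) (List.mem_finRange i)
      hf).eq_of_nhds
  rw [h1]
  have h2 : (∏ j, (((α + Finsupp.single i 1 : Fin n →₀ ℕ) j).factorial : ℂ)) =
      (∏ j, ((α j).factorial : ℂ)) * ((α i : ℂ) + 1) := by
    rw [← Finset.mul_prod_erase _ _ (Finset.mem_univ i),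
      ← Finset.mul_prod_erase _ (fun j => ((α j).factorial : ℂ)) (Finset.mem_univ i)]
    have h3 : ∀ j ∈ Finset.univ.erase i,
        (((α + Finsupp.single i 1 : Fin n →₀ ℕ) j).factorial : ℂ) = ((α j).factorial : ℂ) := by
      intro j hj
      rw [Finsupp.add_apply, Finsupp.single_eq_of_ne (Finset.ne_of_mem_erase hj), add_zero]
    rw [Finset.prod_congr rfl h3, Finsupp.add_apply, Finsupp.single_eq_same, Nat.factorial_succ]
    push_cast
    ring
  rw [h2, mul_inv]
  have h4 : (α i : ℂ) + 1 ≠ 0 := Nat.cast_add_one_ne_zero _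
  field_simp

/-- Two power series agree up to order `d + 1` if their constant terms agree and their partial
derivatives agree up to order `d`. -/
theorem coeff_eq_of_pderiv {F G : PS n} {d : ℕ}
    (h0 : MvPowerSeries.constantCoeff F = MvPowerSeries.constantCoeff G)
    (h : ∀ i, ∀ α : Fin n →₀ ℕ, α.degree < d → MvPowerSeries.coeff α (MvPowerSeries.pderiv ℂ i F) =
      MvPowerSeries.coeff α (MvPowerSeries.pderiv ℂ i G))
    (α : Fin n →₀ ℕ) (hα : α.degree < d + 1) :
    MvPowerSeries.coeff α F = MvPowerSeries.coeff α G := by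
  by_cases h1 : α = 0
  · subst h1
    simpa using h0
  · obtain ⟨i, hi⟩ : ∃ i, α i ≠ 0 := by
      by_contra! h2
      exact h1 (Finsupp.ext h2)
    obtain ⟨β, rfl⟩ : ∃ β : Fin n →₀ ℕ, α = β + Finsupp.single i 1 := by
      refine ⟨α - Finsupp.single i 1, (tsub_add_cancel_of_le ?_).symm⟩
      rw [Finsupp.single_le_iff]
      omega
    have h3 := h i β (by rw [map_add, Finsupp.degree_single] at hα; omega)
    rw [MvPowerSeries.coeff_pderiv, MvPowerSeries.coeff_pderiv] at h3
    exact mul_right_cancel₀ (Nat.cast_add_one_ne_zero (R := ℂ) (β i)) h3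

/-- Induction on the degree: the constant terms agree, and the partial derivatives of the two sides
are an instance of the same claim for the derivatives of `f` and `g`. The product, constant and
conjugation rules follow the same pattern. -/
theorem taylor_add {f g : EuclideanSpace ℝ (Fin n) → ℂ} (hf : ContDiffAt ℝ ∞ f 0)
    (hg : ContDiffAt ℝ ∞ g 0) : taylor (fun y => f y + g y) = taylor f + taylor g := by
  suffices H : ∀ d : ℕ, ∀ f g : EuclideanSpace ℝ (Fin n) → ℂ, ContDiffAt ℝ ∞ f 0 →
      ContDiffAt ℝ ∞ g 0 → ∀ α : Fin n →₀ ℕ, α.degree < d →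
      MvPowerSeries.coeff α (taylor fun y => f y + g y) =
        MvPowerSeries.coeff α (taylor f + taylor g) by
    ext α
    exact H _ f g hf hg α (Nat.lt_succ_self _)
  intro d
  induction d with
  | zero => intro f g _ _ α hα; exact absurd hα (Nat.not_lt_zero _)
  | succ d ih =>
    intro f g hf hg
    apply coeff_eq_of_pderiv
    · rw [map_add]
      simp only [constantCoeff_taylor]
    · intro i α hα
      rw [map_add, pderiv_taylor i (hf.add hg), pderiv_taylor i hf, pderiv_taylor i hg,
        taylor_congr (pd_add i hf hg)]
      exact ih _ _ (pd_contDiffAt i hf) (pd_contDiffAt i hg) α hα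

theorem taylor_mul {f g : EuclideanSpace ℝ (Fin n) → ℂ} (hf : ContDiffAt ℝ ∞ f 0)
    (hg : ContDiffAt ℝ ∞ g 0) : taylor (fun y => f y * g y) = taylor f * taylor g := by
  suffices H : ∀ d : ℕ, ∀ f g : EuclideanSpace ℝ (Fin n) → ℂ, ContDiffAt ℝ ∞ f 0 →
      ContDiffAt ℝ ∞ g 0 → ∀ α : Fin n →₀ ℕ, α.degree < d →
      MvPowerSeries.coeff α (taylor fun y => f y * g y) =
        MvPowerSeries.coeff α (taylor f * taylor g) by
    ext α
    exact H _ f g hf hg α (Nat.lt_succ_self _)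
  intro d
  induction d with
  | zero => intro f g _ _ α hα; exact absurd hα (Nat.not_lt_zero _)
  | succ d ih =>
    intro f g hf hg
    apply coeff_eq_of_pderiv
    · rw [map_mul]
      simp only [constantCoeff_taylor]
    · intro i α hα
      have hf' := pd_contDiffAt i hf
      have hg' := pd_contDiffAt i hg
      rw [Derivation.leibniz, pderiv_taylor i (hf.mul hg), pderiv_taylor i hf, pderiv_taylor i hg,
        taylor_congr (pd_mul i hf hg), taylor_add (hf'.mul hg) (hf.mul hg'), map_add, map_add,
        ih _ _ hf' hg α hα, ih _ _ hf hg' α hα, smul_eq_mul, smul_eq_mul,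
        mul_comm (taylor g), add_comm]

theorem taylor_const (c : ℂ) :
    taylor (fun _ : EuclideanSpace ℝ (Fin n) => c) = MvPowerSeries.C c := by
  suffices H : ∀ d : ℕ, ∀ c : ℂ, ∀ α : Fin n →₀ ℕ, α.degree < d →
      MvPowerSeries.coeff α (taylor fun _ : EuclideanSpace ℝ (Fin n) => c) =
        MvPowerSeries.coeff α (MvPowerSeries.C c) by
    ext α
    exact H _ c α (Nat.lt_succ_self _)
  intro d
  induction d with
  | zero => intro c α hα; exact absurd hα (Nat.not_lt_zero _)
  | succ d ih =>
    intro c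
    apply coeff_eq_of_pderiv
    · rw [constantCoeff_taylor, MvPowerSeries.constantCoeff_C]
    · intro i α hα
      rw [pderiv_taylor i contDiffAt_const, pd_const, ih 0 α hα]
      have : MvPowerSeries.pderiv ℂ i (MvPowerSeries.C c : PS n) = 0 := by simp
      rw [this, map_zero]

theorem taylor_conj {f : EuclideanSpace ℝ (Fin n) → ℂ} (hf : ContDiffAt ℝ ∞ f 0) :
    taylor (fun y => starRingEnd ℂ (f y)) = MvPowerSeries.map (starRingEnd ℂ) (taylor f) := by
  suffices H : ∀ d : ℕ, ∀ f : EuclideanSpace ℝ (Fin n) → ℂ, ContDiffAt ℝ ∞ f 0 →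
      ∀ α : Fin n →₀ ℕ, α.degree < d →
      MvPowerSeries.coeff α (taylor fun y => starRingEnd ℂ (f y)) =
        MvPowerSeries.coeff α (MvPowerSeries.map (starRingEnd ℂ) (taylor f)) by
    ext α
    exact H _ f hf α (Nat.lt_succ_self _)
  have hc : ∀ f : EuclideanSpace ℝ (Fin n) → ℂ, ContDiffAt ℝ ∞ f 0 →
      ContDiffAt ℝ ∞ (fun y => starRingEnd ℂ (f y)) 0 := fun f hf =>
    Complex.conjCLE.contDiff.contDiffAt.comp _ hf
  intro d
  induction d with
  | zero => intro f _ α hα; exact absurd hα (Nat.not_lt_zero _)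
  | succ d ih =>
    intro f hf
    apply coeff_eq_of_pderiv
    · rw [constantCoeff_taylor, MvPowerSeries.constantCoeff_map, constantCoeff_taylor]
    · intro i α hα
      rw [pderiv_taylor i (hc f hf), taylor_congr (pd_conj i hf), ih _ (pd_contDiffAt i hf) α hα]
      have : MvPowerSeries.pderiv ℂ i (MvPowerSeries.map (starRingEnd ℂ) (taylor f)) =
          MvPowerSeries.map (starRingEnd ℂ) (MvPowerSeries.pderiv ℂ i (taylor f)) := by
        ext β
        simp [MvPowerSeries.coeff_pderiv]
      rw [this, pderiv_taylor i hf]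

theorem taylor_sum {ι : Type*} (s : Finset ι) {f : ι → EuclideanSpace ℝ (Fin n) → ℂ}
    (hf : ∀ i ∈ s, ContDiffAt ℝ ∞ (f i) 0) :
    taylor (fun y => ∑ i ∈ s, f i y) = ∑ i ∈ s, taylor (f i) := by
  classical
  induction s using Finset.induction_on with
  | empty => simp [taylor_const]
  | insert a s ha ih =>
    have h1 : ∀ i ∈ s, ContDiffAt ℝ ∞ (f i) 0 := fun i hi => hf i (Finset.mem_insert_of_mem hi)
    simp only [Finset.sum_insert ha]
    rw [taylor_add (hf a (Finset.mem_insert_self a s)) (ContDiffAt.sum h1), ih h1]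

theorem taylor_neg {f : EuclideanSpace ℝ (Fin n) → ℂ} (hf : ContDiffAt ℝ ∞ f 0) :
    taylor (fun y => - f y) = - taylor f := by
  have h := taylor_add hf hf.neg
  simp only [add_neg_cancel] at h
  rw [taylor_const, map_zero] at h
  exact (neg_eq_of_add_eq_zero_right h.symm).symm

theorem taylor_coord (i : Fin n) :
    taylor (fun y : EuclideanSpace ℝ (Fin n) => ((y i : ℝ) : ℂ)) = MvPowerSeries.X i := by
  have hc : ContDiffAt ℝ ∞ (fun y : EuclideanSpace ℝ (Fin n) => ((y i : ℝ) : ℂ)) 0 :=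
    ((Complex.ofRealCLM.comp (EuclideanSpace.proj i)).contDiff).contDiffAt
  ext α
  -- No induction is needed here, since the partial derivatives of a coordinate are constants.
  refine coeff_eq_of_pderiv (d := α.degree) ?_ ?_ α (Nat.lt_succ_self _)
  · rw [constantCoeff_taylor]
    simp
  · intro j β _
    rw [pderiv_taylor j hc]
    have : pd j (fun y : EuclideanSpace ℝ (Fin n) => ((y i : ℝ) : ℂ)) =
        fun _ => if i = j then 1 else 0 := by
      funext y
      have h := (Complex.ofRealCLM.comp
        (EuclideanSpace.proj i : EuclideanSpace ℝ (Fin n) →L[ℝ] ℝ)).hasFDerivAt (x := y) |>.fderiv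
      change fderiv ℝ (⇑(Complex.ofRealCLM.comp
        (EuclideanSpace.proj i : EuclideanSpace ℝ (Fin n) →L[ℝ] ℝ))) y (stdVec j) = _
      rw [h]
      by_cases hij : i = j <;> simp [stdVec, hij]
    rw [this, taylor_const]
    congr 1
    ext β
    classical
    rw [MvPowerSeries.coeff_pderiv, MvPowerSeries.coeff_X, MvPowerSeries.coeff_C]
    by_cases hij : i = j
    · subst hij
      by_cases hβ : β = 0
      · simp [hβ]
      · simp [hβ]
    · by_cases hβ : β + Finsupp.single j 1 = Finsupp.single i 1
      · have h1 := DFunLike.congr_fun hβ j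
        simp [hij] at h1
      · simp [hβ, hij]

end TaylorCalculus

/-! ### Smoothness of the metric in a chart, and covector norms under change of basis -/

section ChartLemmas

open Filter Topology

variable {n : ℕ} {M : Type*} [TopologicalSpace M] [ChartedSpace (EuclideanSpace ℝ (Fin n)) M]
  [IsManifold (𝓡 n) ∞ M]

theorem contDiffOn_comp_chart_symm {X : Type*} [NormedAddCommGroup X] [NormedSpace ℝ X]
    {x : OpenPartialHomeomorph M (EuclideanSpace ℝ (Fin n))}
    (hx : x ∈ IsManifold.maximalAtlas (𝓡 n) ∞ M) {f : M → X} {O : Set M}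
    (hf : ContMDiffOn (𝓡 n) 𝓘(ℝ, X) ∞ f O) (hO : x.source ⊆ O) :
    ContDiffOn ℝ ∞ (fun y => f (x.symm y)) x.target := by
  rw [← contMDiffOn_iff_contDiffOn]
  exact hf.comp (contMDiffOn_symm_of_mem_maximalAtlas hx)
    fun y hy => hO (x.map_target hy)

/-- The coordinate field is the tangent map of `x.symm` composed with a constant section of the
trivial tangent bundle. On the open target `mfderivWithin` and `mfderiv` agree. -/
theorem contMDiffAt_mfderiv_chart_symm {x : OpenPartialHomeomorph M (EuclideanSpace ℝ (Fin n))}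
    (hx : x ∈ IsManifold.maximalAtlas (𝓡 n) ∞ M) {y : EuclideanSpace ℝ (Fin n)}
    (hy : y ∈ x.target) (v : EuclideanSpace ℝ (Fin n)) :
    ContMDiffAt 𝓘(ℝ, EuclideanSpace ℝ (Fin n)) (𝓡 n).tangent ∞
      (fun z => (⟨x.symm z, mfderiv 𝓘(ℝ, EuclideanSpace ℝ (Fin n)) (𝓡 n) x.symm z v⟩ :
        TangentBundle (𝓡 n) M)) y := by
  have h1 := ContMDiffOn.contMDiffOn_tangentMapWithin (m := ∞)
    (contMDiffOn_symm_of_mem_maximalAtlas hx) (by simp) x.open_target.uniqueMDiffOn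
  have h2 : ContMDiff 𝓘(ℝ, EuclideanSpace ℝ (Fin n)) (𝓘(ℝ, EuclideanSpace ℝ (Fin n))).tangent ∞
      (fun z => (⟨z, v⟩ : TangentBundle 𝓘(ℝ, EuclideanSpace ℝ (Fin n))
        (EuclideanSpace ℝ (Fin n)))) :=
    contMDiff_vectorSpace_iff_contDiff.mpr contDiff_const
  have h3 := (h1.comp (h2.contMDiffOn (s := x.target)) fun z hz => hz).contMDiffAt
    (x.open_target.mem_nhds hy)
  refine h3.congr_of_eventuallyEq ?_
  filter_upwards [x.open_target.mem_nhds hy] with z hz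
  simp only [Function.comp, tangentMapWithin]
  rw [mfderivWithin_of_isOpen x.open_target hz]

theorem contDiffOn_gram (g : RMetric n M) {x : OpenPartialHomeomorph M (EuclideanSpace ℝ (Fin n))}
    (hx : x ∈ IsManifold.maximalAtlas (𝓡 n) ∞ M) (i j : Fin n) :
    ContDiffOn ℝ ∞ (fun y => gram g x y i j) x.target := by
  intro y hy
  refine ContDiffAt.contDiffWithinAt ?_
  rw [← contMDiffAt_iff_contDiffAt]
  have hb : ContMDiffAt 𝓘(ℝ, EuclideanSpace ℝ (Fin n)) (𝓡 n) ∞ x.symm y :=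
    (contMDiffOn_symm_of_mem_maximalAtlas hx).contMDiffAt (x.open_target.mem_nhds hy)
  have : ContMDiffAt 𝓘(ℝ, EuclideanSpace ℝ (Fin n)) ((𝓡 n).prod 𝓘(ℝ)) ∞
      (fun z ↦ TotalSpace.mk' ℝ (E := Bundle.Trivial M ℝ) (x.symm z) (gram g x z i j)) y := by
    apply ContMDiffAt.clm_bundle_apply₂ (F₁ := EuclideanSpace ℝ (Fin n))
      (F₂ := EuclideanSpace ℝ (Fin n))
    · exact g.contMDiff.contMDiffAt.comp y hb
    · exact contMDiffAt_mfderiv_chart_symm hx hy _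
    · exact contMDiffAt_mfderiv_chart_symm hx hy _
  rw [contMDiffAt_totalSpace] at this
  exact this.2

theorem gram_symm (g : RMetric n M) (x : OpenPartialHomeomorph M (EuclideanSpace ℝ (Fin n)))
    (y : EuclideanSpace ℝ (Fin n)) (i j : Fin n) : gram g x y i j = gram g x y j i :=
  g.symm _ _ _

/-- Change of basis for the squared norm of a covector. -/
theorem conorm_change_of_basis
    (B : EuclideanSpace ℝ (Fin n) →L[ℝ] EuclideanSpace ℝ (Fin n) →L[ℝ] ℝ)
    (J : EuclideanSpace ℝ (Fin n) →L[ℝ] EuclideanSpace ℝ (Fin n))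
    (ξ : EuclideanSpace ℝ (Fin n) →L[ℝ] ℝ)
    (hdet : IsUnit (Matrix.of fun i j : Fin n => B (J (stdVec i)) (J (stdVec j))).det) :
    ∑ i, ∑ j, (Matrix.of fun i j : Fin n => B (stdVec i) (stdVec j))⁻¹ i j *
        ξ (stdVec i) * ξ (stdVec j) =
      ∑ i, ∑ j, (Matrix.of fun i j : Fin n => B (J (stdVec i)) (J (stdVec j)))⁻¹ i j *
        ξ (J (stdVec i)) * ξ (J (stdVec j)) := by
  set A : Matrix (Fin n) (Fin n) ℝ := Matrix.of fun a i => J (stdVec i) a with hA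
  set G : Matrix (Fin n) (Fin n) ℝ := Matrix.of fun i j => B (stdVec i) (stdVec j) with hG
  set G' : Matrix (Fin n) (Fin n) ℝ := Matrix.of fun i j => B (J (stdVec i)) (J (stdVec j))
    with hG'
  have hJe : ∀ i, J (stdVec i) = ∑ a, A a i • stdVec a := by
    intro i
    have := (EuclideanSpace.basisFun (Fin n) ℝ).sum_repr (J (stdVec i))
    simp only [EuclideanSpace.basisFun_repr, EuclideanSpace.basisFun_apply] at this
    exact this.symm
  have hgram : G' = A.transpose * G * A := by
    ext i j
    rw [hG', Matrix.of_apply, hJe, hJe]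
    simp only [Matrix.mul_apply, Matrix.transpose_apply, map_sum, map_smul, sum_apply, smul_apply,
      smul_eq_mul, Finset.mul_sum, Finset.sum_mul, hG, Matrix.of_apply]
    refine Finset.sum_congr rfl fun b _ => Finset.sum_congr rfl fun a _ => ?_
    ring
  have hpd : ∀ i, ξ (J (stdVec i)) = ∑ a, A a i * ξ (stdVec a) := by
    intro i
    rw [hJe, map_sum]
    simp only [map_smul, smul_eq_mul]
  -- The new Gram determinant is det A · det G · det A, so its invertibility forces that of the
  -- Jacobian matrix and of the old Gram matrix.
  have hdet' : IsUnit A.det ∧ IsUnit G.det := by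
    rw [hgram, Matrix.det_mul, Matrix.det_mul, Matrix.det_transpose] at hdet
    simp only [IsUnit.mul_iff] at hdet
    exact ⟨hdet.2, hdet.1.2⟩
  have hAT : IsUnit A.transpose.det := by rw [Matrix.det_transpose]; exact hdet'.1
  have hinv : A * G'⁻¹ * A.transpose = G⁻¹ := by
    rw [hgram, Matrix.mul_inv_rev, Matrix.mul_inv_rev,
      Matrix.mul_nonsing_inv_cancel_left _ _ hdet'.1,
      Matrix.nonsing_inv_mul_cancel_right _ _ hAT]
  have h4 : ∀ F : Fin n → Fin n → Fin n → Fin n → ℝ, ∑ i, ∑ j, ∑ b, ∑ a, F i j b a =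
      ∑ a, ∑ b, ∑ j, ∑ i, F i j b a := by
    intro F
    calc ∑ i, ∑ j, ∑ b, ∑ a, F i j b a = ∑ i, ∑ j, ∑ a, ∑ b, F i j b a := by
          refine Finset.sum_congr rfl fun i _ => Finset.sum_congr rfl fun j _ => ?_
          exact Finset.sum_comm
      _ = ∑ i, ∑ a, ∑ j, ∑ b, F i j b a :=
          Finset.sum_congr rfl fun i _ => Finset.sum_comm
      _ = ∑ a, ∑ i, ∑ j, ∑ b, F i j b a := Finset.sum_comm
      _ = ∑ a, ∑ i, ∑ b, ∑ j, F i j b a :=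
          Finset.sum_congr rfl fun a _ => Finset.sum_congr rfl fun i _ => Finset.sum_comm
      _ = ∑ a, ∑ b, ∑ i, ∑ j, F i j b a :=
          Finset.sum_congr rfl fun a _ => Finset.sum_comm
      _ = ∑ a, ∑ b, ∑ j, ∑ i, F i j b a :=
          Finset.sum_congr rfl fun a _ => Finset.sum_congr rfl fun b _ => Finset.sum_comm
  rw [← hinv]
  simp only [hpd, Matrix.mul_apply, Matrix.transpose_apply, Finset.sum_mul, Finset.mul_sum]
  rw [h4 fun i j b a => G'⁻¹ i j * (A a i * ξ (stdVec a)) * (A b j * ξ (stdVec b))]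
  refine Finset.sum_congr rfl fun a _ => Finset.sum_congr rfl fun b _ =>
    Finset.sum_congr rfl fun j _ => Finset.sum_congr rfl fun i _ => ?_
  ring

/-- The squared norm of a differential is computed by the inverse Gram matrix of any chart. -/
theorem conormSq_eq (g : RMetric n M) {x : OpenPartialHomeomorph M (EuclideanSpace ℝ (Fin n))}
    (hx : x ∈ IsManifold.maximalAtlas (𝓡 n) ∞ M) {f : M → ℝ} {U : Set M} (hU : IsOpen U)
    (hf : ContMDiffOn (𝓡 n) 𝓘(ℝ, ℝ) ∞ f U) {y : EuclideanSpace ℝ (Fin n)} (hy : y ∈ x.target)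
    (hyU : x.symm y ∈ U) (hdet : IsUnit (gram g x y).det) :
    conormSq g (x.symm y) (mfderiv (𝓡 n) 𝓘(ℝ, ℝ) f (x.symm y)) =
      ∑ i, ∑ j, (gram g x y)⁻¹ i j * pd i (fun z => f (x.symm z)) y *
        pd j (fun z => f (x.symm z)) y := by
  have h1 : MDifferentiableAt (𝓡 n) 𝓘(ℝ, ℝ) f (x.symm y) :=
    (hf.contMDiffAt (hU.mem_nhds hyU)).mdifferentiableAt (by simp)
  have h2 : MDifferentiableAt 𝓘(ℝ, EuclideanSpace ℝ (Fin n)) (𝓡 n) x.symm y :=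
    ((contMDiffOn_symm_of_mem_maximalAtlas hx).contMDiffAt
      (x.open_target.mem_nhds hy)).mdifferentiableAt (by simp)
  have h3 := mfderiv_comp y h1 h2
  rw [mfderiv_eq_fderiv] at h3
  have h4 := conorm_change_of_basis (g.inner (x.symm y))
    (mfderiv 𝓘(ℝ, EuclideanSpace ℝ (Fin n)) (𝓡 n) x.symm y)
    (mfderiv (𝓡 n) 𝓘(ℝ, ℝ) f (x.symm y)) hdet
  refine h4.trans ?_
  change _ = ∑ i, ∑ j, (gram g x y)⁻¹ i j * fderiv ℝ (f ∘ x.symm) y (stdVec i) *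
        fderiv ℝ (f ∘ x.symm) y (stdVec j)
  rw [h3]
  rfl

end ChartLemmas

/-! ### Weak adjoints of second order operators -/

section WeakAdjoint

open Filter Topology MeasureTheory

variable {n : ℕ}

/-- The complex-valued function underlying a real-valued one. -/
abbrev cpx (f : EuclideanSpace ℝ (Fin n) → ℝ) : EuclideanSpace ℝ (Fin n) → ℂ := fun y => (f y : ℂ)

theorem contDiff_cpx {f : EuclideanSpace ℝ (Fin n) → ℝ} (hf : ContDiff ℝ ∞ f) :
    ContDiff ℝ ∞ (cpx f) :=
  Complex.ofRealCLM.contDiff.comp hf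

theorem contDiff_pd {f : EuclideanSpace ℝ (Fin n) → ℂ} (i : Fin n) (hf : ContDiff ℝ ∞ f) :
    ContDiff ℝ ∞ (pd i f) :=
  contDiff_iff_contDiffAt.mpr fun _ => pd_contDiffAt i hf.contDiffAt

theorem tsupport_pd_subset (f : EuclideanSpace ℝ (Fin n) → ℂ) (i : Fin n) :
    tsupport (pd i f) ⊆ tsupport f :=
  (tsupport_comp_subset (g := fun L : EuclideanSpace ℝ (Fin n) →L[ℝ] ℂ => L (stdVec i)) rfl
    (fderiv ℝ f)).trans (tsupport_fderiv_subset ℝ)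

theorem pd_conj_cpx {f : EuclideanSpace ℝ (Fin n) → ℝ} (i : Fin n) (hf : ContDiff ℝ ∞ f) :
    pd i (cpx f) = cpx (fun y => fderiv ℝ f y (stdVec i)) := by
  funext y
  have h1 : DifferentiableAt ℝ f y := (hf.differentiable (by simp)) y
  have := (Complex.ofRealCLM.hasFDerivAt.comp y h1.hasFDerivAt).fderiv
  change fderiv ℝ (⇑Complex.ofRealCLM ∘ f) y (stdVec i) = _
  rw [this]
  rfl

/-- A smooth function on an open set times a test function is a test function. -/
theorem contDiff_mul_of_tsupport_subset {O : Set (EuclideanSpace ℝ (Fin n))} (hO : IsOpen O)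
    {a ψ : EuclideanSpace ℝ (Fin n) → ℂ} (ha : ContDiffOn ℝ ∞ a O) (hψ : ContDiff ℝ ∞ ψ)
    (hs : tsupport ψ ⊆ O) : ContDiff ℝ ∞ fun y => a y * ψ y := by
  rw [contDiff_iff_contDiffAt]
  intro y
  by_cases hy : y ∈ O
  · exact (ha.contDiffAt (hO.mem_nhds hy)).mul hψ.contDiffAt
  · have : (fun y => a y * ψ y) =ᶠ[𝓝 y] fun _ => 0 := by
      filter_upwards [(isClosed_tsupport ψ).isOpen_compl.mem_nhds fun h => hy (hs h)] with z hz
      rw [image_eq_zero_of_notMem_tsupport hz, mul_zero]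
    exact contDiffAt_const.congr_of_eventuallyEq this

theorem integrable_mul_of_contDiff {F G : EuclideanSpace ℝ (Fin n) → ℂ} (hF : ContDiff ℝ ∞ F)
    (hG : ContDiff ℝ ∞ G) (hs : HasCompactSupport G) : Integrable fun y => F y * G y :=
  (hF.continuous.mul hG.continuous).integrable_of_hasCompactSupport hs.mul_left

theorem hasCompactSupport_pd {f : EuclideanSpace ℝ (Fin n) → ℂ} (i : Fin n)
    (hs : HasCompactSupport f) : HasCompactSupport (pd i f) :=
  hs.of_isClosed_subset (isClosed_tsupport _) (tsupport_pd_subset f i)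

/-- The compact support of `η` alone makes all the products integrable and removes boundary terms.
-/
theorem integral_mul_pd {F η : EuclideanSpace ℝ (Fin n) → ℂ} (i : Fin n) (hF : ContDiff ℝ ∞ F)
    (hη : ContDiff ℝ ∞ η) (hs : HasCompactSupport η) :
    ∫ y, F y * pd i η y = -∫ y, pd i F y * η y :=
  integral_mul_fderiv_eq_neg_fderiv_mul_of_integrable
    (integrable_mul_of_contDiff (contDiff_pd i hF) hη hs)
    (integrable_mul_of_contDiff hF (contDiff_pd i hη) (hasCompactSupport_pd i hs))
    (integrable_mul_of_contDiff hF hη hs)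
    (fun y _ => hF.differentiable (by simp) y) (fun y _ => hη.differentiable (by simp) y)

/-- If a second order operator applied to test functions integrates to a continuous function, its
formal transpose is that function. -/
theorem transpose_eq_of_integral_eq {O : Set (EuclideanSpace ℝ (Fin n))} (hO : IsOpen O)
    {A : Fin n → Fin n → EuclideanSpace ℝ (Fin n) → ℂ} {B : Fin n → EuclideanSpace ℝ (Fin n) → ℂ}
    {C R : EuclideanSpace ℝ (Fin n) → ℂ} (hA : ∀ i j, ContDiff ℝ ∞ (A i j))
    (hB : ∀ j, ContDiff ℝ ∞ (B j)) (hC : ContDiff ℝ ∞ C) (hR : ContDiff ℝ ∞ R)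
    (h : ∀ η : EuclideanSpace ℝ (Fin n) → ℝ, ContDiff ℝ ∞ η → HasCompactSupport η →
      tsupport η ⊆ O →
      ∫ y, (-(∑ i, ∑ j, A i j y * pd i (pd j (cpx η)) y) + ∑ j, B j y * pd j (cpx η) y
        + C y * cpx η y) = ∫ y, R y * cpx η y) :
    ∀ y ∈ O, -(∑ i, ∑ j, pd j (pd i (A i j)) y) - ∑ j, pd j (B j) y + C y = R y := by
  -- The difference of the two sides of the claim. Integration by parts turns the hypothesis into
  -- its orthogonality to all test functions supported in `O`.
  set S : EuclideanSpace ℝ (Fin n) → ℂ := fun y =>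
    -(∑ i, ∑ j, pd j (pd i (A i j)) y) - ∑ j, pd j (B j) y + C y - R y with hS
  have hSc : ContDiff ℝ ∞ S := by
    refine ContDiff.sub (ContDiff.add (ContDiff.sub (ContDiff.neg ?_) ?_) hC) hR
    · exact ContDiff.sum fun i _ => ContDiff.sum fun j _ => contDiff_pd j (contDiff_pd i (hA i j))
    · exact ContDiff.sum fun j _ => contDiff_pd j (hB j)
  have key : ∀ η : EuclideanSpace ℝ (Fin n) → ℝ, ContDiff ℝ ∞ η → HasCompactSupport η →
      tsupport η ⊆ O → ∫ y, η y • S y = 0 := by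
    intro η hη hs hsO
    have hη' := contDiff_cpx hη
    have hs' : HasCompactSupport (cpx η) := hs.comp_left (g := fun t : ℝ => (t : ℂ)) (by simp)
    have hA2 : ∀ i j, ∫ y, A i j y * pd i (pd j (cpx η)) y =
        ∫ y, pd j (pd i (A i j)) y * cpx η y := by
      intro i j
      rw [integral_mul_pd i (hA i j) (contDiff_pd j hη') (hasCompactSupport_pd j hs'),
        integral_mul_pd j (contDiff_pd i (hA i j)) hη' hs', neg_neg]
    have hB1 := fun j => integral_mul_pd j (hB j) hη' hs'
    have iA : ∀ i j, Integrable fun y => A i j y * pd i (pd j (cpx η)) y := fun i j =>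
      integrable_mul_of_contDiff (hA i j) (contDiff_pd i (contDiff_pd j hη'))
        (hasCompactSupport_pd i (hasCompactSupport_pd j hs'))
    have iB : ∀ j, Integrable fun y => B j y * pd j (cpx η) y := fun j =>
      integrable_mul_of_contDiff (hB j) (contDiff_pd j hη') (hasCompactSupport_pd j hs')
    have iC := integrable_mul_of_contDiff hC hη' hs'
    have iR := integrable_mul_of_contDiff hR hη' hs'
    have iA' : ∀ i j, Integrable fun y => pd j (pd i (A i j)) y * cpx η y := fun i j =>
      integrable_mul_of_contDiff (contDiff_pd j (contDiff_pd i (hA i j))) hη' hs'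
    have iB' : ∀ j, Integrable fun y => pd j (B j) y * cpx η y := fun j =>
      integrable_mul_of_contDiff (contDiff_pd j (hB j)) hη' hs'
    have iA1 : ∀ i, Integrable fun y => ∑ j, A i j y * pd i (pd j (cpx η)) y :=
      fun i => integrable_finsetSum _ fun j _ => iA i j
    have iA1' : ∀ i, Integrable fun y => ∑ j, pd j (pd i (A i j)) y * cpx η y :=
      fun i => integrable_finsetSum _ fun j _ => iA' i j
    have iA2 : Integrable fun y => ∑ i, ∑ j, A i j y * pd i (pd j (cpx η)) y :=
      integrable_finsetSum _ fun i _ => iA1 i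
    have iA2' : Integrable fun y => ∑ i, ∑ j, pd j (pd i (A i j)) y * cpx η y :=
      integrable_finsetSum _ fun i _ => iA1' i
    have iB2 : Integrable fun y => ∑ j, B j y * pd j (cpx η) y :=
      integrable_finsetSum _ fun j _ => iB j
    have iB2' : Integrable fun y => ∑ j, pd j (B j) y * cpx η y :=
      integrable_finsetSum _ fun j _ => iB' j
    have n2 : Integrable fun y => -∑ i, ∑ j, A i j y * pd i (pd j (cpx η)) y := iA2.neg
    have p2 : Integrable fun y => -(∑ i, ∑ j, A i j y * pd i (pd j (cpx η)) y) +
      ∑ j, B j y * pd j (cpx η) y := n2.add iB2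
    have n2' : Integrable fun y => -∑ i, ∑ j, pd j (pd i (A i j)) y * cpx η y := iA2'.neg
    have p2' : Integrable fun y => -(∑ i, ∑ j, pd j (pd i (A i j)) y * cpx η y) -
      ∑ j, pd j (B j) y * cpx η y := n2'.sub iB2'
    have q2' : Integrable fun y => -(∑ i, ∑ j, pd j (pd i (A i j)) y * cpx η y) -
      (∑ j, pd j (B j) y * cpx η y) + C y * cpx η y := p2'.add iC
    have e1 := h η hη hs hsO
    rw [integral_add p2 iC, integral_add n2 iB2, integral_neg,
      integral_finsetSum _ (fun i _ => iA1 i), integral_finsetSum _ (fun j _ => iB j)] at e1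
    simp_rw [integral_finsetSum Finset.univ (fun j _ => iA _ j), hA2, hB1] at e1
    have e2 : ∀ y, η y • S y = -(∑ i, ∑ j, pd j (pd i (A i j)) y * cpx η y)
        - (∑ j, pd j (B j) y * cpx η y) + C y * cpx η y - R y * cpx η y := by
      intro y
      rw [Complex.real_smul]
      simp only [hS, ← Finset.sum_mul]
      ring
    simp_rw [e2]
    rw [integral_sub q2' iR, integral_add p2' iC, integral_sub n2' iB2', integral_neg, integral_finsetSum _ (fun i _ => iA1' i),
      integral_finsetSum _ (fun j _ => iB' j)]
    simp_rw [integral_finsetSum Finset.univ (fun j _ => iA' _ j)]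
    rw [← e1, Finset.sum_neg_distrib]
    ring
  -- The fundamental lemma of the calculus of variations gives vanishing almost everywhere on `O`;
  -- continuity then gives it everywhere there.
  have hae := hO.ae_eq_zero_of_integral_contDiff_smul_eq_zero
    ((hSc.continuous.locallyIntegrable (μ := volume)).locallyIntegrableOn O) key
  have h0 : Set.EqOn S (fun _ => 0) O := by
    refine Measure.eqOn_open_of_ae_eq (μ := volume) ?_ hO hSc.continuous.continuousOn
      continuousOn_const
    exact (ae_restrict_iff' hO.measurableSet).mpr hae
  intro y hy
  exact sub_eq_zero.mp (h0 hy)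

end WeakAdjoint

/-! ### The Hessian at a minimum in an arbitrary chart -/

section HessianLemma

open Filter Topology

variable {n : ℕ} {M : Type*} [TopologicalSpace M] [ChartedSpace (EuclideanSpace ℝ (Fin n)) M]

theorem fderiv_chart_eq_zero_of_isLocalMin {f : M → ℝ} {p : M} (hmin : IsLocalMin f p)
    (x : OpenPartialHomeomorph M (EuclideanSpace ℝ (Fin n))) (hp : p ∈ x.source) :
    fderiv ℝ (fun y => f (x.symm y)) (x p) = 0 := by
  refine IsLocalMin.fderiv_eq_zero ?_
  have h1 : Tendsto x.symm (𝓝 (x p)) (𝓝 p) := by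
    have := x.continuousAt_symm (x.map_source hp)
    rwa [ContinuousAt, x.left_inv hp] at this
  have h2 := h1.eventually hmin
  filter_upwards [h2] with y hy
  rwa [x.left_inv hp]

/-- Non-degeneracy is defined through the preferred chart at `p`. At a critical point the Hessian
transforms as a quadratic form under the transition map, and the derivative of that map is
injective; so positivity carries over. -/
theorem hessian_pos [IsManifold (𝓡 n) ∞ M] {f : M → ℝ} {p : M} {U : Set M} (hU : IsOpen U)
    (hp : p ∈ U) (hf : ContMDiffOn (𝓡 n) 𝓘(ℝ, ℝ) ∞ f U) (hmin : IsNondegMin n f p)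
    {x : OpenPartialHomeomorph M (EuclideanSpace ℝ (Fin n))}
    (hx : x ∈ IsManifold.maximalAtlas (𝓡 n) ∞ M) (hpx : p ∈ x.source)
    (v : EuclideanSpace ℝ (Fin n)) (hv : v ≠ 0) :
    0 < fderiv ℝ (fun y => fderiv ℝ (fun z => f (x.symm z)) y v) (x p) v := by
  set c := chartAt (EuclideanSpace ℝ (Fin n)) p with hc
  have hcm : c ∈ IsManifold.maximalAtlas (𝓡 n) ∞ M := IsManifold.chart_mem_maximalAtlas p
  have hpc : p ∈ c.source := mem_chart_source _ p
  set ψ : EuclideanSpace ℝ (Fin n) → ℝ := fun z => f (c.symm z) with hψdef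
  have hψ : ContDiffAt ℝ ∞ ψ (c p) := by
    rw [← contMDiffAt_iff_contDiffAt]
    refine ContMDiffAt.comp (c p) (g := f) (f := c.symm) (I' := 𝓡 n) ?_ ?_
    · rw [c.left_inv hpc]
      exact hf.contMDiffAt (hU.mem_nhds hp)
    · exact (contMDiffOn_symm_of_mem_maximalAtlas hcm).contMDiffAt
        (c.open_target.mem_nhds (c.map_source hpc))
  have hsm : ∀ a b : OpenPartialHomeomorph M (EuclideanSpace ℝ (Fin n)),
      a ∈ IsManifold.maximalAtlas (𝓡 n) ∞ M → b ∈ IsManifold.maximalAtlas (𝓡 n) ∞ M →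
      p ∈ a.source → p ∈ b.source → ContDiffAt ℝ ∞ (fun z => a (b.symm z)) (b p) := by
    intro a b ha hb hpa hpb
    rw [← contMDiffAt_iff_contDiffAt]
    refine ContMDiffAt.comp (b p) (g := a) (f := b.symm) (I' := 𝓡 n) ?_ ?_
    · rw [b.left_inv hpb]
      exact (contMDiffOn_of_mem_maximalAtlas ha).contMDiffAt (a.open_source.mem_nhds hpa)
    · exact (contMDiffOn_symm_of_mem_maximalAtlas hb).contMDiffAt
        (b.open_target.mem_nhds (b.map_source hpb))
  set τ : EuclideanSpace ℝ (Fin n) → EuclideanSpace ℝ (Fin n) := fun z => c (x.symm z) with hτdef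
  have hτ : ContDiffAt ℝ ∞ τ (x p) := hsm c x hcm hx hpc hpx
  have hσ : ContDiffAt ℝ ∞ (fun z => x (c.symm z)) (c p) := hsm x c hx hcm hpx hpc
  have hτp : τ (x p) = c p := by simp only [hτdef, x.left_inv hpx]
  have hsymm : Tendsto x.symm (𝓝 (x p)) (𝓝 p) := by
    have := x.continuousAt_symm (x.map_source hpx)
    rwa [ContinuousAt, x.left_inv hpx] at this
  have hev : ∀ᶠ z in 𝓝 (x p), x.symm z ∈ c.source :=
    hsymm.eventually (c.open_source.mem_nhds hpc)
  have hcomp : (fun z => f (x.symm z)) =ᶠ[𝓝 (x p)] fun z => ψ (τ z) := by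
    filter_upwards [hev] with z hz
    simp only [hψdef, hτdef, c.left_inv hz]
  have hψ2 : ContDiffAt ℝ 2 ψ (τ (x p)) := by
    rw [hτp]; exact hψ.of_le (WithTop.coe_le_coe.mpr le_top)
  have hτ2 : ContDiffAt ℝ 2 τ (x p) := hτ.of_le (WithTop.coe_le_coe.mpr le_top)
  have hfd : (fun y => fderiv ℝ (fun z => f (x.symm z)) y v) =ᶠ[𝓝 (x p)]
      fun y => fderiv ℝ ψ (τ y) (fderiv ℝ τ y v) := by
    have e1 : ∀ᶠ y in 𝓝 (x p), DifferentiableAt ℝ τ y :=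
      (hτ2.eventually (by simp)).mono fun y hy => hy.differentiableAt (by simp)
    have e2 : ∀ᶠ y in 𝓝 (x p), DifferentiableAt ℝ ψ (τ y) :=
      hτ.continuousAt.eventually ((hψ2.eventually (by simp)).mono
        fun y hy => hy.differentiableAt (by simp))
    filter_upwards [hcomp.fderiv (𝕜 := ℝ), e1, e2] with y hy h1 h2
    rw [hy]
    have := (h2.hasFDerivAt.comp y h1.hasFDerivAt).fderiv
    change fderiv ℝ (ψ ∘ τ) y v = _
    rw [this]
    rfl
  rw [hfd.fderiv_eq]
  have dτ : DifferentiableAt ℝ τ (x p) := hτ2.differentiableAt (by simp)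
  have dψ' : DifferentiableAt ℝ (fderiv ℝ ψ) (τ (x p)) :=
    (hψ2.fderiv_right (m := 1) (by norm_num)).differentiableAt (by simp)
  have dτ' : DifferentiableAt ℝ (fun y => fderiv ℝ τ y v) (x p) :=
    ((hτ2.fderiv_right (m := 1) (by norm_num)).differentiableAt (by simp)).clm_apply
      (differentiableAt_const v)
  have dcomp : HasFDerivAt (fun y => fderiv ℝ ψ (τ y))
      ((fderiv ℝ (fderiv ℝ ψ) (τ (x p))).comp (fderiv ℝ τ (x p))) (x p) :=
    dψ'.hasFDerivAt.comp (x p) dτ.hasFDerivAt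
  rw [fderiv_clm_apply dcomp.differentiableAt dτ', dcomp.fderiv]
  -- Criticality removes the term of the chain rule that contains second derivatives of the
  -- transition map.
  have hz : fderiv ℝ ψ (τ (x p)) = 0 := by
    rw [hτp]
    exact fderiv_chart_eq_zero_of_isLocalMin hmin.1 c hpc
  rw [hz]
  -- The inverse transition map is differentiable, so differentiating the composite gives a left
  -- inverse of the derivative of `τ`.
  have hw : fderiv ℝ τ (x p) v ≠ 0 := by
    intro h0
    have e3 : (fun z => x (c.symm (τ z))) =ᶠ[𝓝 (x p)] fun z => z := by
      filter_upwards [hev, x.open_target.mem_nhds (x.map_source hpx)] with z hz hz'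
      simp only [hτdef, c.left_inv hz, x.right_inv hz']
    have hσd : DifferentiableAt ℝ (fun z => x (c.symm z)) (τ (x p)) := by
      rw [hτp]; exact hσ.differentiableAt (by simp)
    have e4 := (hσd.hasFDerivAt.comp (x p) dτ.hasFDerivAt).fderiv
    have e5 : fderiv ℝ ((fun z => x (c.symm z)) ∘ τ) (x p) = ContinuousLinearMap.id ℝ _ :=
      (e3.fderiv_eq (𝕜 := ℝ)).trans fderiv_fun_id
    rw [e5] at e4
    have e6 := DFunLike.congr_fun e4 v
    rw [ContinuousLinearMap.comp_apply, h0, map_zero] at e6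
    exact hv e6
  have hpos := hmin.2 _ hw
  have hpos' : fderiv ℝ (fun y => fderiv ℝ ψ y (fderiv ℝ τ (x p) v)) (c p)
      (fderiv ℝ τ (x p) v) = fderiv ℝ (fderiv ℝ ψ) (c p) (fderiv ℝ τ (x p) v)
        (fderiv ℝ τ (x p) v) := by
    rw [fderiv_clm_apply (hτp ▸ dψ') (differentiableAt_const _)]
    simp
  have hpos2 : 0 < fderiv ℝ (fderiv ℝ ψ) (c p) (fderiv ℝ τ (x p) v) (fderiv ℝ τ (x p) v) := by
    rw [← hpos']
    exact hpos
  rw [hτp]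
  simpa using hpos2

end HessianLemma

/-! ### Smoothness of determinants and inverses of matrix functions -/

section MatrixSmooth

theorem contDiffAt_matrix_det {X 𝕜 : Type*} [NormedAddCommGroup X] [NormedSpace ℝ X]
    [NormedField 𝕜] [NormedAlgebra ℝ 𝕜] {m : ℕ} {N : X → Matrix (Fin m) (Fin m) 𝕜} {y : X}
    (hN : ∀ k l, ContDiffAt ℝ ∞ (fun z => N z k l) y) :
    ContDiffAt ℝ ∞ (fun z => (N z).det) y := by
  simp only [Matrix.det_apply]
  exact ContDiffAt.sum fun σ _ => (contDiffAt_prod fun i _ => hN _ _).const_smul _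

theorem contDiffAt_matrix_inv {X 𝕜 : Type*} [NormedAddCommGroup X] [NormedSpace ℝ X]
    [NormedField 𝕜] [NormedAlgebra ℝ 𝕜] {m : ℕ} {N : X → Matrix (Fin m) (Fin m) 𝕜} {y : X}
    (hN : ∀ k l, ContDiffAt ℝ ∞ (fun z => N z k l) y) (h : (N y).det ≠ 0) (k l : Fin m) :
    ContDiffAt ℝ ∞ (fun z => (N z)⁻¹ k l) y := by
  simp only [Matrix.inv_def, Ring.inverse_eq_inv', Matrix.smul_apply, smul_eq_mul,
    Matrix.adjugate_apply]
  refine ((contDiffAt_matrix_det hN).inv h).mul (contDiffAt_matrix_det fun a b => ?_)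
  simp only [Matrix.updateRow_apply]
  split_ifs
  · exact contDiffAt_const
  · exact hN a b

end MatrixSmooth

/-- The density `(det g)^{1/2} γ` of the hermitian form, as a matrix of power series. -/
def TaylorData.density {n r : ℕ} (D : TaylorData n r) (k l : Fin r) : PS n := D.vol * D.γ k l

/-- Coefficientwise complex conjugation of power series. -/
abbrev conjPS (n : ℕ) : PS n →+* PS n := MvPowerSeries.map (starRingEnd ℂ)

/-- The identities between the Taylor series of the geometric data on which the formal theory
rests: reality and normalization at `p`, the eikonal equation, and the symmetry of `W` and `L`. -/
structure TaylorData.Good {n r : ℕ} (D : TaylorData n r) : Prop where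
  lam_pos (i : Fin n) : 0 < D.lam i
  ginv_symm (i j : Fin n) : D.ginv i j = D.ginv j i
  ginv_conj (i j : Fin n) : conjPS n (D.ginv i j) = D.ginv i j
  ginv_zero (i j : Fin n) : MvPowerSeries.constantCoeff (D.ginv i j) = if i = j then 1 else 0
  φ_conj : conjPS n D.φ = D.φ
  phaseRest_coeff (α : Fin n →₀ ℕ) : α.degree < 3 → MvPowerSeries.coeff α D.phaseRest = 0
  vol_conj : conjPS n D.vol = D.vol
  vol_zero : MvPowerSeries.constantCoeff D.vol = 1
  γ_conj (k l : Fin r) : conjPS n (D.γ k l) = D.γ l k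
  γ_zero (k l : Fin r) : MvPowerSeries.constantCoeff (D.γ k l) = if k = l then 1 else 0
  eikonal : D.V = ∑ i, ∑ j, D.ginv i j * MvPowerSeries.pderiv ℂ i D.φ *
    MvPowerSeries.pderiv ℂ j D.φ
  w_zero (k l : Fin r) : MvPowerSeries.constantCoeff (D.w k l) = if k = l then (D.mu k : ℂ) else 0
  w_symm (k l : Fin r) : ∑ a, D.γ k a * D.w a l = ∑ a, conjPS n (D.w a k) * D.γ a l
  lap_zero (k l : Fin r) :
    -(∑ i, ∑ j, MvPowerSeries.pderiv ℂ j (MvPowerSeries.pderiv ℂ i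
        (D.ginv i j * D.density k l)))
      - ∑ j, MvPowerSeries.pderiv ℂ j (∑ a, conjPS n (D.b j a k) * D.density a l)
      + ∑ a, conjPS n (D.c a k) * D.density a l = ∑ a, D.density k a * D.c a l
  lap_one (j : Fin n) (k l : Fin r) :
    -2 * (∑ i, MvPowerSeries.pderiv ℂ i (D.ginv i j * D.density k l))
      - ∑ a, conjPS n (D.b j a k) * D.density a l = ∑ a, D.density k a * D.b j a l

/-! ### Components with respect to a frame -/

namespace FramedChart

variable {n r : ℕ} {M : Type*} [TopologicalSpace M] [ChartedSpace (EuclideanSpace ℝ (Fin n)) M]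
  {E : M → Type*} [TopologicalSpace (TotalSpace (Fib r) E)]
  [∀ q, TopologicalSpace (E q)] [∀ q, AddCommGroup (E q)] [∀ q, Module ℂ (E q)]
  [FiberBundle (Fib r) E] (κ : FramedChart n r E)

theorem sum_comp {q : M} (hq : q ∈ κ.x.source) (v : E q) :
    v = ∑ k, κ.comp q v k • κ.frame k q := by
  have h : ∃ a : Fin r → ℂ, v = ∑ k, a k • κ.frame k q := by
    obtain ⟨a, ha⟩ := (Submodule.mem_span_range_iff_exists_fun ℂ).mp
      (κ.span q hq (Submodule.mem_top : v ∈ ⊤))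
    exact ⟨a, ha.symm⟩
  have h2 : κ.comp q v = h.choose := dif_pos h
  rw [h2]
  exact h.choose_spec

theorem comp_unique {q : M} (hq : q ∈ κ.x.source) {v : E q} {a : Fin r → ℂ}
    (h : v = ∑ k, a k • κ.frame k q) : κ.comp q v = a := by
  have h1 := κ.sum_comp hq v
  funext k
  have h2 : ∑ k, (κ.comp q v k - a k) • κ.frame k q = 0 := by
    simp only [sub_smul, Finset.sum_sub_distrib]
    rw [← h1, ← h, sub_self]
  exact sub_eq_zero.mp (Fintype.linearIndependent_iff.mp (κ.indep q hq) _ h2 k)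

end FramedChart

/-! ### Frame sections multiplied by test functions -/

section TestSections

open Filter Topology

variable {n r : ℕ} {M : Type*} [TopologicalSpace M] [T2Space M]
  [ChartedSpace (EuclideanSpace ℝ (Fin n)) M]
  [IsManifold (𝓡 n) ∞ M] {E : M → Type*} [TopologicalSpace (TotalSpace (Fib r) E)]
  [∀ q, TopologicalSpace (E q)] [∀ q, AddCommGroup (E q)] [∀ q, Module ℂ (E q)]
  [FiberBundle (Fib r) E] [VectorBundle ℂ (Fib r) E]
  [VectorBundle ℝ (Fib r) E] [ContMDiffVectorBundle ∞ (Fib r) E (𝓡 n)]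
  (κ : FramedChart n r E)

open Classical in
/-- A test function times a frame section, extended by zero. -/
def testSection (f : EuclideanSpace ℝ (Fin n) → ℝ) (hf : ContDiff ℝ ∞ f)
    (hs : HasCompactSupport f) (hst : tsupport f ⊆ κ.x.target) (k : Fin r) : Sections n r E where
  toFun q := if q ∈ κ.x.source then f (κ.x q) • κ.frame k q else 0
  contMDiff_toFun := by
    intro q
    by_cases hq : q ∈ κ.x.source
    · have h1 : ContMDiffAt (𝓡 n) 𝓘(ℝ, ℝ) ∞ (fun q => f (κ.x q)) q :=
        (hf.contMDiff.contMDiffAt (x := κ.x q)).comp q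
          ((contMDiffOn_of_mem_maximalAtlas κ.x_mem).contMDiffAt (κ.x.open_source.mem_nhds hq))
      have h2 := h1.smul_section ((κ.smooth k).contMDiffAt (κ.x.open_source.mem_nhds hq))
      refine h2.congr_of_eventuallyEq ?_
      filter_upwards [κ.x.open_source.mem_nhds hq] with z hz
      rw [if_pos hz]
      rfl
    -- In a Hausdorff space this compact set is closed. A point outside the chart domain therefore
    -- has a whole neighbourhood on which the section is zero, which is what smoothness across the
    -- boundary of the domain requires.
    · have hc : IsCompact (κ.x.symm '' tsupport f) :=
        hs.isCompact.image_of_continuousOn (κ.x.continuousOn_symm.mono hst)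
      have hq' : q ∉ κ.x.symm '' tsupport f := by
        rintro ⟨y, hy, rfl⟩
        exact hq (κ.x.map_target (hst hy))
      refine ((Bundle.contMDiff_zeroSection ℝ (F := Fib r) E).contMDiffAt
        (x := q) (n := ∞)).congr_of_eventuallyEq ?_
      filter_upwards [hc.isClosed.isOpen_compl.mem_nhds hq'] with z hz
      have : (if z ∈ κ.x.source then f (κ.x z) • κ.frame k z else 0) = 0 := by
        split_ifs with h
        · have h0 : f (κ.x z) = 0 := image_eq_zero_of_notMem_tsupport fun h3 =>
            hz ⟨κ.x z, h3, κ.x.left_inv h⟩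
          rw [h0, zero_smul]
        · rfl
      rw [this]
      rfl

variable {f : EuclideanSpace ℝ (Fin n) → ℝ} (hf : ContDiff ℝ ∞ f)
    (hs : HasCompactSupport f) (hst : tsupport f ⊆ κ.x.target) (k : Fin r)

open Classical in
theorem testSection_apply {y : EuclideanSpace ℝ (Fin n)} (hy : y ∈ κ.x.target) :
    testSection κ f hf hs hst k (κ.x.symm y) = (f y : ℂ) • κ.frame k (κ.x.symm y) := by
  change (if κ.x.symm y ∈ κ.x.source then _ else _) = _
  rw [if_pos (κ.x.map_target hy), κ.x.right_inv hy]
  rfl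

open Classical in
theorem testSection_eq_zero {q : M} (hq : q ∉ κ.x.symm '' tsupport f) :
    testSection κ f hf hs hst k q = 0 := by
  change (if q ∈ κ.x.source then _ else _) = _
  split_ifs with h
  · have h0 : f (κ.x q) = 0 := image_eq_zero_of_notMem_tsupport fun h3 =>
      hq ⟨κ.x q, h3, κ.x.left_inv h⟩
    rw [h0, zero_smul]
  · rfl

theorem rep_testSection {y : EuclideanSpace ℝ (Fin n)} (hy : y ∈ κ.x.target) :
    κ.rep (testSection κ f hf hs hst k) y = Pi.single k (f y : ℂ) := by
  refine κ.comp_unique (κ.x.map_target hy) ?_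
  rw [testSection_apply κ hf hs hst k hy, Finset.sum_eq_single k]
  · rw [Pi.single_eq_same]
  · intro b _ hb
    rw [Pi.single_eq_of_ne hb, zero_smul]
  · intro h
    exact absurd (Finset.mem_univ k) h

theorem pd_single {f : EuclideanSpace ℝ (Fin n) → ℂ} (hf : ContDiff ℝ ∞ f) (j : Fin n) :
    pd j (fun y => (Pi.single k (f y) : Fin r → ℂ)) = fun y => Pi.single k (pd j f y) := by
  funext y
  have := ((ContinuousLinearMap.single ℝ (fun _ : Fin r => ℂ) k).hasFDerivAt.comp y
    (hf.differentiable (by simp) y).hasFDerivAt).fderiv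
  change fderiv ℝ (⇑(ContinuousLinearMap.single ℝ (fun _ : Fin r => ℂ) k) ∘ f) y (stdVec j) = _
  rw [this]
  rfl

/-- The components of a Laplace type operator applied to a test section. -/
def laplaceTest {g : RMetric n M} {L : Sections n r E → Sections n r E}
    (ℓ : LaplaceForm g L κ) (f : EuclideanSpace ℝ (Fin n) → ℝ) (k : Fin r)
    (y : EuclideanSpace ℝ (Fin n)) (a : Fin r) : ℂ :=
  (if a = k then -(∑ i, ∑ j, (((gram g κ.x y)⁻¹ i j : ℝ) : ℂ) * pd i (pd j (cpx f)) y) else 0)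
    + ∑ j, ℓ.b j y a k * pd j (cpx f) y + ℓ.c y a k * cpx f y

/-- The representation of a test section is known only on the chart target. Since the target is
open, the equality holds near each of its points and can be differentiated twice. -/
theorem rep_laplace_testSection {g : RMetric n M} {L : Sections n r E → Sections n r E}
    (ℓ : LaplaceForm g L κ) {y : EuclideanSpace ℝ (Fin n)} (hy : y ∈ κ.x.target) :
    κ.rep (L (testSection κ f hf hs hst k)) y = laplaceTest κ ℓ f k y := by
  rw [ℓ.apply_eq _ y hy]
  set u := testSection κ f hf hs hst k
  have h0 : ∀ z ∈ κ.x.target, κ.rep u =ᶠ[𝓝 z] fun y => (Pi.single k (cpx f y) : Fin r → ℂ) := by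
    intro z hz
    filter_upwards [κ.x.open_target.mem_nhds hz] with y hy
    exact rep_testSection κ hf hs hst k hy
  have h1 : ∀ j, ∀ z ∈ κ.x.target, pd j (κ.rep u) z = Pi.single k (pd j (cpx f) z) := by
    intro j z hz
    have := (h0 z hz).fderiv_eq (𝕜 := ℝ)
    simp only [pd]
    rw [this]
    exact congr_fun (pd_single k (contDiff_cpx hf) j) z
  have h2 : ∀ i j, pd i (pd j (κ.rep u)) y = Pi.single k (pd i (pd j (cpx f)) y) := by
    intro i j
    have h3 : pd j (κ.rep u) =ᶠ[𝓝 y] fun z => (Pi.single k (pd j (cpx f) z) : Fin r → ℂ) := by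
      filter_upwards [κ.x.open_target.mem_nhds hy] with z hz
      exact h1 j z hz
    have := h3.fderiv_eq (𝕜 := ℝ)
    change fderiv ℝ (pd j (κ.rep u)) y (stdVec i) = _
    rw [this]
    exact congr_fun (pd_single k (contDiff_pd j (contDiff_cpx hf)) i) y
  funext a
  have h3 : ∀ z : ℂ, ∀ N : Matrix (Fin r) (Fin r) ℂ, N.mulVec (Pi.single k z) a = N a k * z := by
    intro z N
    rw [Matrix.mulVec_single]
    rfl
  rw [(h0 y hy).eq_of_nhds]
  simp only [h2, h1 _ y hy, Pi.add_apply, Pi.neg_apply, Finset.sum_apply, Pi.smul_apply, h3,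
    laplaceTest]
  congr 2
  by_cases hak : a = k
  · subst hak
    simp
  · simp [hak]

end TestSections

/-! ### The symmetry of the Laplace type operator as a pointwise identity -/

section SetupGood

open Filter Topology MeasureTheory

variable {n r : ℕ} {M : Type*} [TopologicalSpace M] [T2Space M]
  [ChartedSpace (EuclideanSpace ℝ (Fin n)) M]
  [IsManifold (𝓡 n) ∞ M] {E : M → Type*} [TopologicalSpace (TotalSpace (Fib r) E)]
  [∀ q, TopologicalSpace (E q)] [∀ q, AddCommGroup (E q)] [∀ q, Module ℂ (E q)]
  [FiberBundle (Fib r) E] [VectorBundle ℂ (Fib r) E]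
  [VectorBundle ℝ (Fib r) E] [ContMDiffVectorBundle ∞ (Fib r) E (𝓡 n)]
  {p : M} (𝒮 : Setup n r E p) (κ : FramedChart n r E)

/-- The matrix of the bundle metric in a frame. -/
def frameGram (k l : Fin r) (y : EuclideanSpace ℝ (Fin n)) : ℂ :=
  𝒮.γ.form (κ.x.symm y) (κ.frame k (κ.x.symm y)) (κ.frame l (κ.x.symm y))

theorem contDiffOn_frameGram (k l : Fin r) : ContDiffOn ℝ ∞ (frameGram 𝒮 κ k l) κ.x.target :=
  contDiffOn_comp_chart_symm κ.x_mem
    (𝒮.γ.smooth κ.x.source _ _ κ.x.open_source (κ.smooth k) (κ.smooth l)) subset_rfl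

/-- The Riemannian density in a chart. -/
def volDensity (y : EuclideanSpace ℝ (Fin n)) : ℂ := (Real.sqrt (gram 𝒮.g κ.x y).det : ℂ)

/-- The inverse metric in a chart. -/
def invGram (i j : Fin n) (y : EuclideanSpace ℝ (Fin n)) : ℂ := (((gram 𝒮.g κ.x y)⁻¹ i j : ℝ) : ℂ)

/-- The part of the chart domain where the Gram determinant is positive. -/
def regularSet : Set (EuclideanSpace ℝ (Fin n)) :=
  κ.x.target ∩ {y | 0 < (gram 𝒮.g κ.x y).det}

theorem contDiffOn_gram_det : ContDiffOn ℝ ∞ (fun y => (gram 𝒮.g κ.x y).det) κ.x.target :=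
  fun _ hy => (contDiffAt_matrix_det fun i j => (contDiffOn_gram 𝒮.g κ.x_mem i j).contDiffAt
    (κ.x.open_target.mem_nhds hy)).contDiffWithinAt

theorem isOpen_regularSet : IsOpen (regularSet 𝒮 κ) :=
  (contDiffOn_gram_det 𝒮 κ).continuousOn.isOpen_inter_preimage κ.x.open_target isOpen_Ioi

theorem contDiffOn_volDensity : ContDiffOn ℝ ∞ (volDensity 𝒮 κ) (regularSet 𝒮 κ) := by
  intro y hy
  have h := (contDiffOn_gram_det 𝒮 κ).contDiffAt (κ.x.open_target.mem_nhds hy.1)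
  exact (Complex.ofRealCLM.contDiff.contDiffAt.comp y
    (h.sqrt (ne_of_gt hy.2))).contDiffWithinAt

theorem contDiffOn_invGram (i j : Fin n) :
    ContDiffOn ℝ ∞ (invGram 𝒮 κ i j) (regularSet 𝒮 κ) := by
  intro y hy
  refine (Complex.ofRealCLM.contDiff.contDiffAt.comp y
    (contDiffAt_matrix_inv (N := fun y => gram 𝒮.g κ.x y) (fun a b => ?_)
      (ne_of_gt hy.2) i j)).contDiffWithinAt
  exact (contDiffOn_gram 𝒮.g κ.x_mem a b).contDiffAt (κ.x.open_target.mem_nhds hy.1)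

variable {𝒮 κ} (ℓ : LaplaceForm 𝒮.g 𝒮.L κ)

/-- The symmetry of `L` tested against a frame section cut off by `ψ`. -/
theorem transpose_laplace_eq {ψ : EuclideanSpace ℝ (Fin n) → ℝ} (hψ : ContDiff ℝ ∞ ψ)
    (hs : HasCompactSupport ψ) (hst : tsupport ψ ⊆ regularSet 𝒮 κ) (k l : Fin r) :
    ∀ y ∈ regularSet 𝒮 κ,
      -(∑ i, ∑ j, pd j (pd i fun y =>
          volDensity 𝒮 κ y * invGram 𝒮 κ i j y * frameGram 𝒮 κ k l y * cpx ψ y) y)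
        - ∑ j, pd j (fun y => (∑ a, volDensity 𝒮 κ y *
          (starRingEnd ℂ (ℓ.b j y a k) * frameGram 𝒮 κ a l y)) * cpx ψ y) y
        + (∑ a, volDensity 𝒮 κ y * (starRingEnd ℂ (ℓ.c y a k) * frameGram 𝒮 κ a l y)) * cpx ψ y
      = ∑ a, volDensity 𝒮 κ y * frameGram 𝒮 κ k a y * laplaceTest κ ℓ ψ l y a := by
  have hO := isOpen_regularSet 𝒮 κ
  have hsub : regularSet 𝒮 κ ⊆ κ.x.target := Set.inter_subset_left
  have hv := contDiffOn_volDensity 𝒮 κ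
  have hgi := contDiffOn_invGram 𝒮 κ
  have hG := fun k l => (contDiffOn_frameGram 𝒮 κ k l).mono hsub
  have hb := fun j a k => (ℓ.b_smooth j a k).mono hsub
  have hc := fun a k => (ℓ.c_smooth a k).mono hsub
  have hψ' := contDiff_cpx hψ
  have hconj : ∀ f : EuclideanSpace ℝ (Fin n) → ℂ, ContDiffOn ℝ ∞ f (regularSet 𝒮 κ) →
      ContDiffOn ℝ ∞ (fun y => starRingEnd ℂ (f y)) (regularSet 𝒮 κ) := fun f hf =>
    Complex.conjCLE.contDiff.comp_contDiffOn hf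
  have hs' : tsupport (cpx ψ) ⊆ regularSet 𝒮 κ :=
    (tsupport_comp_subset (g := fun t : ℝ => (t : ℂ)) (by simp) ψ).trans hst
  have hmul : ∀ a : EuclideanSpace ℝ (Fin n) → ℂ, ContDiffOn ℝ ∞ a (regularSet 𝒮 κ) →
      ContDiff ℝ ∞ fun y => a y * cpx ψ y := fun a ha =>
    contDiff_mul_of_tsupport_subset hO ha hψ' hs'
  have hmul1 : ∀ j, ∀ a : EuclideanSpace ℝ (Fin n) → ℂ, ContDiffOn ℝ ∞ a (regularSet 𝒮 κ) →
      ContDiff ℝ ∞ fun y => a y * pd j (cpx ψ) y := fun j a ha =>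
    contDiff_mul_of_tsupport_subset hO ha (contDiff_pd j hψ')
      ((tsupport_pd_subset _ j).trans hs')
  have hmul2 : ∀ i j, ∀ a : EuclideanSpace ℝ (Fin n) → ℂ, ContDiffOn ℝ ∞ a (regularSet 𝒮 κ) →
      ContDiff ℝ ∞ fun y => a y * pd i (pd j (cpx ψ)) y := fun i j a ha =>
    contDiff_mul_of_tsupport_subset hO ha (contDiff_pd i (contDiff_pd j hψ'))
      ((tsupport_pd_subset _ i).trans ((tsupport_pd_subset _ j).trans hs'))
  -- The cut-off `ψ` is put into the coefficients `A`, `B`, `C`: the geometric coefficients are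
  -- smooth only on the regular set, but their products with `ψ` are smooth on the whole space.
  refine transpose_eq_of_integral_eq hO
    (A := fun i j y => volDensity 𝒮 κ y * invGram 𝒮 κ i j y * frameGram 𝒮 κ k l y * cpx ψ y)
    (B := fun j y => (∑ a, volDensity 𝒮 κ y *
      (starRingEnd ℂ (ℓ.b j y a k) * frameGram 𝒮 κ a l y)) * cpx ψ y)
    (C := fun y => (∑ a, volDensity 𝒮 κ y *
      (starRingEnd ℂ (ℓ.c y a k) * frameGram 𝒮 κ a l y)) * cpx ψ y)
    (fun i j => hmul _ ((hv.mul (hgi i j)).mul (hG k l)))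
    (fun j => hmul _ (ContDiffOn.sum fun a _ => hv.mul ((hconj _ (hb j a k)).mul (hG a l))))
    (hmul _ (ContDiffOn.sum fun a _ => hv.mul ((hconj _ (hc a k)).mul (hG a l)))) ?_ ?_
  · refine ContDiff.sum fun a _ => ?_
    have e : ∀ y, volDensity 𝒮 κ y * frameGram 𝒮 κ k a y * laplaceTest κ ℓ ψ l y a =
        (∑ i, ∑ j, (volDensity 𝒮 κ y * frameGram 𝒮 κ k a y *
          (if a = l then -invGram 𝒮 κ i j y else 0)) * pd i (pd j (cpx ψ)) y)
        + (∑ j, (volDensity 𝒮 κ y * frameGram 𝒮 κ k a y * ℓ.b j y a l) * pd j (cpx ψ) y)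
        + (volDensity 𝒮 κ y * frameGram 𝒮 κ k a y * ℓ.c y a l) * cpx ψ y := by
      intro y
      rw [laplaceTest, mul_add, mul_add, Finset.mul_sum]
      congr 1
      · congr 1
        · split_ifs with h
          · rw [← Finset.sum_neg_distrib, Finset.mul_sum]
            refine Finset.sum_congr rfl fun i _ => ?_
            rw [← Finset.sum_neg_distrib, Finset.mul_sum]
            refine Finset.sum_congr rfl fun j _ => ?_
            rw [invGram]
            ring
          · simp
        · exact Finset.sum_congr rfl fun j _ => by ring
      · ring
    simp_rw [e]
    refine ContDiff.add (ContDiff.add ?_ ?_) ?_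
    · refine ContDiff.sum fun i _ => ContDiff.sum fun j _ => hmul2 i j _ ?_
      refine (hv.mul (hG k a)).mul ?_
      split_ifs
      · exact (hgi i j).neg
      · exact contDiffOn_const
    · exact ContDiff.sum fun j _ => hmul1 j _ ((hv.mul (hG k a)).mul (hb j a l))
    · exact hmul _ ((hv.mul (hG k a)).mul (hc a l))
  · intro η hη hηs hηO
    have hηt := hηO.trans hsub
    have hψt := hst.trans hsub
    -- Here `η` is the free test function from which the derivatives will be removed, whereas `ψ`
    -- stays fixed. The union of the two supports serves as the common compact set.
    have hsym := 𝒮.L_symm κ.x κ.x_mem (κ.x.symm '' (tsupport η ∪ tsupport ψ))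
      ((hηs.isCompact.union hs.isCompact).image_of_continuousOn
        (κ.x.continuousOn_symm.mono (Set.union_subset hηt hψt)))
      (by
        rintro _ ⟨y, hy, rfl⟩
        exact κ.x.map_target (Set.union_subset hηt hψt hy))
      (testSection κ η hη hηs hηt k) (testSection κ ψ hψ hs hψt l)
      (fun q hq => testSection_eq_zero κ hη hηs hηt k fun h =>
        hq (Set.image_mono Set.subset_union_left h))
      (fun q hq => testSection_eq_zero κ hψ hs hψt l fun h =>
        hq (Set.image_mono Set.subset_union_right h))
    have hz : ∀ f : EuclideanSpace ℝ (Fin n) → ℝ, tsupport f ⊆ κ.x.target → ∀ y ∉ κ.x.target,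
        cpx f y = 0 := by
      intro f hf y hy
      simp only [cpx, image_eq_zero_of_notMem_tsupport fun h => hy (hf h), Complex.ofReal_zero]
    -- Since `η` is real, the conjugate linearity in the first argument conjugates only the
    -- coefficients of the operator.
    have hreal1 : ∀ j y, starRingEnd ℂ (pd j (cpx η) y) = pd j (cpx η) y := by
      intro j y
      rw [pd_conj_cpx j hη, Complex.conj_ofReal]
    have hreal2 : ∀ i j y, starRingEnd ℂ (pd i (pd j (cpx η)) y) = pd i (pd j (cpx η)) y := by
      intro i j y
      rw [pd_conj_cpx j hη, pd_conj_cpx i ((hη.fderiv_right (m := ∞) (by simp)).clm_apply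
        contDiff_const), Complex.conj_ofReal]
    unfold chartIntegral at hsym
    have hl : ∀ y ∈ κ.x.target, (Real.sqrt (gram 𝒮.g κ.x y).det : ℂ) *
        𝒮.γ.form (κ.x.symm y) (𝒮.L (testSection κ η hη hηs hηt k) (κ.x.symm y))
          (testSection κ ψ hψ hs hψt l (κ.x.symm y)) =
        -(∑ i, ∑ j, volDensity 𝒮 κ y * invGram 𝒮 κ i j y * frameGram 𝒮 κ k l y * cpx ψ y *
            pd i (pd j (cpx η)) y)
          + ∑ j, (∑ a, volDensity 𝒮 κ y *
            (starRingEnd ℂ (ℓ.b j y a k) * frameGram 𝒮 κ a l y)) * cpx ψ y * pd j (cpx η) y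
          + (∑ a, volDensity 𝒮 κ y *
            (starRingEnd ℂ (ℓ.c y a k) * frameGram 𝒮 κ a l y)) * cpx ψ y * cpx η y := by
      intro y hy
      have h1 := κ.sum_comp (κ.x.map_target hy)
        (𝒮.L (testSection κ η hη hηs hηt k) (κ.x.symm y))
      have h2 : κ.comp (κ.x.symm y) (𝒮.L (testSection κ η hη hηs hηt k) (κ.x.symm y)) =
          laplaceTest κ ℓ η k y := rep_laplace_testSection κ hη hηs hηt k ℓ hy
      rw [h2] at h1
      rw [h1, testSection_apply κ hψ hs hψt l hy]
      simp only [map_sum, LinearMap.sum_apply, LinearMap.map_smulₛₗ, LinearMap.smul_apply,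
        smul_eq_mul, RingHom.id_apply]
      change volDensity 𝒮 κ y * (cpx ψ y * ∑ a, (starRingEnd ℂ) (laplaceTest κ ℓ η k y a) *
        frameGram 𝒮 κ a l y) = _
      have h3 : ∀ a, starRingEnd ℂ (laplaceTest κ ℓ η k y a) =
          (if a = k then -(∑ i, ∑ j, invGram 𝒮 κ i j y * pd i (pd j (cpx η)) y) else 0)
          + ∑ j, starRingEnd ℂ (ℓ.b j y a k) * pd j (cpx η) y
          + starRingEnd ℂ (ℓ.c y a k) * cpx η y := by
        intro a
        have hX : starRingEnd ℂ (if a = k then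
            -(∑ i, ∑ j, (((gram 𝒮.g κ.x y)⁻¹ i j : ℝ) : ℂ) * pd i (pd j (cpx η)) y) else 0) =
            if a = k then -(∑ i, ∑ j, invGram 𝒮 κ i j y * pd i (pd j (cpx η)) y) else 0 := by
          split_ifs
          · simp only [map_neg, map_sum, map_mul, Complex.conj_ofReal, hreal2, invGram]
          · exact map_zero _
        rw [laplaceTest, map_add, map_add, hX]
        simp only [map_sum, map_mul, hreal1, cpx, Complex.conj_ofReal]
      simp only [h3, add_mul, Finset.sum_add_distrib, mul_add, ite_mul, zero_mul,
        Finset.sum_ite_eq', Finset.mem_univ, if_true]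
      congr 1
      · congr 1
        · simp only [neg_mul, mul_neg, Finset.sum_mul, Finset.mul_sum]
          rw [neg_inj]
          exact Finset.sum_congr rfl fun i _ => Finset.sum_congr rfl fun j _ => by ring
        · simp only [Finset.sum_mul, Finset.mul_sum]
          rw [Finset.sum_comm]
          exact Finset.sum_congr rfl fun i _ => Finset.sum_congr rfl fun j _ => by ring
      · simp only [Finset.sum_mul, Finset.mul_sum]
        exact Finset.sum_congr rfl fun i _ => by ring
    have hr : ∀ y ∈ κ.x.target, (Real.sqrt (gram 𝒮.g κ.x y).det : ℂ) *
        𝒮.γ.form (κ.x.symm y) (testSection κ η hη hηs hηt k (κ.x.symm y))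
          (𝒮.L (testSection κ ψ hψ hs hψt l) (κ.x.symm y)) =
        (∑ a, volDensity 𝒮 κ y * frameGram 𝒮 κ k a y * laplaceTest κ ℓ ψ l y a) * cpx η y := by
      intro y hy
      have h1 := κ.sum_comp (κ.x.map_target hy)
        (𝒮.L (testSection κ ψ hψ hs hψt l) (κ.x.symm y))
      have h2 : κ.comp (κ.x.symm y) (𝒮.L (testSection κ ψ hψ hs hψt l) (κ.x.symm y)) =
          laplaceTest κ ℓ ψ l y := rep_laplace_testSection κ hψ hs hψt l ℓ hy
      rw [h2] at h1
      rw [h1, testSection_apply κ hη hηs hηt k hy]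
      simp only [map_sum, LinearMap.map_smulₛₗ, LinearMap.smul_apply,
        smul_eq_mul, RingHom.id_apply, Complex.conj_ofReal]
      change volDensity 𝒮 κ y * ∑ a, laplaceTest κ ℓ ψ l y a *
        (cpx η y * frameGram 𝒮 κ k a y) = _
      rw [Finset.mul_sum, Finset.sum_mul]
      exact Finset.sum_congr rfl fun i _ => by ring
    -- Off the chart target one integrand contains the factor `cpx ψ` and the other `cpx η`, so both
    -- integrals extend to the whole space.
    rw [setIntegral_congr_fun κ.x.open_target.measurableSet hl,
      setIntegral_congr_fun κ.x.open_target.measurableSet hr,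
      setIntegral_eq_integral_of_forall_compl_eq_zero,
      setIntegral_eq_integral_of_forall_compl_eq_zero] at hsym
    · exact hsym
    · intro y hy
      rw [hz η hηt y hy, mul_zero]
    · intro y hy
      simp only [hz ψ hψt y hy, mul_zero, zero_mul, Finset.sum_const_zero, neg_zero, add_zero]

end SetupGood

/-! ### The Taylor series of the transposed operator -/

section SetupGood

open Filter Topology MeasureTheory

variable {n r : ℕ} {M : Type*} [TopologicalSpace M] [T2Space M]
  [ChartedSpace (EuclideanSpace ℝ (Fin n)) M]
  [IsManifold (𝓡 n) ∞ M] {E : M → Type*} [TopologicalSpace (TotalSpace (Fib r) E)]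
  [∀ q, TopologicalSpace (E q)] [∀ q, AddCommGroup (E q)] [∀ q, Module ℂ (E q)]
  [FiberBundle (Fib r) E] [VectorBundle ℂ (Fib r) E]
  [VectorBundle ℝ (Fib r) E] [ContMDiffVectorBundle ∞ (Fib r) E (𝓡 n)]
  {p : M} {𝒮 : Setup n r E p} {κ : FramedChart n r E} (ℓ : LaplaceForm 𝒮.g 𝒮.L κ)

/-- A bump function equal to 1 near the origin makes `ψ₀` admissible for the pointwise identity
without changing its Taylor series. Everything else is compatibility of `taylor` with sums, products
and derivatives. -/
theorem taylor_transpose_laplace (h0 : (0 : EuclideanSpace ℝ (Fin n)) ∈ regularSet 𝒮 κ)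
    {ψ₀ : EuclideanSpace ℝ (Fin n) → ℝ} (hψ₀ : ContDiff ℝ ∞ ψ₀) (k l : Fin r) :
    -(∑ i, ∑ j, MvPowerSeries.pderiv ℂ j (MvPowerSeries.pderiv ℂ i
        (taylor (volDensity 𝒮 κ) * taylor (invGram 𝒮 κ i j) * taylor (frameGram 𝒮 κ k l) *
          taylor (cpx ψ₀))))
      - ∑ j, MvPowerSeries.pderiv ℂ j ((∑ a, taylor (volDensity 𝒮 κ) *
        (conjPS n (taylor fun y => ℓ.b j y a k) * taylor (frameGram 𝒮 κ a l))) * taylor (cpx ψ₀))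
      + (∑ a, taylor (volDensity 𝒮 κ) *
        (conjPS n (taylor fun y => ℓ.c y a k) * taylor (frameGram 𝒮 κ a l))) * taylor (cpx ψ₀)
    = ∑ a, taylor (volDensity 𝒮 κ) * taylor (frameGram 𝒮 κ k a) *
        ((if a = l then -(∑ i, ∑ j, taylor (invGram 𝒮 κ i j) *
          MvPowerSeries.pderiv ℂ i (MvPowerSeries.pderiv ℂ j (taylor (cpx ψ₀)))) else 0)
        + ∑ j, (taylor fun y => ℓ.b j y a l) * MvPowerSeries.pderiv ℂ j (taylor (cpx ψ₀))
        + (taylor fun y => ℓ.c y a l) * taylor (cpx ψ₀)) := by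
  have hO := isOpen_regularSet 𝒮 κ
  have hOn : regularSet 𝒮 κ ∈ 𝓝 (0 : EuclideanSpace ℝ (Fin n)) := hO.mem_nhds h0
  have htn : κ.x.target ∈ 𝓝 (0 : EuclideanSpace ℝ (Fin n)) := κ.x.open_target.mem_nhds h0.1
  -- The outer radius R/2 keeps the closed support inside the ball of radius R, hence inside the
  -- regular set.
  obtain ⟨R, hR, hRO⟩ := Metric.isOpen_iff.mp hO 0 h0
  let χ : ContDiffBump (0 : EuclideanSpace ℝ (Fin n)) :=
    ⟨R / 4, R / 2, by positivity, by linarith⟩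
  set ψ : EuclideanSpace ℝ (Fin n) → ℝ := fun y => χ y * ψ₀ y with hψdef
  have hψ : ContDiff ℝ ∞ ψ := χ.contDiff.mul hψ₀
  have hsub : tsupport ψ ⊆ tsupport χ := tsupport_mul_subset_left
  have hs : HasCompactSupport ψ := χ.hasCompactSupport.mul_right
  have hst : tsupport ψ ⊆ regularSet 𝒮 κ := by
    refine hsub.trans ?_
    rw [χ.tsupport_eq]
    exact (Metric.closedBall_subset_ball (by change R / 2 < R; linarith)).trans hRO
  have hψψ : cpx ψ =ᶠ[𝓝 0] cpx ψ₀ := by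
    filter_upwards [χ.eventuallyEq_one] with y hy
    simp only [hψdef, cpx, hy, Pi.one_apply, one_mul]
  rw [← taylor_congr hψψ]
  have hv : ContDiffAt ℝ ∞ (volDensity 𝒮 κ) 0 := (contDiffOn_volDensity 𝒮 κ).contDiffAt hOn
  have hgi : ∀ i j, ContDiffAt ℝ ∞ (invGram 𝒮 κ i j) 0 := fun i j =>
    (contDiffOn_invGram 𝒮 κ i j).contDiffAt hOn
  have hG : ∀ k l, ContDiffAt ℝ ∞ (frameGram 𝒮 κ k l) 0 := fun k l =>
    (contDiffOn_frameGram 𝒮 κ k l).contDiffAt htn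
  have hb : ∀ j a k, ContDiffAt ℝ ∞ (fun y => ℓ.b j y a k) 0 := fun j a k =>
    (ℓ.b_smooth j a k).contDiffAt htn
  have hc : ∀ a k, ContDiffAt ℝ ∞ (fun y => ℓ.c y a k) 0 := fun a k =>
    (ℓ.c_smooth a k).contDiffAt htn
  have hψ0 : ContDiffAt ℝ ∞ (cpx ψ) 0 := (contDiff_cpx hψ).contDiffAt
  have hconj : ∀ f : EuclideanSpace ℝ (Fin n) → ℂ, ContDiffAt ℝ ∞ f 0 →
      ContDiffAt ℝ ∞ (fun y => starRingEnd ℂ (f y)) 0 := fun f hf =>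
    Complex.conjCLE.contDiff.contDiffAt.comp _ hf
  have key : (fun y => -(∑ i, ∑ j, pd j (pd i fun y =>
          volDensity 𝒮 κ y * invGram 𝒮 κ i j y * frameGram 𝒮 κ k l y * cpx ψ y) y)
        - ∑ j, pd j (fun y => (∑ a, volDensity 𝒮 κ y *
          (starRingEnd ℂ (ℓ.b j y a k) * frameGram 𝒮 κ a l y)) * cpx ψ y) y
        + (∑ a, volDensity 𝒮 κ y * (starRingEnd ℂ (ℓ.c y a k) * frameGram 𝒮 κ a l y)) * cpx ψ y)
      =ᶠ[𝓝 0] fun y => ∑ a, volDensity 𝒮 κ y * frameGram 𝒮 κ k a y *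
        ((if a = l then -(∑ i, ∑ j, invGram 𝒮 κ i j y * pd i (pd j (cpx ψ)) y) else 0)
          + ∑ j, ℓ.b j y a l * pd j (cpx ψ) y + ℓ.c y a l * cpx ψ y) := by
    filter_upwards [hOn] with y hy
    exact transpose_laplace_eq ℓ hψ hs hst k l y hy
  have hF2 : ∀ i j, ContDiffAt ℝ ∞ (fun y => volDensity 𝒮 κ y * invGram 𝒮 κ i j y *
      frameGram 𝒮 κ k l y * cpx ψ y) 0 := fun i j => ((hv.mul (hgi i j)).mul (hG k l)).mul hψ0
  have hF1a : ∀ j a, ContDiffAt ℝ ∞ (fun y => volDensity 𝒮 κ y *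
      (starRingEnd ℂ (ℓ.b j y a k) * frameGram 𝒮 κ a l y)) 0 := fun j a =>
    hv.mul ((hconj _ (hb j a k)).mul (hG a l))
  have hF1s : ∀ j, ContDiffAt ℝ ∞ (fun y => ∑ a, volDensity 𝒮 κ y *
      (starRingEnd ℂ (ℓ.b j y a k) * frameGram 𝒮 κ a l y)) 0 := fun j =>
    ContDiffAt.sum fun a _ => hF1a j a
  have hF1 : ∀ j, ContDiffAt ℝ ∞ (fun y => (∑ a, volDensity 𝒮 κ y *
      (starRingEnd ℂ (ℓ.b j y a k) * frameGram 𝒮 κ a l y)) * cpx ψ y) 0 := fun j =>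
    (hF1s j).mul hψ0
  have hF0a : ∀ a, ContDiffAt ℝ ∞ (fun y => volDensity 𝒮 κ y *
      (starRingEnd ℂ (ℓ.c y a k) * frameGram 𝒮 κ a l y)) 0 := fun a =>
    hv.mul ((hconj _ (hc a k)).mul (hG a l))
  have hF0s : ContDiffAt ℝ ∞ (fun y => ∑ a, volDensity 𝒮 κ y *
      (starRingEnd ℂ (ℓ.c y a k) * frameGram 𝒮 κ a l y)) 0 :=
    ContDiffAt.sum fun a _ => hF0a a
  have hF0 : ContDiffAt ℝ ∞ (fun y => (∑ a, volDensity 𝒮 κ y *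
      (starRingEnd ℂ (ℓ.c y a k) * frameGram 𝒮 κ a l y)) * cpx ψ y) 0 := hF0s.mul hψ0
  have hP2 : ∀ i j, ContDiffAt ℝ ∞ (fun y => pd j (pd i fun y => volDensity 𝒮 κ y *
      invGram 𝒮 κ i j y * frameGram 𝒮 κ k l y * cpx ψ y) y) 0 := fun i j =>
    pd_contDiffAt j (pd_contDiffAt i (hF2 i j))
  have hP2s : ∀ i, ContDiffAt ℝ ∞ (fun y => ∑ j, pd j (pd i fun y => volDensity 𝒮 κ y *
      invGram 𝒮 κ i j y * frameGram 𝒮 κ k l y * cpx ψ y) y) 0 := fun i =>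
    ContDiffAt.sum fun j _ => hP2 i j
  have hP2ss : ContDiffAt ℝ ∞ (fun y => ∑ i, ∑ j, pd j (pd i fun y => volDensity 𝒮 κ y *
      invGram 𝒮 κ i j y * frameGram 𝒮 κ k l y * cpx ψ y) y) 0 :=
    ContDiffAt.sum fun i _ => hP2s i
  have hP1 : ∀ j, ContDiffAt ℝ ∞ (fun y => pd j (fun y => (∑ a, volDensity 𝒮 κ y *
      (starRingEnd ℂ (ℓ.b j y a k) * frameGram 𝒮 κ a l y)) * cpx ψ y) y) 0 := fun j =>
    pd_contDiffAt j (hF1 j)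
  have hP1s : ContDiffAt ℝ ∞ (fun y => ∑ j, pd j (fun y => (∑ a, volDensity 𝒮 κ y *
      (starRingEnd ℂ (ℓ.b j y a k) * frameGram 𝒮 κ a l y)) * cpx ψ y) y) 0 :=
    ContDiffAt.sum fun j _ => hP1 j
  have hpp : ∀ i j, ContDiffAt ℝ ∞ (fun y => pd i (pd j (cpx ψ)) y) 0 := fun i j =>
    pd_contDiffAt i (pd_contDiffAt j hψ0)
  have hpj : ∀ j, ContDiffAt ℝ ∞ (fun y => pd j (cpx ψ) y) 0 := fun j => pd_contDiffAt j hψ0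
  have hL2 : ∀ i j, ContDiffAt ℝ ∞ (fun y => invGram 𝒮 κ i j y * pd i (pd j (cpx ψ)) y) 0 :=
    fun i j => (hgi i j).mul (hpp i j)
  have hL2s : ∀ i, ContDiffAt ℝ ∞
      (fun y => ∑ j, invGram 𝒮 κ i j y * pd i (pd j (cpx ψ)) y) 0 :=
    fun i => ContDiffAt.sum fun j _ => hL2 i j
  have hL2ss : ContDiffAt ℝ ∞
      (fun y => ∑ i, ∑ j, invGram 𝒮 κ i j y * pd i (pd j (cpx ψ)) y) 0 :=
    ContDiffAt.sum fun i _ => hL2s i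
  have hL1 : ∀ a j, ContDiffAt ℝ ∞ (fun y => ℓ.b j y a l * pd j (cpx ψ) y) 0 := fun a j =>
    (hb j a l).mul (hpj j)
  have hL1s : ∀ a, ContDiffAt ℝ ∞ (fun y => ∑ j, ℓ.b j y a l * pd j (cpx ψ) y) 0 := fun a =>
    ContDiffAt.sum fun j _ => hL1 a j
  have hite : ∀ a, ContDiffAt ℝ ∞ (fun y => if a = l then
      -(∑ i, ∑ j, invGram 𝒮 κ i j y * pd i (pd j (cpx ψ)) y) else 0) 0 := by
    intro a
    split_ifs
    · exact hL2ss.neg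
    · exact contDiffAt_const
  have hR : ∀ a, ContDiffAt ℝ ∞ (fun y => volDensity 𝒮 κ y * frameGram 𝒮 κ k a y *
        ((if a = l then -(∑ i, ∑ j, invGram 𝒮 κ i j y * pd i (pd j (cpx ψ)) y) else 0)
          + ∑ j, ℓ.b j y a l * pd j (cpx ψ) y + ℓ.c y a l * cpx ψ y)) 0 := fun a =>
    (hv.mul (hG k a)).mul (((hite a).add (hL1s a)).add ((hc a l).mul hψ0))
  have key2 := taylor_congr key
  rw [taylor_add (hP2ss.neg.sub hP1s) hF0] at key2
  simp_rw [sub_eq_add_neg] at key2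
  rw [taylor_add hP2ss.neg hP1s.neg, taylor_neg hP2ss, taylor_neg hP1s,
    taylor_sum _ (fun i _ => hP2s i), taylor_sum _ (fun j _ => hP1 j), taylor_mul hF0s hψ0,
    taylor_sum _ (fun a _ => hF0a a), taylor_sum _ (fun a _ => hR a)] at key2
  rw [sub_eq_add_neg]
  refine Eq.trans (Eq.trans ?_ key2) ?_
  · refine congr_arg₂ _ (congr_arg₂ _ (congr_arg _ ?_) (congr_arg _ ?_)) (congr_arg₂ _ ?_ rfl)
    · refine Finset.sum_congr rfl fun i _ => ?_
      rw [taylor_sum _ (fun j _ => hP2 i j)]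
      refine Finset.sum_congr rfl fun j _ => ?_
      rw [← taylor_mul hv (hgi i j), ← taylor_mul (hv.mul (hgi i j)) (hG k l),
        ← taylor_mul ((hv.mul (hgi i j)).mul (hG k l)) hψ0, pderiv_taylor i (hF2 i j),
        pderiv_taylor j (pd_contDiffAt i (hF2 i j))]
    · refine Finset.sum_congr rfl fun j _ => ?_
      rw [← pderiv_taylor j (hF1 j), taylor_mul (hF1s j) hψ0, taylor_sum _ (fun a _ => hF1a j a)]
      congr 2
      refine Finset.sum_congr rfl fun a _ => ?_
      rw [taylor_mul hv ((hconj _ (hb j a k)).mul (hG a l)),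
        taylor_mul (hconj _ (hb j a k)) (hG a l), taylor_conj (hb j a k)]
    · refine Finset.sum_congr rfl fun a _ => ?_
      rw [taylor_mul hv ((hconj _ (hc a k)).mul (hG a l)),
        taylor_mul (hconj _ (hc a k)) (hG a l), taylor_conj (hc a k)]
  · refine Finset.sum_congr rfl fun a _ => ?_
    rw [taylor_mul (hv.mul (hG k a)) (((hite a).add (hL1s a)).add ((hc a l).mul hψ0)),
      taylor_mul hv (hG k a), taylor_add ((hite a).add (hL1s a)) ((hc a l).mul hψ0),
      taylor_add (hite a) (hL1s a), taylor_mul (hc a l) hψ0, taylor_sum _ (fun j _ => hL1 a j)]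
    congr 2
    refine congr_arg₂ _ ?_ ?_
    · split_ifs
      · rw [taylor_neg hL2ss, taylor_sum _ (fun i _ => hL2s i)]
        congr 1
        refine Finset.sum_congr rfl fun i _ => ?_
        rw [taylor_sum _ (fun j _ => hL2 i j)]
        refine Finset.sum_congr rfl fun j _ => ?_
        rw [taylor_mul (hgi i j) (hpp i j), pderiv_taylor j hψ0, pderiv_taylor i (hpj j)]
      · rw [taylor_const, map_zero]
    · refine Finset.sum_congr rfl fun j _ => ?_
      rw [taylor_mul (hb j a l) (hpj j), pderiv_taylor j hψ0]

end SetupGood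

/-! ### From the geometric setup to the formal identities -/

section SetupGood

open Filter Topology MeasureTheory

variable {n r : ℕ}

theorem pd_ofReal {f : EuclideanSpace ℝ (Fin n) → ℝ} {y : EuclideanSpace ℝ (Fin n)} (i : Fin n)
    (hf : ContDiffAt ℝ ∞ f y) : pd i (cpx f) =ᶠ[𝓝 y] cpx (pd i f) := by
  filter_upwards [(hf.of_le (m := 1) (by simp)).eventually (by simp)] with z hz
  have h1 : DifferentiableAt ℝ f z := hz.differentiableAt (by simp)
  have := (Complex.ofRealCLM.hasFDerivAt.comp z h1.hasFDerivAt).fderiv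
  change fderiv ℝ (⇑Complex.ofRealCLM ∘ f) z (stdVec i) = _
  rw [this]
  rfl

theorem contDiffAt_cpx {f : EuclideanSpace ℝ (Fin n) → ℝ} {y : EuclideanSpace ℝ (Fin n)}
    (hf : ContDiffAt ℝ ∞ f y) : ContDiffAt ℝ ∞ (cpx f) y :=
  Complex.ofRealCLM.contDiff.contDiffAt.comp y hf

theorem conjPS_taylor_cpx {f : EuclideanSpace ℝ (Fin n) → ℝ} (hf : ContDiffAt ℝ ∞ f 0) :
    conjPS n (taylor (cpx f)) = taylor (cpx f) := by
  rw [← taylor_conj (contDiffAt_cpx hf)]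
  simp only [cpx, Complex.conj_ofReal]

theorem pderiv_X_eq (i j : Fin n) :
    MvPowerSeries.pderiv ℂ i (MvPowerSeries.X j : PS n) = if j = i then 1 else 0 := by
  rw [MvPowerSeries.pderiv_X]
  by_cases h : j = i <;> simp [h]

/-- A smooth function with given Hessian `diag(lam)` at a critical zero. -/
theorem coeff_taylor_sub_quadratic {f : EuclideanSpace ℝ (Fin n) → ℝ} (hf : ContDiffAt ℝ ∞ f 0)
    (h0 : f 0 = 0) (h1 : fderiv ℝ f 0 = 0) {lam : Fin n → ℝ}
    (h2 : ∀ i j, pd i (pd j f) 0 = if i = j then lam i else 0) (α : Fin n →₀ ℕ)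
    (hα : α.degree < 3) :
    MvPowerSeries.coeff α (taylor (cpx f) -
      ∑ i, MvPowerSeries.C ((lam i / 2 : ℝ) : ℂ) * MvPowerSeries.X i ^ 2) = 0 := by
  rw [map_sub, sub_eq_zero]
  have hc := contDiffAt_cpx hf
  have hpq : ∀ j, MvPowerSeries.pderiv ℂ j (∑ i, MvPowerSeries.C ((lam i / 2 : ℝ) : ℂ) *
      MvPowerSeries.X i ^ 2 : PS n) = MvPowerSeries.C (lam j : ℂ) * MvPowerSeries.X j := by
    intro j
    rw [map_sum, Finset.sum_eq_single j]
    · rw [Derivation.leibniz, sq, Derivation.leibniz, pderiv_X_eq, if_pos rfl,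
        MvPowerSeries.pderiv_C, smul_zero, add_zero]
      simp only [smul_eq_mul, mul_one]
      have : (MvPowerSeries.C (lam j : ℂ) : PS n) = MvPowerSeries.C ((lam j / 2 : ℝ) : ℂ) +
          MvPowerSeries.C ((lam j / 2 : ℝ) : ℂ) := by
        rw [← map_add]
        congr 1
        push_cast
        ring
      rw [this]
      ring
    · intro i _ hij
      rw [Derivation.leibniz, sq, Derivation.leibniz, pderiv_X_eq, if_neg hij,
        MvPowerSeries.pderiv_C]
      simp
    · intro h
      exact absurd (Finset.mem_univ j) h
  -- Three descents, with bounds 2, 1 and 0, compare in turn the values, the gradients and the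
  -- Hessians at the origin.
  refine coeff_eq_of_pderiv (d := 2) ?_ (fun j β hβ => ?_) α hα
  · rw [constantCoeff_taylor]
    simp [cpx, h0]
  rw [hpq, pderiv_taylor j hc]
  have hj := pd_ofReal j hf
  have hpj : ContDiffAt ℝ ∞ (pd j f) 0 :=
    (hf.fderiv_right (m := ∞) (by simp)).clm_apply contDiffAt_const
  refine coeff_eq_of_pderiv (d := 1) ?_ (fun i γ hγ => ?_) β hβ
  · rw [constantCoeff_taylor, hj.eq_of_nhds]
    simp [cpx, pd, h1]
  rw [Derivation.leibniz, MvPowerSeries.pderiv_C, pderiv_X_eq, smul_zero, add_zero,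
    pderiv_taylor i (pd_contDiffAt j hc)]
  refine coeff_eq_of_pderiv (d := 0) ?_ (fun _ _ h => absurd h (Nat.not_lt_zero _)) γ hγ
  rw [constantCoeff_taylor, (pd_congr i hj).eq_of_nhds, (pd_ofReal i hpj).eq_of_nhds]
  simp only [cpx, h2]
  by_cases hij : i = j
  · simp [hij]
  · simp [hij, Ne.symm hij]

variable {M : Type*} [TopologicalSpace M] [T2Space M]
  [ChartedSpace (EuclideanSpace ℝ (Fin n)) M]
  [IsManifold (𝓡 n) ∞ M] {E : M → Type*} [TopologicalSpace (TotalSpace (Fib r) E)]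
  [∀ q, TopologicalSpace (E q)] [∀ q, AddCommGroup (E q)] [∀ q, Module ℂ (E q)]
  [FiberBundle (Fib r) E] [VectorBundle ℂ (Fib r) E]
  [VectorBundle ℝ (Fib r) E] [ContMDiffVectorBundle ∞ (Fib r) E (𝓡 n)]
  {p : M} {𝒮 : Setup n r E p} {κ : FramedChart n r E}

theorem sum_density_mul {n r : ℕ} (D : TaylorData n r) (s : Finset (Fin r))
    (F : Fin r → PS n) (l : Fin r) :
    ∑ a ∈ s, D.vol * (F a * D.γ a l) = ∑ a ∈ s, F a * D.density a l :=
  Finset.sum_congr rfl fun a _ => by rw [TaylorData.density]; ring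

/-- The symmetry identities follow from testing with the functions `1` and `x_m`. -/
theorem laplace_identities {n r : ℕ} (D : TaylorData n r)
    (hsymm : ∀ i j, D.ginv i j = D.ginv j i)
    (H : ∀ Ψ : PS n, (Ψ = 1 ∨ ∃ m, Ψ = MvPowerSeries.X m) → ∀ k l,
      -(∑ i, ∑ j, MvPowerSeries.pderiv ℂ j (MvPowerSeries.pderiv ℂ i
        (D.ginv i j * D.density k l * Ψ)))
      - ∑ j, MvPowerSeries.pderiv ℂ j ((∑ a, conjPS n (D.b j a k) * D.density a l) * Ψ)
      + (∑ a, conjPS n (D.c a k) * D.density a l) * Ψ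
      = ∑ a, D.density k a * ((if a = l then -(∑ i, ∑ j, D.ginv i j *
          MvPowerSeries.pderiv ℂ i (MvPowerSeries.pderiv ℂ j Ψ)) else 0)
        + ∑ j, D.b j a l * MvPowerSeries.pderiv ℂ j Ψ + D.c a l * Ψ)) (k l : Fin r) :
    (-(∑ i, ∑ j, MvPowerSeries.pderiv ℂ j (MvPowerSeries.pderiv ℂ i
        (D.ginv i j * D.density k l)))
      - ∑ j, MvPowerSeries.pderiv ℂ j (∑ a, conjPS n (D.b j a k) * D.density a l)
      + ∑ a, conjPS n (D.c a k) * D.density a l = ∑ a, D.density k a * D.c a l) ∧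
    ∀ m, -2 * (∑ i, MvPowerSeries.pderiv ℂ i (D.ginv i m * D.density k l))
      - ∑ a, conjPS n (D.b m a k) * D.density a l = ∑ a, D.density k a * D.b m a l := by
  have hone : ∀ i, MvPowerSeries.pderiv ℂ i (1 : PS n) = 0 := fun i => Derivation.map_one_eq_zero _
  have e0 := H 1 (Or.inl rfl) k l
  simp only [mul_one, hone, map_zero, mul_zero, Finset.sum_const_zero, neg_zero, ite_self,
    zero_add] at e0
  refine ⟨e0, fun m => ?_⟩
  have e1 := H (MvPowerSeries.X m) (Or.inr ⟨m, rfl⟩) k l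
  have hX2 : ∀ i j, MvPowerSeries.pderiv ℂ i (MvPowerSeries.pderiv ℂ j
      (MvPowerSeries.X m : PS n)) = 0 := by
    intro i j
    rw [pderiv_X_eq]
    split_ifs
    · exact hone i
    · exact map_zero _
  have hd1 : ∀ (F : PS n) (j : Fin n), MvPowerSeries.pderiv ℂ j (F * MvPowerSeries.X m) =
      MvPowerSeries.pderiv ℂ j F * MvPowerSeries.X m + if m = j then F else 0 := by
    intro F j
    rw [Derivation.leibniz, pderiv_X_eq, smul_eq_mul, smul_eq_mul, mul_ite, mul_one, mul_zero,
      mul_comm (MvPowerSeries.X m), add_comm]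
  have hd2 : ∀ (F : PS n) (i j : Fin n), MvPowerSeries.pderiv ℂ j (MvPowerSeries.pderiv ℂ i
      (F * MvPowerSeries.X m)) =
      MvPowerSeries.pderiv ℂ j (MvPowerSeries.pderiv ℂ i F) * MvPowerSeries.X m
      + (if m = j then MvPowerSeries.pderiv ℂ i F else 0)
      + if m = i then MvPowerSeries.pderiv ℂ j F else 0 := by
    intro F i j
    rw [hd1, map_add, hd1]
    congr 1
    split_ifs
    · rfl
    · exact map_zero _
  simp only [hX2, hd2] at e1
  simp only [hd1, pderiv_X_eq, mul_zero, Finset.sum_const_zero, neg_zero, ite_self,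
    zero_add, mul_ite, mul_one, Finset.sum_ite_eq, Finset.mem_univ, if_true,
    Finset.sum_add_distrib, ← Finset.sum_mul, mul_add, ← mul_assoc] at e1
  -- The product rule contributes the first derivatives of the principal coefficients twice, once
  -- for each index. The symmetry of the inverse metric identifies the two contributions, whence the
  -- factor 2 in the first order identity.
  have hs : ∑ j, ∑ i, (if m = j then MvPowerSeries.pderiv ℂ i (D.ginv j i * D.density k l) else 0)
      = ∑ i, MvPowerSeries.pderiv ℂ i (D.ginv i m * D.density k l) := by
    rw [Finset.sum_comm]
    refine Finset.sum_congr rfl fun i _ => ?_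
    rw [Finset.sum_ite_eq, if_pos (Finset.mem_univ m), hsymm m i]
  -- Inserting the identity for the test function 1 makes all terms with a factor x_m cancel; what
  -- remains is the first order identity.
  rw [hs, ← e0] at e1
  linear_combination e1

/-- The bridge from analysis to algebra: later arguments use the geometry only through this result.
The Gram matrix is the identity at the centre, so its determinant is positive nearby and inverse
metric and density are smooth there; positivity of `lam` is that of the Hessian of `φ`. -/
theorem Setup.good {U : Set M} {φ : M → ℝ} (hφ : 𝒮.IsEikonal U φ) {lam : Fin n → ℝ}
    {mu : Fin r → ℝ} (hκ : 𝒮.IsAdapted U φ κ lam mu) (ℓ : LaplaceForm 𝒮.g 𝒮.L κ) :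
    (𝒮.taylorData φ κ ℓ lam mu).Good := by
  have ht : (0 : EuclideanSpace ℝ (Fin n)) ∈ κ.x.target := by
    rw [← hκ.centred]
    exact κ.x.map_source hκ.mem
  have hx0 : κ.x.symm 0 = p := by
    rw [← hκ.centred]
    exact κ.x.left_inv hκ.mem
  have h0 : (0 : EuclideanSpace ℝ (Fin n)) ∈ regularSet 𝒮 κ := by
    refine ⟨ht, ?_⟩
    change 0 < (gram 𝒮.g κ.x 0).det
    rw [hκ.metric, Matrix.det_one]
    exact one_pos
  have hOn : regularSet 𝒮 κ ∈ 𝓝 (0 : EuclideanSpace ℝ (Fin n)) :=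
    (isOpen_regularSet 𝒮 κ).mem_nhds h0
  have htn : κ.x.target ∈ 𝓝 (0 : EuclideanSpace ℝ (Fin n)) := κ.x.open_target.mem_nhds ht
  have hφc : ContDiffAt ℝ ∞ (fun y => φ (κ.x.symm y)) 0 :=
    (contDiffOn_comp_chart_symm κ.x_mem hφ.smooth hκ.source_subset).contDiffAt htn
  have hgram : ∀ i j, ContDiffAt ℝ ∞ (fun y => gram 𝒮.g κ.x y i j) 0 := fun i j =>
    (contDiffOn_gram 𝒮.g κ.x_mem i j).contDiffAt htn
  have hgi : ∀ i j, ContDiffAt ℝ ∞ (fun y => (gram 𝒮.g κ.x y)⁻¹ i j) 0 := fun i j =>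
    contDiffAt_matrix_inv (N := fun y => gram 𝒮.g κ.x y) hgram (ne_of_gt h0.2) i j
  have hvol : ContDiffAt ℝ ∞ (fun y => Real.sqrt (gram 𝒮.g κ.x y).det) 0 :=
    ((contDiffOn_gram_det 𝒮 κ).contDiffAt htn).sqrt (ne_of_gt h0.2)
  have hG : ∀ k l, ContDiffAt ℝ ∞ (frameGram 𝒮 κ k l) 0 := fun k l =>
    (contDiffOn_frameGram 𝒮 κ k l).contDiffAt htn
  have hG0 : ∀ k l, frameGram 𝒮 κ k l 0 = if k = l then 1 else 0 := by
    intro k l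
    rw [frameGram, hx0]
    exact hκ.orthonormal k l
  have hgsymm : ∀ i j, (𝒮.taylorData φ κ ℓ lam mu).ginv i j =
      (𝒮.taylorData φ κ ℓ lam mu).ginv j i := by
    intro i j
    have hT : ∀ y, (gram 𝒮.g κ.x y).transpose = gram 𝒮.g κ.x y := fun y =>
      Matrix.ext fun i j => gram_symm _ _ _ _ _
    change taylor _ = taylor _
    congr 1
    funext y
    rw [← hT y, ← Matrix.transpose_nonsing_inv, Matrix.transpose_apply, Matrix.transpose_nonsing_inv,
      hT y]
  -- the matrix of `W`
  set Γ : Fin r → Fin r → EuclideanSpace ℝ (Fin n) → ℂ := fun k l y =>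
    𝒮.γ.form (κ.x.symm y) (κ.frame k (κ.x.symm y))
      (𝒮.W (κ.x.symm y) (κ.frame l (κ.x.symm y))) with hΓ
  have hΓs : ∀ k l, ContDiffAt ℝ ∞ (Γ k l) 0 := fun k l =>
    (contDiffOn_comp_chart_symm κ.x_mem (𝒮.γ.smooth κ.x.source _ _ κ.x.open_source (κ.smooth k)
      (𝒮.W_smooth _ _ κ.x.open_source (κ.smooth l))) subset_rfl).contDiffAt htn
  have hWexp : ∀ y ∈ κ.x.target, ∀ l, 𝒮.W (κ.x.symm y) (κ.frame l (κ.x.symm y)) =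
      ∑ a, κ.repEnd 𝒮.W y a l • κ.frame a (κ.x.symm y) := fun y hy l =>
    κ.sum_comp (κ.x.map_target hy) _
  have hΓw : ∀ y ∈ κ.x.target, ∀ k l, Γ k l y = ∑ a, frameGram 𝒮 κ k a y * κ.repEnd 𝒮.W y a l := by
    intro y hy k l
    simp only [hΓ]
    rw [hWexp y hy l, map_sum]
    exact Finset.sum_congr rfl fun a _ => by rw [map_smul, smul_eq_mul, mul_comm]; rfl
  have hΓw' : ∀ y ∈ κ.x.target, ∀ k l, Γ k l y =
      ∑ a, starRingEnd ℂ (κ.repEnd 𝒮.W y a k) * frameGram 𝒮 κ a l y := by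
    intro y hy k l
    simp only [hΓ]
    rw [← 𝒮.W_symm, hWexp y hy k]
    simp only [map_sum, LinearMap.sum_apply, LinearMap.map_smulₛₗ, LinearMap.smul_apply,
      smul_eq_mul]
    rfl
  set N : EuclideanSpace ℝ (Fin n) → Matrix (Fin r) (Fin r) ℂ := fun y =>
    Matrix.of fun k l => frameGram 𝒮 κ k l y with hN
  have hN0 : (N 0).det ≠ 0 := by
    have : N 0 = 1 := by
      ext k l
      change frameGram 𝒮 κ k l 0 = _
      rw [hG0, Matrix.one_apply]
    rw [this, Matrix.det_one]
    exact one_ne_zero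
  have hNs : ∀ k l, ContDiffAt ℝ ∞ (fun y => N y k l) 0 := hG
  -- Smoothness of `W` is given only through its action on sections. Its matrix is recovered as the
  -- inverse Gram matrix of the frame times the smooth matrix `Γ`; the frame is orthonormal at the
  -- centre, so the inverse is smooth nearby.
  have hws : ∀ k l, ContDiffAt ℝ ∞ (fun y => κ.repEnd 𝒮.W y k l) 0 := by
    intro k l
    have h1 : ContDiffAt ℝ ∞ (fun y => ∑ a, (N y)⁻¹ k a * Γ a l y) 0 :=
      ContDiffAt.sum fun a _ => (contDiffAt_matrix_inv hNs hN0 k a).mul (hΓs a l)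
    refine h1.congr_of_eventuallyEq ?_
    filter_upwards [htn, (contDiffAt_matrix_det hNs).continuousAt.eventually_ne hN0] with y hy hy2
    have h2 : (Matrix.of fun a l => Γ a l y) = N y * κ.repEnd 𝒮.W y := by
      ext a l
      rw [Matrix.of_apply, hΓw y hy, Matrix.mul_apply]
      rfl
    have h3 : κ.repEnd 𝒮.W y = (N y)⁻¹ * (Matrix.of fun a l => Γ a l y) := by
      rw [h2, Matrix.nonsing_inv_mul_cancel_left _ _ (isUnit_iff_ne_zero.mpr hy2)]
    have h4 := congr_fun (congr_fun h3 k) l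
    rw [h4, Matrix.mul_apply]
    rfl
  have hconj : ∀ f : EuclideanSpace ℝ (Fin n) → ℂ, ContDiffAt ℝ ∞ f 0 →
      ContDiffAt ℝ ∞ (fun y => starRingEnd ℂ (f y)) 0 := fun f hf =>
    Complex.conjCLE.contDiff.contDiffAt.comp _ hf
  -- The test series 1 and x_m are Taylor series of globally smooth real functions, as the
  -- transposition identity requires.
  have hlap := laplace_identities (𝒮.taylorData φ κ ℓ lam mu) hgsymm (by
    intro Ψ hΨ k l
    obtain ⟨ψ₀, hψ₀, rfl⟩ : ∃ ψ₀ : EuclideanSpace ℝ (Fin n) → ℝ, ContDiff ℝ ∞ ψ₀ ∧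
        taylor (cpx ψ₀) = Ψ := by
      rcases hΨ with rfl | ⟨m, rfl⟩
      · refine ⟨fun _ => 1, contDiff_const, ?_⟩
        have := taylor_const (n := n) 1
        rw [map_one] at this
        have h1 : (cpx fun _ : EuclideanSpace ℝ (Fin n) => (1 : ℝ)) = fun _ => 1 := by
          funext y
          simp [cpx]
        rw [h1, this]
      · exact ⟨fun y => y m, (EuclideanSpace.proj (𝕜 := ℝ) m).contDiff, taylor_coord m⟩
    have := taylor_transpose_laplace ℓ h0 hψ₀ k l
    refine Eq.trans ?_ this
    refine congr_arg₂ _ (congr_arg₂ _ (congr_arg _ ?_) ?_) ?_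
    · refine Finset.sum_congr rfl fun i _ => Finset.sum_congr rfl fun j _ => ?_
      congr 2
      change taylor (invGram 𝒮 κ i j) * (taylor (volDensity 𝒮 κ) * taylor (frameGram 𝒮 κ k l)) *
        _ = _
      ring
    · refine Finset.sum_congr rfl fun j _ => ?_
      rw [← sum_density_mul]
      rfl
    · rw [← sum_density_mul]
      rfl)
  refine
    { lam_pos := ?_
      ginv_symm := hgsymm
      ginv_conj := fun i j => conjPS_taylor_cpx (hgi i j)
      ginv_zero := ?_
      φ_conj := conjPS_taylor_cpx hφc
      phaseRest_coeff := ?_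
      vol_conj := conjPS_taylor_cpx hvol
      vol_zero := ?_
      γ_conj := ?_
      γ_zero := ?_
      eikonal := ?_
      w_zero := ?_
      w_symm := ?_
      lap_zero := fun k l => (hlap k l).1
      lap_one := fun j k l => (hlap k l).2 j }
  · intro i
    have h := hessian_pos hφ.isOpen hφ.mem hφ.smooth hφ.min κ.x_mem hκ.mem (stdVec i) (by simp)
    have h2 := hκ.hessian i i
    rw [if_pos rfl] at h2
    rw [hκ.centred] at h
    change 0 < lam i
    rw [← h2]
    exact h
  · intro i j
    refine (constantCoeff_taylor _).trans ?_
    rw [hκ.metric, inv_one, Matrix.one_apply]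
    split_ifs <;> simp
  · intro α hα
    refine coeff_taylor_sub_quadratic hφc ?_ ?_ hκ.hessian α hα
    · rw [hx0, hφ.zero]
    · have := fderiv_chart_eq_zero_of_isLocalMin hφ.min.1 κ.x hκ.mem
      rwa [hκ.centred] at this
  · refine (constantCoeff_taylor _).trans ?_
    rw [hκ.metric, Matrix.det_one]
    simp
  · intro k l
    refine (taylor_conj (hG k l)).symm.trans ?_
    congr 1
    funext y
    exact (𝒮.γ.symm _ _ _).symm
  · intro k l
    exact (constantCoeff_taylor _).trans (hG0 k l)
  · have e1 : (fun y => (𝒮.V (κ.x.symm y) : ℂ)) =ᶠ[𝓝 0] fun y => ∑ i, ∑ j,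
        invGram 𝒮 κ i j y * pd i (cpx fun z => φ (κ.x.symm z)) y *
          pd j (cpx fun z => φ (κ.x.symm z)) y := by
      have e2 : ∀ᶠ y in 𝓝 0, ∀ i, pd i (cpx fun z => φ (κ.x.symm z)) y =
          cpx (pd i fun z => φ (κ.x.symm z)) y :=
        eventually_all.mpr fun i => pd_ofReal i hφc
      filter_upwards [hOn, e2] with y hy hy2
      have hU := hκ.source_subset (κ.x.map_target hy.1)
      have h3 := conormSq_eq 𝒮.g κ.x_mem hφ.isOpen hφ.smooth hy.1 hU
        (isUnit_iff_ne_zero.mpr (ne_of_gt hy.2))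
      rw [hφ.eikonal _ hU] at h3
      rw [h3]
      push_cast
      refine Finset.sum_congr rfl fun i _ => Finset.sum_congr rfl fun j _ => ?_
      rw [hy2, hy2]
      rfl
    have hφ' := contDiffAt_cpx hφc
    have hgc : ∀ i j, ContDiffAt ℝ ∞ (invGram 𝒮 κ i j) 0 := fun i j => contDiffAt_cpx (hgi i j)
    have hterm : ∀ i j, ContDiffAt ℝ ∞ (fun y =>
        invGram 𝒮 κ i j y * pd i (cpx fun z => φ (κ.x.symm z)) y *
          pd j (cpx fun z => φ (κ.x.symm z)) y) 0 := fun i j =>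
      ((hgc i j).mul (pd_contDiffAt i hφ')).mul (pd_contDiffAt j hφ')
    refine (taylor_congr e1).trans ?_
    rw [taylor_sum _ (fun i _ => ContDiffAt.sum fun j _ => hterm i j)]
    refine Finset.sum_congr rfl fun i _ => ?_
    rw [taylor_sum _ (fun j _ => hterm i j)]
    refine Finset.sum_congr rfl fun j _ => ?_
    rw [taylor_mul ((hgc i j).mul (pd_contDiffAt i hφ')) (pd_contDiffAt j hφ'),
      taylor_mul (hgc i j) (pd_contDiffAt i hφ'), ← pderiv_taylor i hφ', ← pderiv_taylor j hφ']
    rfl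
  · intro k l
    refine (constantCoeff_taylor _).trans ?_
    have h1 : κ.comp p (𝒮.W p (κ.frame l p)) = Pi.single l (mu l : ℂ) := by
      refine κ.comp_unique hκ.mem ?_
      rw [hκ.eigen, Finset.sum_eq_single l]
      · rw [Pi.single_eq_same]
      · intro b _ hb
        rw [Pi.single_eq_of_ne hb, zero_smul]
      · intro h
        exact absurd (Finset.mem_univ l) h
    change κ.comp (κ.x.symm 0) (𝒮.W (κ.x.symm 0) (κ.frame l (κ.x.symm 0))) k = _
    rw [hx0, h1]
    by_cases hkl : k = l
    · subst hkl
      rw [Pi.single_eq_same, if_pos rfl]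
      rfl
    · rw [Pi.single_eq_of_ne hkl, if_neg hkl]
  · intro k l
    have e1 : (fun y => ∑ a, frameGram 𝒮 κ k a y * κ.repEnd 𝒮.W y a l) =ᶠ[𝓝 0]
        fun y => ∑ a, starRingEnd ℂ (κ.repEnd 𝒮.W y a k) * frameGram 𝒮 κ a l y := by
      filter_upwards [htn] with y hy
      rw [← hΓw y hy, hΓw' y hy]
    have e2 := taylor_congr e1
    rw [taylor_sum _ (fun a _ => (hG k a).mul (hws a l)),
      taylor_sum _ (fun a _ => (hconj _ (hws a k)).mul (hG a l))] at e2
    refine Eq.trans ?_ (e2.trans ?_)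
    · refine Finset.sum_congr rfl fun a _ => ?_
      rw [taylor_mul (hG k a) (hws a l)]
      rfl
    · refine Finset.sum_congr rfl fun a _ => ?_
      rw [taylor_mul (hconj _ (hws a k)) (hG a l), taylor_conj (hws a k)]
      rfl

end SetupGood

/-! ## Laurent series -/

section Laurent

variable {R S : Type*} [CommRing R] [CommRing S]

/-- All coefficients of index below `k` vanish. -/
def VanishBelow (k : ℤ) (a : LaurentSeries R) : Prop := ∀ l < k, a.coeff l = 0

namespace VanishBelow

variable {k l : ℤ} {a b : LaurentSeries R}

theorem zero : VanishBelow k (0 : LaurentSeries R) := fun _ _ => rfl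

theorem add (ha : VanishBelow k a) (hb : VanishBelow k b) : VanishBelow k (a + b) := fun m hm => by
  rw [HahnSeries.coeff_add, ha m hm, hb m hm, add_zero]

theorem neg (ha : VanishBelow k a) : VanishBelow k (-a) := fun m hm => by
  rw [HahnSeries.coeff_neg, ha m hm, neg_zero]

theorem sub (ha : VanishBelow k a) (hb : VanishBelow k b) : VanishBelow k (a - b) := fun m hm => by
  rw [HahnSeries.coeff_sub, ha m hm, hb m hm, sub_zero]

theorem mono (ha : VanishBelow k a) (h : l ≤ k) : VanishBelow l a := fun m hm => ha m (by omega)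

theorem sum {ι : Type*} (s : Finset ι) {f : ι → LaurentSeries R}
    (hf : ∀ i ∈ s, VanishBelow k (f i)) : VanishBelow k (∑ i ∈ s, f i) := by
  intro m hm
  rw [HahnSeries.coeff_sum]
  exact Finset.sum_eq_zero fun i hi => hf i hi m hm

theorem order (a : LaurentSeries R) : VanishBelow a.order a := fun _ hm =>
  HahnSeries.coeff_eq_zero_of_lt_order hm

theorem single (r : R) : VanishBelow k (HahnSeries.single k r) := fun m hm => by
  rw [HahnSeries.coeff_single_of_ne (by omega)]

theorem C (r : R) : VanishBelow 0 (HahnSeries.C r : LaurentSeries R) := single r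

theorem one : VanishBelow 0 (1 : LaurentSeries R) := single 1

end VanishBelow

/-- The convolution over an explicit interval that depends only on lower bounds, not on the
supports. Products of different series can so be compared over one index set, which is how
coefficientwise maps are shown to be multiplicative. -/
theorem coeff_mul_eq_sum {k l : ℤ} {a b : LaurentSeries R} (ha : VanishBelow k a)
    (hb : VanishBelow l b) (m : ℤ) :
    (a * b).coeff m = ∑ i ∈ Finset.Icc k (m - l), a.coeff i * b.coeff (m - i) := by
  rw [HahnSeries.coeff_mul]
  refine Finset.sum_of_injOn Prod.fst ?_ ?_ ?_ ?_
  · rintro ⟨i, j⟩ h1 ⟨i', j'⟩ h2 h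
    simp only [Finset.mem_coe, Finset.mem_antidiagonal] at h1 h2
    ext
    · exact h
    · change j = j'
      have := h1.2.2
      have := h2.2.2
      simp only at *
      omega
  · rintro ⟨i, j⟩ h
    simp only [Finset.mem_coe, Finset.mem_antidiagonal, HahnSeries.mem_support] at h
    simp only [Finset.coe_Icc, Set.mem_Icc]
    constructor
    · by_contra hlt
      exact h.1 (ha i (by omega))
    · by_contra hlt
      exact h.2.1 (hb j (by omega))
  · intro i _ hi
    by_contra hne
    refine hi ⟨(i, m - i), ?_, rfl⟩
    simp only [Finset.mem_coe, Finset.mem_antidiagonal, HahnSeries.mem_support]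
    exact ⟨left_ne_zero_of_mul hne, right_ne_zero_of_mul hne, by omega⟩
  · rintro ⟨i, j⟩ h
    simp only [Finset.mem_antidiagonal] at h
    have : m - i = j := by omega
    simp only [this]

theorem VanishBelow.mul {k l : ℤ} {a b : LaurentSeries R} (ha : VanishBelow k a)
    (hb : VanishBelow l b) : VanishBelow (k + l) (a * b) := by
  intro m hm
  rw [coeff_mul_eq_sum ha hb]
  refine Finset.sum_eq_zero fun i hi => ?_
  rw [Finset.mem_Icc] at hi
  omega

theorem coeff_mul_lowest {k l : ℤ} {a b : LaurentSeries R} (ha : VanishBelow k a)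
    (hb : VanishBelow l b) : (a * b).coeff (k + l) = a.coeff k * b.coeff l := by
  rw [coeff_mul_eq_sum ha hb, Finset.sum_eq_single k]
  · congr 2
    ring
  · intro i hi hik
    rw [Finset.mem_Icc] at hi
    omega
  · intro h
    rw [Finset.mem_Icc] at h
    omega

theorem coeff_single_mul' (k m : ℤ) (r : R) (b : LaurentSeries R) :
    (HahnSeries.single k r * b).coeff m = r * b.coeff (m - k) := by
  have := HahnSeries.coeff_single_mul_add (r := r) (x := b) (a := m - k) (b := k)
  rwa [sub_add_cancel] at this

theorem coeff_C_mul' (m : ℤ) (r : R) (b : LaurentSeries R) :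
    (HahnSeries.C r * b).coeff m = r * b.coeff m := by
  rw [HahnSeries.C_apply, coeff_single_mul', sub_zero]

/-- Coefficientwise application of a ring homomorphism. -/
def mapCoeff (f : R →+* S) : LaurentSeries R →+* LaurentSeries S where
  toFun a := a.map f
  map_zero' := by ext; simp
  map_one' := by
    ext m
    simp only [HahnSeries.map_coeff, HahnSeries.coeff_one]
    split_ifs <;> simp
  map_add' a b := by ext; simp
  map_mul' a b := by
    ext m
    have ha : VanishBelow a.order (a.map f) := fun l hl => by
      rw [HahnSeries.map_coeff, HahnSeries.coeff_eq_zero_of_lt_order hl, map_zero]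
    have hb : VanishBelow b.order (b.map f) := fun l hl => by
      rw [HahnSeries.map_coeff, HahnSeries.coeff_eq_zero_of_lt_order hl, map_zero]
    rw [HahnSeries.map_coeff, coeff_mul_eq_sum (VanishBelow.order a) (VanishBelow.order b),
      coeff_mul_eq_sum ha hb, map_sum]
    simp

theorem coeff_mapCoeff (f : R →+* S) (a : LaurentSeries R) (m : ℤ) :
    (mapCoeff f a).coeff m = f (a.coeff m) := rfl

theorem mapCoeff_single (f : R →+* S) (k : ℤ) (c : R) :
    mapCoeff f (HahnSeries.single k c) = HahnSeries.single k (f c) :=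
  HahnSeries.map_single (f : ZeroHom R S)

theorem mapCoeff_C (f : R →+* S) (c : R) :
    mapCoeff f (HahnSeries.C c) = HahnSeries.C (f c) := mapCoeff_single f 0 c

theorem VanishBelow.mapCoeff (f : R →+* S) {k : ℤ} {a : LaurentSeries R} (ha : VanishBelow k a) :
    VanishBelow k (mapCoeff f a) := fun m hm => by
  rw [coeff_mapCoeff, ha m hm, map_zero]

/-- The sign `(-1)^m`. -/
def sgn (m : ℤ) : ℤ := (Int.negOnePow m : ℤˣ)

theorem sgn_add (k l : ℤ) : sgn (k + l) = sgn k * sgn l := by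
  simp [sgn, Int.negOnePow_add]

theorem sgn_of_even {m : ℤ} (h : Even m) : sgn m = 1 := by
  simp [sgn, Int.negOnePow_even m h]

theorem sgn_of_odd {m : ℤ} (h : Odd m) : sgn m = -1 := by
  simp [sgn, Int.negOnePow_odd m h]

/-- The substitution `t ↦ -t`. -/
def flip : LaurentSeries R →+* LaurentSeries R where
  toFun a := HahnSeries.ofSuppBddBelow (fun m => (sgn m : R) * a.coeff m) ⟨a.order, fun m hm => by
    by_contra hlt
    exact hm (by simp [HahnSeries.coeff_eq_zero_of_lt_order (not_le.mp hlt)])⟩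
  map_zero' := by
    ext m
    change (sgn m : R) * 0 = 0
    exact mul_zero _
  map_one' := by
    ext m
    change (sgn m : R) * (1 : LaurentSeries R).coeff m = (1 : LaurentSeries R).coeff m
    rw [HahnSeries.coeff_one]
    split_ifs with h
    · subst h
      simp [sgn]
    · exact mul_zero _
  map_add' a b := by
    ext m
    change (sgn m : R) * (a + b).coeff m = (sgn m : R) * a.coeff m + (sgn m : R) * b.coeff m
    rw [HahnSeries.coeff_add, mul_add]
  map_mul' a b := by
    ext m
    have h : ∀ c : LaurentSeries R, VanishBelow c.order (HahnSeries.ofSuppBddBelow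
        (fun m => (sgn m : R) * c.coeff m) ⟨c.order, fun m hm => by
          by_contra hlt
          exact hm (by simp [HahnSeries.coeff_eq_zero_of_lt_order (not_le.mp hlt)])⟩) :=
      fun c l hl => by
        change (sgn l : R) * c.coeff l = 0
        rw [HahnSeries.coeff_eq_zero_of_lt_order hl, mul_zero]
    rw [coeff_mul_eq_sum (h a) (h b)]
    change (sgn m : R) * (a * b).coeff m = _
    rw [coeff_mul_eq_sum (VanishBelow.order a) (VanishBelow.order b), Finset.mul_sum]
    refine Finset.sum_congr rfl fun i _ => ?_
    change _ = (sgn i : R) * a.coeff i * ((sgn (m - i) : R) * b.coeff (m - i))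
    have : sgn m = sgn i * sgn (m - i) := by rw [← sgn_add, add_sub_cancel]
    rw [this]
    push_cast
    ring

theorem coeff_flip (a : LaurentSeries R) (m : ℤ) : (flip a).coeff m = (sgn m : R) * a.coeff m := rfl

theorem flip_single_of_even {k : ℤ} (hk : Even k) (c : R) :
    flip (HahnSeries.single k c) = HahnSeries.single k c := by
  ext m
  rw [coeff_flip]
  by_cases h : m = k
  · subst h
    rw [sgn_of_even hk, Int.cast_one, one_mul]
  · rw [HahnSeries.coeff_single_of_ne h, mul_zero]

theorem flip_C (c : R) : flip (HahnSeries.C c) = HahnSeries.C c := flip_single_of_even Even.zero c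

theorem VanishBelow.flip {k : ℤ} {a : LaurentSeries R} (ha : VanishBelow k a) :
    VanishBelow k (flip a) := fun m hm => by
  rw [coeff_flip, ha m hm, mul_zero]

end Laurent

/-- Coefficientwise conjugation on `ℂ((ħ^{1/2}))`. -/
abbrev conjK : K →+* K := mapCoeff (starRingEnd ℂ)

theorem conjK_conjK (a : K) : conjK (conjK a) = a := by
  ext m
  simp [coeff_mapCoeff]

theorem isIntegral_iff_flip {a : K} : IsIntegral a ↔ flip a = a := by
  constructor
  · intro h
    ext m
    rw [coeff_flip]
    rcases Int.even_or_odd m with hm | hm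
    · rw [sgn_of_even hm, Int.cast_one, one_mul]
    · rw [h m hm, mul_zero]
  · intro h m hm
    have := congr_arg (fun b : K => b.coeff m) h
    simp only [coeff_flip, sgn_of_odd hm, Int.cast_neg, Int.cast_one, neg_mul, one_mul] at this
    linear_combination (-1 / 2 : ℂ) * this

theorem isRealSeries_of_conjK {a : K} (h : conjK a = a) : IsRealSeries a := by
  intro m
  have := congr_arg (fun b : K => b.coeff m) h
  simp only [coeff_mapCoeff] at this
  exact Complex.conj_eq_iff_im.mp this

/-! ## Matrices of Laurent series -/

section Matrices

variable {I J L : Type*} [Fintype I] [Fintype J] [Fintype L] [DecidableEq I] [DecidableEq J]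

/-- All entries vanish below index `k`. -/
def MatVanish (k : ℤ) (X : Matrix I J K) : Prop := ∀ i j, VanishBelow k (X i j)

theorem MatVanish.add {k : ℤ} {X Y : Matrix I J K} (hX : MatVanish k X) (hY : MatVanish k Y) :
    MatVanish k (X + Y) := fun i j => (hX i j).add (hY i j)

theorem MatVanish.sub {k : ℤ} {X Y : Matrix I J K} (hX : MatVanish k X) (hY : MatVanish k Y) :
    MatVanish k (X - Y) := fun i j => (hX i j).sub (hY i j)

theorem MatVanish.neg {k : ℤ} {X : Matrix I J K} (hX : MatVanish k X) :
    MatVanish k (-X) := fun i j => (hX i j).neg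

theorem MatVanish.mono {k l : ℤ} {X : Matrix I J K} (hX : MatVanish k X) (h : l ≤ k) :
    MatVanish l X := fun i j => (hX i j).mono h

theorem MatVanish.mul {k l : ℤ} {X : Matrix I J K} {Y : Matrix J L K} (hX : MatVanish k X)
    (hY : MatVanish l Y) : MatVanish (k + l) (X * Y) := fun i j => by
  rw [Matrix.mul_apply]
  exact VanishBelow.sum _ fun a _ => (hX i a).mul (hY a j)

theorem MatVanish.zero {k : ℤ} : MatVanish k (0 : Matrix I J K) := fun _ _ => VanishBelow.zero

theorem MatVanish.one : MatVanish 0 (1 : Matrix I I K) := fun i j => by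
  rw [Matrix.one_apply]
  split_ifs
  · exact VanishBelow.one
  · exact VanishBelow.zero

theorem MatVanish.eq_zero {X : Matrix I J K} (h : ∀ k : ℕ, MatVanish k X) : X = 0 := by
  ext i j m
  exact h (m.toNat + 1) i j m (by push_cast; omega)

/-- The `t`-adic contraction principle. -/
theorem exists_fixed_point (Φ : Matrix I J K → Matrix I J K)
    (h1 : ∀ X, MatVanish 1 X → MatVanish 1 (Φ X))
    (hc : ∀ k : ℤ, ∀ X Y, MatVanish 1 X → MatVanish 1 Y → MatVanish k (X - Y) →
      MatVanish (k + 1) (Φ X - Φ Y)) : ∃ X, MatVanish 1 X ∧ Φ X = X := by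
  set s : ℕ → Matrix I J K := fun m => Φ^[m] 0 with hs
  have hsucc : ∀ m, s (m + 1) = Φ (s m) := fun m => Function.iterate_succ_apply' Φ m 0
  have hs1 : ∀ m, MatVanish 1 (s m) := by
    intro m
    induction m with
    | zero => exact MatVanish.zero
    | succ m ih => rw [hsucc]; exact h1 _ ih
  have hd : ∀ m : ℕ, MatVanish ((m : ℤ) + 1) (s (m + 1) - s m) := by
    intro m
    induction m with
    | zero => exact ((hs1 1).sub (hs1 0)).mono (by simp)
    | succ m ih =>
      rw [hsucc (m + 1), hsucc m]
      have := hc _ _ _ (hs1 (m + 1)) (hs1 m) ih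
      rw [hsucc m] at this
      push_cast
      exact this
  have hd2 : ∀ m d : ℕ, MatVanish ((m : ℤ) + 1) (s (m + d) - s m) := by
    intro m d
    induction d with
    | zero => rw [add_zero, sub_self]; exact MatVanish.zero
    | succ d ih =>
      have := ((hd (m + d)).mono (l := (m : ℤ) + 1) (by push_cast; omega)).add ih
      rwa [sub_add_sub_cancel] at this
  -- The coefficient of index l is unchanged from the iterate number l on, because iterates m and
  -- m+1 agree below index m+1.
  let X : Matrix I J K := Matrix.of fun i j => HahnSeries.ofSuppBddBelow
    (fun l => (s l.toNat i j).coeff l) ⟨0, fun l hl => by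
      by_contra hlt
      exact hl (hs1 _ i j l (by omega))⟩
  have hX : ∀ m : ℕ, MatVanish ((m : ℤ) + 1) (X - s m) := by
    intro m i j l hl
    change (s l.toNat i j).coeff l - (s m i j).coeff l = 0
    rcases le_or_gt l 0 with h0 | h0
    · rw [hs1 _ i j l (by omega), hs1 _ i j l (by omega), sub_zero]
    · obtain ⟨d, hd⟩ : ∃ d, m = l.toNat + d := ⟨m - l.toNat, by omega⟩
      have := hd2 l.toNat d i j l (by omega)
      rw [← hd] at this
      change (s m i j).coeff l - (s l.toNat i j).coeff l = 0 at this
      linear_combination -this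
  have hX1 : MatVanish 1 X := by
    have := (hX 0).add (hs1 0)
    rwa [sub_add_cancel] at this
  refine ⟨X, hX1, sub_eq_zero.mp (MatVanish.eq_zero fun m => ?_)⟩
  have e1 := hc _ _ _ hX1 (hs1 m) (hX m)
  rw [← hsucc] at e1
  have e2 := e1.sub ((hX (m + 1)).mono (l := (m : ℤ) + 1 + 1) (by push_cast; omega))
  rw [sub_sub_sub_cancel_right] at e2
  exact e2.mono (by omega)

/-- The conjugate transpose of a matrix of Laurent series. -/
def adj (X : Matrix I J K) : Matrix J I K := X.transpose.map conjK

theorem adj_apply (X : Matrix I J K) (i : J) (j : I) : adj X i j = conjK (X j i) := rfl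

theorem adj_mul (X : Matrix I J K) (Y : Matrix J L K) : adj (X * Y) = adj Y * adj X := by
  rw [adj, Matrix.transpose_mul, Matrix.map_mul]
  rfl

theorem adj_adj (X : Matrix I J K) : adj (adj X) = X := by
  refine Matrix.ext fun i j => ?_
  exact conjK_conjK _

theorem adj_add (X Y : Matrix I J K) : adj (X + Y) = adj X + adj Y := by
  refine Matrix.ext fun i j => ?_
  exact map_add conjK _ _

theorem adj_sub (X Y : Matrix I J K) : adj (X - Y) = adj X - adj Y := by
  refine Matrix.ext fun i j => ?_
  exact map_sub conjK _ _

theorem adj_one : adj (1 : Matrix I I K) = 1 := by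
  rw [adj, Matrix.transpose_one, Matrix.map_one _ (map_zero _) (map_one _)]

theorem MatVanish.adj {k : ℤ} {X : Matrix I J K} (hX : MatVanish k X) : MatVanish k (adj X) :=
  fun i j => (hX j i).mapCoeff _

/-- Half of a matrix. -/
def half (X : Matrix I J K) : Matrix I J K := X.map fun a => HahnSeries.C (1 / 2 : ℂ) * a

theorem half_add_half (X : Matrix I J K) : half X + half X = X := by
  refine Matrix.ext fun i j => ?_
  change HahnSeries.C (1 / 2 : ℂ) * X i j + HahnSeries.C (1 / 2 : ℂ) * X i j = X i j
  rw [← add_mul, ← map_add, add_halves, map_one, one_mul]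

theorem half_sub (X Y : Matrix I J K) : half (X - Y) = half X - half Y := by
  refine Matrix.ext fun i j => ?_
  exact mul_sub (HahnSeries.C (1 / 2 : ℂ) : K) (X i j) (Y i j)

theorem half_neg (X : Matrix I J K) : half (-X) = -half X := by
  refine Matrix.ext fun i j => ?_
  exact mul_neg (HahnSeries.C (1 / 2 : ℂ) : K) (X i j)

theorem half_add (X Y : Matrix I J K) : half (X + Y) = half X + half Y := by
  refine Matrix.ext fun i j => ?_
  exact mul_add (HahnSeries.C (1 / 2 : ℂ) : K) (X i j) (Y i j)

theorem MatVanish.half {k : ℤ} {X : Matrix I J K} (hX : MatVanish k X) :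
    MatVanish k (half X) := fun i j => by
  have := (VanishBelow.C (1 / 2 : ℂ)).mul (hX i j)
  rwa [zero_add] at this

/-- With A = 1 + N and B = 1 + X the equation B²A = 1 becomes 2X = -(N + 2XN + X² + X²N). On
matrices without constant term the right side gains one order in t, so the contraction principle
applies; no commutation of X with N is used. -/
theorem exists_invSqrt {A : Matrix I I K} (hA : MatVanish 1 (A - 1)) :
    ∃ B : Matrix I I K, MatVanish 1 (B - 1) ∧ B * B * A = 1 := by
  set N := A - 1 with hN
  obtain ⟨X, hX1, hX⟩ := exists_fixed_point
    (fun X : Matrix I I K => -(half (N + X * N + X * N + X * X + X * X * N)))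
    (fun X hX => by
      refine (MatVanish.half ?_).neg
      have e1 := (hX.mul hA).mono (l := 1) (by norm_num)
      have e2 := (hX.mul hX).mono (l := 1) (by norm_num)
      have e3 := ((hX.mul hX).mul hA).mono (l := 1) (by norm_num)
      exact (((hA.add e1).add e1).add e2).add e3)
    (fun k X Y hX hY hXY => by
      have : -(half (N + X * N + X * N + X * X + X * X * N)) -
          -(half (N + Y * N + Y * N + Y * Y + Y * Y * N)) =
          -(half ((X - Y) * N + (X - Y) * N + ((X - Y) * X + Y * (X - Y)) +
            ((X - Y) * X + Y * (X - Y)) * N)) := by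
        rw [← half_neg, ← half_neg, ← half_neg, ← half_sub]
        congr 1
        simp only [sub_mul, mul_sub, add_mul, mul_add, mul_assoc]
        abel
      rw [this]
      refine (MatVanish.half ?_).neg
      have e1 := hXY.mul hA
      have e2 : MatVanish (k + 1) ((X - Y) * X + Y * (X - Y)) := by
        have := hY.mul hXY
        rw [add_comm] at this
        exact (hXY.mul hX).add this
      have e3 := (e2.mul hA).mono (l := k + 1) (by omega)
      exact ((e1.add e1).add e2).add e3)
  refine ⟨1 + X, by rwa [add_sub_cancel_left], ?_⟩
  have hA' : A = 1 + N := by rw [hN]; abel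
  have h2 : X + X = -(N + X * N + X * N + X * X + X * X * N) := by
    have h := half_add_half (N + X * N + X * N + X * X + X * X * N)
    calc X + X = -(half (N + X * N + X * N + X * X + X * X * N)) +
          -(half (N + X * N + X * N + X * X + X * X * N)) := by rw [hX]
      _ = _ := by rw [← neg_add, h]
  rw [hA']
  calc (1 + X) * (1 + X) * (1 + N) = 1 + (X + X) + (N + X * N + X * N + X * X + X * X * N) := by
        simp only [add_mul, mul_add, one_mul, mul_one]
        abel
    _ = 1 := by rw [h2]; abel

/-- Both squares are inverse to A, so B² = B'². Then 2(B - B') = -((B - 1)(B - B') + (B - B')(B' -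
1)), so agreement to some order implies agreement to the next. Uniqueness is what transfers the
symmetries of A, adjunction and t ↦ -t, to B. -/
theorem invSqrt_unique {A B B' : Matrix I I K} (hB : MatVanish 1 (B - 1))
    (hB' : MatVanish 1 (B' - 1)) (h : B * B * A = 1) (h' : B' * B' * A = 1) : B = B' := by
  have hsq : B * B = B' * B' := by
    have e := mul_eq_one_comm.mp h
    calc B * B = (B' * B' * A) * (B * B) := by rw [h', one_mul]
      _ = B' * B' * (A * (B * B)) := mul_assoc _ _ _
      _ = B' * B' := by rw [e, mul_one]
  have key : B - B' = half
      (-((B - 1) * (B - B') + (B - B') * (B' - 1))) := by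
    have : -((B - 1) * (B - B') + (B - B') * (B' - 1)) = (B - B') + (B - B') := by
      have e : (B - 1) * (B - B') + (B - B') * (B' - 1) =
          B * B - B' * B' - ((B - B') + (B - B')) := by
        simp only [sub_mul, mul_sub, one_mul, mul_one]
        abel
      rw [e, hsq]
      abel
    rw [this, half_add, half_add_half]
  refine sub_eq_zero.mp (MatVanish.eq_zero fun k => ?_)
  induction k with
  | zero =>
    have := (hB.sub hB').mono (l := (0 : ℕ)) (by norm_num)
    rwa [sub_sub_sub_cancel_right] at this
  | succ k ih =>
    rw [key]
    refine (MatVanish.half ?_).mono (l := ((k + 1 : ℕ) : ℤ)) (le_refl _)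
    have e1 := hB.mul ih
    have e2 := ih.mul hB'
    rw [add_comm] at e1
    push_cast
    exact (e1.add e2).neg

theorem isInvSqrt_of {m : ℕ} {A B : Matrix (Fin m) (Fin m) K} (hB : MatVanish 1 (B - 1))
    (h : B * B * A = 1) : IsInvSqrt A B := by
  refine ⟨fun i j => ?_, h⟩
  have e : B i j = (B - 1) i j + (1 : Matrix (Fin m) (Fin m) K) i j := by
    rw [Matrix.sub_apply, sub_add_cancel]
  constructor
  · intro l hl
    rw [e, HahnSeries.coeff_add, hB i j l (by omega), MatVanish.one i j l hl, add_zero]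
  · rw [e, HahnSeries.coeff_add, hB i j 0 (by omega), zero_add, Matrix.one_apply, Matrix.one_apply]
    split_ifs <;> simp

/-- The adjoint of B is again a normalized inverse square root of A, so it equals B. -/
theorem adj_invSqrt {A B : Matrix I I K} (hA : adj A = A) (hB : MatVanish 1 (B - 1))
    (h : B * B * A = 1) : adj B = B := by
  refine invSqrt_unique (A := A) ?_ hB ?_ h
  · have := hB.adj
    rwa [adj_sub, adj_one] at this
  · have := congr_arg adj (mul_eq_one_comm.mp h)
    rwa [adj_mul, adj_mul, adj_one, hA] at this

theorem invSqrt_conj {A B : Matrix I I K} (h : B * B * A = 1) : B * A * B = 1 := by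
  rw [mul_assoc] at h
  exact mul_eq_one_comm.mp h

end Matrices

/-! ## Diagonalization of hermitian matrices over `ℂ((ħ^{1/2}))` -/

section Diagonalization

variable {I J : Type} [Fintype I] [Fintype J] [DecidableEq I] [DecidableEq J]

/-- `M` is similar to a diagonal matrix with real entries. -/
def RealDiag (M : Matrix I I K) : Prop :=
  ∃ (P P' : Matrix I I K) (d : I → K), P' * P = 1 ∧ M * P = P * Matrix.diagonal d ∧
    ∀ i, conjK (d i) = d i

theorem RealDiag.of_similar {M N T T' : Matrix I I K} (hT : T' * T = 1) (h : M * T = T * N)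
    (hN : RealDiag N) : RealDiag M := by
  obtain ⟨P, P', d, h1, h2, h3⟩ := hN
  refine ⟨T * P, P' * T', d, ?_, ?_, h3⟩
  · rw [mul_assoc, ← mul_assoc T', hT, one_mul, h1]
  · rw [← mul_assoc, h, mul_assoc, h2, mul_assoc]

theorem RealDiag.affine {N : Matrix I I K} {a c : K} (ha : conjK a = a) (hc : conjK c = c)
    (hN : RealDiag N) : RealDiag (Matrix.scalar I c + Matrix.scalar I a * N) := by
  obtain ⟨P, P', d, h1, h2, h3⟩ := hN
  refine ⟨P, P', fun i => c + a * d i, h1, ?_, fun i => by rw [map_add, map_mul, ha, hc, h3]⟩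
  have e : Matrix.diagonal (fun i => c + a * d i) =
      Matrix.scalar I c + Matrix.scalar I a * Matrix.diagonal d := by
    rw [Matrix.scalar_apply, Matrix.scalar_apply, Matrix.diagonal_mul_diagonal,
      Matrix.diagonal_add]
  have e1 := (Matrix.scalar_commute c (Commute.all c) P).eq
  have e2 := (Matrix.scalar_commute a (Commute.all a) P).eq
  rw [e, add_mul, mul_add, e1, mul_assoc, h2, ← mul_assoc, e2, mul_assoc]

theorem RealDiag.reindex (e : J ≃ I) {M : Matrix I I K} (h : RealDiag (M.submatrix e e)) :
    RealDiag M := by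
  obtain ⟨P, P', d, h1, h2, h3⟩ := h
  refine ⟨P.submatrix e.symm e.symm, P'.submatrix e.symm e.symm, d ∘ e.symm, ?_, ?_,
    fun i => h3 _⟩
  · rw [Matrix.submatrix_mul_equiv, h1, Matrix.submatrix_one_equiv]
  · have := congr_arg (fun X => X.submatrix e.symm e.symm) h2
    simp only [← Matrix.submatrix_mul_equiv _ _ e.symm e.symm e.symm, Matrix.submatrix_submatrix,
      Equiv.self_comp_symm, Matrix.submatrix_id_id] at this
    rw [this, Matrix.submatrix_diagonal_equiv]

theorem RealDiag.fromBlocks {A : Matrix I I K} {D : Matrix J J K} (hA : RealDiag A)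
    (hD : RealDiag D) : RealDiag (Matrix.fromBlocks A 0 0 D) := by
  obtain ⟨P, P', d, h1, h2, h3⟩ := hA
  obtain ⟨Q, Q', e, h4, h5, h6⟩ := hD
  refine ⟨Matrix.fromBlocks P 0 0 Q, Matrix.fromBlocks P' 0 0 Q', Sum.elim d e, ?_, ?_, ?_⟩
  · rw [Matrix.fromBlocks_multiply]
    simp [h1, h4]
  · rw [← Matrix.fromBlocks_diagonal, Matrix.fromBlocks_multiply, Matrix.fromBlocks_multiply]
    simp [h2, h5]
  · rintro (i | i)
    · exact h3 i
    · exact h6 i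

theorem RealDiag.charpoly {M : Matrix I I K} (h : RealDiag M) :
    ∃ d : I → K, M.charpoly = ∏ i, (Polynomial.X - Polynomial.C (d i)) ∧
      ∀ i, conjK (d i) = d i := by
  obtain ⟨P, P', d, h1, h2, h3⟩ := h
  refine ⟨d, ?_, h3⟩
  have e : M = P * (Matrix.diagonal d * P') := by
    rw [← mul_assoc, ← h2, mul_assoc, mul_eq_one_comm.mp h1, mul_one]
  rw [e, Matrix.charpoly_mul_comm, mul_assoc, h1, mul_one, Matrix.charpoly_diagonal]

theorem RealDiag.scalar {c : K} (hc : conjK c = c) : RealDiag (Matrix.scalar I c) :=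
  ⟨1, 1, fun _ => c, one_mul 1, by rw [mul_one, one_mul]; rfl, fun _ => hc⟩

/-- Reduction of a metric `G = 1 + O(t)` to the standard one. -/
theorem RealDiag.of_metric (hI : ∀ M : Matrix I I K, adj M = M → RealDiag M)
    {M G : Matrix I I K} (hG1 : MatVanish 1 (G - 1)) (hG : adj G = G) (h : adj (G * M) = G * M) :
    RealDiag M := by
  obtain ⟨B, hB1, hB⟩ := exists_invSqrt hG1
  have hBs := adj_invSqrt hG hB1 hB
  have hBG := invSqrt_conj hB
  -- Conjugation by B = G^{-1/2} turns a matrix symmetric for the metric G into a hermitian one; BGB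
  -- = 1 shows that BG is a left inverse of B.
  refine RealDiag.of_similar (T := B) (T' := B * G) (N := B * (G * M) * B) hBG ?_ (hI _ ?_)
  · have e : B * (B * G) = 1 := by rw [← mul_assoc, hB]
    calc M * B = B * (B * G) * M * B := by rw [e, one_mul]
      _ = B * (B * (G * M) * B) := by simp only [mul_assoc]
  · rw [adj_mul, adj_mul, h, hBs]
    simp only [mul_assoc]

/-- A complex matrix, regarded as a matrix of Laurent series. -/
def constMat (U : Matrix I J ℂ) : Matrix I J K := U.map (HahnSeries.C : ℂ →+* K)

theorem constMat_mul {L : Type} [Fintype L] (U : Matrix I J ℂ) (U' : Matrix J L ℂ) :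
    constMat (U * U') = constMat U * constMat U' := Matrix.map_mul

theorem constMat_one : constMat (1 : Matrix I I ℂ) = 1 :=
  Matrix.map_one _ (map_zero _) (map_one _)

theorem constMat_vanish (U : Matrix I J ℂ) : MatVanish 0 (constMat U) := fun _ _ =>
  VanishBelow.C _

theorem adj_constMat (U : Matrix I J ℂ) : adj (constMat U) = constMat U.conjTranspose := by
  refine Matrix.ext fun i j => ?_
  exact mapCoeff_C _ _

theorem constMat_diagonal_mul (d : I → ℂ) (X : Matrix I J K) (i : I) (j : J) :
    (constMat (Matrix.diagonal d) * X) i j = HahnSeries.C (d i) * X i j := by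
  rw [constMat, Matrix.diagonal_map (map_zero _)]
  exact Matrix.diagonal_mul _ _ _ _

theorem mul_constMat_diagonal (d : J → ℂ) (X : Matrix I J K) (i : I) (j : J) :
    (X * constMat (Matrix.diagonal d)) i j = X i j * HahnSeries.C (d j) := by
  rw [constMat, Matrix.diagonal_map (map_zero _)]
  exact Matrix.mul_diagonal _ _ _ _

/-- The Riccati equation of a block matrix. -/
theorem exists_riccati {A : Matrix I I K} {B : Matrix I J K} {C : Matrix J I K} {D : Matrix J J K}
    {d : J → ℂ} {c : ℂ} (hd : ∀ j, d j ≠ c)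
    (hA : MatVanish 1 (A - constMat (Matrix.diagonal fun _ : I => c))) (hB : MatVanish 1 B)
    (hC : MatVanish 1 C) (hD : MatVanish 1 (D - constMat (Matrix.diagonal d))) :
    ∃ X : Matrix J I K, MatVanish 1 X ∧ C + D * X = X * A + X * B * X := by
  set A1 := A - constMat (Matrix.diagonal fun _ : I => c) with hA1
  set D1 := D - constMat (Matrix.diagonal d) with hD1
  -- The constant part of the linear operator X ↦ DX - XA multiplies row j by d_j - c, which is
  -- non-zero by hypothesis. Dividing by it leaves a fixed point equation that is contracting in
  -- powers of t.
  set Δ : Matrix J J K := constMat (Matrix.diagonal fun j => (d j - c)⁻¹) with hΔ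
  have hΔv : MatVanish 0 Δ := constMat_vanish _
  obtain ⟨X, hX1, hX⟩ := exists_fixed_point
    (fun X : Matrix J I K => Δ * (X * A1 - D1 * X - C + X * B * X))
    (fun X hX => by
      have e1 := (hX.mul hA).mono (l := 1) (by norm_num)
      have e2 := (hD.mul hX).mono (l := 1) (by norm_num)
      have e3 := ((hX.mul hB).mul hX).mono (l := 1) (by norm_num)
      have := hΔv.mul (((e1.sub e2).sub hC).add e3)
      rwa [zero_add] at this)
    (fun k X Y hX hY hXY => by
      have : Δ * (X * A1 - D1 * X - C + X * B * X) - Δ * (Y * A1 - D1 * Y - C + Y * B * Y) =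
          Δ * ((X - Y) * A1 - D1 * (X - Y) + ((X - Y) * (B * X) + Y * B * (X - Y))) := by
        rw [← Matrix.mul_sub]
        congr 1
        simp only [Matrix.sub_mul, Matrix.mul_sub, Matrix.mul_assoc]
        abel
      rw [this]
      have e1 := hXY.mul hA
      have e2 := (hD.mul hXY).mono (l := k + 1) (by omega)
      have e3 := (hXY.mul (hB.mul hX)).mono (l := k + 1) (by omega)
      have e4 := ((hY.mul hB).mul hXY).mono (l := k + 1) (by omega)
      have := hΔv.mul ((e1.sub e2).add (e3.add e4))
      rwa [zero_add] at this)
  refine ⟨X, hX1, ?_⟩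
  have h1 : constMat (Matrix.diagonal fun j => d j - c) * Δ = 1 := by
    rw [hΔ, ← constMat_mul, Matrix.diagonal_mul_diagonal, ← constMat_one, ← Matrix.diagonal_one]
    congr 2
    funext j
    exact mul_inv_cancel₀ (sub_ne_zero.mpr (hd j))
  have h2 : constMat (Matrix.diagonal fun j => d j - c) * X =
      X * A1 - D1 * X - C + X * B * X := by
    conv_lhs => rw [← hX]
    rw [← Matrix.mul_assoc, h1, Matrix.one_mul]
  have h3 : constMat (Matrix.diagonal fun j => d j - c) * X =
      constMat (Matrix.diagonal d) * X -
        X * constMat (Matrix.diagonal fun _ : I => c) := by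
    refine Matrix.ext fun i j => ?_
    rw [Matrix.sub_apply, constMat_diagonal_mul, constMat_diagonal_mul, mul_constMat_diagonal,
      map_sub]
    ring
  have h4 := h3.symm.trans h2
  rw [hA1, hD1, Matrix.mul_sub, Matrix.sub_mul] at h4
  refine sub_eq_zero.mp (Eq.trans ?_ (sub_eq_zero.mpr h4))
  abel

/-- Splitting off a block. -/
theorem RealDiag.of_blocks (hI : ∀ M : Matrix I I K, adj M = M → RealDiag M)
    (hJ : ∀ M : Matrix J J K, adj M = M → RealDiag M)
    {A : Matrix I I K} {B : Matrix I J K} {D : Matrix J J K}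
    {d : J → ℂ} {c : ℂ} (hd : ∀ j, d j ≠ c) (hAs : adj A = A) (hDs : adj D = D)
    (hA : MatVanish 1 (A - constMat (Matrix.diagonal fun _ : I => c))) (hB : MatVanish 1 B)
    (hD : MatVanish 1 (D - constMat (Matrix.diagonal d))) :
    RealDiag (Matrix.fromBlocks A B (adj B) D) := by
  -- The Riccati equation says that the columns of (1, X) span an invariant subspace, and its
  -- adjoint says the same of (-X*, 1). On these subspaces the matrix acts by A + BX and D - B*X*,
  -- which are symmetric for the induced metrics 1 + X*X and 1 + XX*.
  obtain ⟨X, hX, hR⟩ := exists_riccati hd hA hB hB.adj hD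
  have hR' : B + adj X * D = A * adj X + adj X * adj B * adj X := by
    have := congr_arg adj hR
    simpa only [adj_add, adj_mul, adj_adj, hAs, hDs, Matrix.mul_assoc] using this
  have hG1 : MatVanish 1 (1 + adj X * X - 1) := by
    rw [add_sub_cancel_left]
    exact (hX.adj.mul hX).mono (by norm_num)
  have hG2 : MatVanish 1 (1 + X * adj X - 1) := by
    rw [add_sub_cancel_left]
    exact (hX.mul hX.adj).mono (by norm_num)
  have h1 : RealDiag (A + B * X) := by
    refine RealDiag.of_metric hI hG1 (by simp only [adj_add, adj_mul, adj_adj, adj_one]) ?_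
    have e : (1 + adj X * X) * (A + B * X) = A + B * X + adj X * (adj B + D * X) := by
      rw [hR]
      simp only [Matrix.mul_add, Matrix.add_mul, Matrix.one_mul, Matrix.mul_assoc]
      abel
    rw [e]
    simp only [adj_add, adj_mul, adj_adj, hAs, hDs, Matrix.mul_add, Matrix.mul_assoc,
      Matrix.add_mul]
    abel
  have h2 : RealDiag (D - adj B * adj X) := by
    refine RealDiag.of_metric hJ hG2 (by simp only [adj_add, adj_mul, adj_adj, adj_one]) ?_
    have e : (1 + X * adj X) * (D - adj B * adj X) =
        D - adj B * adj X + X * (A * adj X - B) := by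
      have : A * adj X - B = adj X * D - adj X * adj B * adj X := by
        rw [sub_eq_sub_iff_add_eq_add, ← hR', add_comm]
      rw [this]
      simp only [Matrix.mul_sub, Matrix.add_mul, Matrix.one_mul, Matrix.mul_assoc]
      abel
    rw [e]
    simp only [adj_add, adj_sub, adj_mul, adj_adj, hAs, hDs, Matrix.mul_sub, Matrix.mul_assoc,
      Matrix.sub_mul]
    abel
  have hT : MatVanish 1 (Matrix.fromBlocks 1 (-adj X) X 1 - 1) := by
    rw [← Matrix.fromBlocks_one, sub_eq_add_neg, Matrix.fromBlocks_neg, Matrix.fromBlocks_add]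
    rintro (i | i) (j | j)
    · simpa using VanishBelow.zero
    · simpa using hX.adj.neg i j
    · simpa using hX i j
    · simpa using VanishBelow.zero
  -- Only invertibility of the change of basis T = 1 + O(t) is needed; S·S serves as its inverse.
  obtain ⟨S, -, hS⟩ := exists_invSqrt hT
  refine RealDiag.of_similar hS ?_ (h1.fromBlocks h2)
  rw [Matrix.fromBlocks_multiply, Matrix.fromBlocks_multiply]
  congr 1
  · simp
  · simp only [Matrix.mul_neg, Matrix.mul_zero, zero_add, Matrix.mul_one, Matrix.neg_mul,
      Matrix.mul_sub, ← Matrix.mul_assoc]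
    refine sub_eq_zero.mp (Eq.trans ?_ (sub_eq_zero.mpr hR'))
    abel
  · rw [Matrix.mul_one, hR, Matrix.mul_add, Matrix.mul_assoc]
    simp
  · simp only [Matrix.mul_neg, Matrix.mul_zero, zero_add, Matrix.mul_one, Matrix.one_mul]
    abel

theorem exists_order {M : Matrix I J K} (hM : M ≠ 0) :
    ∃ k : ℤ, MatVanish k M ∧ ∃ i j, (M i j).coeff k ≠ 0 := by
  classical
  set s := (Finset.univ : Finset (I × J)).filter fun q => M q.1 q.2 ≠ 0
  have hs : s.Nonempty := by
    by_contra h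
    refine hM (Matrix.ext fun i j => ?_)
    by_contra h0
    exact h ⟨(i, j), by simpa [s] using h0⟩
  obtain ⟨q, hq, hmin⟩ := s.exists_min_image (fun q => (M q.1 q.2).order) hs
  refine ⟨(M q.1 q.2).order, fun i j => ?_, q.1, q.2, ?_⟩
  · by_cases h0 : M i j = 0
    · rw [h0]
      exact VanishBelow.zero
    · exact (VanishBelow.order _).mono (hmin (i, j) (by simpa [s] using h0))
  · exact (HahnSeries.coeff_order_eq_zero.not.mpr (by simpa [s] using hq))

/-- The indices with leading entry d i₁ are separated from the rest. The off-diagonal blocks are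
O(t) and the leading parts of the diagonal blocks share no eigenvalue. The indices i₁ and i₂ show
that both blocks are proper, so `ih` applies to each. -/
theorem realDiag_of_leading_diagonal {N : Matrix I I K} {d : I → ℂ} {i₁ i₂ : I}
    (ih : ∀ (p : I → Prop) [DecidablePred p], (∃ i, ¬ p i) →
      ∀ M : Matrix {i // p i} {i // p i} K, adj M = M → RealDiag M)
    (hN : adj N = N) (hd : MatVanish 1 (N - constMat (Matrix.diagonal d))) (h12 : d i₁ ≠ d i₂) :
    RealDiag N := by
  classical
  have hA : adj (N.submatrix Subtype.val Subtype.val :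
      Matrix {i // d i = d i₁} {i // d i = d i₁} K) = N.submatrix Subtype.val Subtype.val :=
    Matrix.ext fun i j => congr_fun (congr_fun hN i.1) j.1
  have hD : adj (N.submatrix Subtype.val Subtype.val :
      Matrix {i // ¬ d i = d i₁} {i // ¬ d i = d i₁} K) = N.submatrix Subtype.val Subtype.val :=
    Matrix.ext fun i j => congr_fun (congr_fun hN i.1) j.1
  have hent : ∀ a b, VanishBelow 1 (N a b - HahnSeries.C (Matrix.diagonal d a b)) := hd
  have key := RealDiag.of_blocks (A := N.submatrix Subtype.val Subtype.val)
    (B := N.submatrix Subtype.val Subtype.val) (D := N.submatrix Subtype.val Subtype.val)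
    (d := fun j : {i // ¬ d i = d i₁} => d j.1) (c := d i₁)
    (ih (fun i => d i = d i₁) ⟨i₂, fun h => h12 h.symm⟩)
    (ih (fun i => ¬ d i = d i₁) ⟨i₁, fun h => h rfl⟩) (fun j => j.2) hA hD
    (fun i j => by
      have := hent i.1 j.1
      rw [Matrix.sub_apply]
      change VanishBelow 1 (N i.1 j.1 - HahnSeries.C (Matrix.diagonal (fun _ => d i₁) i j))
      by_cases h : i = j
      · subst h
        rw [Matrix.diagonal_apply_eq, i.2] at this
        rwa [Matrix.diagonal_apply_eq]
      · rw [Matrix.diagonal_apply_ne _ (fun h' => h (Subtype.ext h'))] at this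
        rwa [Matrix.diagonal_apply_ne _ h])
    (fun i j => by
      have := hent i.1 j.1
      rwa [Matrix.diagonal_apply_ne _ (fun h' : i.1 = j.1 => j.2 (h' ▸ i.2)), map_zero, sub_zero] at this)
    (fun i j => by
      have := hent i.1 j.1
      rw [Matrix.sub_apply]
      change VanishBelow 1 (N i.1 j.1 - HahnSeries.C (Matrix.diagonal (fun j => d j.1) i j))
      by_cases h : i = j
      · subst h
        rwa [Matrix.diagonal_apply_eq] at this ⊢
      · rw [Matrix.diagonal_apply_ne _ (fun h' => h (Subtype.ext h'))] at this
        rwa [Matrix.diagonal_apply_ne _ h])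
  refine RealDiag.reindex (Equiv.sumCompl fun i => d i = d i₁) ?_
  convert key using 1
  refine Matrix.ext fun a b => ?_
  rcases a with i | i <;> rcases b with j | j
  · rfl
  · rfl
  · exact (congr_fun (congr_fun hN i.1) j.1).symm
  · rfl

/-- The constant term is a hermitian complex matrix, and conjugation by a constant unitary makes it
diagonal. A non-zero entry together with one zero diagonal entry prevents it from being scalar. -/
theorem realDiag_of_nonscalar {N : Matrix I I K}
    (ih : ∀ (p : I → Prop) [DecidablePred p], (∃ i, ¬ p i) →
      ∀ M : Matrix {i // p i} {i // p i} K, adj M = M → RealDiag M)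
    (hN : adj N = N) (hN0 : MatVanish 0 N) {i₀ : I} (hi₀ : (N i₀ i₀).coeff 0 = 0)
    (hne : ∃ i j, (N i j).coeff 0 ≠ 0) : RealDiag N := by
  classical
  set N0 : Matrix I I ℂ := Matrix.of fun i j => (N i j).coeff 0 with hN0def
  have hherm : N0.IsHermitian := by
    refine Matrix.ext fun i j => ?_
    exact congr_arg (fun a : K => a.coeff 0) (congr_fun (congr_fun hN i) j)
  set U : Matrix I I ℂ := (hherm.eigenvectorUnitary : Matrix I I ℂ) with hU
  set d : I → ℂ := fun i => (hherm.eigenvalues i : ℂ) with hd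
  have hU1 : U.conjTranspose * U = 1 := Unitary.coe_star_mul_self hherm.eigenvectorUnitary
  have hU2 : U * U.conjTranspose = 1 := Unitary.coe_mul_star_self hherm.eigenvectorUnitary
  have hspec : N0 = U * Matrix.diagonal d * U.conjTranspose := hherm.spectral_theorem
  have hspec' : U.conjTranspose * N0 * U = Matrix.diagonal d := by
    rw [hspec]
    calc _ = (U.conjTranspose * U) * Matrix.diagonal d * (U.conjTranspose * U) := by
          simp only [mul_assoc]
      _ = _ := by rw [hU1, one_mul, mul_one]
  -- If all eigenvalues were equal, the constant term would be scalar, hence zero because of its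
  -- entry at i₀, contrary to `hne`.
  have hnc : ∃ i j, d i ≠ d j := by
    by_contra! hall
    have e : Matrix.diagonal d = Matrix.scalar I (d i₀) := by
      rw [Matrix.scalar_apply]
      congr 1
      funext i
      exact hall i i₀
    have e2 : N0 = Matrix.scalar I (d i₀) := by
      rw [hspec, e, ← (Matrix.scalar_commute (d i₀) (Commute.all _) U).eq.symm.symm, mul_assoc,
        hU2, mul_one]
    have e3 : d i₀ = 0 := by
      have := congr_fun (congr_fun e2 i₀) i₀
      rw [Matrix.scalar_apply, Matrix.diagonal_apply_eq] at this
      rw [← this]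
      exact hi₀
    obtain ⟨i, j, hij⟩ := hne
    refine hij ?_
    have := congr_fun (congr_fun e2 i) j
    rw [e3, map_zero] at this
    exact this
  obtain ⟨i₁, i₂, h12⟩ := hnc
  have hN1 : MatVanish 1 (N - constMat N0) := by
    intro i j l hl
    rw [Matrix.sub_apply, HahnSeries.coeff_sub]
    change (N i j).coeff l - (HahnSeries.C ((N i j).coeff 0) : K).coeff l = 0
    rcases lt_or_eq_of_le (show l ≤ 0 by omega) with h | h
    · rw [hN0 i j l h, VanishBelow.C _ l h, sub_zero]
    · rw [h, HahnSeries.C_apply, HahnSeries.coeff_single_same, sub_self]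
  set N' := adj (constMat U) * N * constMat U with hN'
  have hUc : adj (constMat U) * constMat U = 1 := by
    rw [adj_constMat, ← constMat_mul, hU1, constMat_one]
  have hUc' : constMat U * adj (constMat U) = 1 := by
    rw [adj_constMat, ← constMat_mul, hU2, constMat_one]
  have hN's : adj N' = N' := by
    rw [hN', adj_mul, adj_mul, adj_adj, hN, mul_assoc]
  have hN'1 : MatVanish 1 (N' - constMat (Matrix.diagonal d)) := by
    have e : N' - constMat (Matrix.diagonal d) =
        adj (constMat U) * (N - constMat N0) * constMat U := by
      rw [← hspec', constMat_mul, constMat_mul, ← adj_constMat, mul_sub, sub_mul]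
    rw [e]
    have := ((constMat_vanish U).adj.mul hN1).mul (constMat_vanish U)
    simpa using this
  refine RealDiag.of_similar hUc (N := N') ?_ ?_
  · rw [hN', ← mul_assoc, ← mul_assoc, hUc', one_mul]
  exact realDiag_of_leading_diagonal ih hN's hN'1 h12

/-- Complex spectral theory diagonalizes only a constant term. Subtracting a real scalar and
dividing by a power of t makes this term non-scalar, which lowers the block size. The induction is
over a bound of the cardinality, since the blocks may have any smaller size. -/
theorem realDiag_of_adj (m : ℕ) : ∀ (I : Type) [Fintype I] [DecidableEq I],
    Fintype.card I ≤ m → ∀ M : Matrix I I K, adj M = M → RealDiag M := by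
  induction m with
  | zero =>
    intro I _ _ hcard M _
    have : IsEmpty I := Fintype.card_eq_zero_iff.mp (by omega)
    exact ⟨1, 1, fun i => isEmptyElim i, one_mul 1, Matrix.ext fun i => isEmptyElim i,
      fun i => isEmptyElim i⟩
  | succ m ih =>
    intro I _ _ hcard M hM
    rcases isEmpty_or_nonempty I with hI | ⟨⟨i₀⟩⟩
    · exact ⟨1, 1, fun i => isEmptyElim i, one_mul 1, Matrix.ext fun i => isEmptyElim i,
        fun i => isEmptyElim i⟩
    -- A diagonal entry of a hermitian matrix is fixed by conjugation, and subtracting it produces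
    -- the zero diagonal entry by which scalar constant terms are excluded.
    set c := M i₀ i₀ with hc
    have hcr : conjK c = c := congr_fun (congr_fun hM i₀) i₀
    by_cases h0 : M - Matrix.scalar I c = 0
    · rw [sub_eq_zero.mp h0]
      exact RealDiag.scalar hcr
    -- k is the exact order of M - c in t, so dividing by t^k leaves a non-zero constant term.
    -- Conjugation fixes t, hence the quotient is still hermitian.
    obtain ⟨k, hk, i, j, hij⟩ := exists_order h0
    set tk : K := HahnSeries.single k 1 with htk
    set tk' : K := HahnSeries.single (-k) 1 with htk'
    have htt : tk * tk' = 1 := by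
      rw [htk, htk', HahnSeries.single_mul_single, add_neg_cancel, one_mul]
      rfl
    have hr1 : conjK tk = tk := by rw [htk, mapCoeff_single, map_one]
    have hr2 : conjK tk' = tk' := by rw [htk', mapCoeff_single, map_one]
    set N : Matrix I I K := Matrix.scalar I tk' * (M - Matrix.scalar I c) with hN
    have hentry : ∀ a b, N a b = tk' * (M - Matrix.scalar I c) a b := fun a b => by
      rw [hN, Matrix.scalar_apply, Matrix.diagonal_mul]
    have hcoeff : ∀ a b l, (N a b).coeff l = ((M - Matrix.scalar I c) a b).coeff (l + k) :=
      fun a b l => by rw [hentry, htk', coeff_single_mul', one_mul, sub_neg_eq_add]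
    have hMN : M = Matrix.scalar I c + Matrix.scalar I tk * N := by
      rw [hN, ← mul_assoc, ← map_mul, htt, map_one, one_mul, add_sub_cancel]
    have hadj : ∀ x : K, adj (Matrix.scalar I x) = Matrix.scalar I (conjK x) := fun x => by
      rw [Matrix.scalar_apply, Matrix.scalar_apply, adj, Matrix.diagonal_transpose,
        Matrix.diagonal_map (map_zero _)]
    rw [hMN]
    refine RealDiag.affine hr1 hcr (realDiag_of_nonscalar ?_ ?_ ?_ (i₀ := i₀) ?_ ?_)
    · intro p _ ⟨a, ha⟩
      refine ih _ ?_
      have := Fintype.card_subtype_lt ha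
      omega
    · rw [hN, adj_mul, adj_sub, hadj, hadj, hr2, hcr, hM]
      exact (Matrix.scalar_commute tk' (Commute.all _) _).eq.symm
    · intro a b l hl
      rw [hcoeff]
      exact hk a b _ (by omega)
    · rw [hentry, Matrix.sub_apply, Matrix.scalar_apply, Matrix.diagonal_apply_eq, ← hc, sub_self,
        mul_zero, HahnSeries.coeff_zero]
    · exact ⟨i, j, by rwa [hcoeff, zero_add]⟩

/-- The embedding `s ↦ t²` of `ℂ((s))` in `ℂ((t))`. -/
def sqSubst : K →+* K :=
  HahnSeries.embDomainRingHom (AddMonoidHom.mulLeft (2 : ℤ))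
    (fun a b h => by simpa using h) (fun a b => by simp)

theorem coeff_sqSubst (a : K) (m : ℤ) : (sqSubst a).coeff (2 * m) = a.coeff m :=
  HahnSeries.embDomain_coeff (a := m)

theorem isIntegral_sqSubst (a : K) : IsIntegral (sqSubst a) := fun m hm =>
  HahnSeries.embDomain_of_notMem_range (by
    rintro ⟨b, hb⟩
    change 2 * b = m at hb
    rw [← hb] at hm
    exact absurd (even_two_mul b) (Int.not_even_iff_odd.mpr hm))

theorem exists_sqSubst {a : K} (ha : IsIntegral a) : ∃ b, sqSubst b = a := by
  -- A crude lower bound, valid for either sign of the order: m < -|order| implies 2m < order.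
  refine ⟨HahnSeries.ofSuppBddBelow (fun m => a.coeff (2 * m)) ⟨-|a.order|, fun m hm => ?_⟩, ?_⟩
  · by_contra hlt
    refine hm (HahnSeries.coeff_eq_zero_of_lt_order ?_)
    have := neg_abs_le a.order
    have := abs_nonneg a.order
    omega
  · ext m
    rcases Int.even_or_odd' m with ⟨l, rfl | rfl⟩
    · rw [coeff_sqSubst]
      rfl
    · rw [isIntegral_sqSubst _ _ ⟨l, rfl⟩, ha _ ⟨l, rfl⟩]

theorem conjK_sqSubst (a : K) : conjK (sqSubst a) = sqSubst (conjK a) := by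
  ext m
  rw [coeff_mapCoeff]
  rcases Int.even_or_odd' m with ⟨l, rfl | rfl⟩
  · rw [coeff_sqSubst, coeff_sqSubst, coeff_mapCoeff]
  · rw [isIntegral_sqSubst _ _ ⟨l, rfl⟩, isIntegral_sqSubst _ _ ⟨l, rfl⟩, map_zero]

theorem sqSubst_injective : Function.Injective sqSubst := RingHom.injective _

/-- Diagonalization over ℂ((t)) alone would not exclude odd powers of t. The matrix is instead
pulled back to ℂ((s)) with s = t², diagonalized there, and its eigenvalues are substituted back;
evenness is then automatic. -/
theorem charpoly_of_adj_of_isIntegral {m : ℕ} {C : Matrix (Fin m) (Fin m) K} (hC : adj C = C)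
    (hint : ∀ i j, IsIntegral (C i j)) :
    ∃ Ev : Fin m → K, C.charpoly = ∏ j, (Polynomial.X - Polynomial.C (Ev j)) ∧
      ∀ j, IsIntegral (Ev j) ∧ IsRealSeries (Ev j) := by
  choose C' hC' using fun i j => exists_sqSubst (hint i j)
  have hCmap : C = (Matrix.of C').map sqSubst := Matrix.ext fun i j => (hC' i j).symm
  have hadj : adj (Matrix.of C') = Matrix.of C' := by
    refine Matrix.ext fun i j => sqSubst_injective ?_
    rw [adj_apply, ← conjK_sqSubst]
    change conjK (sqSubst (C' j i)) = sqSubst (C' i j)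
    rw [hC', hC']
    exact congr_fun (congr_fun hC i) j
  obtain ⟨d, h1, h2⟩ := (realDiag_of_adj m (Fin m) (by simp) _ hadj).charpoly
  refine ⟨fun j => sqSubst (d j), ?_, fun j => ⟨isIntegral_sqSubst _, isRealSeries_of_conjK ?_⟩⟩
  · have e : C.charpoly = (Matrix.of C').charpoly.map sqSubst := by
      rw [hCmap]
      exact Matrix.charpoly_map _ _
    rw [e, h1, Polynomial.map_prod]
    simp
  · rw [conjK_sqSubst, h2]

end Diagonalization

/-! ## Gaussian integrals of polynomials -/

section Gauss

open MeasureTheory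

/-- The moments of the Gaussian weight on the line. -/
def moment (a : ℝ) (k : ℕ) : ℝ := ∫ x : ℝ, x ^ k * Real.exp (-a * x ^ 2)

theorem integrable_moment {a : ℝ} (ha : 0 < a) (k : ℕ) :
    Integrable fun x : ℝ => x ^ k * Real.exp (-a * x ^ 2) := by
  have := integrable_rpow_mul_exp_neg_mul_sq ha (s := (k : ℝ)) (by
    have : (0 : ℝ) ≤ k := Nat.cast_nonneg k
    linarith)
  simpa using this

theorem moment_zero (a : ℝ) : moment a 0 = Real.sqrt (Real.pi / a) := by
  simpa [moment] using integral_gaussian a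

/-- The derivative of x^k e^{-ax²} has integral zero. For k = 0 the truncated index k - 1 is
harmless because of the factor k. -/
theorem moment_succ {a : ℝ} (ha : 0 < a) (k : ℕ) :
    2 * a * moment a (k + 1) = k * moment a (k - 1) := by
  have hd : ∀ x : ℝ, HasDerivAt (fun x : ℝ => x ^ k * Real.exp (-a * x ^ 2))
      (k * (x ^ (k - 1) * Real.exp (-a * x ^ 2)) -
        2 * a * (x ^ (k + 1) * Real.exp (-a * x ^ 2))) x := by
    intro x
    have h1 : HasDerivAt (fun x : ℝ => x ^ k) (k * x ^ (k - 1)) x := hasDerivAt_pow k x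
    have h2 : HasDerivAt (fun x : ℝ => Real.exp (-a * x ^ 2))
        (Real.exp (-a * x ^ 2) * (-a * (2 * x))) x := by
      have := ((hasDerivAt_pow 2 x).const_mul (-a)).exp
      simpa using this
    exact (h1.mul h2).congr_deriv (by ring)
  have h := integral_eq_zero_of_hasDerivAt_of_integrable hd
    (((integrable_moment ha (k - 1)).const_mul _).sub ((integrable_moment ha (k + 1)).const_mul _))
    (integrable_moment ha k)
  rw [integral_sub ((integrable_moment ha (k - 1)).const_mul _)
    ((integrable_moment ha (k + 1)).const_mul _), integral_const_mul, integral_const_mul] at h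
  unfold moment
  linarith

variable {n : ℕ}

/-- The integrand for a monomial is a product of functions of one variable. -/
theorem gauss_integrand_monomial (lam : Fin n → ℝ) (α : Fin n →₀ ℕ) (c : ℂ)
    (y : Fin n → ℝ) :
    MvPolynomial.eval (fun i => (y i : ℂ)) (MvPolynomial.monomial α c) *
      (Real.exp (-∑ i, lam i * y i ^ 2) : ℂ) =
    c * ∏ i, ((y i ^ α i * Real.exp (-lam i * y i ^ 2) : ℝ) : ℂ) := by
  rw [MvPolynomial.eval_monomial, Finsupp.prod_fintype _ _ (fun i => pow_zero _),
    ← Finset.sum_neg_distrib, Real.exp_sum, mul_assoc]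
  push_cast
  rw [← Finset.prod_mul_distrib]
  simp only [neg_mul]

theorem integral_euclidean (f : (Fin n → ℝ) → ℂ) :
    ∫ y : EuclideanSpace ℝ (Fin n), f (fun i => y i) = ∫ y : Fin n → ℝ, f y :=
  (EuclideanSpace.volume_preserving_symm_measurableEquiv_toLp (Fin n)).integral_comp' f

theorem integrable_euclidean {f : (Fin n → ℝ) → ℂ} (hf : Integrable f) :
    Integrable fun y : EuclideanSpace ℝ (Fin n) => f (fun i => y i) :=
  (EuclideanSpace.volume_preserving_symm_measurableEquiv_toLp (Fin n)).integrable_comp_of_integrable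
    hf

theorem integrable_gauss {lam : Fin n → ℝ} (hlam : ∀ i, 0 < lam i) (P : Pol n) :
    Integrable fun y : EuclideanSpace ℝ (Fin n) =>
      MvPolynomial.eval (fun i => (y i : ℂ)) P * (Real.exp (-∑ i, lam i * y i ^ 2) : ℂ) := by
  refine integrable_euclidean (f := fun y => MvPolynomial.eval (fun i => (y i : ℂ)) P *
    (Real.exp (-∑ i, lam i * y i ^ 2) : ℂ)) ?_
  induction P using MvPolynomial.induction_on' with
  | monomial α c =>
    simp only [gauss_integrand_monomial]
    exact (Integrable.fintype_prod
      (f := fun i (x : ℝ) => ((x ^ α i * Real.exp (-lam i * x ^ 2) : ℝ) : ℂ))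
      fun i => (integrable_moment (hlam i) (α i)).ofReal).const_mul c
  | add P Q hP hQ =>
    simp only [map_add, add_mul]
    exact hP.add hQ

namespace TaylorData

variable {r : ℕ} (D : TaylorData n r)

theorem gauss_monomial (α : Fin n →₀ ℕ) (c : ℂ) :
    D.gaussIntegral (MvPolynomial.monomial α c) = c * ∏ i, (moment (D.lam i) (α i) : ℂ) := by
  change ∫ y : EuclideanSpace ℝ (Fin n), _ = _
  rw [integral_euclidean (f := fun y => MvPolynomial.eval (fun i => (y i : ℂ))
    (MvPolynomial.monomial α c) * (Real.exp (-∑ i, D.lam i * y i ^ 2) : ℂ))]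
  simp only [gauss_integrand_monomial]
  rw [integral_const_mul, integral_fintype_prod_volume_eq_prod
    (f := fun i (x : ℝ) => ((x ^ α i * Real.exp (-D.lam i * x ^ 2) : ℝ) : ℂ))]
  simp only [integral_complex_ofReal]
  rfl

theorem gauss_add (hlam : ∀ i, 0 < D.lam i) (P Q : Pol n) :
    D.gaussIntegral (P + Q) = D.gaussIntegral P + D.gaussIntegral Q := by
  change ∫ y : EuclideanSpace ℝ (Fin n), _ = _
  simp only [map_add, add_mul]
  exact integral_add (integrable_gauss hlam P) (integrable_gauss hlam Q)

theorem gauss_C_mul (c : ℂ) (P : Pol n) :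
    D.gaussIntegral (MvPolynomial.C c * P) = c * D.gaussIntegral P := by
  change ∫ y : EuclideanSpace ℝ (Fin n), _ = c * ∫ y : EuclideanSpace ℝ (Fin n), _
  simp only [map_mul, MvPolynomial.eval_C, mul_assoc]
  exact integral_const_mul c _

/-- The Gaussian integral as an additive map. -/
def gaussHom (hlam : ∀ i, 0 < D.lam i) : Pol n →+ ℂ where
  toFun := D.gaussIntegral
  map_zero' := map_zero _
  map_add' := D.gauss_add hlam

theorem gauss_sum (hlam : ∀ i, 0 < D.lam i) {ι : Type*} (s : Finset ι) (P : ι → Pol n) :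
    D.gaussIntegral (∑ i ∈ s, P i) = ∑ i ∈ s, D.gaussIntegral (P i) :=
  map_sum (D.gaussHom hlam) P s

/-- Integration by parts. -/
theorem gauss_pderiv (hlam : ∀ i, 0 < D.lam i) (i : Fin n) (P : Pol n) :
    D.gaussIntegral (MvPolynomial.pderiv i P) =
      2 * D.lam i * D.gaussIntegral (MvPolynomial.X i * P) := by
  induction P using MvPolynomial.induction_on' with
  | monomial α c =>
    have hX : MvPolynomial.X i * MvPolynomial.monomial α c =
        MvPolynomial.monomial (α + Finsupp.single i 1) c := by
      rw [mul_comm, MvPolynomial.X, MvPolynomial.monomial_mul, mul_one]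
    rw [MvPolynomial.pderiv_monomial, hX, gauss_monomial, gauss_monomial]
    set p := ∏ j ∈ Finset.univ.erase i, (moment (D.lam j) (α j) : ℂ) with hp
    have h1 : ∏ j, (moment (D.lam j) ((α - Finsupp.single i 1 : Fin n →₀ ℕ) j) : ℂ) =
        moment (D.lam i) (α i - 1) * p := by
      rw [← Finset.mul_prod_erase _ _ (Finset.mem_univ i)]
      congr 1
      · simp
      · refine Finset.prod_congr rfl fun j hj => ?_
        simp [Finsupp.single_eq_of_ne (Finset.ne_of_mem_erase hj)]
    have h2 : ∏ j, (moment (D.lam j) ((α + Finsupp.single i 1 : Fin n →₀ ℕ) j) : ℂ) =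
        moment (D.lam i) (α i + 1) * p := by
      rw [← Finset.mul_prod_erase _ _ (Finset.mem_univ i)]
      congr 1
      · simp
      · refine Finset.prod_congr rfl fun j hj => ?_
        simp [Finsupp.single_eq_of_ne (Finset.ne_of_mem_erase hj)]
    have h3 : (2 * D.lam i * moment (D.lam i) (α i + 1) : ℂ) =
        α i * moment (D.lam i) (α i - 1) := by
      exact_mod_cast moment_succ (hlam i) (α i)
    rw [h1, h2]
    linear_combination -(c * p) * h3
  | add P Q hP hQ =>
    rw [map_add, mul_add, gauss_add D hlam, gauss_add D hlam, hP, hQ, mul_add]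

theorem gauss_one : D.gaussIntegral 1 = ∏ i, (Real.sqrt (Real.pi / D.lam i) : ℂ) := by
  have := D.gauss_monomial 0 1
  simpa [moment_zero] using this

theorem gauss_map_conj (P : Pol n) (hlam : ∀ i, 0 < D.lam i) :
    D.gaussIntegral (MvPolynomial.map (starRingEnd ℂ) P) = starRingEnd ℂ (D.gaussIntegral P) := by
  induction P using MvPolynomial.induction_on' with
  | monomial α c =>
    rw [MvPolynomial.map_monomial, gauss_monomial, gauss_monomial, map_mul, map_prod]
    simp only [Complex.conj_ofReal]
  | add P Q hP hQ =>
    rw [map_add, gauss_add D hlam, gauss_add D hlam, map_add, hP, hQ]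

theorem moment_odd {a : ℝ} (ha : 0 < a) {k : ℕ} (hk : Odd k) : moment a k = 0 := by
  obtain ⟨l, rfl⟩ := hk
  induction l with
  | zero =>
    have := moment_succ ha 0
    rw [Nat.cast_zero, zero_mul] at this
    exact (mul_eq_zero.mp this).resolve_left (by positivity)
  | succ l ih =>
    have := moment_succ ha (2 * l + 2)
    rw [show 2 * l + 2 - 1 = 2 * l + 1 by omega, ih, mul_zero] at this
    exact (mul_eq_zero.mp this).resolve_left (by positivity)

end TaylorData

/-- The substitution `y ↦ -y`. -/
def negVar (n : ℕ) : Pol n →+* Pol n :=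
  (MvPolynomial.aeval fun i => -(MvPolynomial.X i : Pol n)).toRingHom

theorem negVar_monomial (α : Fin n →₀ ℕ) (c : ℂ) :
    negVar n (MvPolynomial.monomial α c) = MvPolynomial.monomial α ((-1) ^ α.degree * c) := by
  change MvPolynomial.aeval _ _ = _
  rw [MvPolynomial.aeval_monomial, Finsupp.prod_fintype _ _ (fun i => pow_zero _)]
  simp only [neg_pow (MvPolynomial.X _ : Pol n), Finset.prod_mul_distrib]
  rw [Finset.prod_pow_eq_pow_sum, ← Finsupp.degree_eq_sum, MvPolynomial.monomial_eq,
    Finsupp.prod_fintype _ _ (fun i => pow_zero _), MvPolynomial.algebraMap_eq, map_mul, map_pow,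
    map_neg, map_one]
  ring

theorem coeff_negVar (α : Fin n →₀ ℕ) (P : Pol n) :
    MvPolynomial.coeff α (negVar n P) = (-1) ^ α.degree * MvPolynomial.coeff α P := by
  induction P using MvPolynomial.induction_on' with
  | monomial β c =>
    rw [negVar_monomial, MvPolynomial.coeff_monomial, MvPolynomial.coeff_monomial]
    split_ifs with h
    · rw [h]
    · rw [mul_zero]
  | add P Q hP hQ => rw [map_add, MvPolynomial.coeff_add, MvPolynomial.coeff_add, hP, hQ, mul_add]

theorem TaylorData.gauss_negVar {r : ℕ} (D : TaylorData n r) (hlam : ∀ i, 0 < D.lam i) (P : Pol n) :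
    D.gaussIntegral (negVar n P) = D.gaussIntegral P := by
  induction P using MvPolynomial.induction_on' with
  | monomial α c =>
    rw [negVar_monomial, gauss_monomial, gauss_monomial]
    rcases Nat.even_or_odd α.degree with h | h
    · rw [h.neg_one_pow, one_mul]
    -- An odd total degree forces an odd exponent, and the corresponding one-dimensional moment
    -- vanishes.
    · obtain ⟨i, hi⟩ : ∃ i, Odd (α i) := by
        by_contra! hall
        rw [Finsupp.degree_eq_sum, ← Nat.not_even_iff_odd] at h
        exact h (Finset.even_sum _ fun i _ => Nat.not_odd_iff_even.mp (hall i))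
      rw [Finset.prod_eq_zero (Finset.mem_univ i) (by rw [moment_odd (hlam i) hi, Complex.ofReal_zero]),
        mul_zero, mul_zero]
  | add P Q hP hQ => rw [map_add, gauss_add D hlam, gauss_add D hlam, hP, hQ]

end Gauss

/-! ## Derivations and rescaling -/

section Derivations

variable {A : Type*} [CommRing A] [Algebra ℂ A]

/-- Coefficientwise application of a derivation. -/
def mapD (d : Derivation ℂ A A) : LaurentSeries A →+ LaurentSeries A where
  toFun F := F.map d.toLinearMap
  map_zero' := by ext; simp
  map_add' F G := by ext; simp

theorem coeff_mapD (d : Derivation ℂ A A) (F : LaurentSeries A) (m : ℤ) :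
    (mapD d F).coeff m = d (F.coeff m) := rfl

theorem VanishBelow.mapD (d : Derivation ℂ A A) {k : ℤ} {F : LaurentSeries A}
    (hF : VanishBelow k F) : VanishBelow k (mapD d F) := fun m hm => by
  rw [coeff_mapD, hF m hm, map_zero]

theorem mapD_mul (d : Derivation ℂ A A) (F G : LaurentSeries A) :
    mapD d (F * G) = mapD d F * G + F * mapD d G := by
  ext m
  have hF := VanishBelow.order F
  have hG := VanishBelow.order G
  rw [coeff_mapD, HahnSeries.coeff_add, coeff_mul_eq_sum hF hG, coeff_mul_eq_sum (hF.mapD d) hG,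
    coeff_mul_eq_sum hF (hG.mapD d), map_sum, ← Finset.sum_add_distrib]
  refine Finset.sum_congr rfl fun i _ => ?_
  rw [Derivation.leibniz, coeff_mapD, coeff_mapD, smul_eq_mul, smul_eq_mul]
  ring

theorem mapD_single (d : Derivation ℂ A A) (k : ℤ) (a : A) :
    mapD d (HahnSeries.single k a) = HahnSeries.single k (d a) :=
  HahnSeries.map_single (d.toLinearMap : ZeroHom A A)

theorem mapD_C (d : Derivation ℂ A A) (a : A) :
    mapD d (HahnSeries.C a) = HahnSeries.C (d a) := mapD_single d 0 a

theorem mapD_single_one_mul (d : Derivation ℂ A A) (k : ℤ) (F : LaurentSeries A) :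
    mapD d (HahnSeries.single k 1 * F) = HahnSeries.single k 1 * mapD d F := by
  rw [mapD_mul, mapD_single, d.map_one_eq_zero]
  simp

end Derivations

theorem single_mul_single_one {A : Type*} [CommRing A] (k l : ℤ) :
    (HahnSeries.single k 1 * HahnSeries.single l 1 : LaurentSeries A) =
      HahnSeries.single (k + l) 1 := by
  rw [HahnSeries.single_mul_single, one_mul]

theorem single_eq_mul_C {A : Type*} [CommRing A] (k : ℤ) (a : A) :
    (HahnSeries.single k a : LaurentSeries A) = HahnSeries.single k 1 * HahnSeries.C a := by
  rw [HahnSeries.C_apply, HahnSeries.single_mul_single, one_mul, add_zero]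

section Rescale

variable {n : ℕ}

/-- Both sides are sums over the splittings α = β + γ and over an index of t. For fixed β and γ the
index sums correspond under a shift by |β|. -/
theorem rescale_mul (F G : LaurentSeries (PS n)) :
    rescale n (F * G) = rescale n F * rescale n G := by
  classical
  have hR : ∀ {H : LaurentSeries (PS n)}, VanishBelow H.order (rescale n H) := by
    intro H m hm
    refine MvPolynomial.ext _ _ fun α => ?_
    rw [coeff_rescale, HahnSeries.coeff_eq_zero_of_lt_order (by omega), map_zero,
      MvPolynomial.coeff_zero]
  ext m α
  rw [coeff_rescale, coeff_mul_eq_sum (VanishBelow.order F) (VanishBelow.order G),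
    coeff_mul_eq_sum hR hR, map_sum, MvPolynomial.coeff_sum]
  simp only [MvPowerSeries.coeff_mul, MvPolynomial.coeff_mul, coeff_rescale]
  rw [Finset.sum_comm, Finset.sum_comm (s := Finset.Icc F.order (m - G.order))]
  refine Finset.sum_congr rfl fun q hq => ?_
  obtain ⟨β, γ⟩ := q
  have hdeg : α.degree = β.degree + γ.degree := by
    rw [← Finset.HasAntidiagonal.mem_antidiagonal.mp hq, map_add]
  have hF : ∀ i < F.order, F.coeff i = 0 := VanishBelow.order F
  have hG : ∀ i < G.order, G.coeff i = 0 := VanishBelow.order G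
  -- The shift does not map the two index intervals onto each other. Only non-zero terms are
  -- matched, and the lower bounds for `F` and `G` place these in the right ranges.
  refine Finset.sum_bij_ne_zero (fun i _ _ => i + β.degree) ?_ ?_ ?_ ?_
  · intro i hi h
    rw [Finset.mem_Icc] at hi ⊢
    push_cast [hdeg] at hi
    omega
  · intro i _ _ j _ _ h
    omega
  · intro j hj h
    refine ⟨j - β.degree, ?_, ?_, by omega⟩
    · rw [Finset.mem_Icc]
      constructor
      · by_contra hlt
        refine h ?_
        simp only
        rw [hF _ (by omega), map_zero, zero_mul]
      · by_contra hlt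
        refine h ?_
        simp only
        rw [hG _ (by push_cast [hdeg] at hlt; omega), map_zero, mul_zero]
    · have e : m - (α.degree : ℤ) - (j - β.degree) = m - j - γ.degree := by
        push_cast [hdeg]
        ring
      simp only [e]
      exact h
  · intro i _ _
    have e : m - (α.degree : ℤ) - i = m - (i + β.degree) - γ.degree := by
      push_cast [hdeg]
      ring
    simp only [e, add_sub_cancel_right]

theorem rescale_single_one (k : ℤ) :
    rescale n (HahnSeries.single k 1) = HahnSeries.single k 1 := by
  ext m α
  rw [coeff_rescale]
  by_cases hα : α = 0
  · subst hα
    rw [map_zero, Nat.cast_zero, sub_zero]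
    by_cases h : m = k
    · subst h
      rw [HahnSeries.coeff_single_same, HahnSeries.coeff_single_same]
      simp
    · rw [HahnSeries.coeff_single_of_ne h, HahnSeries.coeff_single_of_ne h]
      simp
  · have h1 : MvPolynomial.coeff α ((HahnSeries.single k (1 : Pol n)).coeff m) = 0 := by
      by_cases h : m = k
      · subst h
        rw [HahnSeries.coeff_single_same, MvPolynomial.coeff_one, if_neg (Ne.symm hα)]
      · rw [HahnSeries.coeff_single_of_ne h, MvPolynomial.coeff_zero]
    rw [h1]
    by_cases h : m - (α.degree : ℤ) = k
    · rw [h, HahnSeries.coeff_single_same, MvPowerSeries.coeff_one, if_neg hα]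
    · rw [HahnSeries.coeff_single_of_ne h, map_zero]

/-- The rescaling as a ring homomorphism. -/
def rescaleHom (n : ℕ) : LaurentSeries (PS n) →+* LaurentSeries (Pol n) where
  toFun := rescale n
  map_zero' := map_zero _
  map_one' := rescale_single_one 0
  map_add' := map_add _
  map_mul' := rescale_mul

theorem coeff_rescaleHom (F : LaurentSeries (PS n)) (m : ℤ) (α : Fin n →₀ ℕ) :
    MvPolynomial.coeff α ((rescaleHom n F).coeff m) =
      MvPowerSeries.coeff α (F.coeff (m - (α.degree : ℤ))) := coeff_rescale F m α

theorem rescaleHom_single_one (k : ℤ) :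
    rescaleHom n (HahnSeries.single k 1) = HahnSeries.single k 1 := rescale_single_one k

/-- The rescaling of a power series that does not depend on `ħ`. -/
def resc : PS n →+* LaurentSeries (Pol n) := (rescaleHom n).comp HahnSeries.C

theorem coeff_resc (a : PS n) (m : ℤ) (α : Fin n →₀ ℕ) :
    MvPolynomial.coeff α ((resc a).coeff m) =
      if m = α.degree then MvPowerSeries.coeff α a else 0 := by
  change MvPolynomial.coeff α ((rescaleHom n (HahnSeries.C a)).coeff m) = _
  rw [coeff_rescaleHom, HahnSeries.C_apply]
  split_ifs with h
  · rw [h, sub_self, HahnSeries.coeff_single_same]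
  · rw [HahnSeries.coeff_single_of_ne (sub_ne_zero.mpr h), map_zero]

/-- Under x = ty a monomial of degree d in x becomes t^d times a monomial in y. -/
theorem resc_vanishBelow {a : PS n} {d : ℕ}
    (ha : ∀ α : Fin n →₀ ℕ, α.degree < d → MvPowerSeries.coeff α a = 0) :
    VanishBelow d (resc a) := by
  intro m hm
  refine MvPolynomial.ext _ _ fun α => ?_
  rw [coeff_resc, MvPolynomial.coeff_zero]
  split_ifs with h
  · exact ha α (by omega)
  · rfl

theorem resc_vanishBelow_zero (a : PS n) : VanishBelow 0 (resc a) :=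
  resc_vanishBelow (d := 0) fun _ h => absurd h (Nat.not_lt_zero _)

theorem coeff_resc_zero (a : PS n) :
    (resc a).coeff 0 = MvPolynomial.C (MvPowerSeries.constantCoeff a) := by
  refine MvPolynomial.ext _ _ fun α => ?_
  rw [coeff_resc, MvPolynomial.coeff_C]
  by_cases h : α = 0
  · subst h
    simp
  · rw [if_neg (Ne.symm h), if_neg]
    intro h0
    refine h ((Finsupp.degree_eq_zero_iff α).mp ?_)
    exact_mod_cast h0.symm

/-- `∂/∂y_i` on Laurent series with polynomial coefficients. -/
def dy (i : Fin n) : LaurentSeries (Pol n) →+ LaurentSeries (Pol n) :=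
  mapD (MvPolynomial.pderiv i)

theorem dx_eq (i : Fin n) (F : LaurentSeries (PS n)) :
    dx i F = mapD (MvPowerSeries.pderiv ℂ i) F := rfl

theorem rescaleHom_dx (i : Fin n) (F : LaurentSeries (PS n)) :
    rescaleHom n (dx i F) = HahnSeries.single (-1) 1 * dy i (rescaleHom n F) := by
  ext m α
  rw [coeff_rescaleHom, coeff_single_mul', one_mul, dy, coeff_mapD, dx_eq, coeff_mapD,
    MvPowerSeries.coeff_pderiv, MvPolynomial.coeff_pderiv, coeff_rescaleHom, map_add,
    Finsupp.degree_single]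
  congr 3
  push_cast
  ring

theorem rescaleHom_conj (F : LaurentSeries (PS n)) :
    rescaleHom n (mapCoeff (conjPS n) F) =
      mapCoeff (MvPolynomial.map (starRingEnd ℂ)) (rescaleHom n F) := by
  ext m α
  rw [coeff_rescaleHom, coeff_mapCoeff, coeff_mapCoeff, MvPolynomial.coeff_map, coeff_rescaleHom]
  exact MvPowerSeries.coeff_map _ _ _

/-- The substitution `ħ^{1/2} ↦ -ħ^{1/2}`, `x` fixed, in the variables `y = ħ^{-1/2} x`. -/
def theta (n : ℕ) : LaurentSeries (Pol n) →+* LaurentSeries (Pol n) :=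
  flip.comp (mapCoeff (negVar n))

theorem coeff_theta (F : LaurentSeries (Pol n)) (m : ℤ) (α : Fin n →₀ ℕ) :
    MvPolynomial.coeff α ((theta n F).coeff m) =
      sgn (m - α.degree) * MvPolynomial.coeff α (F.coeff m) := by
  change MvPolynomial.coeff α ((sgn m : Pol n) * negVar n (F.coeff m)) = _
  have h1 : (sgn m : Pol n) = MvPolynomial.C (sgn m : ℂ) := by simp
  have h2 : ((-1 : ℂ)) ^ α.degree = (sgn (-(α.degree : ℤ)) : ℂ) := by
    rw [sgn, Int.negOnePow_neg, Int.negOnePow_def, zpow_natCast]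
    simp
  rw [h1, MvPolynomial.coeff_C_mul, coeff_negVar, h2, sub_eq_add_neg, sgn_add]
  push_cast
  ring

/-- The product x = ty does not change when t and y both change sign; so in the variable x only t ↦
-t remains. -/
theorem theta_rescaleHom (F : LaurentSeries (PS n)) :
    theta n (rescaleHom n F) = rescaleHom n (flip F) := by
  ext m α
  rw [coeff_theta, coeff_rescaleHom, coeff_rescaleHom, coeff_flip]
  have : (sgn (m - α.degree) : PS n) = MvPowerSeries.C (sgn (m - α.degree) : ℂ) := by simp
  rw [this, MvPowerSeries.coeff_C_mul]

end Rescale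

namespace TaylorData

variable {n r : ℕ} (D : TaylorData n r)

/-! ## The formal operator without negative powers of `ħ` -/

/-- `∂_i φ`. -/
def dφ (i : Fin n) : PS n := MvPowerSeries.pderiv ℂ i D.φ

/-- `∂_i ∂_j φ`. -/
def ddφ (i j : Fin n) : PS n := MvPowerSeries.pderiv ℂ i (D.dφ j)

/-- The conjugated derivative on scalar series. -/
def conjD (i : Fin n) (F : LaurentSeries (PS n)) : LaurentSeries (PS n) :=
  dx i F - HahnSeries.single (-2) (D.dφ i) * F

theorem conjDeriv_apply (i : Fin n) (u : S n r) (k : Fin r) :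
    D.conjDeriv i u k = D.conjD i (u k) := rfl

theorem conjD_conjD (i j : Fin n) (F : LaurentSeries (PS n)) :
    D.conjD i (D.conjD j F) = dx i (dx j F) - HahnSeries.single (-2) 1 *
        (HahnSeries.C (D.ddφ i j) * F + HahnSeries.C (D.dφ j) * dx i F +
          HahnSeries.C (D.dφ i) * dx j F) +
      HahnSeries.single (-2) 1 * (HahnSeries.single (-2) 1 *
        (HahnSeries.C (D.dφ i) * HahnSeries.C (D.dφ j) * F)) := by
  have h : dx i (HahnSeries.single (-2) (D.dφ j) * F) = HahnSeries.single (-2) 1 *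
      (HahnSeries.C (D.ddφ i j) * F + HahnSeries.C (D.dφ j) * dx i F) := by
    rw [dx_eq, mapD_mul, mapD_single, single_eq_mul_C, single_eq_mul_C _ (D.dφ j)]
    change _ * HahnSeries.C (D.ddφ i j) * F + _ = _
    rw [← dx_eq]
    ring
  unfold conjD
  rw [map_sub, h, single_eq_mul_C _ (D.dφ i), single_eq_mul_C _ (D.dφ j)]
  ring

theorem matOp_apply (A : Matrix (Fin r) (Fin r) (PS n)) (u : S n r) (k : Fin r) :
    matOp A u k = ∑ l, HahnSeries.C (A k l) * u l := by
  simp only [matOp, LinearMap.pi_apply, LinearMap.sum_apply]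
  rfl

theorem H_apply (u : S n r) (k : Fin r) :
    hPow (-2) (D.H u) k = HahnSeries.single (-2) 1 * (HahnSeries.single 4 1 *
        (-(∑ i, ∑ j, HahnSeries.C (D.ginv i j) * D.conjD i (D.conjD j (u k)))
          + ∑ j, ∑ l, HahnSeries.C (D.b j k l) * D.conjD j (u l)
          + ∑ l, HahnSeries.C (D.c k l) * u l)
      + HahnSeries.single 2 1 * ∑ l, HahnSeries.C (D.w k l) * u l
      + HahnSeries.C D.V * u k) := by
  have h1 : (∑ i, ∑ j, mulOp (HahnSeries.C (D.ginv i j)) ∘ₗ D.conjDeriv i ∘ₗ D.conjDeriv j) u k =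
      ∑ i, ∑ j, HahnSeries.C (D.ginv i j) * D.conjD i (D.conjD j (u k)) := by
    simp only [LinearMap.sum_apply, Finset.sum_apply]
    rfl
  have h2 : (∑ j, matOp (D.b j) ∘ₗ D.conjDeriv j) u k =
      ∑ j, ∑ l, HahnSeries.C (D.b j k l) * D.conjD j (u l) := by
    simp only [LinearMap.sum_apply, Finset.sum_apply, LinearMap.comp_apply, matOp_apply]
    rfl
  rw [← h1, ← h2, ← matOp_apply, ← matOp_apply]
  rfl

variable {D} in
/-- The operator `ħ^{-1} τ_p(H_{φ,ħ})`; the terms of order `ħ^{-1}` cancel by the eikonal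
equation. -/
theorem Good.H_apply (hD : D.Good) (u : S n r) (k : Fin r) :
    hPow (-2) (D.H u) k =
      -(∑ i, ∑ j, HahnSeries.C (D.ginv i j) * (HahnSeries.single 2 1 * dx i (dx j (u k)) -
          (HahnSeries.C (D.ddφ i j) * u k + HahnSeries.C (D.dφ j) * dx i (u k) +
            HahnSeries.C (D.dφ i) * dx j (u k))))
        + ∑ j, ∑ l, HahnSeries.C (D.b j k l) *
            (HahnSeries.single 2 1 * dx j (u l) - HahnSeries.C (D.dφ j) * u l)
        + ∑ l, HahnSeries.C (D.c k l) * (HahnSeries.single 2 1 * u l)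
        + ∑ l, HahnSeries.C (D.w k l) * u l := by
  -- By the eikonal equation the potential equals the square of the gradient of φ that the two
  -- conjugated derivatives produce with the opposite sign.
  have hV : (HahnSeries.C D.V : LaurentSeries (PS n)) = ∑ i, ∑ j,
      HahnSeries.C (D.ginv i j) * (HahnSeries.C (D.dφ i) * HahnSeries.C (D.dφ j)) := by
    rw [hD.eikonal, map_sum]
    refine Finset.sum_congr rfl fun i _ => ?_
    rw [map_sum]
    refine Finset.sum_congr rfl fun j _ => ?_
    rw [map_mul, map_mul, mul_assoc]
    rfl
  set σ : LaurentSeries (PS n) := HahnSeries.single 2 1 with hσ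
  set τ : LaurentSeries (PS n) := HahnSeries.single (-2) 1 with hτ
  have hτσ : τ * σ = 1 := single_mul_single_one _ _
  have h4 : (HahnSeries.single 4 1 : LaurentSeries (PS n)) = σ * σ :=
    (single_mul_single_one 2 2).symm
  rw [D.H_apply, h4, hV]
  have e1 : ∀ X Y Z W N : LaurentSeries (PS n), τ * (σ * σ * (-X + Y + Z) + σ * W + N * u k) =
      -(σ * X - τ * (N * u k)) + σ * Y + σ * Z + W := by
    intro X Y Z W N
    linear_combination (σ * (-X + Y + Z) + W) * hτσ
  rw [e1]
  congr 1
  congr 1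
  · congr 1
    · congr 1
      rw [Finset.sum_mul, Finset.mul_sum, Finset.mul_sum, ← Finset.sum_sub_distrib]
      refine Finset.sum_congr rfl fun i _ => ?_
      rw [Finset.sum_mul, Finset.mul_sum, Finset.mul_sum, ← Finset.sum_sub_distrib]
      refine Finset.sum_congr rfl fun j _ => ?_
      rw [conjD_conjD]
      linear_combination (HahnSeries.C (D.ginv i j) * (-(HahnSeries.C (D.ddφ i j) * u k +
        HahnSeries.C (D.dφ j) * dx i (u k) + HahnSeries.C (D.dφ i) * dx j (u k)) +
        τ * (HahnSeries.C (D.dφ i) * HahnSeries.C (D.dφ j) * u k))) * hτσ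
    · rw [Finset.mul_sum]
      refine Finset.sum_congr rfl fun j _ => ?_
      rw [Finset.mul_sum]
      refine Finset.sum_congr rfl fun l _ => ?_
      unfold conjD
      rw [single_eq_mul_C]
      linear_combination (-HahnSeries.C (D.b j k l) * HahnSeries.C (D.dφ j) * u l) * hτσ
  · rw [Finset.mul_sum]
    exact Finset.sum_congr rfl fun l _ => mul_left_comm _ _ _

variable {D} in
/-- The operator `Q` in the variables `y`. -/
theorem Good.Q_val (hD : D.Good) (w : S₀ n r) (k : Fin r) :
    (D.Q w).val k =
      -(∑ i, ∑ j, resc (D.ginv i j) * (dy i (dy j (w.val k)) -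
          (resc (D.ddφ i j) * w.val k + HahnSeries.single (-1) 1 * resc (D.dφ j) * dy i (w.val k) +
            HahnSeries.single (-1) 1 * resc (D.dφ i) * dy j (w.val k))))
        + ∑ j, ∑ l, resc (D.b j k l) *
            (HahnSeries.single 1 1 * dy j (w.val l) - resc (D.dφ j) * w.val l)
        + ∑ l, resc (D.c k l) * (HahnSeries.single 2 1 * w.val l)
        + ∑ l, resc (D.w k l) * w.val l := by
  have hw : ∀ l, rescaleHom n ((R n r).symm w l) = w.val l := fun l =>
    congr_fun (congr_arg S₀.val ((R n r).apply_symm_apply w)) l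
  change rescaleHom n (hPow (-2) (D.H ((R n r).symm w)) k) = _
  rw [hD.H_apply]
  have hdd : ∀ i j l, HahnSeries.single 2 1 * rescaleHom n (dx i (dx j ((R n r).symm w l))) =
      dy i (dy j (w.val l)) := by
    intro i j l
    rw [rescaleHom_dx, rescaleHom_dx, hw, dy, mapD_single_one_mul, ← dy, ← mul_assoc, ← mul_assoc,
      single_mul_single_one, single_mul_single_one]
    exact one_mul _
  have hd : ∀ i l, rescaleHom n (dx i ((R n r).symm w l)) =
      HahnSeries.single (-1) 1 * dy i (w.val l) := by
    intro i l
    rw [rescaleHom_dx, hw]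
  have h21 : (HahnSeries.single 2 1 * HahnSeries.single (-1) 1 : LaurentSeries (Pol n)) =
      HahnSeries.single 1 1 := single_mul_single_one _ _
  have hresc : ∀ a : PS n, rescaleHom n (HahnSeries.C a) = resc a := fun _ => rfl
  simp only [map_add, map_neg, map_sum, map_mul, map_sub, rescaleHom_single_one, hdd, hd, hw,
    hresc]
  refine congr_arg₂ (· + ·) (congr_arg₂ (· + ·) (congr_arg₂ (· + ·) (congr_arg Neg.neg ?_) ?_)
    rfl) rfl
  · refine Finset.sum_congr rfl fun i _ => Finset.sum_congr rfl fun j _ => ?_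
    ring
  · refine Finset.sum_congr rfl fun j _ => Finset.sum_congr rfl fun l _ => ?_
    rw [← mul_assoc (HahnSeries.single 2 1), h21]

end TaylorData

section ScaleAndFiltration

variable {n r : ℕ}

/-! ## The module structure and the filtrations of `𝔖₀` -/

/-- Series in `ħ^{1/2}` as series with polynomial coefficients. -/
def liftK (n : ℕ) : K →+* LaurentSeries (Pol n) := mapCoeff (algebraMap ℂ (Pol n))

theorem val_scale (a : K) (w : S₀ n r) (k : Fin r) :
    (scale a w).val k = liftK n a * w.val k := rfl

theorem coeff_liftK (a : K) (m : ℤ) : (liftK n a).coeff m = MvPolynomial.C (a.coeff m) := rfl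

theorem liftK_single_one (k : ℤ) :
    liftK n (HahnSeries.single k 1) = HahnSeries.single k 1 := by
  rw [liftK, mapCoeff_single, map_one]

theorem S₀.ext {v w : S₀ n r} (h : ∀ k, v.val k = w.val k) : v = w :=
  S₀.val_injective (funext h)

theorem S₀.val_add (v w : S₀ n r) (k : Fin r) : (v + w).val k = v.val k + w.val k := rfl

theorem S₀.val_sub (v w : S₀ n r) (k : Fin r) : (v - w).val k = v.val k - w.val k := rfl

theorem S₀.val_zero (k : Fin r) : (0 : S₀ n r).val k = 0 := rfl

theorem S₀.val_sum {ι : Type*} (s : Finset ι) (w : ι → S₀ n r) (k : Fin r) :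
    (∑ i ∈ s, w i).val k = ∑ i ∈ s, (w i).val k := by
  rw [map_sum, Finset.sum_apply]

theorem C_smul_eq (c : ℂ) (F : LaurentSeries (Pol n)) :
    c • F = HahnSeries.C (MvPolynomial.C c) * F := by
  ext m : 2
  rw [coeff_C_mul', HahnSeries.coeff_smul, MvPolynomial.smul_eq_C_mul]

theorem smul_eq_scale (c : ℂ) (w : S₀ n r) : c • w = scale (HahnSeries.C c) w := by
  refine S₀.ext fun k => ?_
  rw [val_scale, liftK, mapCoeff_C]
  exact C_smul_eq c _

/-- Multiplication by a series, as a linear map. -/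
def scaleHom (a : K) : S₀ n r →ₗ[ℂ] S₀ n r where
  toFun := scale a
  map_add' v w := S₀.ext fun k => mul_add _ _ _
  map_smul' c w := S₀.ext fun k => by
    rw [RingHom.id_apply, smul_eq_scale, smul_eq_scale, val_scale, val_scale, val_scale, val_scale,
      mul_left_comm]

theorem scale_mul (a b : K) (w : S₀ n r) : scale (a * b) w = scale a (scale b w) :=
  S₀.ext fun k => by rw [val_scale, val_scale, val_scale, map_mul, mul_assoc]

theorem scale_one (w : S₀ n r) : scale 1 w = w :=
  S₀.ext fun k => by rw [val_scale, map_one, one_mul]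

theorem scale_zero_left (w : S₀ n r) : scale 0 w = 0 :=
  S₀.ext fun k => by rw [val_scale, map_zero, zero_mul, S₀.val_zero]

theorem scale_sum {ι : Type*} (s : Finset ι) (a : K) (w : ι → S₀ n r) :
    scale a (∑ i ∈ s, w i) = ∑ i ∈ s, scale a (w i) := map_sum (scaleHom a) w s

theorem sum_scale {ι : Type*} (s : Finset ι) (a : ι → K) (w : S₀ n r) :
    scale (∑ i ∈ s, a i) w = ∑ i ∈ s, scale (a i) w := by
  refine S₀.ext fun k => ?_
  rw [S₀.val_sum, val_scale, map_sum, Finset.sum_mul]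
  rfl

/-- The filtration of `𝔖₀` by powers of `ħ^{1/2}`. -/
def TVanish (s : ℤ) (w : S₀ n r) : Prop := ∀ k, VanishBelow s (w.val k)

/-- The filtration of `𝔖₀` induced by the powers of `ħ^{1/2}` in `𝔖`. -/
def XVanish (s : ℤ) (w : S₀ n r) : Prop := ∀ k, VanishBelow s ((R n r).symm w k)

/-- The monomial t^m y^α is t^{m-|α|} x^α. So this filtration bounds the degree of the coefficient
of t^m by m - s, which keeps order by order constructions inside 𝔖₀. -/
theorem XVanish_iff {s : ℤ} {w : S₀ n r} : XVanish s w ↔ ∀ (k : Fin r) (m : ℤ) (α : Fin n →₀ ℕ),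
    m - α.degree < s → MvPolynomial.coeff α ((w.val k).coeff m) = 0 := by
  constructor
  · intro h k m α hlt
    have := h k _ hlt
    have h2 : MvPowerSeries.coeff α ((unscale w k).coeff (m - α.degree)) = 0 := by
      change MvPowerSeries.coeff α (((R n r).symm w k).coeff (m - α.degree)) = 0
      rw [this, map_zero]
    rwa [coeff_unscale, sub_add_cancel] at h2
  · intro h k m hm
    refine MvPowerSeries.ext fun α => ?_
    change MvPowerSeries.coeff α ((unscale w k).coeff m) = _
    rw [coeff_unscale, map_zero]
    exact h k _ α (by omega)

theorem exists_XVanish (w : S₀ n r) : ∃ s, XVanish s w := by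
  obtain ⟨N, hN⟩ := w.val_mem
  refine ⟨-N, XVanish_iff.mpr fun k m α hlt => ?_⟩
  by_contra h
  have := hN k m α h
  omega

theorem XVanish.tVanish {s : ℤ} {w : S₀ n r} (h : XVanish s w) : TVanish s w := by
  intro k m hm
  refine MvPolynomial.ext _ _ fun α => ?_
  rw [MvPolynomial.coeff_zero]
  exact XVanish_iff.mp h k m α (by omega)

theorem TVanish.add {s : ℤ} {v w : S₀ n r} (hv : TVanish s v) (hw : TVanish s w) :
    TVanish s (v + w) := fun k => (hv k).add (hw k)

theorem TVanish.sub {s : ℤ} {v w : S₀ n r} (hv : TVanish s v) (hw : TVanish s w) :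
    TVanish s (v - w) := fun k => (hv k).sub (hw k)

theorem TVanish.mono {s s' : ℤ} {w : S₀ n r} (hw : TVanish s w) (h : s' ≤ s) : TVanish s' w :=
  fun k => (hw k).mono h

theorem TVanish.zero {s : ℤ} : TVanish s (0 : S₀ n r) := fun _ => VanishBelow.zero

theorem TVanish.scale {s k : ℤ} {w : S₀ n r} {a : K} (ha : VanishBelow k a) (hw : TVanish s w) :
    TVanish (k + s) (scale a w) := fun j => (ha.mapCoeff _).mul (hw j)

theorem TVanish.smul {s : ℤ} {w : S₀ n r} (c : ℂ) (hw : TVanish s w) : TVanish s (c • w) := by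
  rw [smul_eq_scale]
  have := hw.scale (VanishBelow.C c)
  rwa [zero_add] at this

theorem TVanish.eq_zero {w : S₀ n r} (h : ∀ s, TVanish s w) : w = 0 := by
  refine S₀.ext fun k => ?_
  ext m : 1
  exact funext fun m => h (m + 1) k m (by omega)

theorem XVanish.sub {s : ℤ} {v w : S₀ n r} (hv : XVanish s v) (hw : XVanish s w) :
    XVanish s (v - w) := fun k => by
  rw [map_sub]
  exact (hv k).sub (hw k)

theorem XVanish.smul {s : ℤ} {w : S₀ n r} (c : ℂ) (hw : XVanish s w) : XVanish s (c • w) := by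
  rw [XVanish_iff] at hw ⊢
  intro k m α h
  rw [map_smul, Pi.smul_apply, HahnSeries.coeff_smul, MvPolynomial.coeff_smul, hw k m α h,
    smul_zero]

theorem XVanish.zero {s : ℤ} : XVanish s (0 : S₀ n r) := fun k => by
  rw [map_zero]
  exact VanishBelow.zero

/-- The element `ħ^{s/2} P(y)`. -/
def tPol (s : ℤ) (P : Fin r → Pol n) : S₀ n r := scale (HahnSeries.single s 1) (ofPol P)

theorem val_tPol (s : ℤ) (P : Fin r → Pol n) (k : Fin r) :
    (tPol s P).val k = HahnSeries.single s (P k) := by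
  rw [tPol, val_scale, liftK_single_one]
  exact (single_eq_mul_C _ _).symm

theorem tPol_tVanish (s : ℤ) (P : Fin r → Pol n) : TVanish s (tPol s P) := fun k => by
  rw [val_tPol]
  exact VanishBelow.single _

theorem tVanish_succ_iff {s : ℤ} {w : S₀ n r} (hw : TVanish s w) :
    TVanish (s + 1) w ↔ ∀ k, (w.val k).coeff s = 0 := by
  constructor
  · intro h k
    exact h k s (by omega)
  · intro h k m hm
    rcases lt_or_eq_of_le (show m ≤ s by omega) with h' | h'
    · exact hw k m h'
    · rw [h', h k]

/-! ## Properties of the operator `Q` -/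

theorem dy_liftK_mul (i : Fin n) (a : K) (F : LaurentSeries (Pol n)) :
    dy i (liftK n a * F) = liftK n a * dy i F := by
  have : dy i (liftK n a) = 0 := by
    ext m : 1
    refine funext fun m => ?_
    rw [dy, coeff_mapD, coeff_liftK, MvPolynomial.pderiv_C, HahnSeries.coeff_zero]
  rw [dy, mapD_mul, ← dy, this, zero_mul, zero_add]

theorem theta_resc (a : PS n) : theta n (resc a) = resc a := by
  change theta n (rescaleHom n (HahnSeries.C a)) = _
  rw [theta_rescaleHom, flip_C]
  rfl

/-- The derivative in y is t times the derivative in x, and the latter commutes with the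
substitution. -/
theorem theta_dy (i : Fin n) (F : LaurentSeries (Pol n)) :
    theta n (dy i F) = -dy i (theta n F) := by
  ext m α
  rw [coeff_theta, HahnSeries.coeff_neg, MvPolynomial.coeff_neg, dy, coeff_mapD, coeff_mapD,
    MvPolynomial.coeff_pderiv, MvPolynomial.coeff_pderiv, coeff_theta, map_add,
    Finsupp.degree_single]
  have : sgn (m - ((α.degree + 1 : ℕ) : ℤ)) = -sgn (m - α.degree) := by
    have h : m - ((α.degree + 1 : ℕ) : ℤ) = m - α.degree + (-1) := by
      push_cast
      ring
    rw [h, sgn_add, sgn_of_odd (m := -1) ⟨-1, by norm_num⟩, mul_neg_one]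
  rw [this]
  push_cast
  ring

theorem theta_single_one (k : ℤ) :
    theta n (HahnSeries.single k 1) = (sgn k : LaurentSeries (Pol n)) * HahnSeries.single k 1 := by
  have h1 : theta n (HahnSeries.single k 1) = rescaleHom n (flip (HahnSeries.single k 1)) := by
    rw [← theta_rescaleHom, rescaleHom_single_one]
  rw [h1]
  rcases Int.even_or_odd k with h | h
  · rw [flip_single_of_even h, rescaleHom_single_one, sgn_of_even h, Int.cast_one, one_mul]
  · have : flip (HahnSeries.single k (1 : PS n)) = -HahnSeries.single k 1 := by
      ext m : 1
      refine funext fun m => ?_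
      rw [coeff_flip, HahnSeries.coeff_neg]
      by_cases hm : m = k
      · subst hm
        rw [sgn_of_odd h]
        simp
      · rw [HahnSeries.coeff_single_of_ne hm, mul_zero, neg_zero]
    rw [this, map_neg, rescaleHom_single_one, sgn_of_odd h, Int.cast_neg, Int.cast_one]
    ring

/-- The substitution `ħ^{1/2} ↦ -ħ^{1/2}`, `x` fixed, on `𝔖₀`. -/
def thetaS₀ (n r : ℕ) : S₀ n r →ₗ[ℂ] S₀ n r where
  toFun w := S₀.mk (fun k => theta n (w.val k)) (by
    obtain ⟨N, hN⟩ := w.val_mem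
    refine ⟨N, fun k m α h => hN k m α fun h0 => h ?_⟩
    rw [coeff_theta, h0, mul_zero])
  map_add' v w := S₀.ext fun k => map_add (theta n) _ _
  map_smul' c w := S₀.ext fun k => by
    change theta n (c • w.val k) = c • theta n (w.val k)
    rw [C_smul_eq, C_smul_eq, map_mul]
    congr 1
    have : (HahnSeries.C (MvPolynomial.C c) : LaurentSeries (Pol n)) = resc (MvPowerSeries.C c) := by
      ext m α
      rw [coeff_resc, HahnSeries.C_apply, MvPowerSeries.coeff_C]
      by_cases hm : m = 0
      · subst hm
        rw [HahnSeries.coeff_single_same, MvPolynomial.coeff_C]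
        by_cases hα : α = 0
        · subst hα
          simp
        · rw [if_neg (Ne.symm hα), if_neg hα, ite_self]
      · rw [HahnSeries.coeff_single_of_ne hm, MvPolynomial.coeff_zero]
        by_cases hα : α = 0
        · subst hα
          rw [if_neg (by simpa using hm)]
        · rw [if_neg hα, ite_self]
    rw [this, theta_resc]

theorem val_thetaS₀ (w : S₀ n r) (k : Fin r) : (thetaS₀ n r w).val k = theta n (w.val k) := rfl

theorem TVanish.thetaS₀ {s : ℤ} {w : S₀ n r} (hw : TVanish s w) : TVanish s (thetaS₀ n r w) := by
  intro k m hm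
  refine MvPolynomial.ext _ _ fun α => ?_
  rw [val_thetaS₀, coeff_theta, hw k m hm, MvPolynomial.coeff_zero, mul_zero]

namespace TaylorData

variable {D : TaylorData n r}

theorem Good.Q_scale (hD : D.Good) (a : K) (w : S₀ n r) : D.Q (scale a w) = scale a (D.Q w) := by
  refine S₀.ext fun k => ?_
  rw [val_scale, hD.Q_val, hD.Q_val]
  simp only [val_scale, dy_liftK_mul]
  have e : ∀ x a b c d : LaurentSeries (Pol n),
      x * (-a + b + c + d) = -(x * a) + x * b + x * c + x * d := fun x a b c d => by ring
  rw [e]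
  simp only [Finset.mul_sum]
  refine congr_arg₂ (· + ·) (congr_arg₂ (· + ·) (congr_arg₂ (· + ·) (congr_arg Neg.neg ?_) ?_)
    ?_) ?_
  · refine Finset.sum_congr rfl fun i _ => Finset.sum_congr rfl fun j _ => ?_
    ring
  · refine Finset.sum_congr rfl fun j _ => Finset.sum_congr rfl fun l _ => ?_
    ring
  · refine Finset.sum_congr rfl fun l _ => ?_
    ring
  · refine Finset.sum_congr rfl fun l _ => ?_
    ring

/-- Rescaled Taylor coefficients are invariant, and in `Good.Q_val` each odd power of t is
accompanied by exactly one derivative in y. The two sign changes cancel. -/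
theorem Good.Q_theta (hD : D.Good) (w : S₀ n r) :
    D.Q (thetaS₀ n r w) = thetaS₀ n r (D.Q w) := by
  refine S₀.ext fun k => ?_
  have e1 : (sgn (-1) : LaurentSeries (Pol n)) = -1 := by
    rw [sgn_of_odd ⟨-1, by norm_num⟩]
    simp
  have e2 : (sgn 1 : LaurentSeries (Pol n)) = -1 := by
    rw [sgn_of_odd ⟨0, by norm_num⟩]
    simp
  have e3 : (sgn 2 : LaurentSeries (Pol n)) = 1 := by
    rw [sgn_of_even ⟨1, by norm_num⟩]
    simp
  rw [val_thetaS₀, hD.Q_val, hD.Q_val]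
  simp only [val_thetaS₀, map_add, map_neg, map_sub, map_sum, map_mul, theta_resc, theta_dy,
    theta_single_one, e1, e2, e3]
  refine congr_arg₂ (· + ·) (congr_arg₂ (· + ·) (congr_arg₂ (· + ·) (congr_arg Neg.neg ?_) ?_)
    ?_) rfl
  · refine Finset.sum_congr rfl fun i _ => Finset.sum_congr rfl fun j _ => ?_
    ring
  · refine Finset.sum_congr rfl fun j _ => Finset.sum_congr rfl fun l _ => ?_
    ring
  · refine Finset.sum_congr rfl fun l _ => ?_
    ring

/-- After the cancellation in `Good.H_apply`, the operator in the variable x contains no negative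
power of ħ. -/
theorem Good.Q_xVanish (hD : D.Good) {s : ℤ} {w : S₀ n r} (hw : XVanish s w) :
    XVanish s (D.Q w) := by
  intro k
  have e : (R n r).symm (D.Q w) = hPow (-2) (D.H ((R n r).symm w)) := (R n r).symm_apply_apply _
  rw [e, hD.H_apply]
  have h2 : VanishBelow 0 (HahnSeries.single 2 1 : LaurentSeries (PS n)) :=
    (VanishBelow.single 1).mono (by norm_num)
  have hC : ∀ (a : PS n) {F : LaurentSeries (PS n)}, VanishBelow s F →
      VanishBelow s (HahnSeries.C a * F) := fun a F hF => by
    have := (VanishBelow.C a).mul hF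
    rwa [zero_add] at this
  have hσ : ∀ {F : LaurentSeries (PS n)}, VanishBelow s F →
      VanishBelow s (HahnSeries.single 2 1 * F) := fun hF => by
    have := h2.mul hF
    rwa [zero_add] at this
  have hx : ∀ (i : Fin n) {F : LaurentSeries (PS n)}, VanishBelow s F →
      VanishBelow s (dx i F) := fun i F hF => hF.mapD _
  refine ((VanishBelow.neg ?_).add ?_).add ?_ |>.add ?_
  · refine VanishBelow.sum _ fun i _ => VanishBelow.sum _ fun j _ => hC _ ?_
    exact (hσ (hx i (hx j (hw k)))).sub
      (((hC _ (hw k)).add (hC _ (hx i (hw k)))).add (hC _ (hx j (hw k))))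
  · refine VanishBelow.sum _ fun j _ => VanishBelow.sum _ fun l _ => hC _ ?_
    exact (hσ (hx j (hw l))).sub (hC _ (hw l))
  · exact VanishBelow.sum _ fun l _ => hC _ (hσ (hw l))
  · exact VanishBelow.sum _ fun l _ => hC _ (hw l)

/-- The leading part of `Q`, a harmonic oscillator. -/
def Q₀ (D : TaylorData n r) (P : Fin r → Pol n) (k : Fin r) : Pol n :=
  -(∑ i, (MvPolynomial.pderiv i (MvPolynomial.pderiv i (P k)) -
      (MvPolynomial.C (D.lam i : ℂ) * P k +
        2 * (MvPolynomial.C (D.lam i : ℂ) * MvPolynomial.X i * MvPolynomial.pderiv i (P k)))))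
    + MvPolynomial.C (D.mu k : ℂ) * P k

theorem dφ_eq (D : TaylorData n r) (i : Fin n) :
    D.dφ i = MvPowerSeries.pderiv ℂ i D.phaseRest +
      MvPowerSeries.C (D.lam i : ℂ) * MvPowerSeries.X i := by
  have h : D.φ = D.phaseRest +
      ∑ i, MvPowerSeries.C ((D.lam i / 2 : ℝ) : ℂ) * MvPowerSeries.X i ^ 2 := by
    rw [phaseRest, sub_add_cancel]
  have h2 : (MvPowerSeries.C ((D.lam i / 2 : ℝ) : ℂ) + MvPowerSeries.C ((D.lam i / 2 : ℝ) : ℂ) :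
      PS n) = MvPowerSeries.C (D.lam i : ℂ) := by
    rw [← map_add, ← Complex.ofReal_add, add_halves]
  unfold dφ
  conv_lhs => rw [h]
  rw [map_add, map_sum, Finset.sum_eq_single i]
  · rw [Derivation.leibniz, sq, Derivation.leibniz, pderiv_X_eq, if_pos rfl, MvPowerSeries.pderiv_C,
      smul_zero, add_zero, smul_eq_mul, smul_eq_mul, mul_one, ← h2]
    ring
  · intro j _ hj
    rw [Derivation.leibniz, sq, Derivation.leibniz, pderiv_X_eq, if_neg hj, MvPowerSeries.pderiv_C]
    simp
  · exact fun h => absurd (Finset.mem_univ i) h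

theorem Good.coeff_pderiv_phaseRest (hD : D.Good) (i : Fin n) (α : Fin n →₀ ℕ)
    (hα : α.degree < 2) :
    MvPowerSeries.coeff α (MvPowerSeries.pderiv ℂ i D.phaseRest) = 0 := by
  rw [MvPowerSeries.coeff_pderiv, hD.phaseRest_coeff, zero_mul]
  rw [map_add, Finsupp.degree_single]
  omega

theorem resc_C_mul_X (c : ℂ) (i : Fin n) :
    resc (MvPowerSeries.C c * MvPowerSeries.X i : PS n) =
      HahnSeries.single 1 (MvPolynomial.C c * MvPolynomial.X i) := by
  classical
  ext m α
  rw [coeff_resc, MvPowerSeries.coeff_C_mul, MvPowerSeries.coeff_X]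
  by_cases hα : α = Finsupp.single i 1
  · subst hα
    rw [if_pos rfl, Finsupp.degree_single]
    by_cases hm : m = 1
    · subst hm
      rw [HahnSeries.coeff_single_same, MvPolynomial.coeff_C_mul, MvPolynomial.coeff_X]
      simp
    · rw [HahnSeries.coeff_single_of_ne hm, MvPolynomial.coeff_zero, if_neg (by simpa using hm)]
  · rw [if_neg hα, mul_zero, ite_self]
    by_cases hm : m = 1
    · subst hm
      rw [HahnSeries.coeff_single_same, MvPolynomial.coeff_C_mul, MvPolynomial.coeff_X',
        if_neg (Ne.symm hα), mul_zero]
    · rw [HahnSeries.coeff_single_of_ne hm, MvPolynomial.coeff_zero]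

/-- The non-quadratic part of φ starts in degree 3, hence its gradient in degree 2. The quadratic
part contributes λ_i x_i = t λ_i y_i. -/
theorem Good.resc_dφ (hD : D.Good) (i : Fin n) : ∃ ρ, VanishBelow 2 ρ ∧
    resc (D.dφ i) = ρ + HahnSeries.single 1 (MvPolynomial.C (D.lam i : ℂ) * MvPolynomial.X i) :=
  ⟨resc (MvPowerSeries.pderiv ℂ i D.phaseRest),
    resc_vanishBelow (d := 2) (hD.coeff_pderiv_phaseRest i), by
    rw [dφ_eq, map_add, resc_C_mul_X]⟩

theorem Good.resc_dφ_vanish (hD : D.Good) (i : Fin n) : VanishBelow 1 (resc (D.dφ i)) := by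
  obtain ⟨ρ, h1, h2⟩ := hD.resc_dφ i
  rw [h2]
  exact (h1.mono (by norm_num)).add (VanishBelow.single _)

theorem Good.coeff_resc_dφ (hD : D.Good) (i : Fin n) :
    (resc (D.dφ i)).coeff 1 = MvPolynomial.C (D.lam i : ℂ) * MvPolynomial.X i := by
  obtain ⟨ρ, h1, h2⟩ := hD.resc_dφ i
  rw [h2, HahnSeries.coeff_add, h1 1 (by norm_num), zero_add, HahnSeries.coeff_single_same]

theorem Good.constantCoeff_ddφ (hD : D.Good) (i j : Fin n) :
    MvPowerSeries.constantCoeff (D.ddφ i j) = if i = j then (D.lam i : ℂ) else 0 := by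
  rw [ddφ, dφ_eq, map_add, map_add, ← MvPowerSeries.coeff_zero_eq_constantCoeff_apply,
    MvPowerSeries.coeff_pderiv, hD.coeff_pderiv_phaseRest j _ (by
      rw [map_add, Finsupp.degree_single, map_zero]; norm_num), zero_mul, zero_add,
    Derivation.leibniz, pderiv_X_eq, MvPowerSeries.pderiv_C, smul_zero, add_zero, smul_eq_mul]
  by_cases h : i = j
  · subst h
    simp
  · rw [if_neg h, if_neg (Ne.symm h), mul_zero, map_zero]

/-- The form in which lowest coefficients are computed: a factor without negative powers acts
through its constant term. -/
theorem lead_mul {s : ℤ} {a F : LaurentSeries (Pol n)} {c : Pol n} (ha : VanishBelow 0 a)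
    (hc : a.coeff 0 = c) (hF : VanishBelow s F) :
    VanishBelow s (a * F) ∧ (a * F).coeff s = c * F.coeff s := by
  have h1 := ha.mul hF
  have h2 := coeff_mul_lowest ha hF
  rw [zero_add] at h1 h2
  exact ⟨h1, by rw [h2, hc]⟩

/-- At lowest order the inverse metric, the Hessian of φ and `W` enter through their values at the
centre, and t^{-1} times the rescaled gradient of φ through λ_j y_j. The terms with `b` and `c`
carry at least one extra power of t. -/
theorem Good.Q_leading (hD : D.Good) {s : ℤ} {w : S₀ n r} (hw : TVanish s w) :
    TVanish s (D.Q w) ∧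
      ∀ k, ((D.Q w).val k).coeff s = D.Q₀ (fun l => (w.val l).coeff s) k := by
  have hτ : ∀ (j : Fin n) {F : LaurentSeries (Pol n)}, VanishBelow s F →
      VanishBelow s (HahnSeries.single (-1) 1 * resc (D.dφ j) * F) ∧
      (HahnSeries.single (-1) 1 * resc (D.dφ j) * F).coeff s =
        MvPolynomial.C (D.lam j : ℂ) * MvPolynomial.X j * F.coeff s := by
    intro j F hF
    refine lead_mul ?_ ?_ hF
    · have := (VanishBelow.single (k := -1) (1 : Pol n)).mul (hD.resc_dφ_vanish j)
      exact this.mono (by norm_num)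
    · rw [coeff_single_mul', one_mul, sub_neg_eq_add, zero_add, hD.coeff_resc_dφ]
  have hr : ∀ (a : PS n) {F : LaurentSeries (Pol n)}, VanishBelow s F →
      VanishBelow s (resc a * F) ∧ (resc a * F).coeff s =
        MvPolynomial.C (MvPowerSeries.constantCoeff a) * F.coeff s := fun a F hF =>
    lead_mul (resc_vanishBelow_zero a) (coeff_resc_zero a) hF
  have hsmall : ∀ {F : LaurentSeries (Pol n)}, VanishBelow (s + 1) F →
      VanishBelow s F ∧ F.coeff s = 0 := fun hF => ⟨hF.mono (by omega), hF s (by omega)⟩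
  have hd : ∀ (i : Fin n) {F : LaurentSeries (Pol n)}, VanishBelow s F →
      VanishBelow s (dy i F) := fun i F hF => hF.mapD _
  have h1 : ∀ k i j, VanishBelow s (dy i (dy j (w.val k)) -
          (resc (D.ddφ i j) * w.val k + HahnSeries.single (-1) 1 * resc (D.dφ j) * dy i (w.val k) +
            HahnSeries.single (-1) 1 * resc (D.dφ i) * dy j (w.val k))) := fun k i j =>
    (hd i (hd j (hw k))).sub (((hr _ (hw k)).1.add (hτ j (hd i (hw k))).1).add
      (hτ i (hd j (hw k))).1)
  have h2 : ∀ k l j, VanishBelow (s + 1) (resc (D.b j k l) *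
      (HahnSeries.single 1 1 * dy j (w.val l) - resc (D.dφ j) * w.val l)) := by
    intro k l j
    have e1 := (VanishBelow.single (k := 1) (1 : Pol n)).mul (hd j (hw l))
    have e2 := (hD.resc_dφ_vanish j).mul (hw l)
    have := (resc_vanishBelow_zero (D.b j k l)).mul (e1.sub e2)
    exact this.mono (by omega)
  have h3 : ∀ k l, VanishBelow (s + 1) (resc (D.c k l) * (HahnSeries.single 2 1 * w.val l)) := by
    intro k l
    have := (resc_vanishBelow_zero (D.c k l)).mul
      ((VanishBelow.single (k := 2) (1 : Pol n)).mul (hw l))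
    exact this.mono (by omega)
  constructor
  · intro k
    rw [hD.Q_val]
    refine ((VanishBelow.neg ?_).add ?_).add ?_ |>.add ?_
    · exact VanishBelow.sum _ fun i _ => VanishBelow.sum _ fun j _ => (hr _ (h1 k i j)).1
    · exact VanishBelow.sum _ fun j _ => VanishBelow.sum _ fun l _ => (hsmall (h2 k l j)).1
    · exact VanishBelow.sum _ fun l _ => (hsmall (h3 k l)).1
    · exact VanishBelow.sum _ fun l _ => (hr _ (hw l)).1
  · intro k
    rw [hD.Q_val]
    simp only [HahnSeries.coeff_add, HahnSeries.coeff_neg, HahnSeries.coeff_sum]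
    have e1 : ∀ i j, (resc (D.ginv i j) * (dy i (dy j (w.val k)) -
          (resc (D.ddφ i j) * w.val k + HahnSeries.single (-1) 1 * resc (D.dφ j) * dy i (w.val k) +
            HahnSeries.single (-1) 1 * resc (D.dφ i) * dy j (w.val k)))).coeff s =
        if i = j then MvPolynomial.pderiv i (MvPolynomial.pderiv i ((w.val k).coeff s)) -
      (MvPolynomial.C (D.lam i : ℂ) * (w.val k).coeff s +
        2 * (MvPolynomial.C (D.lam i : ℂ) * MvPolynomial.X i *
          MvPolynomial.pderiv i ((w.val k).coeff s))) else 0 := by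
      intro i j
      rw [(hr _ (h1 k i j)).2, hD.ginv_zero, HahnSeries.coeff_sub, HahnSeries.coeff_add,
        HahnSeries.coeff_add, (hr _ (hw k)).2, (hτ j (hd i (hw k))).2, (hτ i (hd j (hw k))).2,
        hD.constantCoeff_ddφ]
      split_ifs with h
      · subst h
        rw [map_one, one_mul]
        change MvPolynomial.pderiv i (MvPolynomial.pderiv i ((w.val k).coeff s)) -
          (_ + _ * MvPolynomial.pderiv i ((w.val k).coeff s) +
            _ * MvPolynomial.pderiv i ((w.val k).coeff s)) = _
        ring
      · rw [map_zero, zero_mul]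
    have e2 : ∀ l, (resc (D.w k l) * w.val l).coeff s =
        if k = l then MvPolynomial.C (D.mu k : ℂ) * (w.val k).coeff s else 0 := by
      intro l
      rw [(hr _ (hw l)).2, hD.w_zero]
      split_ifs with h
      · rw [h]
      · rw [map_zero, zero_mul]
    simp only [e1, e2, (hsmall (h2 k _ _)).2, (hsmall (h3 k _)).2, Finset.sum_const_zero, add_zero,
      Finset.sum_ite_eq, Finset.mem_univ, if_true]
    rfl

end TaylorData

end ScaleAndFiltration

/-! ## Hermite polynomials -/

/-- Assuming the formula for j, the defining recursion becomes the three term recurrence, which is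
then differentiated. This yields the recurrence and Hermite's equation below. -/
theorem derivative_hermiteH_succ (j : ℕ) :
    Polynomial.derivative (hermiteH (j + 1)) = Polynomial.C (2 * ((j : ℝ) + 1)) * hermiteH j := by
  induction j with
  | zero =>
    simp only [hermiteH, Polynomial.derivative_mul]
    simp
    exact (map_ofNat Polynomial.C 2).symm
  | succ j ih =>
    have e : hermiteH (j + 1 + 1) = 2 * Polynomial.X * hermiteH (j + 1) -
        Polynomial.C (2 * ((j : ℝ) + 1)) * hermiteH j := by
      rw [← ih]
      rfl
    rw [e, Polynomial.derivative_sub, Polynomial.derivative_mul, ih, Polynomial.derivative_C_mul]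
    have h2 : Polynomial.derivative (hermiteH j) =
        2 * Polynomial.X * hermiteH j - hermiteH (j + 1) := by
      rw [hermiteH]
      ring
    have h3 : Polynomial.derivative (2 * Polynomial.X : Polynomial ℝ) = 2 := by
      simp [Polynomial.derivative_mul]
    rw [h2, h3]
    simp only [map_mul, map_add, map_ofNat, map_natCast, map_one, Nat.cast_add, Nat.cast_one]
    ring

theorem two_X_mul_hermiteH (j : ℕ) : 2 * Polynomial.X * hermiteH (j + 1) =
    hermiteH (j + 2) + Polynomial.C (2 * ((j : ℝ) + 1)) * hermiteH j := by
  rw [← derivative_hermiteH_succ]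
  change _ = 2 * Polynomial.X * hermiteH (j + 1) - Polynomial.derivative (hermiteH (j + 1)) + _
  ring

/-- Hermite's differential equation. -/
theorem hermiteH_ode (j : ℕ) :
    2 * Polynomial.X * Polynomial.derivative (hermiteH j) -
      Polynomial.derivative (Polynomial.derivative (hermiteH j)) =
    Polynomial.C (2 * (j : ℝ)) * hermiteH j := by
  have h := derivative_hermiteH_succ j
  have h3 : Polynomial.derivative (2 * Polynomial.X : Polynomial ℝ) = 2 := by
    simp [Polynomial.derivative_mul]
  rw [hermiteH, Polynomial.derivative_sub, Polynomial.derivative_mul, h3] at h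
  have h4 : Polynomial.C (2 * ((j : ℝ) + 1)) = Polynomial.C (2 * (j : ℝ)) + 2 := by
    simp only [map_mul, map_add, map_ofNat, map_natCast, map_one]
    ring
  rw [h4] at h
  linear_combination h

namespace TaylorData

variable {n r : ℕ} (D : TaylorData n r)

/-- `λ_ν^{1/2} y_ν`. -/
def oscVar (ν : Fin n) : Pol n := MvPolynomial.C ((Real.sqrt (D.lam ν) : ℝ) : ℂ) * MvPolynomial.X ν

/-- The factors of a product of Hermite polynomials in the variables other than `y_i`. -/
def hermiteRest (i : Fin n) (a : Fin n → ℕ) : Pol n :=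
  ∏ ν ∈ Finset.univ.erase i, Polynomial.aeval (D.oscVar ν) (hermiteH (a ν))

/-- The product of Hermite polynomials `∏_ν H_{a_ν}(λ_ν^{1/2} y_ν)`. -/
def hermiteProd (a : Fin n → ℕ) : Pol n :=
  ∏ ν, Polynomial.aeval (D.oscVar ν) (hermiteH (a ν))

theorem hermiteProd_update (i : Fin n) (a : Fin n → ℕ) (j : ℕ) :
    D.hermiteProd (Function.update a i j) =
      Polynomial.aeval (D.oscVar i) (hermiteH j) * D.hermiteRest i a := by
  rw [hermiteProd, hermiteRest, ← Finset.mul_prod_erase _ _ (Finset.mem_univ i),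
    Function.update_self]
  congr 1
  refine Finset.prod_congr rfl fun ν hν => ?_
  rw [Function.update_of_ne (Finset.ne_of_mem_erase hν)]

theorem hermiteProd_eq (i : Fin n) (a : Fin n → ℕ) :
    D.hermiteProd a = Polynomial.aeval (D.oscVar i) (hermiteH (a i)) * D.hermiteRest i a := by
  rw [← hermiteProd_update, Function.update_eq_self]

theorem pderiv_aeval_oscVar (i ν : Fin n) (f : Polynomial ℝ) :
    MvPolynomial.pderiv i (Polynomial.aeval (D.oscVar ν) f) =
      if ν = i then MvPolynomial.C ((Real.sqrt (D.lam i) : ℝ) : ℂ) *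
        Polynomial.aeval (D.oscVar i) (Polynomial.derivative f) else 0 := by
  have h := ((MvPolynomial.pderiv i : Derivation ℂ (Pol n) (Pol n)).restrictScalars ℝ).map_aeval
    f (D.oscVar ν)
  have h2 : MvPolynomial.pderiv i (D.oscVar ν) =
      if ν = i then MvPolynomial.C ((Real.sqrt (D.lam i) : ℝ) : ℂ) else 0 := by
    rw [oscVar, MvPolynomial.pderiv_C_mul, MvPolynomial.pderiv_X]
    by_cases h : ν = i
    · subst h
      simp
    · simp [h]
  change MvPolynomial.pderiv i (Polynomial.aeval (D.oscVar ν) f) =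
    _ • MvPolynomial.pderiv i (D.oscVar ν) at h
  rw [h, h2]
  split_ifs with h
  · rw [h, smul_eq_mul, mul_comm]
  · rw [smul_zero]

theorem pderiv_hermiteRest (i : Fin n) (a : Fin n → ℕ) :
    MvPolynomial.pderiv i (D.hermiteRest i a) = 0 := by
  rw [hermiteRest]
  refine Finset.prod_induction _ (fun P => MvPolynomial.pderiv i P = 0) ?_ ?_ ?_
  · intro P Q hP hQ
    rw [Derivation.leibniz, hP, hQ, smul_zero, smul_zero, add_zero]
  · exact Derivation.map_one_eq_zero _
  · intro ν hν
    rw [pderiv_aeval_oscVar, if_neg (Finset.ne_of_mem_erase hν)]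

theorem pderiv_factor (i : Fin n) (a : Fin n → ℕ) (f : Polynomial ℝ) :
    MvPolynomial.pderiv i (Polynomial.aeval (D.oscVar i) f * D.hermiteRest i a) =
      MvPolynomial.C ((Real.sqrt (D.lam i) : ℝ) : ℂ) *
        (Polynomial.aeval (D.oscVar i) (Polynomial.derivative f) * D.hermiteRest i a) := by
  rw [Derivation.leibniz, pderiv_hermiteRest, smul_zero, zero_add, pderiv_aeval_oscVar, if_pos rfl,
    smul_eq_mul]
  ring

theorem pderiv_hermiteProd_succ {i : Fin n} {a : Fin n → ℕ} {j : ℕ} (ha : a i = j + 1) :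
    MvPolynomial.pderiv i (D.hermiteProd a) =
      MvPolynomial.C ((Real.sqrt (D.lam i) * (2 * (j + 1)) : ℝ) : ℂ) *
        D.hermiteProd (Function.update a i j) := by
  rw [D.hermiteProd_eq i, pderiv_factor, ha, derivative_hermiteH_succ, hermiteProd_update, map_mul,
    Polynomial.aeval_C, Complex.ofReal_mul (Real.sqrt (D.lam i)), map_mul MvPolynomial.C]
  change _ * (MvPolynomial.C ((2 * ((j : ℝ) + 1) : ℝ) : ℂ) * _ * _) = _
  ring

variable {D}

theorem sqrt_lam_mul (hlam : ∀ i, 0 < D.lam i) (i : Fin n) :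
    (MvPolynomial.C ((Real.sqrt (D.lam i) : ℝ) : ℂ) *
      MvPolynomial.C ((Real.sqrt (D.lam i) : ℝ) : ℂ) : Pol n) = MvPolynomial.C (D.lam i : ℂ) := by
  rw [← map_mul, ← Complex.ofReal_mul, Real.mul_self_sqrt (hlam i).le]

/-- The harmonic oscillator in one variable. -/
theorem oscillator_hermiteProd (hlam : ∀ i, 0 < D.lam i) (i : Fin n) (a : Fin n → ℕ) :
    2 * (MvPolynomial.C (D.lam i : ℂ) * MvPolynomial.X i *
        MvPolynomial.pderiv i (D.hermiteProd a)) -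
      MvPolynomial.pderiv i (MvPolynomial.pderiv i (D.hermiteProd a)) =
    MvPolynomial.C ((2 * (a i : ℝ) * D.lam i : ℝ) : ℂ) * D.hermiteProd a := by
  have hX : MvPolynomial.C (D.lam i : ℂ) * MvPolynomial.X i =
      MvPolynomial.C ((Real.sqrt (D.lam i) : ℝ) : ℂ) * D.oscVar i := by
    rw [oscVar, ← mul_assoc, sqrt_lam_mul hlam]
  rw [hX, D.hermiteProd_eq i a, pderiv_factor, MvPolynomial.pderiv_C_mul, pderiv_factor]
  have h := congr_arg (Polynomial.aeval (D.oscVar i)) (hermiteH_ode (a i))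
  simp only [map_sub, map_mul, Polynomial.aeval_X, map_ofNat, Polynomial.aeval_C] at h
  have hc : (MvPolynomial.C ((2 * (a i : ℝ) * D.lam i : ℝ) : ℂ) : Pol n) =
      2 * algebraMap ℝ (Pol n) (a i : ℝ) * MvPolynomial.C (D.lam i : ℂ) := by
    rw [Complex.ofReal_mul, Complex.ofReal_mul, map_mul, map_mul]
    congr 2
  rw [hc, ← sqrt_lam_mul hlam]
  linear_combination (MvPolynomial.C ((Real.sqrt (D.lam i) : ℝ) : ℂ) *
    MvPolynomial.C ((Real.sqrt (D.lam i) : ℝ) : ℂ) * D.hermiteRest i a) * h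

/-- Integration by parts of P·∂_iQ against the Gaussian: the one-variable oscillator belongs to the
Dirichlet form, so it is symmetric. -/
theorem gauss_oscillator (hlam : ∀ i, 0 < D.lam i) (i : Fin n) (P Q : Pol n) :
    D.gaussIntegral (P * (2 * (MvPolynomial.C (D.lam i : ℂ) * MvPolynomial.X i *
        MvPolynomial.pderiv i Q) - MvPolynomial.pderiv i (MvPolynomial.pderiv i Q))) =
      D.gaussIntegral (MvPolynomial.pderiv i P * MvPolynomial.pderiv i Q) := by
  have h := D.gauss_pderiv hlam i (P * MvPolynomial.pderiv i Q)
  rw [Derivation.leibniz, smul_eq_mul, smul_eq_mul, gauss_add D hlam] at h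
  have e : P * (2 * (MvPolynomial.C (D.lam i : ℂ) * MvPolynomial.X i *
        MvPolynomial.pderiv i Q) - MvPolynomial.pderiv i (MvPolynomial.pderiv i Q)) =
      MvPolynomial.C (2 * D.lam i : ℂ) * (MvPolynomial.X i * (P * MvPolynomial.pderiv i Q)) +
        MvPolynomial.C (-1) * (P * MvPolynomial.pderiv i (MvPolynomial.pderiv i Q)) := by
    simp only [map_mul, map_neg, map_one, map_ofNat]
    ring
  rw [e, gauss_add D hlam, gauss_C_mul, gauss_C_mul, ← h, mul_comm (MvPolynomial.pderiv i Q)]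
  ring

/-- In a coordinate where the indices differ, the two products are eigenvectors of the same
symmetric one-variable oscillator for different eigenvalues. Working in one coordinate avoids
coincidences of the total energies. -/
theorem gauss_hermiteProd_ne (hlam : ∀ i, 0 < D.lam i) {a b : Fin n → ℕ} (hab : a ≠ b) :
    D.gaussIntegral (D.hermiteProd a * D.hermiteProd b) = 0 := by
  obtain ⟨i, hi⟩ := Function.ne_iff.mp hab
  have h1 := gauss_oscillator hlam i (D.hermiteProd a) (D.hermiteProd b)
  have h2 := gauss_oscillator hlam i (D.hermiteProd b) (D.hermiteProd a)
  rw [oscillator_hermiteProd hlam, mul_left_comm, gauss_C_mul] at h1 h2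
  rw [mul_comm (D.hermiteProd b), mul_comm (MvPolynomial.pderiv i (D.hermiteProd b)), ← h1] at h2
  have h3 : (2 * (a i : ℝ) * D.lam i : ℝ) ≠ 2 * (b i : ℝ) * D.lam i := fun h => by
    have := mul_right_cancel₀ (hlam i).ne' h
    have : (a i : ℝ) = b i := by linarith
    exact hi (by exact_mod_cast this)
  by_contra hne
  exact h3 (by exact_mod_cast mul_right_cancel₀ hne h2)

/-- Induction on the total degree. The Dirichlet form expresses the eigenvalue times the norm of `a`
as the norm of a derivative, which is a multiple of the product with one index lowered. -/
theorem gauss_hermiteProd_self (hlam : ∀ i, 0 < D.lam i) (a : Fin n → ℕ) :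
    D.gaussIntegral (D.hermiteProd a * D.hermiteProd a) =
      ((∏ ν, (2 ^ a ν * ((a ν).factorial : ℝ) * Real.sqrt (Real.pi / D.lam ν)) : ℝ) : ℂ) := by
  induction hm : ∑ ν, a ν generalizing a with
  | zero =>
    have h0 : ∀ ν, a ν = 0 := fun ν => by simpa using (Finset.sum_eq_zero_iff.mp hm) ν
    have h1 : D.hermiteProd a = 1 := by
      rw [hermiteProd]
      refine Finset.prod_eq_one fun ν _ => ?_
      rw [h0, hermiteH, map_one]
    rw [h1, mul_one, gauss_one]
    simp [h0]
  | succ m ih =>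
    obtain ⟨i, hi⟩ : ∃ i, a i ≠ 0 := by
      by_contra! h
      simp [h] at hm
    obtain ⟨j, hj⟩ := Nat.exists_eq_succ_of_ne_zero hi
    set b := Function.update a i j with hb
    have hsum : ∑ ν, b ν = m := by
      have h5 := Finset.add_sum_erase Finset.univ a (Finset.mem_univ i)
      have h6 := Finset.add_sum_erase Finset.univ b (Finset.mem_univ i)
      have h7 : ∑ ν ∈ Finset.univ.erase i, b ν = ∑ ν ∈ Finset.univ.erase i, a ν :=
        Finset.sum_congr rfl fun ν hν => by
          rw [hb, Function.update_of_ne (Finset.ne_of_mem_erase hν)]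
      have h8 : b i = j := by rw [hb, Function.update_self]
      omega
    have h1 := gauss_oscillator hlam i (D.hermiteProd a) (D.hermiteProd a)
    rw [oscillator_hermiteProd hlam, mul_left_comm, gauss_C_mul, D.pderiv_hermiteProd_succ hj,
      mul_mul_mul_comm, ← map_mul, gauss_C_mul, ← hb, ih b hsum] at h1
    have h2 : ((2 * (a i : ℝ) * D.lam i : ℝ) : ℂ) ≠ 0 := by
      refine Complex.ofReal_ne_zero.mpr ?_
      have := hlam i
      rw [hj]
      positivity
    refine mul_left_cancel₀ h2 (h1.trans ?_)
    rw [← Complex.ofReal_mul, ← Complex.ofReal_mul, ← Complex.ofReal_mul]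
    congr 1
    rw [← Finset.mul_prod_erase _ _ (Finset.mem_univ i),
      ← Finset.mul_prod_erase (a := i) Finset.univ
        (fun ν => 2 ^ a ν * ((a ν).factorial : ℝ) * Real.sqrt (Real.pi / D.lam ν))
        (Finset.mem_univ i)]
    have h3 : ∏ ν ∈ Finset.univ.erase i,
        (2 ^ b ν * ((b ν).factorial : ℝ) * Real.sqrt (Real.pi / D.lam ν)) =
        ∏ ν ∈ Finset.univ.erase i,
        (2 ^ a ν * ((a ν).factorial : ℝ) * Real.sqrt (Real.pi / D.lam ν)) :=
      Finset.prod_congr rfl fun ν hν => by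
        rw [hb, Function.update_of_ne (Finset.ne_of_mem_erase hν)]
    rw [h3, hb, Function.update_self, hj, Nat.factorial_succ, pow_succ]
    have h4 := Real.mul_self_sqrt (hlam i).le
    push_cast
    linear_combination (2 * ((j : ℝ) + 1)) ^ 2 * (2 ^ j * (j.factorial : ℝ) *
      Real.sqrt (Real.pi / D.lam i)) * (∏ ν ∈ Finset.univ.erase i,
        (2 ^ a ν * ((a ν).factorial : ℝ) * Real.sqrt (Real.pi / D.lam ν))) * h4

end TaylorData

namespace TaylorData

variable {n r : ℕ} (D : TaylorData n r)

/-! ## The orthonormal eigenvectors of the harmonic oscillator -/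

/-- The normalization constant of a product of Hermite polynomials. -/
def hermiteNorm (a : Fin n → ℕ) : ℝ :=
  ∏ ν, (D.lam ν ^ (1 / 4 : ℝ) *
    (Real.sqrt (2 ^ a ν * ((a ν).factorial : ℝ)) * Real.pi ^ (1 / 4 : ℝ))⁻¹)

/-- The polynomial vector `h_{α,k}`. -/
def hPol (a : (Fin n → ℕ) × Fin r) : Fin r → Pol n :=
  Pi.single a.2 (MvPolynomial.C (D.hermiteNorm a.1 : ℂ) * D.hermiteProd a.1)

theorem h_eq (a : (Fin n → ℕ) × Fin r) : D.h a = ofPol (D.hPol a) := by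
  have : (∏ ν, MvPolynomial.C ((D.lam ν ^ (1 / 4 : ℝ) : ℝ) : ℂ) *
      Polynomial.aeval (D.oscVar ν) (hermiteNormalized (a.1 ν)) : Pol n) =
      MvPolynomial.C (D.hermiteNorm a.1 : ℂ) * D.hermiteProd a.1 := by
    rw [hermiteNorm, hermiteProd, Complex.ofReal_prod, map_prod, ← Finset.prod_mul_distrib]
    refine Finset.prod_congr rfl fun ν _ => ?_
    rw [hermiteNormalized, map_mul, Polynomial.aeval_C, Complex.ofReal_mul, map_mul, mul_assoc]
    rfl
  rw [h, hPol, ← this]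
  rfl

variable {D}

theorem rpow_quarter_mul_self {x : ℝ} (hx : 0 < x) :
    x ^ (1 / 4 : ℝ) * x ^ (1 / 4 : ℝ) = Real.sqrt x := by
  rw [← Real.rpow_add hx, Real.sqrt_eq_rpow]
  norm_num

theorem hermiteNorm_pos (hlam : ∀ i, 0 < D.lam i) (a : Fin n → ℕ) : 0 < D.hermiteNorm a := by
  refine Finset.prod_pos fun ν _ => ?_
  have := hlam ν
  positivity

theorem hermiteNorm_sq (hlam : ∀ i, 0 < D.lam i) (a : Fin n → ℕ) :
    D.hermiteNorm a * D.hermiteNorm a *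
      ∏ ν, (2 ^ a ν * ((a ν).factorial : ℝ) * Real.sqrt (Real.pi / D.lam ν)) = 1 := by
  rw [hermiteNorm, ← Finset.prod_mul_distrib, ← Finset.prod_mul_distrib]
  refine Finset.prod_eq_one fun ν _ => ?_
  have h1 := rpow_quarter_mul_self (hlam ν)
  have h2 := rpow_quarter_mul_self Real.pi_pos
  have h3 : Real.sqrt (2 ^ a ν * ((a ν).factorial : ℝ)) *
      Real.sqrt (2 ^ a ν * ((a ν).factorial : ℝ)) = 2 ^ a ν * ((a ν).factorial : ℝ) :=
    Real.mul_self_sqrt (by positivity)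
  have hl : 0 < Real.sqrt (D.lam ν) := Real.sqrt_pos.mpr (hlam ν)
  have hp : 0 < Real.sqrt Real.pi := Real.sqrt_pos.mpr Real.pi_pos
  have hf : (0 : ℝ) < 2 ^ a ν * ((a ν).factorial : ℝ) := by positivity
  rw [Real.sqrt_div Real.pi_pos.le]
  calc _ = (D.lam ν ^ (1 / 4 : ℝ) * D.lam ν ^ (1 / 4 : ℝ)) *
        ((Real.sqrt (2 ^ a ν * ((a ν).factorial : ℝ)) *
          Real.sqrt (2 ^ a ν * ((a ν).factorial : ℝ))) *
          (Real.pi ^ (1 / 4 : ℝ) * Real.pi ^ (1 / 4 : ℝ)))⁻¹ *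
        (2 ^ a ν * ((a ν).factorial : ℝ) * (Real.sqrt Real.pi / Real.sqrt (D.lam ν))) := by
        rw [mul_inv, mul_inv, mul_inv, mul_inv]
        ring
    _ = 1 := by
        rw [h1, h2, h3]
        field_simp

theorem conj_hermiteProd (a : Fin n → ℕ) :
    MvPolynomial.map (starRingEnd ℂ) (D.hermiteProd a) = D.hermiteProd a := by
  rw [hermiteProd, map_prod]
  refine Finset.prod_congr rfl fun ν _ => ?_
  have h1 : MvPolynomial.map (starRingEnd ℂ) (D.oscVar ν) = D.oscVar ν := by
    rw [oscVar, map_mul, MvPolynomial.map_C, MvPolynomial.map_X, Complex.conj_ofReal]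
  rw [Polynomial.aeval_def, Polynomial.hom_eval₂, h1]
  congr 1
  refine RingHom.ext fun x => ?_
  change MvPolynomial.map (starRingEnd ℂ) (MvPolynomial.C (x : ℂ)) = MvPolynomial.C (x : ℂ)
  rw [MvPolynomial.map_C, Complex.conj_ofReal]

/-- The scalar product of polynomial vectors. -/
def polInner (D : TaylorData n r) (P Q : Fin r → Pol n) : ℂ :=
  D.gaussIntegral (∑ k, MvPolynomial.map (starRingEnd ℂ) (P k) * Q k)

theorem polInner_hPol (hlam : ∀ i, 0 < D.lam i) (a b : (Fin n → ℕ) × Fin r) :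
    D.polInner (D.hPol a) (D.hPol b) = if a = b then 1 else 0 := by
  rw [polInner]
  by_cases hk : a.2 = b.2
  · have e : ∑ k, MvPolynomial.map (starRingEnd ℂ) (D.hPol a k) * D.hPol b k =
        MvPolynomial.C (D.hermiteNorm a.1 * D.hermiteNorm b.1 : ℂ) *
          (D.hermiteProd a.1 * D.hermiteProd b.1) := by
      rw [Finset.sum_eq_single a.2]
      · rw [hPol, hPol, ← hk, Pi.single_eq_same, Pi.single_eq_same, map_mul, MvPolynomial.map_C,
          conj_hermiteProd, Complex.conj_ofReal, map_mul]
        ring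
      · intro k _ hne
        rw [hPol, Pi.single_eq_of_ne hne, map_zero, zero_mul]
      · exact fun h => absurd (Finset.mem_univ _) h
    rw [e, gauss_C_mul]
    by_cases hab : a.1 = b.1
    · rw [if_pos (Prod.ext hab hk), ← hab, gauss_hermiteProd_self hlam]
      exact_mod_cast hermiteNorm_sq hlam a.1
    · rw [gauss_hermiteProd_ne hlam hab, mul_zero, if_neg fun h => hab (congr_arg Prod.fst h)]
  · rw [if_neg fun h => hk (congr_arg Prod.snd h), Finset.sum_eq_zero, map_zero]
    intro k _
    by_cases h : k = b.2
    · rw [hPol, Pi.single_eq_of_ne fun h' => hk (h'.symm.trans h), map_zero, zero_mul]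
    · have : D.hPol b k = 0 := Pi.single_eq_of_ne h _
      rw [this, mul_zero]

/-- The leading part of `Q` as a linear map. -/
def Q₀Hom (D : TaylorData n r) : (Fin r → Pol n) →ₗ[ℂ] (Fin r → Pol n) where
  toFun := D.Q₀
  map_add' P Q := by
    funext k
    simp only [Q₀, Pi.add_apply, map_add, mul_add, Finset.sum_sub_distrib, Finset.sum_add_distrib]
    ring
  map_smul' c P := by
    funext k
    simp only [Q₀, Pi.smul_apply, Derivation.map_smul, RingHom.id_apply, smul_add, smul_neg, Finset.smul_sum,
      smul_sub, mul_smul_comm]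

/-- In each variable Hermite's equation contributes 2α_iλ_i, and the zero order term of the
oscillator, which is the Laplacian of the quadratic phase, contributes the remaining λ_i. -/
theorem Q₀_hPol (hlam : ∀ i, 0 < D.lam i) (a : (Fin n → ℕ) × Fin r) :
    D.Q₀Hom (D.hPol a) = (D.energy a : ℂ) • D.hPol a := by
  funext k
  change D.Q₀ (D.hPol a) k = _
  rw [Pi.smul_apply, Q₀]
  by_cases hk : k = a.2
  · subst hk
    rw [hPol, Pi.single_eq_same]
    have e : ∀ i, MvPolynomial.pderiv i (MvPolynomial.pderiv i
          (MvPolynomial.C (D.hermiteNorm a.1 : ℂ) * D.hermiteProd a.1)) -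
        (MvPolynomial.C (D.lam i : ℂ) *
          (MvPolynomial.C (D.hermiteNorm a.1 : ℂ) * D.hermiteProd a.1) +
          2 * (MvPolynomial.C (D.lam i : ℂ) * MvPolynomial.X i * MvPolynomial.pderiv i
            (MvPolynomial.C (D.hermiteNorm a.1 : ℂ) * D.hermiteProd a.1))) =
        -(MvPolynomial.C (((2 * (a.1 i : ℝ) + 1) * D.lam i : ℝ) : ℂ) *
          (MvPolynomial.C (D.hermiteNorm a.1 : ℂ) * D.hermiteProd a.1)) := by
      intro i
      have h := oscillator_hermiteProd hlam i a.1
      have hc : (MvPolynomial.C (((2 * (a.1 i : ℝ) + 1) * D.lam i : ℝ) : ℂ) : Pol n) =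
          MvPolynomial.C ((2 * (a.1 i : ℝ) * D.lam i : ℝ) : ℂ) +
            MvPolynomial.C (D.lam i : ℂ) := by
        rw [← map_add, ← Complex.ofReal_add]
        congr 2
        ring
      rw [MvPolynomial.pderiv_C_mul, MvPolynomial.pderiv_C_mul, hc]
      linear_combination -MvPolynomial.C (D.hermiteNorm a.1 : ℂ) * h
    simp only [e]
    rw [Finset.sum_neg_distrib, neg_neg, ← Finset.sum_mul, ← map_sum, ← add_mul, ← map_add,
      MvPolynomial.smul_eq_C_mul]
    congr 2
    rw [energy]
    push_cast
    rfl
  · rw [hPol, Pi.single_eq_of_ne hk]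
    simp

/-- The degree of the multi-index of `h_{α,k}`. -/
def hdeg (a : (Fin n → ℕ) × Fin r) : ℕ := ∑ ν, a.1 ν

theorem aeval_oscVar_two (ν : Fin n) : Polynomial.aeval (D.oscVar ν) (2 : Polynomial ℝ) = 2 :=
  map_ofNat _ 2

theorem totalDegree_aeval_hermiteH (ν : Fin n) (j : ℕ) :
    (Polynomial.aeval (D.oscVar ν) (hermiteH j)).totalDegree ≤ j := by
  have hX : (D.oscVar ν).totalDegree ≤ 1 := by
    refine (MvPolynomial.totalDegree_mul _ _).trans ?_
    rw [MvPolynomial.totalDegree_C, MvPolynomial.totalDegree_X]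
  have h2 : (2 * D.oscVar ν).totalDegree ≤ 1 := by
    refine (MvPolynomial.totalDegree_mul _ _).trans ?_
    have : (2 : Pol n).totalDegree = 0 := MvPolynomial.totalDegree_C (2 : ℂ)
    omega
  induction j using Nat.twoStepInduction with
  | zero => simp [hermiteH]
  | one =>
    have : Polynomial.aeval (D.oscVar ν) (hermiteH 1) = 2 * D.oscVar ν := by
      simp [hermiteH, aeval_oscVar_two]
    rw [this]
    exact h2
  | more j h0 h1 =>
    have e : hermiteH (j + 2) = 2 * Polynomial.X * hermiteH (j + 1) -
        Polynomial.C (2 * ((j : ℝ) + 1)) * hermiteH j := by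
      rw [two_X_mul_hermiteH]
      ring
    rw [e, map_sub, map_mul, map_mul, map_mul, map_ofNat, Polynomial.aeval_X, Polynomial.aeval_C]
    refine (MvPolynomial.totalDegree_sub _ _).trans (max_le ?_ ?_)
    · refine (MvPolynomial.totalDegree_mul _ _).trans ?_
      omega
    · refine (MvPolynomial.totalDegree_mul _ _).trans ?_
      have : (algebraMap ℝ (Pol n) (2 * ((j : ℝ) + 1))).totalDegree = 0 :=
        MvPolynomial.totalDegree_C ((2 * ((j : ℝ) + 1) : ℝ) : ℂ)
      omega

theorem coeff_hPol (a : (Fin n → ℕ) × Fin r) (k : Fin r) (α : Fin n →₀ ℕ) (hα : hdeg a < α.degree) :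
    MvPolynomial.coeff α (D.hPol a k) = 0 := by
  rw [hPol]
  by_cases hk : k = a.2
  · subst hk
    rw [Pi.single_eq_same, MvPolynomial.coeff_C_mul,
      MvPolynomial.coeff_eq_zero_of_totalDegree_lt, mul_zero]
    refine lt_of_le_of_lt ?_ hα
    refine (MvPolynomial.totalDegree_finset_prod _ _).trans ?_
    exact Finset.sum_le_sum fun ν _ => totalDegree_aeval_hermiteH ν _
  · rw [Pi.single_eq_of_ne hk, MvPolynomial.coeff_zero]

theorem negVar_aeval_hermiteH (ν : Fin n) (j : ℕ) :
    negVar n (Polynomial.aeval (D.oscVar ν) (hermiteH j)) =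
      (-1) ^ j * Polynomial.aeval (D.oscVar ν) (hermiteH j) := by
  have hX : negVar n (D.oscVar ν) = -D.oscVar ν := by
    change MvPolynomial.aeval _ _ = _
    rw [oscVar, map_mul, MvPolynomial.aeval_C, MvPolynomial.aeval_X]
    exact mul_neg _ _
  have hC : ∀ c : ℝ, negVar n (algebraMap ℝ (Pol n) c) = algebraMap ℝ (Pol n) c := fun c =>
    MvPolynomial.aeval_C _ (c : ℂ)
  induction j using Nat.twoStepInduction with
  | zero => simp [hermiteH]
  | one =>
    have : Polynomial.aeval (D.oscVar ν) (hermiteH 1) = 2 * D.oscVar ν := by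
      simp [hermiteH, aeval_oscVar_two]
    rw [this, map_mul, hX, map_ofNat]
    ring
  | more j h0 h1 =>
    have e : hermiteH (j + 2) = 2 * Polynomial.X * hermiteH (j + 1) -
        Polynomial.C (2 * ((j : ℝ) + 1)) * hermiteH j := by
      rw [two_X_mul_hermiteH]
      ring
    rw [e, map_sub, map_mul, map_mul, map_mul, map_ofNat, Polynomial.aeval_X, Polynomial.aeval_C,
      map_sub, map_mul, map_mul, map_mul, h0, h1, hX, hC, map_ofNat]
    ring

theorem negVar_hPol (a : (Fin n → ℕ) × Fin r) (k : Fin r) :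
    negVar n (D.hPol a k) = (-1) ^ hdeg a * D.hPol a k := by
  rw [hPol]
  by_cases hk : k = a.2
  · subst hk
    rw [Pi.single_eq_same, map_mul, hermiteProd, map_prod]
    simp only [negVar_aeval_hermiteH]
    have : negVar n (MvPolynomial.C (D.hermiteNorm a.1 : ℂ)) =
        MvPolynomial.C (D.hermiteNorm a.1 : ℂ) := MvPolynomial.aeval_C _ _
    rw [this, Finset.prod_mul_distrib, Finset.prod_pow_eq_pow_sum]
    exact mul_left_comm _ _ _
  · rw [Pi.single_eq_of_ne hk, map_zero, mul_zero]

/-- The span of the `h_{α,k}` with `|α| ≤ d`. -/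
def hSpan (D : TaylorData n r) (d : ℕ) : Submodule ℂ (Fin r → Pol n) :=
  Submodule.span ℂ (D.hPol '' {a | hdeg a ≤ d})

theorem single_hermiteProd_mem (hlam : ∀ i, 0 < D.lam i) {a : Fin n → ℕ} {d : ℕ}
    (ha : ∑ ν, a ν ≤ d) (k : Fin r) : Pi.single k (D.hermiteProd a) ∈ D.hSpan d := by
  have h0 : (D.hermiteNorm a : ℂ) ≠ 0 := Complex.ofReal_ne_zero.mpr (hermiteNorm_pos hlam a).ne'
  have h1 : D.hPol (a, k) ∈ D.hSpan d := Submodule.subset_span ⟨(a, k), ha, rfl⟩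
  have h2 := (D.hSpan d).smul_mem (D.hermiteNorm a : ℂ)⁻¹ h1
  convert h2 using 1
  rw [hPol, ← Pi.single_smul, MvPolynomial.smul_eq_C_mul, ← mul_assoc, ← map_mul,
    inv_mul_cancel₀ h0, map_one, one_mul]

theorem hSpan_mono {d d' : ℕ} (h : d ≤ d') : D.hSpan d ≤ D.hSpan d' :=
  Submodule.span_mono (Set.image_mono fun _ ha => le_trans ha h)

/-- The three term recurrence in one variable. For a_i = 0 the truncated index a_i - 1 is harmless,
as its coefficient vanishes. -/
theorem oscVar_mul_hermiteProd (i : Fin n) (a : Fin n → ℕ) :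
    2 * D.oscVar i * D.hermiteProd a = D.hermiteProd (Function.update a i (a i + 1)) +
      MvPolynomial.C (2 * (a i : ℂ)) * D.hermiteProd (Function.update a i (a i - 1)) := by
  rw [hermiteProd_update, hermiteProd_update, D.hermiteProd_eq i a]
  cases h : a i with
  | zero => simp [hermiteH, aeval_oscVar_two]
  | succ j =>
    have e := congr_arg (Polynomial.aeval (D.oscVar i)) (two_X_mul_hermiteH j)
    rw [map_add, map_mul, map_mul, map_mul, map_ofNat, Polynomial.aeval_X, Polynomial.aeval_C] at e
    have hc : (MvPolynomial.C (2 * ((j + 1 : ℕ) : ℂ)) : Pol n) =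
        algebraMap ℝ (Pol n) (2 * ((j : ℝ) + 1)) := by
      change _ = MvPolynomial.C ((2 * ((j : ℝ) + 1) : ℝ) : ℂ)
      push_cast
      rfl
    rw [hc, Nat.add_sub_cancel]
    linear_combination D.hermiteRest i a * e

/-- By the recurrence, multiplying a Hermite product by a variable gives a combination of two such
products, whose degree increases by at most one. -/
theorem X_mul_mem_hSpan (hlam : ∀ i, 0 < D.lam i) (i : Fin n) {d : ℕ} {P : Fin r → Pol n}
    (hP : P ∈ D.hSpan d) : (fun k => MvPolynomial.X i * P k) ∈ D.hSpan (d + 1) := by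
  induction hP using Submodule.span_induction with
  | mem P hP =>
    obtain ⟨⟨a, k⟩, ha, rfl⟩ := hP
    have ha' : ∑ ν, a ν ≤ d := ha
    set s : ℂ := ((Real.sqrt (D.lam i) : ℝ) : ℂ) with hs
    have hs0 : s ≠ 0 := Complex.ofReal_ne_zero.mpr (Real.sqrt_pos.mpr (hlam i)).ne'
    set c : ℂ := D.hermiteNorm a * (2 * s)⁻¹ with hc
    have hsum : ∀ j, ∑ ν, Function.update a i j ν + a i = ∑ ν, a ν + j := by
      intro j
      have h5 := Finset.add_sum_erase Finset.univ a (Finset.mem_univ i)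
      have h6 := Finset.add_sum_erase Finset.univ (Function.update a i j) (Finset.mem_univ i)
      have h7 : ∑ ν ∈ Finset.univ.erase i, Function.update a i j ν =
          ∑ ν ∈ Finset.univ.erase i, a ν :=
        Finset.sum_congr rfl fun ν hν => by
          rw [Function.update_of_ne (Finset.ne_of_mem_erase hν)]
      rw [Function.update_self] at h6
      omega
    have m1 := (D.hSpan (d + 1)).smul_mem c (single_hermiteProd_mem hlam (d := d + 1)
      (a := Function.update a i (a i + 1)) (by have := hsum (a i + 1); omega) k)
    have m2 := (D.hSpan (d + 1)).smul_mem (c * (2 * (a i : ℂ)))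
      (single_hermiteProd_mem hlam (d := d + 1)
      (a := Function.update a i (a i - 1)) (by have := hsum (a i - 1); omega) k)
    convert (D.hSpan (d + 1)).add_mem m1 m2 using 1
    funext l
    by_cases hl : l = k
    · subst hl
      have e := D.oscVar_mul_hermiteProd i a
      have e2 : MvPolynomial.C (D.hermiteNorm a : ℂ) * MvPolynomial.X i =
          MvPolynomial.C c * (2 * D.oscVar i) := by
        have : (2 : Pol n) = MvPolynomial.C 2 := (map_ofNat MvPolynomial.C 2).symm
        rw [oscVar, ← hs, this, ← mul_assoc, ← mul_assoc, ← map_mul, ← map_mul, hc]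
        congr 2
        field_simp
      simp only [hPol, Pi.add_apply, Pi.smul_apply, Pi.single_eq_same, MvPolynomial.smul_eq_C_mul]
      rw [map_mul MvPolynomial.C c]
      linear_combination D.hermiteProd a * e2 + MvPolynomial.C c * e
    · simp [hPol, hl]
  | zero =>
    simp only [Pi.zero_apply, mul_zero]
    exact (D.hSpan _).zero_mem
  | add P Q _ _ hP hQ =>
    simp only [Pi.add_apply, mul_add]
    exact (D.hSpan _).add_mem hP hQ
  | smul c P _ hP =>
    simp only [Pi.smul_apply, mul_smul_comm]
    exact (D.hSpan _).smul_mem c hP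

/-- Monomials are built up from 1, the Hermite product of degree zero, by multiplication with
variables. -/
theorem single_monomial_mem (hlam : ∀ i, 0 < D.lam i) (k : Fin r) (d : ℕ) (α : Fin n →₀ ℕ)
    (hα : α.degree ≤ d) : Pi.single k (MvPolynomial.monomial α (1 : ℂ)) ∈ D.hSpan d := by
  induction d generalizing α with
  | zero =>
    have h0 : α = 0 := (Finsupp.degree_eq_zero_iff α).mp (Nat.le_zero.mp hα)
    have : MvPolynomial.monomial α (1 : ℂ) = D.hermiteProd 0 := by
      rw [h0, hermiteProd, Finset.prod_eq_one fun ν _ => by rw [Pi.zero_apply, hermiteH, map_one]]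
      rfl
    rw [this]
    exact single_hermiteProd_mem hlam (by simp) k
  | succ d ih =>
    by_cases h : α.degree ≤ d
    · exact hSpan_mono (Nat.le_succ d) (ih α h)
    · obtain ⟨i, hi⟩ : ∃ i, α i ≠ 0 := by
        by_contra! h0
        refine h ?_
        have : α = 0 := Finsupp.ext h0
        rw [this, map_zero]
        exact Nat.zero_le _
      have hle : Finsupp.single i 1 ≤ α := by
        rw [Finsupp.single_le_iff]
        omega
      have hβ := tsub_add_cancel_of_le hle
      have hdeg : (α - Finsupp.single i 1).degree ≤ d := by
        have := congr_arg Finsupp.degree hβ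
        rw [map_add, Finsupp.degree_single] at this
        omega
      convert X_mul_mem_hSpan hlam i (ih _ hdeg) using 1
      funext l
      by_cases hl : l = k
      · subst hl
        rw [Pi.single_eq_same, Pi.single_eq_same, mul_comm, MvPolynomial.X,
          MvPolynomial.monomial_mul, hβ, one_mul]
      · rw [Pi.single_eq_of_ne hl, Pi.single_eq_of_ne hl, mul_zero]

/-- Every polynomial vector is a linear combination of the `h_{α,k}`, with control of degrees. -/
theorem exists_hPol_expansion (hlam : ∀ i, 0 < D.lam i) (d : ℕ) (P : Fin r → Pol n)
    (hP : ∀ k α, d < Finsupp.degree α → MvPolynomial.coeff α (P k) = 0) :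
    ∃ (s : Finset ((Fin n → ℕ) × Fin r)) (c : (Fin n → ℕ) × Fin r → ℂ),
      (∀ a ∈ s, hdeg a ≤ d) ∧ P = ∑ a ∈ s, c a • D.hPol a := by
  have hmem : P ∈ D.hSpan d := by
    have e : P = ∑ k, ∑ α ∈ (P k).support,
        MvPolynomial.coeff α (P k) • Pi.single k (MvPolynomial.monomial α (1 : ℂ)) := by
      funext l
      rw [Finset.sum_apply, Finset.sum_eq_single l]
      · conv_lhs => rw [(P l).as_sum]
        rw [Finset.sum_apply]
        refine Finset.sum_congr rfl fun α _ => ?_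
        rw [Pi.smul_apply, Pi.single_eq_same, MvPolynomial.smul_monomial, smul_eq_mul, mul_one]
      · intro k _ hk
        rw [Finset.sum_apply]
        refine Finset.sum_eq_zero fun α _ => ?_
        rw [Pi.smul_apply, Pi.single_eq_of_ne (Ne.symm hk), smul_zero]
      · exact fun h => absurd (Finset.mem_univ _) h
    rw [e]
    refine Submodule.sum_mem _ fun k _ => Submodule.sum_mem _ fun α hα => ?_
    refine Submodule.smul_mem _ _ (single_monomial_mem hlam k d α ?_)
    by_contra hlt
    exact MvPolynomial.mem_support_iff.mp hα (hP k α (not_le.mp hlt))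
  obtain ⟨l, hl, rfl⟩ := (Finsupp.mem_span_image_iff_linearCombination ℂ).mp hmem
  exact ⟨l.support, l, fun a ha => hl ha, rfl⟩

end TaylorData

/-! ## Leading terms and completeness -/

section Leading

variable {n r : ℕ}

/-- The coefficient of `ħ^{s/2}`. -/
def leadHom (s : ℤ) : S₀ n r →ₗ[ℂ] (Fin r → Pol n) where
  toFun w k := (w.val k).coeff s
  map_add' _ _ := rfl
  map_smul' _ _ := rfl

theorem leadHom_apply (s : ℤ) (w : S₀ n r) (k : Fin r) : leadHom s w k = (w.val k).coeff s := rfl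

theorem leadHom_tPol (s : ℤ) (P : Fin r → Pol n) : leadHom s (tPol s P) = P := by
  funext k
  rw [leadHom_apply, val_tPol, HahnSeries.coeff_single_same]

theorem TVanish.succ_iff {s : ℤ} {w : S₀ n r} (hw : TVanish s w) :
    TVanish (s + 1) w ↔ leadHom s w = 0 :=
  (tVanish_succ_iff hw).trans ⟨fun h => funext h, fun h k => congr_fun h k⟩

theorem XVanish.coeff_leadHom {m s : ℤ} {w : S₀ n r} (hw : XVanish m w) (k : Fin r)
    (α : Fin n →₀ ℕ) (hα : (s - m).toNat < α.degree) :
    MvPolynomial.coeff α (leadHom s w k) = 0 :=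
  XVanish_iff.mp hw k s α (by omega)

theorem xVanish_tPol {m s : ℤ} {P : Fin r → Pol n} {d : ℕ}
    (hP : ∀ k α, d < Finsupp.degree α → MvPolynomial.coeff α (P k) = 0) (h : m + d ≤ s) :
    XVanish m (tPol s P) := by
  rw [XVanish_iff]
  intro k l α hlt
  rw [val_tPol]
  by_cases hl : l = s
  · subst hl
    rw [HahnSeries.coeff_single_same]
    exact hP k α (by omega)
  · rw [HahnSeries.coeff_single_of_ne hl, MvPolynomial.coeff_zero]

/-- Construction of an element of `𝔖₀` from its coefficients. -/
theorem exists_of_coeff {m s : ℤ} (c : Fin r → ℤ → Pol n)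
    (hs : ∀ k, ∀ l < s, c k l = 0)
    (hm : ∀ k l (α : Fin n →₀ ℕ), l - α.degree < m → MvPolynomial.coeff α (c k l) = 0) :
    ∃ w : S₀ n r, ∀ k l, (w.val k).coeff l = c k l := by
  refine ⟨S₀.mk (fun k => HahnSeries.ofSuppBddBelow (c k) ⟨s, fun l hl => ?_⟩) ?_, ?_⟩
  · by_contra hlt
    exact hl (hs k l (by omega))
  · refine ⟨(-m).toNat, fun k l α h => ?_⟩
    by_contra hlt
    exact h (hm k l α (by omega))
  · intro k l
    rfl

/-- Only the v_j with s + j ≤ l reach the coefficient of t^l, so the sum is finite in each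
coefficient. The common bound m is essential: without it the limit could leave 𝔖₀. -/
theorem exists_sum {m s : ℤ} (v : ℕ → S₀ n r) (hX : ∀ j, XVanish m (v j))
    (hT : ∀ j : ℕ, TVanish (s + j) (v j)) :
    ∃ w : S₀ n r, XVanish m w ∧ TVanish s w ∧
      ∀ N : ℕ, TVanish (s + N) (w - ∑ j ∈ Finset.range N, v j) := by
  obtain ⟨w, hw⟩ := exists_of_coeff (m := m) (s := s) (r := r) (n := n)
    (fun k l => ∑ j ∈ Finset.range (l - s + 1).toNat, ((v j).val k).coeff l)
    (fun k l hl => by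
      rw [Finset.sum_eq_zero]
      intro j _
      exact hT j k l (by omega))
    (fun k l α h => by
      rw [MvPolynomial.coeff_sum]
      exact Finset.sum_eq_zero fun j _ => XVanish_iff.mp (hX j) k l α h)
  refine ⟨w, ?_, ?_, ?_⟩
  · rw [XVanish_iff]
    intro k l α h
    rw [hw, MvPolynomial.coeff_sum]
    exact Finset.sum_eq_zero fun j _ => XVanish_iff.mp (hX j) k l α h
  · intro k l hl
    rw [hw, Finset.sum_eq_zero]
    intro j _
    exact hT j k l (by omega)
  · intro N k l hl
    rw [S₀.val_sub, HahnSeries.coeff_sub, hw, S₀.val_sum, HahnSeries.coeff_sum, sub_eq_zero]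
    refine Finset.sum_subset (fun j hj => ?_) fun j _ hj => ?_
    · rw [Finset.mem_range] at hj ⊢
      omega
    · rw [Finset.mem_range] at hj
      exact hT j k l (by omega)

/-- Solving an equation in `𝔖₀` order by order. -/
theorem exists_preimage {Φ : Module.End ℂ (S₀ n r)}
    (hT : ∀ {s : ℤ} {w : S₀ n r}, TVanish s w → TVanish s (Φ w))
    (hX : ∀ {s : ℤ} {w : S₀ n r}, XVanish s w → XVanish s (Φ w))
    (step : ∀ (m s : ℤ) (g : S₀ n r), XVanish m g → TVanish s g →
      ∃ v, XVanish m v ∧ TVanish s v ∧ TVanish (s + 1) (g - Φ v))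
    {m s : ℤ} {g : S₀ n r} (hgX : XVanish m g) (hgT : TVanish s g) :
    ∃ w, XVanish m w ∧ TVanish s w ∧ Φ w = g := by
  have key : ∀ (j : ℕ) (p : {p : S₀ n r // XVanish m p ∧ TVanish (s + j) p}),
      ∃ v, XVanish m v ∧ TVanish (s + j) v ∧ TVanish (s + j + 1) (p.1 - Φ v) := fun j p =>
    step m (s + j) p.1 p.2.1 p.2.2
  choose F hF1 hF2 hF3 using key
  -- The remainder after j corrections, carried along with the degree bound it inherits and with the
  -- order it has reached.
  let p : (j : ℕ) → {p : S₀ n r // XVanish m p ∧ TVanish (s + j) p} := fun j =>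
    Nat.rec ⟨g, hgX, by simpa using hgT⟩ (fun j q => ⟨q.1 - Φ (F j q),
      q.2.1.sub (hX (hF1 j q)), by
        have := hF3 j q
        push_cast
        rwa [← add_assoc]⟩) j
  have hp : ∀ j, (p (j + 1)).1 = (p j).1 - Φ (F j (p j)) := fun j => rfl
  obtain ⟨w, h1, h2, h3⟩ := exists_sum (fun j => F j (p j)) (fun j => hF1 j (p j))
    (fun j => hF2 j (p j))
  refine ⟨w, h1, h2, ?_⟩
  have hsum : ∀ N : ℕ, g - Φ (∑ j ∈ Finset.range N, F j (p j)) = (p N).1 := by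
    intro N
    induction N with
    | zero => simp; rfl
    | succ N ih => rw [Finset.sum_range_succ, map_add, hp, ← ih]; abel
  refine (sub_eq_zero.mp (TVanish.eq_zero fun l => ?_))
  have e1 := (hT (h3 (l - s).toNat)).sub (p (l - s).toNat).2.2
  rw [← hsum, map_sub] at e1
  have e2 : Φ w - Φ (∑ j ∈ Finset.range (l - s).toNat, F j (p j)) -
      (g - Φ (∑ j ∈ Finset.range (l - s).toNat, F j (p j))) = Φ w - g := by abel
  rw [e2] at e1
  exact e1.mono (by omega)

end Leading

/-! ## The resolvent -/

namespace TaylorData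

variable {n r : ℕ} {D : TaylorData n r}

theorem Good.Q_tVanish (hD : D.Good) {s : ℤ} {w : S₀ n r} (hw : TVanish s w) :
    TVanish s (D.Q w) := (hD.Q_leading hw).1

theorem Good.leadHom_Q (hD : D.Good) {s : ℤ} {w : S₀ n r} (hw : TVanish s w) :
    leadHom s (D.Q w) = D.Q₀Hom (leadHom s w) := funext (hD.Q_leading hw).2

/-- `z` is not an eigenvalue of the harmonic oscillator. -/
def NonEnergy (D : TaylorData n r) (z : ℂ) : Prop := ∀ a, (D.energy a : ℂ) ≠ z

theorem polInner_sum (hlam : ∀ i, 0 < D.lam i) (a : (Fin n → ℕ) × Fin r)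
    (s : Finset ((Fin n → ℕ) × Fin r)) (c : (Fin n → ℕ) × Fin r → ℂ) (ha : a ∈ s) :
    D.polInner (D.hPol a) (∑ b ∈ s, c b • D.hPol b) = c a := by
  have : ∑ k, MvPolynomial.map (starRingEnd ℂ) (D.hPol a k) * (∑ b ∈ s, c b • D.hPol b) k =
      ∑ b ∈ s, MvPolynomial.C (c b) *
        ∑ k, MvPolynomial.map (starRingEnd ℂ) (D.hPol a k) * D.hPol b k := by
    simp only [Finset.sum_apply, Pi.smul_apply, MvPolynomial.smul_eq_C_mul, Finset.mul_sum]
    rw [Finset.sum_comm]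
    refine Finset.sum_congr rfl fun b _ => Finset.sum_congr rfl fun k _ => ?_
    ring
  have h2 : D.polInner (D.hPol a) (∑ b ∈ s, c b • D.hPol b) =
      ∑ b ∈ s, c b * D.polInner (D.hPol a) (D.hPol b) := by
    rw [polInner, this, gauss_sum D hlam]
    exact Finset.sum_congr rfl fun b _ => D.gauss_C_mul _ _
  rw [h2, Finset.sum_eq_single a]
  · rw [polInner_hPol hlam, if_pos rfl, mul_one]
  · intro b _ hb
    rw [polInner_hPol hlam, if_neg (Ne.symm hb), mul_zero]
  · exact fun h => absurd ha h

theorem linearIndependent_hPol (hlam : ∀ i, 0 < D.lam i) :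
    LinearIndependent ℂ D.hPol := by
  rw [linearIndependent_iff']
  intro s c h a ha
  rw [← polInner_sum hlam a s c ha, h]
  simp [polInner]

/-- `Q - z`. -/
def Qsub (D : TaylorData n r) (z : ℂ) : Module.End ℂ (S₀ n r) :=
  D.Q - algebraMap ℂ (Module.End ℂ (S₀ n r)) z

theorem Qsub_apply (z : ℂ) (w : S₀ n r) : D.Qsub z w = D.Q w - z • w := rfl

theorem Good.Qsub_tVanish (hD : D.Good) (z : ℂ) {s : ℤ} {w : S₀ n r} (hw : TVanish s w) :
    TVanish s (D.Qsub z w) := (hD.Q_tVanish hw).sub (hw.smul z)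

theorem Good.Qsub_xVanish (hD : D.Good) (z : ℂ) {s : ℤ} {w : S₀ n r} (hw : XVanish s w) :
    XVanish s (D.Qsub z w) := (hD.Q_xVanish hw).sub (hw.smul z)

theorem Good.leadHom_Qsub (hD : D.Good) (z : ℂ) {s : ℤ} {w : S₀ n r} (hw : TVanish s w) :
    leadHom s (D.Qsub z w) = D.Q₀Hom (leadHom s w) - z • leadHom s w := by
  rw [Qsub_apply, map_sub, map_smul, hD.leadHom_Q hw]

theorem Good.leadHom_expansion (hD : D.Good) (s : ℤ) (w : S₀ n r) :
    ∃ (t : Finset ((Fin n → ℕ) × Fin r)) (c : (Fin n → ℕ) × Fin r → ℂ),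
      leadHom s w = ∑ a ∈ t, c a • D.hPol a := by
  obtain ⟨m, hm⟩ := exists_XVanish w
  obtain ⟨t, c, -, h⟩ := exists_hPol_expansion hD.lam_pos (s - m).toNat (leadHom s w)
    fun k α hα => hm.coeff_leadHom k α hα
  exact ⟨t, c, h⟩

theorem Q₀Hom_sub_sum (hlam : ∀ i, 0 < D.lam i) (z : ℂ) (t : Finset ((Fin n → ℕ) × Fin r))
    (c : (Fin n → ℕ) × Fin r → ℂ) :
    D.Q₀Hom (∑ a ∈ t, c a • D.hPol a) - z • ∑ a ∈ t, c a • D.hPol a =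
      ∑ a ∈ t, (c a * (D.energy a - z)) • D.hPol a := by
  rw [map_sum, Finset.smul_sum, ← Finset.sum_sub_distrib]
  refine Finset.sum_congr rfl fun a _ => ?_
  rw [map_smul, Q₀_hPol hlam, smul_smul, smul_smul, ← sub_smul]
  congr 1
  ring

/-- At each order the lowest coefficient is expanded in Hermite vectors, and each term is divided by
its energy minus z. The degree control in the expansion keeps the correction in the same filtration
step. -/
theorem Good.Qsub_preimage (hD : D.Good) {z : ℂ} (hz : D.NonEnergy z) {m s : ℤ} {g : S₀ n r}
    (hgX : XVanish m g) (hgT : TVanish s g) :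
    ∃ w, XVanish m w ∧ TVanish s w ∧ D.Qsub z w = g := by
  refine exists_preimage (hD.Qsub_tVanish z) (hD.Qsub_xVanish z) ?_ hgX hgT
  intro m s g hX hT
  by_cases hms : m ≤ s
  · obtain ⟨t, c, ht, h⟩ := exists_hPol_expansion hD.lam_pos (s - m).toNat (leadHom s g)
      fun k α hα => hX.coeff_leadHom k α hα
    refine ⟨tPol s (∑ a ∈ t, (c a / (D.energy a - z)) • D.hPol a), ?_, tPol_tVanish _ _, ?_⟩
    · refine xVanish_tPol (d := (s - m).toNat) (fun k α hα => ?_) (by omega)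
      rw [Finset.sum_apply, MvPolynomial.coeff_sum]
      refine Finset.sum_eq_zero fun a ha => ?_
      rw [Pi.smul_apply, MvPolynomial.coeff_smul,
        coeff_hPol a k α (lt_of_le_of_lt (ht a ha) hα), smul_zero]
    · have hT' := hT.sub (hD.Qsub_tVanish z (tPol_tVanish (r := r) (n := n) s
        (∑ a ∈ t, (c a / (D.energy a - z)) • D.hPol a)))
      rw [hT'.succ_iff, map_sub, hD.leadHom_Qsub z (tPol_tVanish _ _), leadHom_tPol,
        Q₀Hom_sub_sum hD.lam_pos, h, sub_eq_zero]
      refine Finset.sum_congr rfl fun a _ => ?_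
      rw [div_mul_cancel₀ _ (sub_ne_zero.mpr (hz a))]
  -- For s < m the degree bound already makes the coefficient of t^s vanish, so no correction is
  -- needed.
  · refine ⟨0, XVanish.zero, TVanish.zero, ?_⟩
    rw [map_zero, sub_zero]
    exact hX.tVanish.mono (by omega)

/-- The lowest coefficient of a kernel element lies in the kernel of the oscillator minus z, which
is trivial. So its order in t increases without bound. -/
theorem Good.Qsub_injective (hD : D.Good) {z : ℂ} (hz : D.NonEnergy z) :
    Function.Injective (D.Qsub z) := by
  rw [injective_iff_map_eq_zero]
  intro w hw
  obtain ⟨m, hm⟩ := exists_XVanish w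
  have key : ∀ j : ℕ, TVanish (m + j) w := by
    intro j
    induction j with
    | zero => simpa using hm.tVanish
    | succ j ih =>
      push_cast
      rw [← add_assoc, ih.succ_iff]
      obtain ⟨t, c, -, h⟩ := exists_hPol_expansion hD.lam_pos (m + j - m).toNat (leadHom (m + j) w)
        fun k α hα => hm.coeff_leadHom k α hα
      have e := hD.leadHom_Qsub z ih
      rw [hw, map_zero, h, Q₀Hom_sub_sum hD.lam_pos] at e
      rw [h]
      refine Finset.sum_eq_zero fun a ha => ?_
      have := linearIndependent_iff'.mp (linearIndependent_hPol hD.lam_pos) t _ e.symm a ha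
      rw [(mul_eq_zero.mp this).resolve_right (sub_ne_zero.mpr (hz a)), zero_smul]
  refine TVanish.eq_zero fun s => (key (s - m).toNat).mono (by omega)

/-- This makes `resolvent` meaningful, since `Ring.inverse` takes the default value 0 on non-units.
-/
theorem Good.isUnit_Qsub (hD : D.Good) {z : ℂ} (hz : D.NonEnergy z) : IsUnit (D.Qsub z) := by
  rw [Module.End.isUnit_iff]
  refine ⟨hD.Qsub_injective hz, fun g => ?_⟩
  obtain ⟨m, hm⟩ := exists_XVanish g
  obtain ⟨w, -, -, hw⟩ := hD.Qsub_preimage hz hm hm.tVanish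
  exact ⟨w, hw⟩

theorem Good.resolvent_Qsub (hD : D.Good) {z : ℂ} (hz : D.NonEnergy z) (w : S₀ n r) :
    D.resolvent z (D.Qsub z w) = w :=
  congr_arg (fun f : Module.End ℂ (S₀ n r) => f w) (Ring.inverse_mul_cancel _ (hD.isUnit_Qsub hz))

theorem Good.resolvent_tVanish (hD : D.Good) {z : ℂ} (hz : D.NonEnergy z) {s : ℤ} {w : S₀ n r}
    (hw : TVanish s w) : TVanish s (D.resolvent z w) := by
  obtain ⟨m, hm⟩ := exists_XVanish w
  obtain ⟨v, -, hv, rfl⟩ := hD.Qsub_preimage hz hm hw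
  rwa [hD.resolvent_Qsub hz]

/-- The degree bound does not depend on z, so coefficientwise integration over the circle stays
inside 𝔖₀. -/
theorem Good.resolvent_xVanish (hD : D.Good) {z : ℂ} (hz : D.NonEnergy z) {m : ℤ} {w : S₀ n r}
    (hw : XVanish m w) : XVanish m (D.resolvent z w) := by
  obtain ⟨v, hv, -, rfl⟩ := hD.Qsub_preimage hz hw hw.tVanish
  rwa [hD.resolvent_Qsub hz]

end TaylorData

/-! ## The spectral projection -/

open Polynomial in
/-- `∏ (X - E)` over a list. -/
def rootPoly (l : List ℂ) : Polynomial ℂ := (l.map fun E => X - C E).prod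

theorem rootPoly_nil : rootPoly [] = 1 := rfl

theorem rootPoly_cons (E : ℂ) (l : List ℂ) :
    rootPoly (E :: l) = (Polynomial.X - Polynomial.C E) * rootPoly l := List.prod_cons

theorem rootPoly_append (l l' : List ℂ) : rootPoly (l ++ l') = rootPoly l * rootPoly l' := by
  rw [rootPoly, List.map_append, List.prod_append]
  rfl

theorem eval_rootPoly_of_mem {l : List ℂ} {E : ℂ} (h : E ∈ l) : (rootPoly l).eval E = 0 := by
  induction l with
  | nil => simp at h
  | cons a l ih =>
    rw [rootPoly_cons, Polynomial.eval_mul]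
    rcases List.mem_cons.mp h with rfl | h
    · simp
    · rw [ih h, mul_zero]

theorem isCoprime_rootPoly {l l' : List ℂ} (h : ∀ E ∈ l, ∀ E' ∈ l', E ≠ E') :
    IsCoprime (rootPoly l) (rootPoly l') := by
  induction l with
  | nil => exact isCoprime_one_left
  | cons a l ih =>
    rw [rootPoly_cons]
    refine IsCoprime.mul_left ?_ (ih fun E hE => h E (List.mem_cons_of_mem _ hE))
    replace h := h a List.mem_cons_self
    clear ih
    induction l' with
    | nil => exact isCoprime_one_right
    | cons b l' ih =>
      rw [rootPoly_cons]
      refine IsCoprime.mul_right (Polynomial.isCoprime_X_sub_C_of_isUnit_sub ?_)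
        (ih fun E hE => h E (List.mem_cons_of_mem _ hE))
      exact (sub_ne_zero.mpr (h b List.mem_cons_self)).isUnit

namespace TaylorData

variable {n r : ℕ} {D : TaylorData n r}

/-- `p(Q)`. -/
def pQ (D : TaylorData n r) (p : Polynomial ℂ) : Module.End ℂ (S₀ n r) :=
  Polynomial.aeval D.Q p

theorem pQ_mul (p q : Polynomial ℂ) (w : S₀ n r) : D.pQ (p * q) w = D.pQ p (D.pQ q w) := by
  rw [pQ, map_mul]
  rfl

theorem pQ_one (w : S₀ n r) : D.pQ 1 w = w := by
  rw [pQ, map_one]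
  rfl

theorem pQ_X_sub_C (E : ℂ) : D.pQ (Polynomial.X - Polynomial.C E) = D.Qsub E := by
  rw [pQ, map_sub, Polynomial.aeval_X, Polynomial.aeval_C]
  rfl

theorem pQ_rootPoly_cons (E : ℂ) (l : List ℂ) (w : S₀ n r) :
    D.pQ (rootPoly (E :: l)) w = D.pQ (rootPoly l) (D.Qsub E w) := by
  rw [rootPoly_cons, mul_comm, pQ_mul, pQ_X_sub_C]

theorem pQ_intertwine {Φ : S₀ n r →ₗ[ℂ] S₀ n r} (hΦ : ∀ w, Φ (D.Q w) = D.Q (Φ w))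
    (p : Polynomial ℂ) (w : S₀ n r) : Φ (D.pQ p w) = D.pQ p (Φ w) := by
  induction p using Polynomial.induction_on generalizing w with
  | C a =>
    simp only [pQ, Polynomial.aeval_C]
    exact map_smul Φ a w
  | add p q hp hq =>
    simp only [pQ, map_add, LinearMap.add_apply] at hp hq ⊢
    rw [hp, hq]
  | monomial k a ih =>
    rw [pow_succ, ← mul_assoc, pQ_mul _ Polynomial.X, pQ_mul _ Polynomial.X, ih]
    have e : D.pQ Polynomial.X = D.Q := Polynomial.aeval_X _
    rw [e, hΦ]

/-- A polynomial in `Q` acts on lowest coefficients as the same polynomial in the oscillator. In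
particular, factors Q - E can annihilate a lowest coefficient. -/
theorem Good.pQ_tVanish (hD : D.Good) (p : Polynomial ℂ) {s : ℤ} {w : S₀ n r}
    (hw : TVanish s w) :
    TVanish s (D.pQ p w) ∧ leadHom s (D.pQ p w) = Polynomial.aeval D.Q₀Hom p (leadHom s w) := by
  induction p using Polynomial.induction_on generalizing w with
  | C a =>
    have : D.pQ (Polynomial.C a) w = a • w := by
      rw [pQ, Polynomial.aeval_C]
      rfl
    rw [this, Polynomial.aeval_C, map_smul]
    exact ⟨hw.smul a, rfl⟩
  | add p q hp hq =>
    have : D.pQ (p + q) w = D.pQ p w + D.pQ q w := by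
      rw [pQ, map_add]
      rfl
    rw [this, map_add, map_add, (hp hw).2, (hq hw).2]
    exact ⟨(hp hw).1.add (hq hw).1, rfl⟩
  | monomial k a ih =>
    have e : D.pQ Polynomial.X w = D.Q w := by rw [pQ, Polynomial.aeval_X]
    rw [pow_succ, ← mul_assoc, pQ_mul, e]
    refine ⟨(ih (hD.Q_tVanish hw)).1, ?_⟩
    rw [(ih (hD.Q_tVanish hw)).2, hD.leadHom_Q hw, map_mul _ (_ * _) Polynomial.X,
      Polynomial.aeval_X]
    rfl

theorem aeval_Q₀Hom_hPol (hlam : ∀ i, 0 < D.lam i) (p : Polynomial ℂ)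
    (a : (Fin n → ℕ) × Fin r) :
    Polynomial.aeval D.Q₀Hom p (D.hPol a) = p.eval (D.energy a : ℂ) • D.hPol a :=
  Module.End.aeval_apply_of_hasEigenvector
    ⟨Module.End.mem_eigenspace_iff.mpr (Q₀_hPol hlam a), (linearIndependent_hPol hlam).ne_zero a⟩

/-- Modulo `ħ^{s/2}`, the vector `v` is a generalized eigenvector. -/
def Near (D : TaylorData n r) (E₀ : ℝ) (s : ℤ) (v : S₀ n r) : Prop :=
  ∃ l : List ℂ, (∀ E ∈ l, E = E₀) ∧ TVanish s (D.pQ (rootPoly l) v)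

/-- Modulo `ħ^{s/2}`, the vector `v` is a sum of generalized eigenvectors for the other
energies. -/
def Far (D : TaylorData n r) (E₀ : ℝ) (s : ℤ) (v : S₀ n r) : Prop :=
  ∃ l : List ℂ, (∀ E ∈ l, ∃ a, E = D.energy a ∧ D.energy a ≠ E₀) ∧
    TVanish s (D.pQ (rootPoly l) v)

theorem Good.exists_rootPoly_add (hD : D.Good) {s : ℤ} {v w : S₀ n r} {l l' : List ℂ}
    (h : TVanish s (D.pQ (rootPoly l) v)) (h' : TVanish s (D.pQ (rootPoly l') w)) :
    TVanish s (D.pQ (rootPoly (l ++ l')) (v + w)) := by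
  rw [rootPoly_append, map_add]
  refine TVanish.add ?_ ?_
  · rw [mul_comm, pQ_mul]
    exact (hD.pQ_tVanish _ h).1
  · rw [pQ_mul]
    exact (hD.pQ_tVanish _ h').1

theorem Good.near_add (hD : D.Good) {E₀ : ℝ} {s : ℤ} {v w : S₀ n r} (hv : D.Near E₀ s v)
    (hw : D.Near E₀ s w) : D.Near E₀ s (v + w) := by
  obtain ⟨l, h1, h2⟩ := hv
  obtain ⟨l', h1', h2'⟩ := hw
  exact ⟨l ++ l', fun E hE => (List.mem_append.mp hE).elim (h1 E) (h1' E),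
    hD.exists_rootPoly_add h2 h2'⟩

theorem Good.far_add (hD : D.Good) {E₀ : ℝ} {s : ℤ} {v w : S₀ n r} (hv : D.Far E₀ s v)
    (hw : D.Far E₀ s w) : D.Far E₀ s (v + w) := by
  obtain ⟨l, h1, h2⟩ := hv
  obtain ⟨l', h1', h2'⟩ := hw
  exact ⟨l ++ l', fun E hE => (List.mem_append.mp hE).elim (h1 E) (h1' E),
    hD.exists_rootPoly_add h2 h2'⟩

theorem near_of_tVanish {E₀ : ℝ} {s : ℤ} {v : S₀ n r} (hv : TVanish s v) : D.Near E₀ s v :=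
  ⟨[], by simp, by rwa [rootPoly_nil, pQ_one]⟩

theorem far_of_tVanish {E₀ : ℝ} {s : ℤ} {v : S₀ n r} (hv : TVanish s v) : D.Far E₀ s v :=
  ⟨[], by simp, by rwa [rootPoly_nil, pQ_one]⟩

theorem Near.map {Φ : S₀ n r →ₗ[ℂ] S₀ n r} (hΦ : ∀ w, Φ (D.Q w) = D.Q (Φ w)) {s s' : ℤ}
    (hT : ∀ w, TVanish s w → TVanish s' (Φ w)) {E₀ : ℝ} {v : S₀ n r} (hv : D.Near E₀ s v) :
    D.Near E₀ s' (Φ v) := by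
  obtain ⟨l, h1, h2⟩ := hv
  exact ⟨l, h1, by rw [← pQ_intertwine hΦ]; exact hT _ h2⟩

theorem Far.map {Φ : S₀ n r →ₗ[ℂ] S₀ n r} (hΦ : ∀ w, Φ (D.Q w) = D.Q (Φ w)) {s s' : ℤ}
    (hT : ∀ w, TVanish s w → TVanish s' (Φ w)) {E₀ : ℝ} {v : S₀ n r} (hv : D.Far E₀ s v) :
    D.Far E₀ s' (Φ v) := by
  obtain ⟨l, h1, h2⟩ := hv
  exact ⟨l, h1, by rw [← pQ_intertwine hΦ]; exact hT _ h2⟩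

theorem Near.neg {E₀ : ℝ} {s : ℤ} {v : S₀ n r} (hv : D.Near E₀ s v) : D.Near E₀ s (-v) :=
  hv.map (Φ := -LinearMap.id) (fun w => (map_neg D.Q w).symm) fun w hw => by
    have := TVanish.zero.sub hw
    rwa [zero_sub] at this

theorem Far.neg {E₀ : ℝ} {s : ℤ} {v : S₀ n r} (hv : D.Far E₀ s v) : D.Far E₀ s (-v) :=
  hv.map (Φ := -LinearMap.id) (fun w => (map_neg D.Q w).symm) fun w hw => by
    have := TVanish.zero.sub hw
    rwa [zero_sub] at this

theorem Good.near_sub (hD : D.Good) {E₀ : ℝ} {s : ℤ} {v w : S₀ n r} (hv : D.Near E₀ s v)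
    (hw : D.Near E₀ s w) : D.Near E₀ s (v - w) := by
  rw [sub_eq_add_neg]
  exact hD.near_add hv hw.neg

theorem Good.far_sub (hD : D.Good) {E₀ : ℝ} {s : ℤ} {v w : S₀ n r} (hv : D.Far E₀ s v)
    (hw : D.Far E₀ s w) : D.Far E₀ s (v - w) := by
  rw [sub_eq_add_neg]
  exact hD.far_add hv hw.neg

/-- The two annihilating polynomials have no common root, so Bézout's identity writes `v` as a
combination of vectors that vanish below order s. -/
theorem Good.tVanish_of_near_of_far (hD : D.Good) {E₀ : ℝ} {s : ℤ} {v : S₀ n r}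
    (h : D.Near E₀ s v) (h' : D.Far E₀ s v) : TVanish s v := by
  obtain ⟨l, h1, h2⟩ := h
  obtain ⟨l', h1', h2'⟩ := h'
  obtain ⟨a, b, hab⟩ := isCoprime_rootPoly (l := l) (l' := l') (by
    intro E hE E' hE' h
    obtain ⟨c, hc, hne⟩ := h1' E' hE'
    rw [h1 E hE, hc] at h
    exact hne (by exact_mod_cast h.symm))
  have e : v = D.pQ a (D.pQ (rootPoly l) v) + D.pQ b (D.pQ (rootPoly l') v) := by
    rw [← pQ_mul, ← pQ_mul, ← LinearMap.add_apply, pQ, pQ, ← map_add, hab, map_one]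
    rfl
  rw [e]
  exact (hD.pQ_tVanish a h2).1.add (hD.pQ_tVanish b h2').1

/-- Each lowest coefficient is a finite combination of oscillator eigenvectors; the factors for
their energies annihilate it and raise the order by one. -/
theorem Good.exists_rootPoly (hD : D.Good) (u : S₀ n r) (s : ℤ) :
    ∃ l : List ℂ, (∀ E ∈ l, ∃ a, E = D.energy a) ∧ TVanish s (D.pQ (rootPoly l) u) := by
  obtain ⟨m, hm⟩ := exists_XVanish u
  have key : ∀ j : ℕ, ∃ l : List ℂ, (∀ E ∈ l, ∃ a, E = D.energy a) ∧
      TVanish (m + j) (D.pQ (rootPoly l) u) := by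
    intro j
    induction j with
    | zero => exact ⟨[], by simp, by simpa [rootPoly_nil, pQ_one] using hm.tVanish⟩
    | succ j ih =>
      obtain ⟨l, h1, h2⟩ := ih
      obtain ⟨t, c, h⟩ := hD.leadHom_expansion (m + j) (D.pQ (rootPoly l) u)
      refine ⟨(t.toList.map fun a => (D.energy a : ℂ)) ++ l, ?_, ?_⟩
      · intro E hE
        rcases List.mem_append.mp hE with hE | hE
        · obtain ⟨a, -, rfl⟩ := List.mem_map.mp hE
          exact ⟨a, rfl⟩
        · exact h1 E hE
      · obtain ⟨h3, h4⟩ := hD.pQ_tVanish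
          (rootPoly (t.toList.map fun a => (D.energy a : ℂ))) h2
        rw [rootPoly_append, pQ_mul]
        push_cast
        rw [← add_assoc, h3.succ_iff, h4, h, map_sum]
        refine Finset.sum_eq_zero fun a ha => ?_
        rw [map_smul, aeval_Q₀Hom_hPol hD.lam_pos, eval_rootPoly_of_mem, zero_smul, smul_zero]
        exact List.mem_map.mpr ⟨a, Finset.mem_toList.mpr ha, rfl⟩
  obtain ⟨l, h1, h2⟩ := key (s - m).toNat
  exact ⟨l, h1, h2.mono (by omega)⟩

theorem exists_rootPoly_split (E₀ : ℝ) {l : List ℂ} (h : ∀ E ∈ l, ∃ a, E = D.energy a) :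
    ∃ l₀ l₁ : List ℂ, (∀ E ∈ l₀, E = E₀) ∧ (∀ E ∈ l₁, ∃ a, E = D.energy a ∧ D.energy a ≠ E₀) ∧
      rootPoly l = rootPoly l₀ * rootPoly l₁ := by
  induction l with
  | nil => exact ⟨[], [], by simp, by simp, by simp [rootPoly_nil]⟩
  | cons E l ih =>
    obtain ⟨l₀, l₁, h0, h1, h2⟩ := ih fun E hE => h E (List.mem_cons_of_mem _ hE)
    obtain ⟨a, ha⟩ := h E List.mem_cons_self
    by_cases hE : D.energy a = E₀
    · refine ⟨E :: l₀, l₁, ?_, h1, by rw [rootPoly_cons, rootPoly_cons, h2, mul_assoc]⟩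
      intro E' hE'
      rcases List.mem_cons.mp hE' with rfl | hE'
      · rw [ha, hE]
      · exact h0 E' hE'
    · refine ⟨l₀, E :: l₁, h0, ?_, by rw [rootPoly_cons, rootPoly_cons, h2]; ring⟩
      intro E' hE'
      rcases List.mem_cons.mp hE' with rfl | hE'
      · exact ⟨a, ha, hE⟩
      · exact h1 E' hE'

/-- The primary decomposition modulo t^s. With a p₀ + b p₁ = 1 for the annihilating factors p₀ at E₀
and p₁ elsewhere, the vector b p₁ applied to `u` is annihilated by p₀, and the remainder by p₁. -/
theorem Good.exists_near_far (hD : D.Good) (E₀ : ℝ) (u : S₀ n r) (s : ℤ) :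
    ∃ v, D.Near E₀ s v ∧ D.Far E₀ s (u - v) := by
  obtain ⟨l, h1, h2⟩ := hD.exists_rootPoly u s
  obtain ⟨l₀, l₁, h0, h1, e⟩ := exists_rootPoly_split E₀ h1
  obtain ⟨a, b, hab⟩ := isCoprime_rootPoly (l := l₀) (l' := l₁) (by
    intro E hE E' hE' h
    obtain ⟨c, hc, hne⟩ := h1 E' hE'
    rw [h0 E hE, hc] at h
    exact hne (by exact_mod_cast h.symm))
  rw [e] at h2
  refine ⟨D.pQ (b * rootPoly l₁) u, ⟨l₀, h0, ?_⟩, ⟨l₁, h1, ?_⟩⟩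
  · rw [← pQ_mul, mul_left_comm, pQ_mul]
    exact (hD.pQ_tVanish b h2).1
  · have e1 : u - D.pQ (b * rootPoly l₁) u = D.pQ (a * rootPoly l₀) u := by
      rw [sub_eq_iff_eq_add, ← LinearMap.add_apply, pQ, pQ, ← map_add, hab, map_one]
      rfl
    rw [e1, ← pQ_mul, mul_left_comm, mul_comm (rootPoly l₁), pQ_mul]
    exact (hD.pQ_tVanish a h2).1

/-! ### The contour integral -/

/-- A coefficient of an element of `𝔖₀`. -/
def cf (k : Fin r) (m : ℤ) (α : Fin n →₀ ℕ) (w : S₀ n r) : ℂ :=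
  MvPolynomial.coeff α ((w.val k).coeff m)

theorem cf_add (k : Fin r) (m : ℤ) (α : Fin n →₀ ℕ) (v w : S₀ n r) :
    cf k m α (v + w) = cf k m α v + cf k m α w := by
  rw [cf, S₀.val_add, HahnSeries.coeff_add, MvPolynomial.coeff_add]
  rfl

theorem cf_smul (k : Fin r) (m : ℤ) (α : Fin n →₀ ℕ) (c : ℂ) (w : S₀ n r) :
    cf k m α (c • w) = c * cf k m α w := by
  rw [cf, map_smul]
  exact MvPolynomial.coeff_smul α c _

theorem cf_of_tVanish {k : Fin r} {m s : ℤ} {α : Fin n →₀ ℕ} {w : S₀ n r} (hw : TVanish s w)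
    (h : m < s) : cf k m α w = 0 := by
  rw [cf, hw k m h, MvPolynomial.coeff_zero]

/-- This is Q - E = (Q - z) + (z - E) with the resolvent applied. It trades one annihilating factor
for one power of z - E. -/
theorem Good.cf_resolvent_Qsub (hD : D.Good) {z : ℂ} (hz : D.NonEnergy z) (E : ℂ) (k : Fin r)
    (m : ℤ) (α : Fin n →₀ ℕ) (v : S₀ n r) :
    cf k m α (D.resolvent z (D.Qsub E v)) =
      cf k m α v + (z - E) * cf k m α (D.resolvent z v) := by
  have e : D.Qsub E v = D.Qsub z v + (z - E) • v := by
    rw [Qsub_apply, Qsub_apply, sub_smul]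
    abel
  rw [e, map_add, hD.resolvent_Qsub hz, map_smul, cf_add, cf_smul]

/-- Solving the preceding identity for the resolvent on `v` divides by z - E for each factor, until
the remaining vector vanishes below order s and no longer contributes to coefficient m. So poles
occur only at the listed energies. -/
theorem Good.cf_resolvent_rational (hD : D.Good) (k : Fin r) {m s : ℤ} (hms : m < s)
    (α : Fin n →₀ ℕ) (l : List ℂ) (v : S₀ n r) (h : TVanish s (D.pQ (rootPoly l) v)) :
    ∃ g : ℂ → ℂ, (∀ z ∉ l, DifferentiableAt ℂ g z) ∧
      ∀ z, D.NonEnergy z → z ∉ l → cf k m α (D.resolvent z v) = g z := by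
  induction l generalizing v with
  | nil =>
    rw [rootPoly_nil, pQ_one] at h
    exact ⟨fun _ => 0, fun z _ => differentiableAt_const _, fun z hz _ =>
      cf_of_tVanish (hD.resolvent_tVanish hz h) hms⟩
  | cons E l ih =>
    rw [pQ_rootPoly_cons] at h
    obtain ⟨g, hg, hg'⟩ := ih _ h
    refine ⟨fun z => (z - E)⁻¹ * (g z - cf k m α v), fun z hz => ?_, fun z hz hzl => ?_⟩
    · rw [List.mem_cons, not_or] at hz
      exact ((differentiableAt_id.sub_const E).inv (sub_ne_zero.mpr hz.1)).mul
        ((hg z hz.2).sub_const _)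
    · rw [List.mem_cons, not_or] at hzl
      dsimp only
      rw [← hg' z hz hzl.2, hD.cf_resolvent_Qsub hz, add_sub_cancel_left, ← mul_assoc,
        inv_mul_cancel₀ (sub_ne_zero.mpr hzl.1), one_mul]

/-- The circle `|z - E₀| = ε` separates `E₀` from the other energies. -/
def Separates (D : TaylorData n r) (E₀ ε : ℝ) : Prop :=
  0 < ε ∧ ∀ a, |D.energy a - E₀| ≤ ε → D.energy a = E₀

variable {E₀ ε : ℝ}

theorem Separates.nonEnergy (hs : D.Separates E₀ ε) {z : ℂ}
    (hz : z ∈ Metric.sphere (E₀ : ℂ) ε) : D.NonEnergy z := by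
  rintro a rfl
  rw [mem_sphere_iff_norm, ← Complex.ofReal_sub, Complex.norm_real, Real.norm_eq_abs] at hz
  have := hs.2 a hz.le
  rw [this, sub_self, abs_zero] at hz
  exact hs.1.ne hz

theorem Separates.not_mem_closedBall (hs : D.Separates E₀ ε) {l : List ℂ}
    (hl : ∀ E ∈ l, ∃ a, E = D.energy a ∧ D.energy a ≠ E₀) {z : ℂ}
    (hz : z ∈ Metric.closedBall (E₀ : ℂ) ε) : z ∉ l := by
  intro hzl
  obtain ⟨a, rfl, hne⟩ := hl z hzl
  rw [mem_closedBall_iff_norm, ← Complex.ofReal_sub, Complex.norm_real, Real.norm_eq_abs] at hz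
  exact hne (hs.2 a hz)

theorem Good.continuousOn_cf_resolvent (hD : D.Good) (hs : D.Separates E₀ ε) (k : Fin r)
    {m s : ℤ} (hms : m < s) (α : Fin n →₀ ℕ) {l : List ℂ}
    (hl : ∀ z ∈ Metric.sphere (E₀ : ℂ) ε, z ∉ l) {v : S₀ n r}
    (h : TVanish s (D.pQ (rootPoly l) v)) :
    ContinuousOn (fun z => cf k m α (D.resolvent z v)) (Metric.sphere (E₀ : ℂ) ε) := by
  obtain ⟨g, hg, hg'⟩ := hD.cf_resolvent_rational k hms α l v h
  exact ContinuousOn.congr (f := g)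
    (fun z hz => (hg z (hl z hz)).continuousAt.continuousWithinAt)
    fun z hz => hg' z (hs.nonEnergy hz) (hl z hz)

/-- All poles belong to energies outside the closed disc, so Cauchy's theorem applies. -/
theorem Good.circleIntegral_far (hD : D.Good) (hs : D.Separates E₀ ε) (k : Fin r)
    {m s : ℤ} (hms : m < s) (α : Fin n →₀ ℕ) {v : S₀ n r} (h : D.Far E₀ s v) :
    ∮ z in C((E₀ : ℂ), ε), cf k m α (D.resolvent z v) = 0 := by
  obtain ⟨l, hl, hv⟩ := h
  obtain ⟨g, hg, hg'⟩ := hD.cf_resolvent_rational k hms α l v hv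
  rw [circleIntegral.integral_congr hs.1.le (g := g) fun z hz =>
    hg' z (hs.nonEnergy hz) (hs.not_mem_closedBall hl (Metric.sphere_subset_closedBall hz))]
  refine Complex.circleIntegral_eq_zero_of_differentiable_on_off_countable hs.1.le
    Set.countable_empty (fun z hz => ?_) fun z hz => ?_
  · exact (hg z (hs.not_mem_closedBall hl hz)).continuousAt.continuousWithinAt
  · exact hg z (hs.not_mem_closedBall hl (Metric.ball_subset_closedBall hz.1))

theorem not_mem_of_sphere (hε : 0 < ε) {l : List ℂ} (hl : ∀ E ∈ l, E = E₀) :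
    ∀ z ∈ Metric.sphere (E₀ : ℂ) ε, z ∉ l := by
  intro z hz hzl
  rw [hl z hzl, mem_sphere_iff_norm, sub_self, norm_zero] at hz
  exact hε.ne hz

/-- Removing one factor Q - E₀ divides by z - E₀. The extra power with exponent -j makes the
statement stable under this step: the resolvent term falls under the induction hypothesis for j + 1
and integrates to zero, and the explicit term has a residue only for j = 0. -/
theorem Good.circleIntegral_near_aux (hD : D.Good) (hs : D.Separates E₀ ε) (k : Fin r)
    {m s : ℤ} (hms : m < s) (α : Fin n →₀ ℕ) (l : List ℂ) (hl : ∀ E ∈ l, E = E₀) (v : S₀ n r)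
    (h : TVanish s (D.pQ (rootPoly l) v)) (j : ℕ) :
    ∮ z in C((E₀ : ℂ), ε), (z - E₀) ^ (-(j : ℤ)) * cf k m α (D.resolvent z v) =
      if j = 0 then -(2 * Real.pi * Complex.I * cf k m α v) else 0 := by
  induction l generalizing v j with
  | nil =>
    rw [rootPoly_nil, pQ_one] at h
    rw [circleIntegral.integral_congr hs.1.le (g := fun _ => 0) fun z hz => by
      dsimp only
      rw [cf_of_tVanish (hD.resolvent_tVanish (hs.nonEnergy hz) h) hms, mul_zero],
      cf_of_tVanish h hms]
    simp [circleIntegral]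
  | cons E l ih =>
    obtain rfl := hl E List.mem_cons_self
    rw [pQ_rootPoly_cons] at h
    have hl' : ∀ E ∈ l, E = E₀ := fun E hE => hl E (List.mem_cons_of_mem _ hE)
    have hne : ∀ z ∈ Metric.sphere (E₀ : ℂ) ε, z - E₀ ≠ 0 := by
      intro z hz h0
      rw [mem_sphere_iff_norm, h0, norm_zero] at hz
      exact hs.1.ne hz
    have hpow : ContinuousOn (fun z : ℂ => (z - E₀) ^ (-((j + 1 : ℕ) : ℤ)))
        (Metric.sphere (E₀ : ℂ) ε) := by
      intro z hz
      exact ((continuousAt_id.sub continuousAt_const).zpow₀ _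
        (Or.inl (hne z hz))).continuousWithinAt
    rw [circleIntegral.integral_congr hs.1.le (g := fun z => (z - E₀) ^ (-((j + 1 : ℕ) : ℤ)) *
        cf k m α (D.resolvent z (D.Qsub E₀ v)) - (z - E₀) ^ (-((j + 1 : ℕ) : ℤ)) * cf k m α v)
        fun z hz => ?_, circleIntegral.integral_sub, ih hl' _ h, if_neg (Nat.succ_ne_zero j),
        zero_sub]
    · have e : ∀ z : ℂ, (z - E₀) ^ (-((j + 1 : ℕ) : ℤ)) * cf k m α v =
        cf k m α v * (z - E₀) ^ (-((j + 1 : ℕ) : ℤ)) := fun z => mul_comm _ _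
      simp_rw [e]
      rw [circleIntegral.integral_const_mul]
      split_ifs with hj
      · subst hj
        have : ∀ z : ℂ, (z - E₀) ^ (-((0 + 1 : ℕ) : ℤ)) = (z - E₀)⁻¹ := fun z => by simp
        simp_rw [this]
        rw [circleIntegral.integral_sub_center_inv _ hs.1.ne', mul_comm]
      · rw [circleIntegral.integral_sub_zpow_of_ne (by push_cast; omega), mul_zero, neg_zero]
    · exact (hpow.mul (hD.continuousOn_cf_resolvent hs k hms α
        (not_mem_of_sphere hs.1 hl') h)).circleIntegrable hs.1.le
    · exact (hpow.mul continuousOn_const).circleIntegrable hs.1.le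
    · dsimp only
      rw [hD.cf_resolvent_Qsub (hs.nonEnergy hz), mul_add, add_sub_cancel_left, ← mul_assoc,
        ← zpow_add_one₀ (hne z hz)]
      congr 2
      push_cast
      ring

theorem Good.circleIntegral_near (hD : D.Good) (hs : D.Separates E₀ ε) (k : Fin r)
    {m s : ℤ} (hms : m < s) (α : Fin n →₀ ℕ) {v : S₀ n r} (h : D.Near E₀ s v) :
    ∮ z in C((E₀ : ℂ), ε), cf k m α (D.resolvent z v) =
      -(2 * Real.pi * Complex.I * cf k m α v) := by
  obtain ⟨l, hl, hv⟩ := h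
  have := hD.circleIntegral_near_aux hs k hms α l hl v hv 0
  simpa using this

theorem Good.circleIntegral_eq (hD : D.Good) (hs : D.Separates E₀ ε) (k : Fin r)
    {m s : ℤ} (hms : m < s) (α : Fin n →₀ ℕ) {u v : S₀ n r} (h : D.Near E₀ s v)
    (h' : D.Far E₀ s (u - v)) :
    -(2 * Real.pi * Complex.I)⁻¹ * ∮ z in C((E₀ : ℂ), ε), cf k m α (D.resolvent z u) =
      cf k m α v := by
  have e : ∀ z, cf k m α (D.resolvent z u) =
      cf k m α (D.resolvent z v) + cf k m α (D.resolvent z (u - v)) := fun z => by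
    rw [← cf_add, ← map_add, add_sub_cancel]
  simp_rw [e]
  rw [circleIntegral.integral_add, hD.circleIntegral_near hs k hms α h,
    hD.circleIntegral_far hs k hms α h', add_zero]
  · field_simp [Complex.I_ne_zero, Real.pi_ne_zero]
  · obtain ⟨l, hl, hv⟩ := h
    exact (hD.continuousOn_cf_resolvent hs k hms α
      (not_mem_of_sphere hs.1 hl) hv).circleIntegrable hs.1.le
  · obtain ⟨l, hl, hv⟩ := h'
    exact (hD.continuousOn_cf_resolvent hs k hms α (fun z hz =>
      hs.not_mem_closedBall hl (Metric.sphere_subset_closedBall hz)) hv).circleIntegrable hs.1.le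

/-- The decompositions modulo different powers of t are compatible, because the contour integral
computes the coefficients of each. Their common limit exists in 𝔖₀ and is the projection. Later only
this algebraic characterization is used, never the integral. -/
theorem Good.proj_spec (hD : D.Good) (hs : D.Separates E₀ ε) (u : S₀ n r) (s : ℤ) :
    D.Near E₀ s (D.proj E₀ ε u) ∧ D.Far E₀ s (u - D.proj E₀ ε u) := by
  choose v hv hv' using hD.exists_near_far E₀ u
  have hint : ∀ {m s : ℤ} (_ : m < s) k α, cf k m α (v s) = cf k m α (v (m + 1)) := by
    intro m s hms k α
    rw [← hD.circleIntegral_eq hs k hms α (hv s) (hv' s),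
      hD.circleIntegral_eq hs k (lt_add_one m) α (hv (m + 1)) (hv' (m + 1))]
  obtain ⟨x, hx⟩ := exists_XVanish u
  -- The resolvent preserves the degree bound of `u` uniformly on the circle. Order m + 1 is the
  -- first at which the coefficient of index m is determined.
  have hzero : ∀ k m (α : Fin n →₀ ℕ), m - α.degree < x → cf k m α (v (m + 1)) = 0 := by
    intro k m α hlt
    rw [← hD.circleIntegral_eq hs k (lt_add_one m) α (hv (m + 1)) (hv' (m + 1)),
      circleIntegral.integral_congr (f := fun z => cf k m α (D.resolvent z u)) hs.1.le
        (g := fun _ => 0) fun z hz =>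
          XVanish_iff.mp (hD.resolvent_xVanish (hs.nonEnergy hz) hx) k m α hlt]
    simp [circleIntegral]
  obtain ⟨w, hw⟩ := exists_of_coeff (m := x) (s := x)
    (fun k m => ((v (m + 1)).val k).coeff m)
    (fun k m hm => MvPolynomial.ext _ _ fun α => by
      rw [MvPolynomial.coeff_zero]
      exact hzero k m α (by omega))
    (fun k m α hlt => hzero k m α hlt)
  -- The integrals are the coefficients of an element of 𝔖₀, so the default value 0 in the
  -- definition of `proj` does not occur.
  have hex : ∃ v : S₀ n r, ∀ (k : Fin r) (m : ℤ) (α : Fin n →₀ ℕ),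
      MvPolynomial.coeff α ((v.val k).coeff m) = -(2 * Real.pi * Complex.I)⁻¹ *
        ∮ z in C((E₀ : ℂ), ε), MvPolynomial.coeff α (((D.resolvent z u).val k).coeff m) := by
    refine ⟨w, fun k m α => ?_⟩
    rw [hw]
    exact (hD.circleIntegral_eq hs k (lt_add_one m) α (hv (m + 1)) (hv' (m + 1))).symm
  have hp : ∀ k m α, cf k m α (D.proj E₀ ε u) = cf k m α (v (m + 1)) := by
    intro k m α
    rw [← hD.circleIntegral_eq hs k (lt_add_one m) α (hv (m + 1)) (hv' (m + 1))]
    rw [proj, dif_pos hex]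
    exact hex.choose_spec k m α
  have hd : TVanish s (D.proj E₀ ε u - v s) := by
    intro k m hm
    refine MvPolynomial.ext _ _ fun α => ?_
    rw [S₀.val_sub, HahnSeries.coeff_sub, MvPolynomial.coeff_sub, MvPolynomial.coeff_zero,
      sub_eq_zero]
    exact (hp k m α).trans (hint hm k α).symm
  constructor
  · have := hD.near_add (hv s) (near_of_tVanish hd)
    rwa [add_sub_cancel] at this
  · have := hD.far_sub (hv' s) (far_of_tVanish hd)
    rwa [sub_sub_sub_cancel_right] at this

/-- The difference of two candidates belongs both to E₀ and to the other energies modulo every power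
of t, hence vanishes. Linearity, idempotence and commutation of the projection all follow from this.
-/
theorem Good.proj_unique (hD : D.Good) (hs : D.Separates E₀ ε) {u v : S₀ n r}
    (h : ∀ s, D.Near E₀ s v ∧ D.Far E₀ s (u - v)) : D.proj E₀ ε u = v := by
  refine sub_eq_zero.mp (TVanish.eq_zero fun s => ?_)
  obtain ⟨h1, h2⟩ := hD.proj_spec hs u s
  refine hD.tVanish_of_near_of_far (hD.near_sub h1 (h s).1) ?_
  have := hD.far_sub (h s).2 h2
  rwa [sub_sub_sub_cancel_left] at this

theorem Good.proj_add (hD : D.Good) (hs : D.Separates E₀ ε) (u v : S₀ n r) :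
    D.proj E₀ ε (u + v) = D.proj E₀ ε u + D.proj E₀ ε v := by
  refine hD.proj_unique hs fun s => ?_
  obtain ⟨h1, h2⟩ := hD.proj_spec hs u s
  obtain ⟨h3, h4⟩ := hD.proj_spec hs v s
  refine ⟨hD.near_add h1 h3, ?_⟩
  rw [add_sub_add_comm]
  exact hD.far_add h2 h4

theorem Good.proj_proj (hD : D.Good) (hs : D.Separates E₀ ε) (u : S₀ n r) :
    D.proj E₀ ε (D.proj E₀ ε u) = D.proj E₀ ε u :=
  hD.proj_unique hs fun s => ⟨(hD.proj_spec hs u s).1, by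
    rw [sub_self]
    exact far_of_tVanish TVanish.zero⟩

/-- The projection commutes with operators that commute with `Q` and are continuous. -/
theorem Good.proj_map (hD : D.Good) (hs : D.Separates E₀ ε) {Φ : S₀ n r →ₗ[ℂ] S₀ n r}
    (hΦ : ∀ w, Φ (D.Q w) = D.Q (Φ w)) {d : ℤ} (hT : ∀ s w, TVanish s w → TVanish (s + d) (Φ w))
    (u : S₀ n r) : D.proj E₀ ε (Φ u) = Φ (D.proj E₀ ε u) := by
  refine hD.proj_unique hs fun s => ?_
  -- `Φ` shifts orders by d, possibly downwards, so the decomposition of `u` is taken to the order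
  -- that the shift turns into s.
  obtain ⟨h1, h2⟩ := hD.proj_spec hs u (s - d)
  have hT' : ∀ w, TVanish (s - d) w → TVanish s (Φ w) := fun w hw => by
    have := hT _ w hw
    rwa [sub_add_cancel] at this
  refine ⟨h1.map hΦ hT', ?_⟩
  rw [← map_sub]
  exact h2.map hΦ hT'

theorem Good.proj_Q (hD : D.Good) (hs : D.Separates E₀ ε) (u : S₀ n r) :
    D.proj E₀ ε (D.Q u) = D.Q (D.proj E₀ ε u) :=
  hD.proj_map hs (fun _ => rfl) (d := 0) (fun s w hw => by
    rw [add_zero]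
    exact hD.Q_tVanish hw) u

theorem Good.proj_theta (hD : D.Good) (hs : D.Separates E₀ ε) (u : S₀ n r) :
    D.proj E₀ ε (thetaS₀ n r u) = thetaS₀ n r (D.proj E₀ ε u) :=
  hD.proj_map hs (fun w => (hD.Q_theta w).symm) (d := 0) (fun s w hw => by
    rw [add_zero]
    exact hw.thetaS₀) u

theorem exists_vanishBelow (a : K) : ∃ d, VanishBelow d a :=
  ⟨_, VanishBelow.order a⟩

theorem Good.proj_scale (hD : D.Good) (hs : D.Separates E₀ ε) (a : K) (u : S₀ n r) :
    D.proj E₀ ε (scale a u) = scale a (D.proj E₀ ε u) := by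
  obtain ⟨d, hd⟩ := exists_vanishBelow a
  exact hD.proj_map hs (Φ := scaleHom a) (fun w => (hD.Q_scale a w).symm) (d := d)
    (fun s w hw => by
      rw [add_comm]
      exact hw.scale hd) u

/-- On lowest coefficients the projection keeps exactly the oscillator eigenvectors of energy E₀. -/
theorem Good.proj_leading (hD : D.Good) (hs : D.Separates E₀ ε) {s : ℤ} {u : S₀ n r}
    (hu : TVanish s u) (t : Finset ((Fin n → ℕ) × Fin r)) (c : (Fin n → ℕ) × Fin r → ℂ)
    (h : leadHom s u = ∑ a ∈ t, c a • D.hPol a) :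
    TVanish s (D.proj E₀ ε u) ∧
      leadHom s (D.proj E₀ ε u) = ∑ a ∈ t with D.energy a = E₀, c a • D.hPol a := by
  obtain ⟨h1, h2⟩ := hD.proj_spec hs u (s + 1)
  set P : Fin r → Pol n := ∑ a ∈ t with D.energy a = E₀, c a • D.hPol a with hP
  have hT := tPol_tVanish s P
  -- Modulo t^{s+1} the candidate is annihilated by the single factor Q - E₀, and its complement in
  -- `u` by the factors of the remaining energies. So it agrees with the projection to this order.
  have hlow : TVanish (s + 1) (D.proj E₀ ε u - tPol s P) := by
    refine hD.tVanish_of_near_of_far (hD.near_sub h1 ⟨[(E₀ : ℂ)], by simp, ?_⟩) ?_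
    · obtain ⟨h3, h4⟩ := hD.pQ_tVanish (rootPoly [(E₀ : ℂ)]) hT
      rw [h3.succ_iff, h4, leadHom_tPol, hP, map_sum]
      refine Finset.sum_eq_zero fun a ha => ?_
      rw [map_smul, aeval_Q₀Hom_hPol hD.lam_pos, eval_rootPoly_of_mem, zero_smul, smul_zero]
      rw [(Finset.mem_filter.mp ha).2]
      exact List.mem_cons_self
    · have : D.Far E₀ (s + 1) (u - tPol s P) := by
        refine ⟨(t.filter fun a => D.energy a ≠ E₀).toList.map fun a => (D.energy a : ℂ), ?_, ?_⟩
        · intro E hE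
          obtain ⟨a, ha, rfl⟩ := List.mem_map.mp hE
          exact ⟨a, rfl, (Finset.mem_filter.mp (Finset.mem_toList.mp ha)).2⟩
        · obtain ⟨h3, h4⟩ := hD.pQ_tVanish (rootPoly ((t.filter fun a =>
            D.energy a ≠ E₀).toList.map fun a => (D.energy a : ℂ))) (hu.sub hT)
          rw [h3.succ_iff, h4, map_sub, leadHom_tPol, h, hP,
            ← Finset.sum_filter_add_sum_filter_not t (fun a => D.energy a = E₀),
            add_sub_cancel_left, map_sum]
          refine Finset.sum_eq_zero fun a ha => ?_
          rw [map_smul, aeval_Q₀Hom_hPol hD.lam_pos, eval_rootPoly_of_mem, zero_smul, smul_zero]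
          exact List.mem_map.mpr ⟨a, Finset.mem_toList.mpr ha, rfl⟩
      have := hD.far_sub this h2
      rwa [sub_sub_sub_cancel_left] at this
  have e : D.proj E₀ ε u = tPol s P + (D.proj E₀ ε u - tPol s P) := (add_sub_cancel _ _).symm
  constructor
  · rw [e]
    exact hT.add (hlow.mono (by omega))
  · rw [e, map_add, leadHom_tPol,
      (hlow.mono (by omega : s ≤ s + 1)).succ_iff.mp hlow, add_zero]

end TaylorData

/-! ## The exponential of a series without constant term -/

section Exp

variable {A : Type*} [CommRing A] [Algebra ℚ A]

/-- The rational number `q`, as a Laurent series. -/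
def ratC (A : Type*) [CommRing A] [Algebra ℚ A] : ℚ →+* LaurentSeries A :=
  HahnSeries.C.comp (algebraMap ℚ A)

/-- The truncated exponential series. -/
def expTrunc (X : LaurentSeries A) (N : ℕ) : LaurentSeries A :=
  ∑ j ∈ Finset.range N, ratC A (1 / j.factorial) * X ^ j

/-- The exponential series. -/
def expL (X : LaurentSeries A) : LaurentSeries A := PowerSeries.heval X (PowerSeries.exp A)

theorem VanishBelow.pow {X : LaurentSeries A} (hX : VanishBelow 1 X) (j : ℕ) :
    VanishBelow j (X ^ j) := by
  induction j with
  | zero =>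
    rw [pow_zero]
    exact VanishBelow.one
  | succ j ih =>
    rw [pow_succ]
    push_cast
    exact ih.mul hX

theorem VanishBelow.orderTop_pos {X : LaurentSeries A} (hX : VanishBelow 1 X) :
    0 < X.orderTop := by
  by_cases h : X = 0
  · rw [h, HahnSeries.orderTop_zero]
    exact WithTop.coe_lt_top 0
  · rw [HahnSeries.zero_lt_orderTop_iff h]
    by_contra hlt
    exact h (HahnSeries.coeff_order_eq_zero.mp (hX _ (by omega)))

/-- The power X^j starts at order j, so the terms from N on do not affect coefficients below N.
Properties of the exponential are then checked on finite sums. -/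
theorem vanishBelow_expL_sub {X : LaurentSeries A} (hX : VanishBelow 1 X) (N : ℕ) :
    VanishBelow N (expL X - expTrunc X N) := by
  intro m hm
  have hc : ∀ (j : ℕ), (HahnSeries.SummableFamily.powerSeriesFamily X (PowerSeries.exp A) j).coeff m
      = (ratC A (1 / j.factorial) * X ^ j).coeff m := by
    intro j
    rw [HahnSeries.SummableFamily.powerSeriesFamily_of_orderTop_pos hX.orderTop_pos,
      PowerSeries.coeff_exp]
    exact (coeff_C_mul' _ _ _).symm
  have h0 : ∀ j : ℕ, N ≤ j → (ratC A (1 / j.factorial) * X ^ j).coeff m = 0 := by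
    intro j hj
    refine (coeff_C_mul' _ _ _).trans ?_
    rw [hX.pow j m (by omega), mul_zero]
  rw [HahnSeries.coeff_sub, sub_eq_zero, expL, PowerSeries.heval_apply,
    HahnSeries.SummableFamily.coeff_hsum, expTrunc, HahnSeries.coeff_sum]
  simp only [hc]
  refine finsum_eq_sum_of_support_subset _ fun j hj => ?_
  rw [Finset.coe_range, Set.mem_Iio]
  by_contra hlt
  exact hj (h0 j (not_lt.mp hlt))

theorem eq_zero_of_vanishBelow {F : LaurentSeries A} (h : ∀ N : ℕ, VanishBelow N F) : F = 0 := by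
  ext m
  exact h (m.toNat + 1) m (by push_cast; omega)

theorem coeff_expL_zero (X : LaurentSeries A) : (expL X).coeff 0 = 1 := by
  rw [expL, PowerSeries.coeff_heval_zero, PowerSeries.constantCoeff_exp]

theorem expL_vanishBelow {X : LaurentSeries A} (hX : VanishBelow 1 X) :
    VanishBelow 0 (expL X) := by
  have := vanishBelow_expL_sub hX 0
  rwa [expTrunc, Finset.range_zero, Finset.sum_empty, sub_zero] at this

/-- A ring homomorphism fixes the rational coefficients of the truncations; continuity in t does the
rest. Used for complex conjugation and for t ↦ -t, y ↦ -y. -/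
theorem expL_map {X : LaurentSeries A} (hX : VanishBelow 1 X) (σ : LaurentSeries A →+* LaurentSeries A)
    (hσ : ∀ (N : ℕ) F, VanishBelow N F → VanishBelow N (σ F)) (h : σ X = X) :
    σ (expL X) = expL X := by
  have htr : ∀ N, σ (expTrunc X N) = expTrunc X N := by
    intro N
    rw [expTrunc, map_sum]
    refine Finset.sum_congr rfl fun j _ => ?_
    rw [map_mul, map_pow, h]
    congr 1
    exact RingHom.congr_fun (Subsingleton.elim (σ.comp (ratC A)) (ratC A)) _
  refine sub_eq_zero.mp (eq_zero_of_vanishBelow fun N => ?_)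
  have e := (hσ N _ (vanishBelow_expL_sub hX N)).sub (vanishBelow_expL_sub hX N)
  rwa [map_sub, htr, sub_sub_sub_cancel_right] at e

end Exp

theorem mapD_pow {A : Type*} [CommRing A] [Algebra ℂ A] (d : Derivation ℂ A A)
    (X : LaurentSeries A) (j : ℕ) : mapD d (X ^ (j + 1)) = (j + 1 : ℕ) * X ^ j * mapD d X := by
  induction j with
  | zero => simp
  | succ j ih =>
    rw [pow_succ, mapD_mul, ih]
    push_cast
    ring

/-- The derivation turns the truncation with N + 1 terms into the one with N terms times the
derivative of X. Both approximation errors vanish below N. -/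
theorem mapD_expL {A : Type*} [CommRing A] [Algebra ℂ A] [Algebra ℚ A] (d : Derivation ℂ A A)
    {X : LaurentSeries A} (hX : VanishBelow 1 X) : mapD d (expL X) = expL X * mapD d X := by
  have htr : ∀ N, mapD d (expTrunc X (N + 1)) = expTrunc X N * mapD d X := by
    intro N
    have h0 : ∀ q : ℚ, mapD d (ratC A q) = 0 := by
      intro q
      change mapD d (HahnSeries.C _) = 0
      rw [mapD_C]
      have : algebraMap ℚ A q = algebraMap ℂ A (algebraMap ℚ ℂ q) :=
        RingHom.congr_fun (Subsingleton.elim (algebraMap ℚ A)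
          ((algebraMap ℂ A).comp (algebraMap ℚ ℂ))) q
      rw [this, Derivation.map_algebraMap, map_zero]
    rw [expTrunc, Finset.sum_range_succ', map_add, map_sum, mapD_mul, h0, pow_zero,
      ← (HahnSeries.C (Γ := ℤ) (R := A)).map_one, mapD_C, d.map_one_eq_zero, map_zero, expTrunc,
      Finset.sum_mul]
    rw [zero_mul, mul_zero, add_zero, add_zero]
    refine Finset.sum_congr rfl fun j _ => ?_
    rw [mapD_mul, h0, zero_mul, zero_add, mapD_pow]
    have : ratC A (1 / j.factorial) = ratC A (1 / (j + 1).factorial) * (j + 1 : ℕ) := by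
      rw [← map_natCast (ratC A), ← map_mul]
      congr 1
      rw [Nat.factorial_succ]
      push_cast
      field_simp
    rw [this]
    ring
  refine sub_eq_zero.mp (eq_zero_of_vanishBelow fun N => ?_)
  have e1 := (vanishBelow_expL_sub hX (N + 1)).mapD d
  have e2 := (vanishBelow_expL_sub hX N).mul (hX.mapD d)
  rw [map_sub, htr] at e1
  rw [sub_mul] at e2
  have e := (e1.mono (by push_cast; omega : (N : ℤ) ≤ (N + 1 : ℕ))).sub
    (e2.mono (by omega : (N : ℤ) ≤ (N : ℤ) + 1))
  rwa [sub_sub_sub_cancel_right] at e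

/-! ### The formal weight and integration by parts -/

namespace TaylorData

variable {n r : ℕ} (D : TaylorData n r)

/-- The non-quadratic part of the exponent `-2φ/ħ`, rescaled. -/
def phaseX : LaurentSeries (Pol n) := rescaleHom n (HahnSeries.single (-2) (-2 * D.phaseRest))

/-- The formal exponential of the non-quadratic part of `-2φ/ħ`. -/
def phaseE : LaurentSeries (Pol n) := expL D.phaseX

/-- Coefficientwise Gaussian integration. -/
def mapG (hlam : ∀ i, 0 < D.lam i) : LaurentSeries (Pol n) →+ K where
  toFun F := F.map D.gaussIntegral
  map_zero' := by ext; simp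
  map_add' F G := by
    ext m
    exact D.gauss_add hlam _ _

theorem coeff_mapG (hlam : ∀ i, 0 < D.lam i) (F : LaurentSeries (Pol n)) (m : ℤ) :
    (D.mapG hlam F).coeff m = D.gaussIntegral (F.coeff m) := rfl

theorem mapG_vanishBelow (hlam : ∀ i, 0 < D.lam i) {k : ℤ} {F : LaurentSeries (Pol n)}
    (hF : VanishBelow k F) : VanishBelow k (D.mapG hlam F) := fun m hm => by
  rw [coeff_mapG, hF m hm, map_zero]

theorem mapG_liftK_mul (hlam : ∀ i, 0 < D.lam i) (a : K) (F : LaurentSeries (Pol n)) :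
    D.mapG hlam (liftK n a * F) = a * D.mapG hlam F := by
  have ha := VanishBelow.order a
  have hF := VanishBelow.order F
  ext m
  rw [coeff_mapG, coeff_mul_eq_sum (a := liftK n a) (ha.mapCoeff _) hF,
    coeff_mul_eq_sum ha (D.mapG_vanishBelow hlam hF), gauss_sum D hlam]
  refine Finset.sum_congr rfl fun i _ => ?_
  exact D.gauss_C_mul _ _

theorem mapG_conj (hlam : ∀ i, 0 < D.lam i) (F : LaurentSeries (Pol n)) :
    D.mapG hlam (mapCoeff (MvPolynomial.map (starRingEnd ℂ)) F) = conjK (D.mapG hlam F) := by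
  ext m
  exact D.gauss_map_conj _ hlam

theorem mapG_theta (hlam : ∀ i, 0 < D.lam i) (F : LaurentSeries (Pol n)) :
    D.mapG hlam (theta n F) = flip (D.mapG hlam F) := by
  ext m
  rw [coeff_flip, coeff_mapG, coeff_mapG]
  change D.gaussIntegral ((sgn m : Pol n) * negVar n (F.coeff m)) = _
  have h1 : (sgn m : Pol n) = MvPolynomial.C (sgn m : ℂ) := by simp
  rw [h1, gauss_C_mul, gauss_negVar D hlam]

theorem mapG_dy (hlam : ∀ i, 0 < D.lam i) (i : Fin n) (F : LaurentSeries (Pol n)) :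
    D.mapG hlam (dy i F) =
      D.mapG hlam (HahnSeries.C (MvPolynomial.C (2 * D.lam i : ℂ) * MvPolynomial.X i) * F) := by
  ext m
  rw [coeff_mapG, coeff_mapG, coeff_C_mul', mul_assoc, gauss_C_mul]
  exact D.gauss_pderiv hlam i _

variable {D}

/-- The remainder of the phase is cubic in x, giving at least t³ after rescaling, and division by ħ
= t² leaves a positive power. -/
theorem Good.phaseX_vanishBelow (hD : D.Good) : VanishBelow 1 D.phaseX := by
  intro m hm
  refine MvPolynomial.ext _ _ fun α => ?_
  rw [phaseX, coeff_rescaleHom, MvPolynomial.coeff_zero]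
  by_cases h : m - (α.degree : ℤ) = -2
  · rw [h, HahnSeries.coeff_single_same]
    have : (-2 : PS n) = MvPowerSeries.C (-2 : ℂ) := by rw [map_neg, map_ofNat]
    rw [this, MvPowerSeries.coeff_C_mul, hD.phaseRest_coeff α (by omega), mul_zero]
  · rw [HahnSeries.coeff_single_of_ne h, map_zero]

theorem Good.phaseE_vanishBelow (hD : D.Good) : VanishBelow 0 D.phaseE :=
  expL_vanishBelow hD.phaseX_vanishBelow

theorem Good.phaseRest_conj (hD : D.Good) : conjPS n D.phaseRest = D.phaseRest := by
  unfold phaseRest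
  rw [map_sub, hD.φ_conj, map_sum]
  congr 1
  refine Finset.sum_congr rfl fun i _ => ?_
  rw [map_mul, map_pow, MvPowerSeries.map_X, MvPowerSeries.map_C, Complex.conj_ofReal]

theorem Good.phaseE_conj (hD : D.Good) :
    mapCoeff (MvPolynomial.map (starRingEnd ℂ)) D.phaseE = D.phaseE := by
  refine expL_map hD.phaseX_vanishBelow _ (fun N F hF => hF.mapCoeff _) ?_
  rw [phaseX, ← rescaleHom_conj, mapCoeff_single, map_mul, hD.phaseRest_conj,
    map_neg, map_ofNat]

/-- In the variable x the exponent contains only the even power t^{-2}. -/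
theorem Good.phaseE_theta (hD : D.Good) : theta n D.phaseE = D.phaseE := by
  refine expL_map hD.phaseX_vanishBelow _ (fun N F hF => (hF.mapCoeff _).flip) ?_
  rw [phaseX, theta_rescaleHom, flip_single_of_even ⟨-1, by norm_num⟩]

/-- The formal stationary phase expansion without the Riemannian density. -/
def integ (D : TaylorData n r) (hlam : ∀ i, 0 < D.lam i) : LaurentSeries (PS n) →+ K :=
  (D.mapG hlam).comp ((AddMonoidHom.mulRight D.phaseE).comp (rescaleHom n).toAddMonoidHom)

theorem integ_apply (hlam : ∀ i, 0 < D.lam i) (F : LaurentSeries (PS n)) :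
    D.integ hlam F = D.mapG hlam (rescaleHom n F * D.phaseE) := rfl

theorem integ_single_one_mul (hlam : ∀ i, 0 < D.lam i) (k : ℤ) (F : LaurentSeries (PS n)) :
    D.integ hlam (HahnSeries.single k 1 * F) = HahnSeries.single k 1 * D.integ hlam F := by
  rw [integ_apply, map_mul (rescaleHom n), rescaleHom_single_one, ← liftK_single_one, mul_assoc, mapG_liftK_mul]
  rfl

/-- Integration by parts. -/
theorem Good.integ_dx (hD : D.Good) (i : Fin n) (F : LaurentSeries (PS n)) :
    D.integ hD.lam_pos (dx i F) =
      D.integ hD.lam_pos (HahnSeries.single (-2) (2 * D.dφ i) * F) := by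
  set G := rescaleHom n F with hG
  have hX : HahnSeries.single (-1) 1 * dy i D.phaseX =
      rescaleHom n (HahnSeries.single (-2) (-2 * MvPowerSeries.pderiv ℂ i D.phaseRest)) := by
    rw [phaseX, ← rescaleHom_dx, dx_eq, mapD_single]
    congr 2
    have : (-2 : PS n) = MvPowerSeries.C (-2 : ℂ) := by rw [map_neg, map_ofNat]
    rw [Derivation.leibniz, this, MvPowerSeries.pderiv_C, smul_zero, add_zero, smul_eq_mul]
  -- The derivative falls on the two factors of the weight separately: here on the formal
  -- exponential, and through `mapG_dy` on the Gaussian.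
  have h1 : dy i G * D.phaseE = dy i (G * D.phaseE) - G * D.phaseE * dy i D.phaseX := by
    have e : dy i D.phaseE = D.phaseE * dy i D.phaseX := mapD_expL _ hD.phaseX_vanishBelow
    rw [dy, mapD_mul, ← dy, e]
    ring
  -- The Gaussian contributes the quadratic part 2λ_i y_i and the exponential the remainder;
  -- together they are the rescaled 2ħ^{-1}∂_iφ.
  have h2 : rescaleHom n (HahnSeries.single (-2) (2 * D.dφ i)) = HahnSeries.single (-1) 1 *
      (HahnSeries.C (MvPolynomial.C (2 * D.lam i : ℂ) * MvPolynomial.X i) - dy i D.phaseX) := by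
    have hC : HahnSeries.single (-1) 1 *
        HahnSeries.C (MvPolynomial.C (2 * D.lam i : ℂ) * MvPolynomial.X i) =
        rescaleHom n (HahnSeries.single (-2)
          (MvPowerSeries.C (2 * D.lam i : ℂ) * MvPowerSeries.X i)) := by
      rw [single_eq_mul_C (-2), map_mul (rescaleHom n), rescaleHom_single_one]
      change _ = _ * resc _
      rw [resc_C_mul_X, HahnSeries.single_mul_single, ← single_eq_mul_C, one_mul]
      rfl
    rw [mul_sub, hC, hX, ← map_sub]
    congr 1
    rw [single_eq_mul_C _ (2 * _), single_eq_mul_C _ (MvPowerSeries.C _ * _),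
      single_eq_mul_C _ (-2 * _), ← mul_sub, ← map_sub]
    congr 2
    rw [dφ_eq, map_mul, map_ofNat]
    ring
  rw [integ_apply, integ_apply, rescaleHom_dx, map_mul (rescaleHom n), h2, ← hG, ← liftK_single_one, mul_assoc,
    mapG_liftK_mul, h1, map_sub, mapG_dy, ← map_sub, ← mapG_liftK_mul]
  congr 1
  ring

end TaylorData

/-! ## The hermitian form -/

/-- Componentwise complex conjugation. -/
def conjS {n r : ℕ} (u : S n r) : S n r := fun k => mapCoeff (conjPS n) (u k)

theorem conjS_add {n r : ℕ} (u v : S n r) : conjS (u + v) = conjS u + conjS v :=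
  funext fun _ => map_add (mapCoeff (conjPS n)) _ _

theorem conjS_neg {n r : ℕ} (u : S n r) : conjS (-u) = -conjS u :=
  funext fun _ => map_neg (mapCoeff (conjPS n)) _

theorem conjS_sum {n r : ℕ} {ι : Type*} (s : Finset ι) (u : ι → S n r) :
    conjS (∑ i ∈ s, u i) = ∑ i ∈ s, conjS (u i) := by
  funext k
  simp only [conjS, Finset.sum_apply, map_sum]

theorem conjS_mulOp_C {n r : ℕ} (a : PS n) (u : S n r) :
    conjS (mulOp (HahnSeries.C a) u) = mulOp (HahnSeries.C (conjPS n a)) (conjS u) := by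
  funext k
  refine (map_mul (mapCoeff (conjPS n)) _ _).trans ?_
  rw [mapCoeff_C]
  rfl

theorem conjS_hPow {n r : ℕ} (m : ℤ) (u : S n r) : conjS (hPow m u) = hPow m (conjS u) := by
  funext k
  refine (map_mul (mapCoeff (conjPS n)) _ _).trans ?_
  rw [mapCoeff_single, map_one]
  rfl

theorem conjS_matOp {n r : ℕ} (N : Matrix (Fin r) (Fin r) (PS n)) (u : S n r) :
    conjS (matOp N u) = matOp (N.map (conjPS n)) (conjS u) := by
  funext k
  rw [TaylorData.matOp_apply, conjS, TaylorData.matOp_apply, map_sum]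
  refine Finset.sum_congr rfl fun l _ => ?_
  rw [map_mul, mapCoeff_C]
  rfl

/-- Entrywise partial derivative of a matrix. -/
def matD {n r : ℕ} (i : Fin n) (ρ : Matrix (Fin r) (Fin r) (PS n)) :
    Matrix (Fin r) (Fin r) (PS n) := ρ.map (MvPowerSeries.pderiv ℂ i)

namespace TaylorData

variable {n r : ℕ} {D : TaylorData n r}

theorem Good.conjS_conjDeriv (hD : D.Good) (i : Fin n) (u : S n r) :
    conjS (D.conjDeriv i u) = D.conjDeriv i (conjS u) := by
  funext k
  rw [conjDeriv_apply, conjS, conjDeriv_apply, conjD, conjD, map_sub, map_mul, mapCoeff_single]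
  have h : ∀ a : PS n, conjPS n (MvPowerSeries.pderiv ℂ i a) =
      MvPowerSeries.pderiv ℂ i (conjPS n a) := by
    intro a
    ext α
    rw [MvPowerSeries.coeff_map, MvPowerSeries.coeff_pderiv, MvPowerSeries.coeff_pderiv,
      MvPowerSeries.coeff_map, map_mul]
    simp
  have h1 : conjPS n (D.dφ i) = D.dφ i := by rw [dφ, h, hD.φ_conj]
  rw [h1]
  congr 1
  ext m : 1
  exact funext fun m => h _

/-- The pairing with a matrix-valued density. -/
def pairing (D : TaylorData n r) (hlam : ∀ i, 0 < D.lam i) :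
    Matrix (Fin r) (Fin r) (PS n) →+ S n r →+ S n r →+ K :=
  AddMonoidHom.mk' (fun ρ => AddMonoidHom.mk' (fun g => AddMonoidHom.mk'
    (fun h => D.integ hlam (∑ k, ∑ l, HahnSeries.C (ρ k l) * g k * h l))
    fun h h' => by
      rw [← map_add]
      simp only [Pi.add_apply, mul_add, Finset.sum_add_distrib])
    fun g g' => by
      refine AddMonoidHom.ext fun h => ?_
      change _ = D.integ hlam _ + D.integ hlam _
      rw [← map_add]
      simp only [Pi.add_apply, mul_add, add_mul, Finset.sum_add_distrib]
      rfl)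
    fun ρ ρ' => by
      refine AddMonoidHom.ext fun g => AddMonoidHom.ext fun h => ?_
      change _ = D.integ hlam _ + D.integ hlam _
      rw [← map_add]
      simp only [Matrix.add_apply, map_add, add_mul, Finset.sum_add_distrib]
      rfl

theorem pairing_apply (hlam : ∀ i, 0 < D.lam i) (ρ : Matrix (Fin r) (Fin r) (PS n))
    (g h : S n r) : D.pairing hlam ρ g h =
      D.integ hlam (∑ k, ∑ l, HahnSeries.C (ρ k l) * g k * h l) := rfl

theorem pairing_mulOp_left (hlam : ∀ i, 0 < D.lam i) (ρ : Matrix (Fin r) (Fin r) (PS n)) (a : PS n)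
    (g h : S n r) :
    D.pairing hlam ρ (mulOp (HahnSeries.C a) g) h = D.pairing hlam (a • ρ) g h := by
  rw [pairing_apply, pairing_apply]
  refine congr_arg _ (Finset.sum_congr rfl fun k _ => Finset.sum_congr rfl fun l _ => ?_)
  change _ * (HahnSeries.C a * g k) * _ = _
  rw [Matrix.smul_apply, smul_eq_mul, map_mul]
  ring

theorem pairing_mulOp_right (hlam : ∀ i, 0 < D.lam i) (ρ : Matrix (Fin r) (Fin r) (PS n))
    (a : PS n) (g h : S n r) :
    D.pairing hlam ρ g (mulOp (HahnSeries.C a) h) = D.pairing hlam (a • ρ) g h := by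
  rw [pairing_apply, pairing_apply]
  refine congr_arg _ (Finset.sum_congr rfl fun k _ => Finset.sum_congr rfl fun l _ => ?_)
  change _ * (HahnSeries.C a * h l) = _
  rw [Matrix.smul_apply, smul_eq_mul, map_mul]
  ring

theorem pairing_hPow_left (hlam : ∀ i, 0 < D.lam i) (ρ : Matrix (Fin r) (Fin r) (PS n)) (m : ℤ)
    (g h : S n r) :
    D.pairing hlam ρ (hPow m g) h = HahnSeries.single m 1 * D.pairing hlam ρ g h := by
  rw [pairing_apply, pairing_apply, ← integ_single_one_mul]
  simp only [Finset.mul_sum]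
  refine congr_arg _ (Finset.sum_congr rfl fun k _ => Finset.sum_congr rfl fun l _ => ?_)
  change _ * (HahnSeries.single m 1 * g k) * _ = _
  ring

theorem pairing_hPow_right (hlam : ∀ i, 0 < D.lam i) (ρ : Matrix (Fin r) (Fin r) (PS n)) (m : ℤ)
    (g h : S n r) :
    D.pairing hlam ρ g (hPow m h) = HahnSeries.single m 1 * D.pairing hlam ρ g h := by
  rw [pairing_apply, pairing_apply, ← integ_single_one_mul]
  simp only [Finset.mul_sum]
  refine congr_arg _ (Finset.sum_congr rfl fun k _ => Finset.sum_congr rfl fun l _ => ?_)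
  change _ * (HahnSeries.single m 1 * h l) = _
  ring

theorem pairing_matOp_left (hlam : ∀ i, 0 < D.lam i) (ρ N : Matrix (Fin r) (Fin r) (PS n))
    (g h : S n r) : D.pairing hlam ρ (matOp N g) h = D.pairing hlam (N.transpose * ρ) g h := by
  rw [pairing_apply, pairing_apply]
  simp only [matOp_apply, Matrix.mul_apply, Matrix.transpose_apply, map_sum, Finset.mul_sum,
    Finset.sum_mul, map_mul]
  simp_rw [fun k => Finset.sum_comm (s := Finset.univ (α := Fin r)) (t := Finset.univ (α := Fin r))
    (f := fun l a => D.integ hlam (HahnSeries.C (ρ k l) * (HahnSeries.C (N k a) * g a) * h l))]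
  rw [Finset.sum_comm]
  refine Finset.sum_congr rfl fun a _ => ?_
  rw [Finset.sum_comm]
  refine Finset.sum_congr rfl fun l _ => Finset.sum_congr rfl fun k _ => ?_
  congr 1
  ring

theorem pairing_matOp_right (hlam : ∀ i, 0 < D.lam i) (ρ N : Matrix (Fin r) (Fin r) (PS n))
    (g h : S n r) : D.pairing hlam ρ g (matOp N h) = D.pairing hlam (ρ * N) g h := by
  rw [pairing_apply, pairing_apply]
  simp only [matOp_apply, Matrix.mul_apply, map_sum, Finset.mul_sum, Finset.sum_mul, map_mul]
  refine Finset.sum_congr rfl fun k _ => ?_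
  rw [Finset.sum_comm]
  refine Finset.sum_congr rfl fun a _ => Finset.sum_congr rfl fun l _ => ?_
  congr 1
  ring

/-- Integration by parts produces 2ħ^{-1}∂_iφ, one half of which is absorbed by each of the two
conjugated derivatives. Thus the conjugated derivative is skew up to the derivative of the density.
-/
theorem Good.pairing_conjDeriv_left (hD : D.Good) (ρ : Matrix (Fin r) (Fin r) (PS n)) (i : Fin n)
    (g h : S n r) :
    D.pairing hD.lam_pos ρ (D.conjDeriv i g) h =
      -D.pairing hD.lam_pos (matD i ρ) g h - D.pairing hD.lam_pos ρ g (D.conjDeriv i h) := by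
  rw [eq_sub_iff_add_eq, eq_neg_iff_add_eq_zero, pairing_apply, pairing_apply, pairing_apply,
    ← map_add, ← map_add, ← Finset.sum_add_distrib, ← Finset.sum_add_distrib, map_sum]
  refine Finset.sum_eq_zero fun k _ => ?_
  rw [← Finset.sum_add_distrib, ← Finset.sum_add_distrib, map_sum]
  refine Finset.sum_eq_zero fun l _ => ?_
  have h1 := hD.integ_dx i (HahnSeries.C (ρ k l) * g k * h l)
  rw [← sub_eq_zero, ← map_sub] at h1
  rw [← h1]
  congr 1
  rw [conjDeriv_apply, conjDeriv_apply, conjD, conjD, dx_eq, dx_eq, dx_eq, mapD_mul, mapD_mul,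
    mapD_C]
  have h2 : (HahnSeries.single (-2) (2 * D.dφ i) : LaurentSeries (PS n)) =
      HahnSeries.single (-2) (D.dφ i) + HahnSeries.single (-2) (D.dφ i) := by
    rw [single_eq_mul_C _ (2 * _), single_eq_mul_C _ (D.dφ i), ← mul_add, ← map_add, two_mul]
  rw [h2, matD, Matrix.map_apply]
  ring

/-- The density as a matrix. -/
def densityM (D : TaylorData n r) : Matrix (Fin r) (Fin r) (PS n) := Matrix.of D.density

/-- The conjugation is moved into the argument, so that adjoints can be computed with a biadditive
pairing and an arbitrary matrix density. -/
theorem form_eq_pairing (hlam : ∀ i, 0 < D.lam i) (u v : S₀ n r) :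
    D.form u v = D.pairing hlam D.densityM (conjS ((R n r).symm u)) ((R n r).symm v) := by
  change D.integ hlam ((∑ k, ∑ l, HahnSeries.C (D.γ k l) *
    conjS ((R n r).symm u) k * (R n r).symm v l) * HahnSeries.C D.vol) = _
  rw [pairing_apply, Finset.sum_mul]
  refine congr_arg _ (Finset.sum_congr rfl fun k _ => ?_)
  rw [Finset.sum_mul]
  refine Finset.sum_congr rfl fun l _ => ?_
  change _ = HahnSeries.C (D.vol * D.γ k l) * _ * _
  rw [map_mul]
  ring

theorem form_eq (hlam : ∀ i, 0 < D.lam i) (u v : S₀ n r) :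
    D.form u v = ∑ k, ∑ l, D.mapG hlam (resc (D.density k l) *
      mapCoeff (MvPolynomial.map (starRingEnd ℂ)) (u.val k) * v.val l * D.phaseE) := by
  have hw : ∀ (w : S₀ n r) l, rescaleHom n ((R n r).symm w l) = w.val l := fun w l =>
    congr_fun (congr_arg S₀.val ((R n r).apply_symm_apply w)) l
  rw [form_eq_pairing hlam, pairing_apply, map_sum]
  refine Finset.sum_congr rfl fun k _ => ?_
  rw [map_sum]
  refine Finset.sum_congr rfl fun l _ => ?_
  rw [integ_apply, map_mul (rescaleHom n), map_mul (rescaleHom n), conjS, rescaleHom_conj, hw, hw]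
  rfl

/-! ### Symmetry of the operator -/

theorem Good.lap_zero_matrix (hD : D.Good) :
    -(∑ i, ∑ j, matD j (matD i (D.ginv i j • D.densityM)))
      - ∑ j, matD j (((D.b j).map (conjPS n)).transpose * D.densityM)
      + (D.c.map (conjPS n)).transpose * D.densityM = D.densityM * D.c := by
  refine Matrix.ext fun k l => ?_
  have := hD.lap_zero k l
  simpa [Matrix.sum_apply, Matrix.mul_apply, matD, densityM] using this

theorem Good.lap_one_matrix (hD : D.Good) (j : Fin n) :
    -(∑ i, matD i (D.ginv i j • D.densityM)) - (∑ i, matD i (D.ginv i j • D.densityM))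
      - ((D.b j).map (conjPS n)).transpose * D.densityM = D.densityM * D.b j := by
  refine Matrix.ext fun k l => ?_
  have := hD.lap_one j k l
  simp only [Matrix.sub_apply, Matrix.neg_apply, Matrix.sum_apply, Matrix.mul_apply, matD, densityM,
    Matrix.map_apply, Matrix.transpose_apply, Matrix.of_apply, Matrix.smul_apply, smul_eq_mul]
  rw [← this]
  ring

theorem Good.w_symm_matrix (hD : D.Good) :
    (D.w.map (conjPS n)).transpose * D.densityM = D.densityM * D.w := by
  refine Matrix.ext fun k l => ?_
  have := congr_arg (D.vol * ·) (hD.w_symm k l)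
  simp only [Finset.mul_sum] at this
  simp only [Matrix.mul_apply, densityM, Matrix.map_apply, Matrix.transpose_apply, Matrix.of_apply,
    density]
  rw [← Finset.sum_congr rfl fun a _ => mul_assoc D.vol (D.γ k a) (D.w a l)] at this
  rw [this]
  exact Finset.sum_congr rfl fun a _ => mul_left_comm _ _ _

/-- By the eikonal equation V is a polynomial expression in real series. -/
theorem Good.V_conj (hD : D.Good) : conjPS n D.V = D.V := by
  have h : ∀ i, conjPS n (D.dφ i) = D.dφ i := by
    intro i
    ext α
    rw [MvPowerSeries.coeff_map, dφ, MvPowerSeries.coeff_pderiv, map_mul, ← MvPowerSeries.coeff_map]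
    have := hD.φ_conj
    rw [conjPS] at this
    rw [this]
    simp
  rw [hD.eikonal, map_sum]
  refine Finset.sum_congr rfl fun i _ => ?_
  rw [map_sum]
  refine Finset.sum_congr rfl fun j _ => ?_
  rw [map_mul, map_mul, hD.ginv_conj]
  exact congr_arg₂ (· * ·) (congr_arg _ (h i)) (h j)

/-- The conjugate of the Laplace type operator. -/
theorem Good.pairing_laplace (hD : D.Good) (g h : S n r) :
    D.pairing hD.lam_pos D.densityM
      (-(∑ i, ∑ j, mulOp (HahnSeries.C (D.ginv i j)) (D.conjDeriv i (D.conjDeriv j g)))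
        + ∑ j, matOp ((D.b j).map (conjPS n)) (D.conjDeriv j g)
        + matOp (D.c.map (conjPS n)) g) h =
    D.pairing hD.lam_pos D.densityM g
      (-(∑ i, ∑ j, mulOp (HahnSeries.C (D.ginv i j)) (D.conjDeriv i (D.conjDeriv j h)))
        + ∑ j, matOp (D.b j) (D.conjDeriv j h) + matOp D.c h) := by
  set P := D.pairing hD.lam_pos with hP
  -- Two integrations by parts. The symmetry of the inverse metric is used to write the last two
  -- terms with exchanged indices, so that after summation they match the operator applied to `h`.
  have hl : ∀ i j, P (D.ginv i j • D.densityM) (D.conjDeriv i (D.conjDeriv j g)) h =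
      P (matD j (matD i (D.ginv i j • D.densityM))) g h +
      P (matD i (D.ginv i j • D.densityM)) g (D.conjDeriv j h) +
      P (matD j (D.ginv j i • D.densityM)) g (D.conjDeriv i h) +
      P (D.ginv j i • D.densityM) g (D.conjDeriv j (D.conjDeriv i h)) := by
    intro i j
    rw [hP, hD.pairing_conjDeriv_left, hD.pairing_conjDeriv_left, hD.pairing_conjDeriv_left,
      hD.ginv_symm j i]
    ring
  simp only [map_add, map_neg, map_sum, AddMonoidHom.add_apply, AddMonoidHom.neg_apply,
    AddMonoidHom.finset_sum_apply]
  simp only [hP, pairing_mulOp_left, pairing_mulOp_right, pairing_matOp_left, pairing_matOp_right]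
  -- The zero and first order coefficients acting on `h` are replaced by the transposed ones; then
  -- all terms with derivatives of the density cancel.
  rw [← hP, ← hD.lap_zero_matrix]
  simp only [← hD.lap_one_matrix, hl]
  simp only [hP, hD.pairing_conjDeriv_left]
  simp only [← hP, map_add, map_sub, map_neg, map_sum, AddMonoidHom.add_apply,
    AddMonoidHom.sub_apply, AddMonoidHom.neg_apply, AddMonoidHom.finset_sum_apply,
    Finset.sum_add_distrib, Finset.sum_sub_distrib, Finset.sum_neg_distrib]
  have e1 : ∑ i, ∑ j, P (matD i (D.ginv i j • D.densityM)) g (D.conjDeriv j h) =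
      ∑ j, ∑ i, P (matD i (D.ginv i j • D.densityM)) g (D.conjDeriv j h) := Finset.sum_comm
  have e2 : ∑ i, ∑ j, P (D.ginv j i • D.densityM) g (D.conjDeriv j (D.conjDeriv i h)) =
      ∑ i, ∑ j, P (D.ginv i j • D.densityM) g (D.conjDeriv i (D.conjDeriv j h)) := Finset.sum_comm
  rw [e1, e2]
  ring

theorem H_eq (w : S n r) : D.H w = hPow 4
      (-(∑ i, ∑ j, mulOp (HahnSeries.C (D.ginv i j)) (D.conjDeriv i (D.conjDeriv j w)))
        + ∑ j, matOp (D.b j) (D.conjDeriv j w) + matOp D.c w)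
      + hPow 2 (matOp D.w w) + mulOp (HahnSeries.C D.V) w := by
  simp only [H, LinearMap.add_apply, LinearMap.neg_apply, LinearMap.sum_apply,
    LinearMap.comp_apply]

theorem Good.conjS_H (hD : D.Good) (w : S n r) : conjS (D.H w) = hPow 4
      (-(∑ i, ∑ j, mulOp (HahnSeries.C (D.ginv i j)) (D.conjDeriv i (D.conjDeriv j (conjS w))))
        + ∑ j, matOp ((D.b j).map (conjPS n)) (D.conjDeriv j (conjS w))
        + matOp (D.c.map (conjPS n)) (conjS w))
      + hPow 2 (matOp (D.w.map (conjPS n)) (conjS w)) + mulOp (HahnSeries.C D.V) (conjS w) := by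
  rw [H_eq]
  simp only [conjS_add, conjS_neg, conjS_sum, conjS_hPow, conjS_mulOp_C, conjS_matOp,
    hD.conjS_conjDeriv, hD.ginv_conj, hD.V_conj]

theorem Good.pairing_H (hD : D.Good) (u v : S n r) :
    D.pairing hD.lam_pos D.densityM (conjS (D.H u)) v =
      D.pairing hD.lam_pos D.densityM (conjS u) (D.H v) := by
  have hl : ∀ X Y Z h, D.pairing hD.lam_pos D.densityM (X + Y + Z) h =
      D.pairing hD.lam_pos D.densityM X h + D.pairing hD.lam_pos D.densityM Y h +
        D.pairing hD.lam_pos D.densityM Z h := fun X Y Z h => by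
    rw [map_add, map_add]
    rfl
  have hr : ∀ g X Y Z, D.pairing hD.lam_pos D.densityM g (X + Y + Z) =
      D.pairing hD.lam_pos D.densityM g X + D.pairing hD.lam_pos D.densityM g Y +
        D.pairing hD.lam_pos D.densityM g Z := fun g X Y Z => by
    rw [map_add, map_add]
  rw [hD.conjS_H, H_eq, hl, hr, pairing_hPow_left, pairing_hPow_left, pairing_hPow_right,
    pairing_hPow_right, hD.pairing_laplace, pairing_matOp_left, pairing_matOp_right,
    hD.w_symm_matrix, pairing_mulOp_left, pairing_mulOp_right]

theorem R_symm_Q (w : S₀ n r) :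
    (R n r).symm (D.Q w) = hPow (-2) (D.H ((R n r).symm w)) := by
  rw [Q, LinearMap.comp_apply, LinearEquiv.coe_coe, LinearEquiv.symm_apply_apply,
    LinearMap.comp_apply, LinearMap.comp_apply, LinearEquiv.coe_coe]

theorem Good.form_Q (hD : D.Good) (u v : S₀ n r) : D.form (D.Q u) v = D.form u (D.Q v) := by
  rw [form_eq_pairing hD.lam_pos, form_eq_pairing hD.lam_pos, R_symm_Q, R_symm_Q, conjS_hPow,
    pairing_hPow_left, pairing_hPow_right, hD.pairing_H]

/-! ### Algebraic properties of the form -/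

theorem form_add_right (hlam : ∀ i, 0 < D.lam i) (u v v' : S₀ n r) :
    D.form u (v + v') = D.form u v + D.form u v' := by
  simp only [form_eq_pairing hlam, map_add]

theorem form_scale_right (hlam : ∀ i, 0 < D.lam i) (a : K) (u v : S₀ n r) :
    D.form u (scale a v) = a * D.form u v := by
  simp only [form_eq hlam, Finset.mul_sum]
  refine Finset.sum_congr rfl fun k _ => Finset.sum_congr rfl fun l _ => ?_
  rw [val_scale, ← mapG_liftK_mul]
  congr 1
  ring

/-- Coefficientwise complex conjugation of polynomials. -/
abbrev conjPol (n : ℕ) : LaurentSeries (Pol n) →+* LaurentSeries (Pol n) :=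
  mapCoeff (MvPolynomial.map (starRingEnd ℂ))

theorem conjPol_conjPol (F : LaurentSeries (Pol n)) : conjPol n (conjPol n F) = F := by
  ext m α
  rw [coeff_mapCoeff, coeff_mapCoeff, MvPolynomial.coeff_map, MvPolynomial.coeff_map,
    Complex.conj_conj]

theorem Good.conjPol_resc_density (hD : D.Good) (k l : Fin r) :
    conjPol n (resc (D.density k l)) = resc (D.density l k) := by
  have h : conjPS n (D.density k l) = D.density l k := by
    rw [density, map_mul, hD.vol_conj, hD.γ_conj]
    rfl
  rw [resc, RingHom.comp_apply, RingHom.comp_apply, ← rescaleHom_conj, mapCoeff_C, h]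

theorem Good.form_conj (hD : D.Good) (u v : S₀ n r) : conjK (D.form u v) = D.form v u := by
  rw [form_eq hD.lam_pos, form_eq hD.lam_pos, map_sum, Finset.sum_comm]
  refine Finset.sum_congr rfl fun k _ => ?_
  rw [map_sum]
  refine Finset.sum_congr rfl fun l _ => ?_
  rw [← mapG_conj, map_mul (conjPol n), map_mul (conjPol n), map_mul (conjPol n),
    conjPol_conjPol, hD.conjPol_resc_density, hD.phaseE_conj,
    mul_right_comm (resc (D.density l k))]

theorem Good.form_scale_left (hD : D.Good) (a : K) (u v : S₀ n r) :
    D.form (scale a u) v = conjK a * D.form u v := by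
  rw [← hD.form_conj, form_scale_right hD.lam_pos, map_mul, hD.form_conj]

theorem form_sum_right (hlam : ∀ i, 0 < D.lam i) {ι : Type*} (s : Finset ι) (u : S₀ n r)
    (v : ι → S₀ n r) : D.form u (∑ i ∈ s, v i) = ∑ i ∈ s, D.form u (v i) := by
  simp only [form_eq_pairing hlam, map_sum]

theorem Good.form_sum_left (hD : D.Good) {ι : Type*} (s : Finset ι) (u : ι → S₀ n r)
    (v : S₀ n r) : D.form (∑ i ∈ s, u i) v = ∑ i ∈ s, D.form (u i) v := by
  rw [← hD.form_conj, form_sum_right hD.lam_pos, map_sum]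
  exact Finset.sum_congr rfl fun i _ => hD.form_conj _ _

/-- Density and formal exponential are invariant, and the Gaussian integral does not notice y ↦ -y.
So only t ↦ -t survives in the value. -/
theorem Good.form_theta (hD : D.Good) (u v : S₀ n r) :
    D.form (thetaS₀ n r u) (thetaS₀ n r v) = flip (D.form u v) := by
  simp only [form_eq hD.lam_pos, map_sum]
  refine Finset.sum_congr rfl fun k _ => Finset.sum_congr rfl fun l _ => ?_
  have h1 : mapCoeff (MvPolynomial.map (starRingEnd ℂ)) (theta n (u.val k)) =
      theta n (mapCoeff (MvPolynomial.map (starRingEnd ℂ)) (u.val k)) := by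
    ext m α
    rw [coeff_theta, coeff_mapCoeff, coeff_mapCoeff, MvPolynomial.coeff_map, MvPolynomial.coeff_map,
      coeff_theta, map_mul]
    simp
  rw [← mapG_theta, map_mul (theta n), map_mul (theta n), map_mul (theta n), theta_resc, hD.phaseE_theta, val_thetaS₀,
    val_thetaS₀, h1]

/-- At t = 0 the density is the identity matrix and the formal exponential is 1, which leaves the
Gaussian inner product of the lowest coefficients. -/
theorem Good.form_leading (hD : D.Good) {u v : S₀ n r} (hu : TVanish 0 u) (hv : TVanish 0 v) :
    VanishBelow 0 (D.form u v) ∧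
      (D.form u v).coeff 0 = D.polInner (leadHom 0 u) (leadHom 0 v) := by
  have hE : D.phaseE.coeff 0 = 1 := coeff_expL_zero _
  have key : ∀ k l, VanishBelow 0 (resc (D.density k l) *
      mapCoeff (MvPolynomial.map (starRingEnd ℂ)) (u.val k) * v.val l * D.phaseE) ∧
      (resc (D.density k l) * mapCoeff (MvPolynomial.map (starRingEnd ℂ)) (u.val k) * v.val l *
        D.phaseE).coeff 0 = if k = l then
          MvPolynomial.map (starRingEnd ℂ) (leadHom 0 u k) * leadHom 0 v k else 0 := by
    intro k l
    obtain ⟨a1, a2⟩ := lead_mul hD.phaseE_vanishBelow hE (hv l)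
    obtain ⟨b1, b2⟩ := lead_mul ((hu k).mapCoeff (MvPolynomial.map (starRingEnd ℂ))) rfl a1
    obtain ⟨c1, c2⟩ := lead_mul (resc_vanishBelow_zero (D.density k l)) (coeff_resc_zero _) b1
    have e : resc (D.density k l) * mapCoeff (MvPolynomial.map (starRingEnd ℂ)) (u.val k) *
        v.val l * D.phaseE = resc (D.density k l) *
          (mapCoeff (MvPolynomial.map (starRingEnd ℂ)) (u.val k) * (D.phaseE * v.val l)) := by
      ring
    rw [e]
    refine ⟨c1, ?_⟩
    rw [c2, b2, a2, density, map_mul, hD.vol_zero, hD.γ_zero, one_mul, one_mul, coeff_mapCoeff]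
    split_ifs with h
    · subst h
      rw [map_one, one_mul]
      rfl
    · rw [map_zero, zero_mul]
  rw [form_eq hD.lam_pos]
  refine ⟨VanishBelow.sum _ fun k _ => VanishBelow.sum _ fun l _ =>
    D.mapG_vanishBelow _ (key k l).1, ?_⟩
  rw [HahnSeries.coeff_sum, polInner, gauss_sum D hD.lam_pos]
  refine Finset.sum_congr rfl fun k _ => ?_
  rw [HahnSeries.coeff_sum, Finset.sum_eq_single k]
  · rw [coeff_mapG, (key k k).2, if_pos rfl]
  · intro l _ hl
    rw [coeff_mapG, (key k l).2, if_neg (Ne.symm hl), map_zero]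
  · exact fun h => absurd (Finset.mem_univ k) h

end TaylorData

/-! ## Orthonormal bases and parity -/

theorem theta_liftK {n : ℕ} (a : K) : theta n (liftK n a) = liftK n (flip a) := by
  ext m α
  rw [coeff_theta, coeff_liftK, coeff_liftK, coeff_flip, MvPolynomial.coeff_C,
    MvPolynomial.coeff_C]
  by_cases h : α = 0
  · subst h
    simp
  · rw [if_neg (Ne.symm h), if_neg (Ne.symm h), mul_zero]

theorem thetaS₀_scale {n r : ℕ} (a : K) (w : S₀ n r) :
    thetaS₀ n r (scale a w) = scale (flip a) (thetaS₀ n r w) := by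
  refine S₀.ext fun k => ?_
  rw [val_thetaS₀, val_scale, map_mul, theta_liftK, val_scale, val_thetaS₀]

/-- Linear combinations of the vectors `v i` with the coefficients in the columns of `X`. -/
def comb {n r m l : ℕ} (X : Matrix (Fin m) (Fin l) K) (v : Fin m → S₀ n r) (j : Fin l) : S₀ n r :=
  ∑ i, scale (X i j) (v i)

theorem comb_comb {n r m l q : ℕ} (X : Matrix (Fin m) (Fin l) K) (Y : Matrix (Fin l) (Fin q) K)
    (v : Fin m → S₀ n r) : comb Y (comb X v) = comb (X * Y) v := by
  funext j
  simp only [comb, scale_sum, Matrix.mul_apply, sum_scale]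
  rw [Finset.sum_comm]
  refine Finset.sum_congr rfl fun i _ => Finset.sum_congr rfl fun a _ => ?_
  rw [← scale_mul, mul_comm]

theorem comb_one {n r m : ℕ} (v : Fin m → S₀ n r) : comb 1 v = v := by
  funext j
  rw [comb, Finset.sum_eq_single j]
  · rw [Matrix.one_apply_eq, scale_one]
  · intro i _ hi
    rw [Matrix.one_apply_ne hi, scale_zero_left]
  · exact fun h => absurd (Finset.mem_univ j) h

theorem ofPol_eq_tPol {n r : ℕ} (P : Fin r → Pol n) : ofPol P = tPol 0 P := by
  have : (HahnSeries.single 0 1 : K) = 1 := rfl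
  rw [tPol, this, scale_one]

namespace TaylorData

variable {n r : ℕ} {D : TaylorData n r}

theorem Good.form_comb (hD : D.Good) {m l q : ℕ} (X : Matrix (Fin m) (Fin q) K)
    (Y : Matrix (Fin l) (Fin q) K) (v : Fin m → S₀ n r) (w : Fin l → S₀ n r) (i j : Fin q) :
    D.form (comb X v i) (comb Y w j) =
      (adj X * Matrix.of (fun a b => D.form (v a) (w b)) * Y) i j := by
  simp only [comb, form_sum_right hD.lam_pos, hD.form_sum_left, form_scale_right hD.lam_pos,
    hD.form_scale_left, Matrix.mul_apply, Matrix.of_apply, adj_apply, Finset.sum_mul,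
    Finset.mul_sum]
  refine Finset.sum_congr rfl fun b _ => Finset.sum_congr rfl fun a _ => ?_
  ring

theorem thetaS₀_h (a : (Fin n → ℕ) × Fin r) :
    thetaS₀ n r (D.h a) = ((-1 : ℂ) ^ hdeg a) • D.h a := by
  refine S₀.ext fun k => ?_
  have e : (D.h a).val k = HahnSeries.C (D.hPol a k) := by
    rw [h_eq]
    rfl
  rw [smul_eq_scale, val_thetaS₀, val_scale, e]
  change flip (mapCoeff (negVar n) (HahnSeries.C _)) = mapCoeff _ (HahnSeries.C _) * _
  rw [mapCoeff_C, flip_C, negVar_hPol, mapCoeff_C, ← map_mul]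
  simp

variable {E₀ ε : ℝ}

theorem Good.proj_h (hD : D.Good) (hs : D.Separates E₀ ε) {a : (Fin n → ℕ) × Fin r}
    (ha : D.energy a = E₀) :
    TVanish 0 (D.proj E₀ ε (D.h a)) ∧ leadHom 0 (D.proj E₀ ε (D.h a)) = D.hPol a := by
  rw [h_eq, ofPol_eq_tPol]
  obtain ⟨h1, h2⟩ := hD.proj_leading hs (tPol_tVanish 0 (D.hPol a)) {a} (fun _ => 1) (by
    rw [leadHom_tPol, Finset.sum_singleton, one_smul])
  refine ⟨h1, ?_⟩
  rw [h2, Finset.filter_singleton, if_pos ha, Finset.sum_singleton, one_smul]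

/-- The form is non-degenerate on the range of the spectral projection. -/
theorem Good.eq_zero_of_form (hD : D.Good) (hs : D.Separates E₀ ε) {w : S₀ n r}
    (hw : D.proj E₀ ε w = w)
    (h : ∀ a, D.energy a = E₀ → D.form (D.proj E₀ ε (D.h a)) w = 0) : w = 0 := by
  obtain ⟨m, hm⟩ := exists_XVanish w
  have key : ∀ j : ℕ, TVanish (m + j) w := by
    intro j
    induction j with
    | zero => simpa using hm.tVanish
    | succ j ih =>
      push_cast
      rw [← add_assoc, ih.succ_iff]
      obtain ⟨t, c, hc⟩ := hD.leadHom_expansion (m + j) w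
      have hl := (hD.proj_leading hs ih t c hc).2
      rw [hw] at hl
      rw [hl]
      refine Finset.sum_eq_zero fun a ha => ?_
      have haE := (Finset.mem_filter.mp ha).2
      obtain ⟨h1, h2⟩ := hD.proj_h hs haE
      -- After multiplication by a power of t the vector starts at order 0. The constant term of its
      -- form with a projected Hermite vector is then the Hermite coefficient of its lowest term,
      -- which the hypothesis makes zero.
      have hsc : TVanish 0 (scale (HahnSeries.single (-(m + j)) 1) w) := by
        have := ih.scale (VanishBelow.single (k := -(m + j)) (1 : ℂ))
        rwa [neg_add_cancel] at this
      have hlead : leadHom 0 (scale (HahnSeries.single (-(m + j)) 1) w) = leadHom (m + j) w := by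
        funext k
        rw [leadHom_apply, val_scale, liftK_single_one, coeff_single_mul', one_mul, zero_sub,
          neg_neg, leadHom_apply]
      have h3 := (hD.form_leading h1 hsc).2
      rw [h2, hlead, hl, polInner_sum hD.lam_pos a _ c ha, form_scale_right hD.lam_pos, h a haE,
        mul_zero, HahnSeries.coeff_zero] at h3
      rw [← h3, zero_smul]
  exact TVanish.eq_zero fun s => (key (s - m).toNat).mono (by omega)

theorem Good.proj_comb (hD : D.Good) (hs : D.Separates E₀ ε) {m l : ℕ}
    (X : Matrix (Fin m) (Fin l) K) {v : Fin m → S₀ n r} (hv : ∀ i, D.proj E₀ ε (v i) = v i)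
    (j : Fin l) : D.proj E₀ ε (comb X v j) = comb X v j := by
  refine (map_sum (AddMonoidHom.mk' (D.proj E₀ ε) (hD.proj_add hs)) _ _).trans ?_
  refine Finset.sum_congr rfl fun i _ => ?_
  change D.proj E₀ ε (scale (X i j) (v i)) = _
  rw [hD.proj_scale hs, hv]

/-- The formal version of the theorem. A is hermitian with constant term 1, which yields B and the
orthonormal basis. C is read off as the matrix of `Q`; it is hermitian by symmetry and even in t by
parity. -/
theorem Good.exists_parity_basis (hD : D.Good) (hs : D.Separates E₀ ε) {m : ℕ}
    (e : Fin m ≃ {a : (Fin n → ℕ) × Fin r // D.energy a = E₀})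
    (hparity : ∀ i j, (Even (∑ ν, (e i).1.1 ν) ↔ Even (∑ ν, (e j).1.1 ν)))
    {f : Fin m → S₀ n r} (hf : ∀ j, f j = D.proj E₀ ε (D.h (e j).1))
    {A : Matrix (Fin m) (Fin m) K} (hA : ∀ i j, A i j = D.form (f i) (f j)) :
    ∃ (B C : Matrix (Fin m) (Fin m) K) (b : Fin m → S₀ n r),
      IsInvSqrt A B ∧ (∀ j, b j = ∑ i, scale (B i j) (f i)) ∧
      (∀ i j, D.form (b i) (b j) = if i = j then 1 else 0) ∧
      Set.range (D.proj E₀ ε) = {v | ∃ a : Fin m → K, v = ∑ i, scale (a i) (b i)} ∧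
      (∀ j, D.Q (b j) = ∑ i, scale (C i j) (b i)) ∧
      (∀ i j, IsIntegral (C i j)) ∧
      ∃ Ev : Fin m → K,
        C.charpoly = ∏ j, (Polynomial.X - Polynomial.C (Ev j)) ∧
        ∀ j, IsIntegral (Ev j) ∧ IsRealSeries (Ev j) := by
  have hf1 : ∀ i, TVanish 0 (f i) ∧ leadHom 0 (f i) = D.hPol (e i).1 := fun i => by
    rw [hf]
    exact hD.proj_h hs (e i).2
  have hfp : ∀ i, D.proj E₀ ε (f i) = f i := fun i => by
    rw [hf, hD.proj_proj hs]
  have hAof : A = Matrix.of fun i j => D.form (f i) (f j) := Matrix.ext hA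
  -- The lowest coefficients of the f^i are distinct Hermite vectors, which are orthonormal for the
  -- Gaussian inner product.
  have hA1 : MatVanish 1 (A - 1) := by
    intro i j l hl
    obtain ⟨h1, h2⟩ := hD.form_leading (hf1 i).1 (hf1 j).1
    have hone : ((1 : Matrix (Fin m) (Fin m) K) i j).coeff l =
        if l = 0 then (if i = j then 1 else 0) else 0 := by
      rw [Matrix.one_apply]
      by_cases hij : i = j
      · rw [if_pos hij, if_pos hij, HahnSeries.coeff_one]
        split_ifs <;> rfl
      · rw [if_neg hij, if_neg hij, ite_self, HahnSeries.coeff_zero]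
    rw [Matrix.sub_apply, HahnSeries.coeff_sub, hone, hA]
    rcases lt_or_eq_of_le (Int.lt_add_one_iff.mp hl : l ≤ 0) with h | rfl
    · rw [h1 l h, if_neg h.ne, sub_zero]
    · rw [h2, (hf1 i).2, (hf1 j).2, polInner_hPol hD.lam_pos, if_pos rfl, sub_eq_zero]
      refine if_congr ?_ rfl rfl
      rw [← Subtype.ext_iff, e.apply_eq_iff_eq]
  have hAadj : adj A = A := Matrix.ext fun i j => by
    rw [adj_apply, hA, hA, hD.form_conj]
  obtain ⟨B, hB1, hB⟩ := exists_invSqrt hA1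
  have hBadj := adj_invSqrt hAadj hB1 hB
  have hortho : ∀ i j, D.form (comb B f i) (comb B f j) = if i = j then 1 else 0 := by
    intro i j
    rw [hD.form_comb, ← hAof, hBadj, invSqrt_conj hB, Matrix.one_apply]
  have hbp : ∀ i, D.proj E₀ ε (comb B f i) = comb B f i := hD.proj_comb hs B hfp
  -- From BAB = 1 the matrix AB inverts B, so the original vectors are combinations of the new ones.
  have hfb : f = comb (A * B) (comb B f) := by
    rw [comb_comb, ← mul_assoc, invSqrt_conj hB, comb_one]
  -- The difference between `v` and its Fourier expansion lies in the range of the projection and is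
  -- orthogonal to every b^i, hence to every f^i. Non-degeneracy of the form there makes it zero.
  have hspan : ∀ v, D.proj E₀ ε v = v →
      v = ∑ i, scale (D.form (comb B f i) v) (comb B f i) := by
    intro v hv
    set a : Matrix (Fin m) (Fin 1) K := Matrix.of fun i _ => D.form (comb B f i) v
    change v = comb a (comb B f) 0
    rw [← sub_eq_zero]
    have hneg : v - comb a (comb B f) 0 = v + scale (-1) (comb a (comb B f) 0) := by
      have : (-1 : K) = HahnSeries.C (-1 : ℂ) := by rw [map_neg, map_one]
      rw [this, ← smul_eq_scale, neg_one_smul, sub_eq_add_neg]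
    have hb0 : ∀ i, D.form (comb B f i) (v - comb a (comb B f) 0) = 0 := by
      intro i
      have hcomb : comb a (comb B f) 0 =
        ∑ j, scale (D.form (comb B f j) v) (comb B f j) := rfl
      rw [hneg, form_add_right hD.lam_pos, form_scale_right hD.lam_pos, hcomb,
        form_sum_right hD.lam_pos, Finset.sum_eq_single i]
      · rw [form_scale_right hD.lam_pos, hortho, if_pos rfl]
        ring
      · intro j _ hj
        rw [form_scale_right hD.lam_pos, hortho, if_neg (Ne.symm hj), mul_zero]
      · exact fun h => absurd (Finset.mem_univ i) h
    refine hD.eq_zero_of_form hs ?_ fun α hα => ?_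
    · rw [hneg, hD.proj_add hs, hD.proj_scale hs, hv, hD.proj_comb hs a hbp]
    · have hi : D.proj E₀ ε (D.h α) = f (e.symm ⟨α, hα⟩) := by
        rw [hf, e.apply_symm_apply]
      rw [hi, congr_fun hfb _, comb, hD.form_sum_left]
      refine Finset.sum_eq_zero fun j _ => ?_
      rw [hD.form_scale_left, hb0, mul_zero]
  -- This is where the common parity enters: the signs (-1)^{|α|} are the same for all i, and the
  -- substitution commutes with the projection.
  obtain ⟨σ, hσ, hθf⟩ : ∃ σ : ℂ, starRingEnd ℂ σ * σ = 1 ∧ ∀ i, thetaS₀ n r (f i) = σ • f i := by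
    have hθ : ∀ i, thetaS₀ n r (f i) = ((-1 : ℂ) ^ hdeg (e i).1) • f i := by
      intro i
      rw [hf, ← hD.proj_theta hs, thetaS₀_h, smul_eq_scale, hD.proj_scale hs, smul_eq_scale]
    by_cases hall : ∀ i, Even (hdeg (e i).1)
    · refine ⟨1, by simp, fun i => ?_⟩
      rw [hθ, (hall i).neg_one_pow]
    · push Not at hall
      obtain ⟨i₀, hi₀⟩ := hall
      refine ⟨-1, by simp, fun i => ?_⟩
      rw [hθ, Odd.neg_one_pow]
      rw [← Nat.not_even_iff_odd]
      exact fun h => hi₀ ((hparity i i₀).mp h)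
  have hformσ : ∀ u v, D.form (σ • u) (σ • v) = D.form u v := by
    intro u v
    rw [smul_eq_scale, smul_eq_scale, hD.form_scale_left, form_scale_right hD.lam_pos, mapCoeff_C,
      ← mul_assoc, ← map_mul, hσ, map_one, one_mul]
  have hflipA : A.map (flip (R := ℂ)) = A := Matrix.ext fun i j => by
    rw [Matrix.map_apply, hA, ← hD.form_theta, hθf, hθf, hformσ]
  -- Since A is even in t, the substitution t ↦ -t maps B to another normalized inverse square root
  -- of A, which by uniqueness is B.
  have hflipB : B.map (flip (R := ℂ)) = B := by
    have hone : (1 : Matrix (Fin m) (Fin m) K).map (flip (R := ℂ)) = 1 :=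
      Matrix.map_one _ (map_zero _) (map_one _)
    refine invSqrt_unique (A := A) ?_ hB1 ?_ hB
    · rw [← hone, ← Matrix.map_sub _ (map_sub flip)]
      exact fun i j => (hB1 i j).flip
    · conv_lhs => rw [← hflipA]
      rw [← Matrix.map_mul, ← Matrix.map_mul, hB, hone]
  have hθb : ∀ j, thetaS₀ n r (comb B f j) = σ • comb B f j := by
    intro j
    rw [comb, map_sum, Finset.smul_sum]
    refine Finset.sum_congr rfl fun i _ => ?_
    have : flip (B i j) = B i j := congr_fun (congr_fun hflipB i) j
    rw [thetaS₀_scale, this, hθf, smul_eq_scale, smul_eq_scale, ← scale_mul, ← scale_mul, mul_comm]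
  set C : Matrix (Fin m) (Fin m) K :=
    Matrix.of fun i j => D.form (comb B f i) (D.Q (comb B f j)) with hC
  -- Applying the substitution to both arguments of the form multiplies them by the same σ with |σ|
  -- = 1; the entry is therefore equal to its image under t ↦ -t.
  have hCint : ∀ i j, IsIntegral (C i j) := by
    intro i j
    rw [isIntegral_iff_flip, hC, Matrix.of_apply, ← hD.form_theta, ← hD.Q_theta, hθb, hθb, map_smul,
      hformσ]
  have hCadj : adj C = C := Matrix.ext fun i j => by
    rw [adj_apply, hC, Matrix.of_apply, Matrix.of_apply, hD.form_conj, hD.form_Q]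
  refine ⟨B, C, comb B f, isInvSqrt_of hB1 hB, fun j => rfl, hortho, ?_, fun j => ?_, hCint,
    charpoly_of_adj_of_isIntegral hCadj hCint⟩
  · ext v
    constructor
    · rintro ⟨u, rfl⟩
      exact ⟨_, hspan _ (hD.proj_proj hs u)⟩
    · rintro ⟨a, rfl⟩
      exact ⟨_, hD.proj_comb hs (Matrix.of fun i (_ : Fin 1) => a i) hbp 0⟩
  · refine hspan _ ?_
    rw [hD.proj_Q hs, hbp]

end TaylorData

end Parity

end

/-! ### The theorem for the geometric setup -/

theorem mainTheorem6 {n r : ℕ} {M : Type*} [TopologicalSpace M] [T2Space M]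
    [SecondCountableTopology M] [ChartedSpace (EuclideanSpace ℝ (Fin n)) M]
    [IsManifold (𝓡 n) ∞ M]
    (E : M → Type*) [TopologicalSpace (TotalSpace (Parity.Fib r) E)]
    [∀ q, TopologicalSpace (E q)] [∀ q, AddCommGroup (E q)] [∀ q, Module ℂ (E q)]
    [FiberBundle (Parity.Fib r) E] [VectorBundle ℂ (Parity.Fib r) E]
    [VectorBundle ℝ (Parity.Fib r) E] [ContMDiffVectorBundle ∞ (Parity.Fib r) E (𝓡 n)]
    (p : M) (𝒮 : Parity.Setup n r E p) (U : Set M) (φ : M → ℝ) (hφ : 𝒮.IsEikonal U φ)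
    (κ : Parity.FramedChart n r E) (lam : Fin n → ℝ) (mu : Fin r → ℝ)
    (hκ : 𝒮.IsAdapted U φ κ lam mu) (ℓ : Parity.LaplaceForm 𝒮.g 𝒮.L κ)
    (D : Parity.TaylorData n r) (hD : D = 𝒮.taylorData φ κ ℓ lam mu)
    (E₀ ε : ℝ) (hε : 0 < ε) (hsep : ∀ a, |D.energy a - E₀| ≤ ε → D.energy a = E₀)
    (m : ℕ) (e : Fin m ≃ {a : (Fin n → ℕ) × Fin r // D.energy a = E₀})
    (hparity : ∀ i j, (Even (∑ ν, (e i).1.1 ν) ↔ Even (∑ ν, (e j).1.1 ν)))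
    (f : Fin m → Parity.S₀ n r) (hf : ∀ j, f j = D.proj E₀ ε (D.h (e j).1))
    (A : Matrix (Fin m) (Fin m) Parity.K) (hA : ∀ i j, A i j = D.form (f i) (f j)) :
    ∃ (B C : Matrix (Fin m) (Fin m) Parity.K) (b : Fin m → Parity.S₀ n r),
      Parity.IsInvSqrt A B ∧ (∀ j, b j = ∑ i, Parity.scale (B i j) (f i)) ∧
      (∀ i j, D.form (b i) (b j) = if i = j then 1 else 0) ∧
      Set.range (D.proj E₀ ε) = {v | ∃ a : Fin m → Parity.K, v = ∑ i, Parity.scale (a i) (b i)} ∧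
      (∀ j, D.Q (b j) = ∑ i, Parity.scale (C i j) (b i)) ∧
      (∀ i j, Parity.IsIntegral (C i j)) ∧
      ∃ Ev : Fin m → Parity.K,
        C.charpoly = ∏ j, (Polynomial.X - Polynomial.C (Ev j)) ∧
        ∀ j, Parity.IsIntegral (Ev j) ∧ Parity.IsRealSeries (Ev j) := by
  subst hD
  exact (𝒮.good hφ hκ ℓ).exists_parity_basis ⟨hε, hsep⟩ e hparity hf hA
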